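/- **Notation.** For $X=(x,\xi)\in\mathbb R^{2n}$ put $\langle X\rangle=(1+|X|^2)^{1/2}$ and $\dot{\mathbb R}^{2n}=\mathbb R^{2n}\setminus\{0\}$; a cone is a subset of $\dot{\mathbb R}^{2n}$ invariant under multiplication by positive reals, and open/closed cones are relatively open/closed in $\dot{\mathbb R}^{2n}$. For $m\in\mathbb R$ let $S^m_{\mathrm{iso}}(\mathbb R^n)$ be the set of $a\in C^\infty(\mathbb R^{2n})$ with $|\partial^\alpha a(X)|\le C_\alpha\langle X\rangle^{m-|\alpha|}$ for all $\alpha$, and let $$\mathrm{Op}^{\mathrm w}(a)u(x)=(2\pi)^{-n}\iint e^{i\langle x-y,\xi\rangle}a\big(\tfrac{x+y}2,\xi\big)u(y)\,dy\,d\xi$$ be its Weyl quantization, acting on $\mathscr S(\mathbb R^n)$ and, by duality, on $\mathscr S'(\mathbb R^n)$. For $s\in\mathbb R$, $B^s(\mathbb R^n)=\{u\in\mathscr S'(\mathbb R^n):\mathrm{Op}^{\mathrm w}(\langle X\rangle^s)u\in L^2\}$. For $a\in S^0_{\mathrm{iso}}$, $\mathrm{Char}(a)$ is the set of $X_0\in\dot{\mathbb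 R}^{2n}$ for which there are no open cone $\Gamma\ni X_0$ and $c,C>0$ with $|a(X)|\ge c$ for $X\in\Gamma$, $|X|\ge C$; and $X_0\ne0$ lies outside the essential conic support of $a$ iff on some open cone $\Gamma\ni X_0$ all derivatives of $a$ are $O(\langle X\rangle^{-N})$ for all $N$, for $|X|\ge1$. For $u\in\mathscr S'(\mathbb R^n)$, $WF_{\mathrm{iso}}(u)$ (resp. $WF^s_{\mathrm{iso}}(u)$) is the intersection of all $\mathrm{Char}(a)$ with $a\in S^0_{\mathrm{iso}}$ and $\mathrm{Op}^{\mathrm w}(a)u\in\mathscr S$ (resp. $\in B^s$). For a closed cone $\Gamma\subseteq\dot{\mathbb R}^{2n}$ let $\mathscr S'_\Gamma=\{u\in\mathscr S'(\mathbb R^n):WF_{\mathrm{iso}}(u)\subseteq\Gamma\}$; $u_j\to u$ in $\mathscr S'_\Gamma$ means that $u_j\to u$ in $\mathscr S'$ and $\mathrm{Op}^{\mathrm w}(a)(u_j-u)\to0$ in $\mathscr S$ for every $a\in S^0_{\mathrm{iso}}$ whose essential conic support does not meet $\Gamma$. For $K\in\mathscr S'(\mathbb R^{m+n})$ put $$WF^s_{\mathrm{iso},X}(K)=\{(x,\xi)\in\dot{\mathbb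 R}^{2m}:(x,0,\xi,0)\in WF^s_{\mathrm{iso}}(K)\},\qquad WF_{\mathrm{iso},Y}(K)=\{(y,\eta)\in\dot{\mathbb R}^{2n}:(0,y,0,-\eta)\in WF_{\mathrm{iso}}(K)\},$$ $$WF^s_{\mathrm{iso}}(K)'=\{(x,y,\xi,\eta):(x,y,\xi,-\eta)\in WF^s_{\mathrm{iso}}(K)\},$$ and, for $B\subseteq\mathbb R^{2n}$, $WF^s_{\mathrm{iso}}(K)'\circ B=\{(x,\xi):\exists (y,\eta)\in B,\ (x,y,\xi,\eta)\in WF^s_{\mathrm{iso}}(K)'\}$. **Theorem.** Let $n\ge m$ and let $\mathscr K:\mathscr S(\mathbb R^n)\to\mathscr S'(\mathbb R^m)$ be a linear operator with Schwartz kernel $K\in B^{-r_1}(\mathbb R^{m+n})$, $r_1\ge0$, i.e. $\langle\mathscr Ku,\varphi\rangle=\langle K,\varphi\otimes u\rangle$. 1. If $u\in\mathscr S(\mathbb R^n)$ and $\mu>n$, then for all $s_1\in\mathbb R$ $$WF^{s_1-\mu}_{\mathrm{iso}}(\mathscr Ku)\subseteq WF^{s_1}_{\mathrm{iso},X}(K).$$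 2. The set $D=\{u\in\mathscr S'(\mathbb R^n): WF_{\mathrm{iso}}(u)\cap WF_{\mathrm{iso},Y}(K)=\emptyset\}$ is a linear subspace containing $\mathscr S(\mathbb R^n)$, and $\mathscr K$ extends uniquely to a linear map $\mathscr K:D\to\mathscr S'(\mathbb R^m)$ that is sequentially continuous $\mathscr S'_\Gamma\to\mathscr S'(\mathbb R^m)$ for every closed cone $\Gamma\subseteq\dot{\mathbb R}^{2n}$ with $\Gamma\cap WF_{\mathrm{iso},Y}(K)=\emptyset$. 3. If $u\in D\cap B^{-r_2}(\mathbb R^n)$, $r_2\ge0$, and $s_1,s_2\in\mathbb R$ satisfy $s_*:=\min\{s_1-r_2,\,s_2-r_1\}\le s_1+s_2$, then for every $\mu>n$ $$WF^{s_*-\mu}_{\mathrm{iso}}(\mathscr Ku)\subseteq WF^{s_1}_{\mathrm{iso},X}(K)\ \cup\ WF^{s_1}_{\mathrm{iso}}(K)'\circ WF^{s_2}_{\mathrm{iso}}(u).$$ -/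

import Mathlib

open MeasureTheory Filter Topology Set
open scoped SchwartzMap ContDiff

/-! ### Euclidean spaces, product coordinates and phase space -/

/-- The Euclidean space `ℝ^ι`. -/
abbrev Eucl (ι : Type*) := EuclideanSpace ℝ ι

/-- The phase space `T*ℝ^ι = ℝ^ι × ℝ^ι`, with points `X = (x, ξ)`. -/
abbrev Phase (ι : Type*) := EuclideanSpace ℝ ι × EuclideanSpace ℝ ι

noncomputable section

/-- The projection `ℝ^(ι ⊕ κ) → ℝ^ι`, `(x, y) ↦ x`. -/
def projX (ι κ : Type*) [Fintype ι] [Fintype κ] : Eucl (ι ⊕ κ) →L[ℝ] Eucl ι :=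
  LinearMap.toContinuousLinearMap
    { toFun := fun z => WithLp.toLp 2 (fun i => z (Sum.inl i))
      map_add' := fun _ _ => rfl
      map_smul' := fun _ _ => rfl }

/-- The projection `ℝ^(ι ⊕ κ) → ℝ^κ`, `(x, y) ↦ y`. -/
def projY (ι κ : Type*) [Fintype ι] [Fintype κ] : Eucl (ι ⊕ κ) →L[ℝ] Eucl κ :=
  LinearMap.toContinuousLinearMap
    { toFun := fun z => WithLp.toLp 2 (fun i => z (Sum.inr i))
      map_add' := fun _ _ => rfl
      map_smul' := fun _ _ => rfl }

/-- The point `(x, y)` of `ℝ^(ι ⊕ κ)`. -/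
def pairXY {ι κ : Type*} (x : Eucl ι) (y : Eucl κ) : Eucl (ι ⊕ κ) :=
  WithLp.toLp 2 (Sum.elim x y)

/-- The Euclidean norm `|X|` of a point `X = (x, ξ)` of phase space. -/
def phaseNorm {ι : Type*} [Fintype ι] (X : Phase ι) : ℝ :=
  Real.sqrt (‖X.1‖ ^ 2 + ‖X.2‖ ^ 2)

/-- `⟨X⟩ = (1 + |X|²)^{1/2}`. -/
def japanese {ι : Type*} [Fintype ι] (X : Phase ι) : ℝ :=
  Real.sqrt (1 + ‖X.1‖ ^ 2 + ‖X.2‖ ^ 2)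

/-- `Γ` is a conic subset of the punctured phase space. -/
def IsCone {ι : Type*} [Fintype ι] (Γ : Set (Phase ι)) : Prop :=
  (0 : Phase ι) ∉ Γ ∧ ∀ t : ℝ, 0 < t → ∀ X ∈ Γ, t • X ∈ Γ

/-- `Γ` is a conic subset of the punctured phase space, open in it. -/
def IsOpenCone {ι : Type*} [Fintype ι] (Γ : Set (Phase ι)) : Prop :=
  IsCone Γ ∧ IsOpen Γ

/-- `Γ` is a conic subset of the punctured phase space, relatively closed in it
(that is, `Γ ∪ {0}` is closed). -/
def IsClosedCone {ι : Type*} [Fintype ι] (Γ : Set (Phase ι)) : Prop :=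
  IsCone Γ ∧ IsClosed (insert 0 Γ)

/-! ### Shubin symbols -/

/-- `a ∈ S^m_iso`: `a` is smooth and `|∂^α a(X)| ≤ C_α ⟨X⟩^{m - |α|}` for every `α`. -/
def IsShubinSymbol {ι : Type*} [Fintype ι] (m : ℝ) (a : Phase ι → ℂ) : Prop :=
  ContDiff ℝ ∞ a ∧ ∀ k : ℕ, ∃ C : ℝ, ∀ X : Phase ι,
    ‖iteratedFDeriv ℝ k a X‖ ≤ C * japanese X ^ (m - (k : ℝ))

/-- The symbol `a`, of order `m`, is elliptic at `X₀`. -/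
def IsEllipticAt {ι : Type*} [Fintype ι] (m : ℝ) (a : Phase ι → ℂ) (X₀ : Phase ι) : Prop :=
  ∃ Γ : Set (Phase ι), IsOpenCone Γ ∧ X₀ ∈ Γ ∧ ∃ c C : ℝ, 0 < c ∧ 0 < C ∧
    ∀ X ∈ Γ, C ≤ phaseNorm X → c * phaseNorm X ^ m ≤ ‖a X‖

/-- The characteristic set of the Weyl operator with symbol `a` of order `m`. -/
def charSet {ι : Type*} [Fintype ι] (m : ℝ) (a : Phase ι → ℂ) : Set (Phase ι) :=
  {X | X ≠ 0 ∧ ¬ IsEllipticAt m a X}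

/-- The essential conic support of `a`: the set of those `X₀ ≠ 0` that have no conic
neighbourhood on which all derivatives of `a` decay rapidly. -/
def essConeSupp {ι : Type*} [Fintype ι] (a : Phase ι → ℂ) : Set (Phase ι) :=
  {X₀ | X₀ ≠ 0 ∧ ¬ ∃ Γ : Set (Phase ι), IsOpenCone Γ ∧ X₀ ∈ Γ ∧
    ∀ k N : ℕ, ∃ C : ℝ, ∀ X ∈ Γ, 1 ≤ phaseNorm X →
      ‖iteratedFDeriv ℝ k a X‖ ≤ C * japanese X ^ (-(N : ℝ))}

/-! ### Weyl quantization -/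

/-- `(2π)^{-n} ∫ (∫ e^{i⟨x - y, ξ⟩} a((x + y)/2, ξ) φ(y) dy) dξ` with `n = |ι|`: the function
`Op^w(a) φ` for a Schwartz function `φ`. -/
def weylIntegral {ι : Type*} [Fintype ι] (a : Phase ι → ℂ) (φ : 𝓢(Eucl ι, ℂ)) (x : Eucl ι) : ℂ :=
  (((2 * Real.pi) ^ Fintype.card ι : ℝ) : ℂ)⁻¹ *
    ∫ ξ : Eucl ι, ∫ y : Eucl ι,
      Complex.exp (Complex.I * ((inner ℝ (x - y) ξ : ℝ) : ℂ)) *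
        a ((2⁻¹ : ℝ) • (x + y), ξ) * φ y

/-- `v = Op^w(a) u` for tempered distributions `u`, `v`. The action of `Op^w(a)` on `𝓢'` is defined
by duality: the transpose of `Op^w(a)` is `Op^w(ã)` with `ã(x, ξ) = a(x, -ξ)`, and
`⟨Op^w(a) u, φ⟩ = ⟨u, Op^w(ã) φ⟩` for all Schwartz `φ`, where `Op^w(ã) φ` is a Schwartz function. -/
def IsWeylImage {ι : Type*} [Fintype ι] (a : Phase ι → ℂ) (u v : 𝓢'(Eucl ι, ℂ)) : Prop :=
  ∀ φ : 𝓢(Eucl ι, ℂ), ∃ g : 𝓢(Eucl ι, ℂ),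
    (∀ x, g x = weylIntegral (fun X => a (X.1, -X.2)) φ x) ∧ v φ = u g

/-! ### Shubin-Sobolev spaces and isotropic wave front sets -/

/-- The tempered distribution `⟨f, φ⟩ = ∫ f φ` given by a Schwartz function `f`. -/
def schwartzDist {ι : Type*} [Fintype ι] (f : 𝓢(Eucl ι, ℂ)) : 𝓢'(Eucl ι, ℂ) :=
  SchwartzMap.toTemperedDistributionCLM (Eucl ι) ℂ volume f

/-- `u` is (given by) an `L²` function. -/
def IsL2Dist {ι : Type*} [Fintype ι] (u : 𝓢'(Eucl ι, ℂ)) : Prop :=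
  ∃ f : Lp ℂ 2 (volume : Measure (Eucl ι)), u = Lp.toTemperedDistribution f

/-- The Shubin-Sobolev space `B^s = {u ∈ 𝓢' : Λ^s u ∈ L²}`, where `Λ^s = Op^w(⟨X⟩^s)`. -/
def shubinSobolev (ι : Type*) [Fintype ι] (s : ℝ) : Set 𝓢'(Eucl ι, ℂ) :=
  {u | ∃ v, IsWeylImage (fun X : Phase ι => ((japanese X ^ s : ℝ) : ℂ)) u v ∧ IsL2Dist v}

/-- `WF_iso(u)`: the intersection of the sets `Char(A)` over all `A = Op^w(a)`, `a ∈ S^0_iso`, with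
`A u ∈ 𝓢`. -/
def wfIso {ι : Type*} [Fintype ι] (u : 𝓢'(Eucl ι, ℂ)) : Set (Phase ι) :=
  {X | X ≠ 0 ∧ ∀ (a : Phase ι → ℂ) (f : 𝓢(Eucl ι, ℂ)),
    IsShubinSymbol 0 a → IsWeylImage a u (schwartzDist f) → X ∈ charSet 0 a}

/-- `WF^s_iso(u)`: the intersection of the sets `Char(A)` over all `A = Op^w(a)`, `a ∈ S^0_iso`,
with `A u ∈ B^s`. -/
def wfIsoOrder {ι : Type*} [Fintype ι] (s : ℝ) (u : 𝓢'(Eucl ι, ℂ)) : Set (Phase ι) :=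
  {X | X ≠ 0 ∧ ∀ (a : Phase ι → ℂ) (v : 𝓢'(Eucl ι, ℂ)),
    IsShubinSymbol 0 a → IsWeylImage a u v → v ∈ shubinSobolev ι s → X ∈ charSet 0 a}

/-- `{(x, ξ) ≠ 0 : (x, 0, ξ, 0) ∈ W}`; for `W = WF^s_iso(K)` this is `WF^s_{iso,X}(K)`. -/
def partX {ι κ : Type*} [Fintype ι] [Fintype κ] (W : Set (Phase (ι ⊕ κ))) : Set (Phase ι) :=
  {X | X ≠ 0 ∧ (pairXY X.1 (0 : Eucl κ), pairXY X.2 (0 : Eucl κ)) ∈ W}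

/-- `{(y, η) ≠ 0 : (0, y, 0, -η) ∈ W}`; for `W = WF_iso(K)` this is `WF_{iso,Y}(K)`. -/
def partY {ι κ : Type*} [Fintype ι] [Fintype κ] (W : Set (Phase (ι ⊕ κ))) : Set (Phase κ) :=
  {Y | Y ≠ 0 ∧ (pairXY (0 : Eucl ι) Y.1, pairXY (0 : Eucl ι) (-Y.2)) ∈ W}

/-- `W' = {(x, y, ξ, η) : (x, y, ξ, -η) ∈ W}`, as a set of pairs `((x, ξ), (y, η))`. -/
def twist {ι κ : Type*} [Fintype ι] [Fintype κ] (W : Set (Phase (ι ⊕ κ))) :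
    Set (Phase ι × Phase κ) :=
  {Z | (pairXY Z.1.1 Z.2.1, pairXY Z.1.2 (-Z.2.2)) ∈ W}

/-- `A ∘ B = {x : ∃ y ∈ B, (x, y) ∈ A}`. -/
def relComp {α β : Type*} (A : Set (α × β)) (B : Set β) : Set α :=
  {x | ∃ y ∈ B, (x, y) ∈ A}

/-! ### Tensor products and Schwartz kernels -/

theorem schwartz_weight_bound {E : Type*} [NormedAddCommGroup E] [NormedSpace ℝ E]
    (f : 𝓢(E, ℂ)) (k i : ℕ) :
    ∃ C : ℝ, 0 ≤ C ∧ ∀ x, (1 + ‖x‖) ^ k * ‖iteratedFDeriv ℝ i f x‖ ≤ C := by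
  refine ⟨2 ^ k * ((Finset.Iic (k, i)).sup fun m => SchwartzMap.seminorm ℝ m.1 m.2) f,
    by positivity, fun x => ?_⟩
  exact SchwartzMap.one_add_le_sup_seminorm_apply (𝕜 := ℝ) (m := (k, i)) le_rfl le_rfl f x

theorem norm_le_proj {ι κ : Type*} [Fintype ι] [Fintype κ] (z : Eucl (ι ⊕ κ)) :
    ‖z‖ ≤ ‖projX ι κ z‖ + ‖projY ι κ z‖ := by
  have h : ‖z‖ ^ 2 = ‖projX ι κ z‖ ^ 2 + ‖projY ι κ z‖ ^ 2 := by
    simp only [EuclideanSpace.norm_sq_eq, Fintype.sum_sum_type]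
    rfl
  nlinarith [norm_nonneg z, norm_nonneg (projX ι κ z), norm_nonneg (projY ι κ z)]

/-- The tensor product `(x, y) ↦ φ(x) ψ(y)` of two Schwartz functions. -/
def schwartzTensor {ι κ : Type*} [Fintype ι] [Fintype κ]
    (φ : 𝓢(Eucl ι, ℂ)) (ψ : 𝓢(Eucl κ, ℂ)) : 𝓢(Eucl (ι ⊕ κ), ℂ) where
  toFun z := φ (projX ι κ z) * ψ (projY ι κ z)
  smooth' := ((φ.smooth ⊤).comp (projX ι κ).contDiff).mul ((ψ.smooth ⊤).comp (projY ι κ).contDiff)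
  decay' := by
    intro k n
    choose C hC0 hC using fun i => schwartz_weight_bound φ k i
    choose D hD0 hD using fun i => schwartz_weight_bound ψ k i
    refine ⟨∑ i ∈ Finset.range (n + 1), (n.choose i : ℝ) *
      (C i * ‖projX ι κ‖ ^ i) * (D (n - i) * ‖projY ι κ‖ ^ (n - i)), fun z => ?_⟩
    have h1 : ContDiff ℝ ∞ (φ ∘ projX ι κ) := (φ.smooth ⊤).comp (projX ι κ).contDiff
    have h2 : ContDiff ℝ ∞ (ψ ∘ projY ι κ) := (ψ.smooth ⊤).comp (projY ι κ).contDiff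
    have hm := norm_iteratedFDeriv_mul_le (𝕜 := ℝ) h1 h2 z
      (n := n) (by exact_mod_cast le_top)
    have hz : ‖z‖ ^ k ≤ (1 + ‖projX ι κ z‖) ^ k * (1 + ‖projY ι κ z‖) ^ k := by
      rw [← mul_pow]
      apply pow_le_pow_left₀ (norm_nonneg z)
      nlinarith [norm_le_proj z, norm_nonneg (projX ι κ z), norm_nonneg (projY ι κ z),
        mul_nonneg (norm_nonneg (projX ι κ z)) (norm_nonneg (projY ι κ z))]
    have e1 : ∀ i, ‖iteratedFDeriv ℝ i (φ ∘ projX ι κ) z‖ ≤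
        ‖iteratedFDeriv ℝ i φ (projX ι κ z)‖ * ‖projX ι κ‖ ^ i := by
      intro i
      rw [ContinuousLinearMap.iteratedFDeriv_comp_right _ (φ.smooth ⊤) z
        (by exact_mod_cast le_top)]
      simpa using ContinuousMultilinearMap.norm_compContinuousLinearMap_le
        (iteratedFDeriv ℝ i φ (projX ι κ z)) (fun _ => projX ι κ)
    have e2 : ∀ i, ‖iteratedFDeriv ℝ i (ψ ∘ projY ι κ) z‖ ≤
        ‖iteratedFDeriv ℝ i ψ (projY ι κ z)‖ * ‖projY ι κ‖ ^ i := by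
      intro i
      rw [ContinuousLinearMap.iteratedFDeriv_comp_right _ (ψ.smooth ⊤) z
        (by exact_mod_cast le_top)]
      simpa using ContinuousMultilinearMap.norm_compContinuousLinearMap_le
        (iteratedFDeriv ℝ i ψ (projY ι κ z)) (fun _ => projY ι κ)
    calc ‖z‖ ^ k * ‖iteratedFDeriv ℝ n
            (fun z => φ (projX ι κ z) * ψ (projY ι κ z)) z‖
        ≤ ((1 + ‖projX ι κ z‖) ^ k * (1 + ‖projY ι κ z‖) ^ k) *
          ∑ i ∈ Finset.range (n + 1), (n.choose i : ℝ) *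
            ‖iteratedFDeriv ℝ i (φ ∘ projX ι κ) z‖ *
            ‖iteratedFDeriv ℝ (n - i) (ψ ∘ projY ι κ) z‖ := by
          apply mul_le_mul hz hm (norm_nonneg _) (by positivity)
      _ ≤ _ := by
          rw [Finset.mul_sum]
          refine Finset.sum_le_sum fun i _ => ?_
          have a1 : (1 + ‖projX ι κ z‖) ^ k * ‖iteratedFDeriv ℝ i (φ ∘ projX ι κ) z‖ ≤
              C i * ‖projX ι κ‖ ^ i := by
            calc _ ≤ (1 + ‖projX ι κ z‖) ^ k *
                  (‖iteratedFDeriv ℝ i φ (projX ι κ z)‖ * ‖projX ι κ‖ ^ i) := by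
                  gcongr; exact e1 i
              _ = ((1 + ‖projX ι κ z‖) ^ k *
                  ‖iteratedFDeriv ℝ i φ (projX ι κ z)‖) * ‖projX ι κ‖ ^ i := by ring
              _ ≤ _ := by gcongr; exact hC i _
          have a2 : (1 + ‖projY ι κ z‖) ^ k *
              ‖iteratedFDeriv ℝ (n - i) (ψ ∘ projY ι κ) z‖ ≤
              D (n - i) * ‖projY ι κ‖ ^ (n - i) := by
            calc _ ≤ (1 + ‖projY ι κ z‖) ^ k *
                  (‖iteratedFDeriv ℝ (n - i) ψ (projY ι κ z)‖ * ‖projY ι κ‖ ^ (n - i)) := by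
                  gcongr; exact e2 (n - i)
              _ = ((1 + ‖projY ι κ z‖) ^ k *
                  ‖iteratedFDeriv ℝ (n - i) ψ (projY ι κ z)‖) * ‖projY ι κ‖ ^ (n - i) := by ring
              _ ≤ _ := by gcongr; exact hD (n - i) _
          have h0 : 0 ≤ C i * ‖projX ι κ‖ ^ i := mul_nonneg (hC0 i) (by positivity)
          have a3 := mul_le_mul a1 a2 (by positivity) h0
          calc _ = (n.choose i : ℝ) * (((1 + ‖projX ι κ z‖) ^ k *
                ‖iteratedFDeriv ℝ i (φ ∘ projX ι κ) z‖) *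
                ((1 + ‖projY ι κ z‖) ^ k *
                ‖iteratedFDeriv ℝ (n - i) (ψ ∘ projY ι κ) z‖)) := by ring
            _ ≤ (n.choose i : ℝ) * ((C i * ‖projX ι κ‖ ^ i) *
                (D (n - i) * ‖projY ι κ‖ ^ (n - i))) := by gcongr
            _ = _ := by ring

/-- The linear operator `𝒦 : 𝓢(ℝ^κ) → 𝓢'(ℝ^ι)` has Schwartz kernel `K ∈ 𝓢'(ℝ^(ι ⊕ κ))`:
`⟨𝒦 u, φ⟩ = ⟨K, φ ⊗ u⟩`. -/
def HasKernel {ι κ : Type*} [Fintype ι] [Fintype κ]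
    (𝒦 : 𝓢(Eucl κ, ℂ) →ₗ[ℂ] 𝓢'(Eucl ι, ℂ)) (K : 𝓢'(Eucl (ι ⊕ κ), ℂ)) : Prop :=
  ∀ (u : 𝓢(Eucl κ, ℂ)) (φ : 𝓢(Eucl ι, ℂ)), 𝒦 u φ = K (schwartzTensor φ u)

/-! ### Convergence in `𝓢'_Γ` and extension by continuity -/

/-- `u_j → u` in `𝓢'_Γ = {u ∈ 𝓢' : WF_iso(u) ⊆ Γ}`: all terms and the limit belong to `𝓢'_Γ`,
`u_j → u` in `𝓢'`, and `Op^w(a)(u_j - u) → 0` in `𝓢` for every `a ∈ S^0_iso` whose essential conic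
support does not meet `Γ`. -/
def TendstoInCone {ι : Type*} [Fintype ι] (Γ : Set (Phase ι))
    (u : ℕ → 𝓢'(Eucl ι, ℂ)) (u₀ : 𝓢'(Eucl ι, ℂ)) : Prop :=
  (∀ j, wfIso (u j) ⊆ Γ) ∧ wfIso u₀ ⊆ Γ ∧ Tendsto u atTop (𝓝 u₀) ∧
    ∀ a : Phase ι → ℂ, IsShubinSymbol 0 a → Disjoint Γ (essConeSupp a) →
      ∃ f : ℕ → 𝓢(Eucl ι, ℂ), (∀ j, IsWeylImage a (u j - u₀) (schwartzDist (f j))) ∧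
        Tendsto f atTop (𝓝 0)

/-- `T`, defined on the space `D` of tempered distributions, extends `𝒦` from `𝓢 ⊆ D` and is
sequentially continuous from `𝓢'_Γ` to `𝓢'` for every closed cone `Γ` that does not meet `F`. -/
def IsContinuousExtension {ι κ : Type*} [Fintype ι] [Fintype κ]
    (𝒦 : 𝓢(Eucl κ, ℂ) →ₗ[ℂ] 𝓢'(Eucl ι, ℂ)) (F : Set (Phase κ))
    (D : Submodule ℂ 𝓢'(Eucl κ, ℂ)) (T : D →ₗ[ℂ] 𝓢'(Eucl ι, ℂ)) : Prop :=
  (∀ f : 𝓢(Eucl κ, ℂ), ∃ h : schwartzDist f ∈ D, T ⟨schwartzDist f, h⟩ = 𝒦 f) ∧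
  ∀ Γ : Set (Phase κ), IsClosedCone Γ → Disjoint Γ F →
    ∀ (u : ℕ → D) (u₀ : D), TendstoInCone Γ (fun j => (u j : 𝓢'(Eucl κ, ℂ))) u₀ →
      Tendsto (fun j => T (u j)) atTop (𝓝 (T u₀))

end

open scoped ENNReal

noncomputable section

set_option linter.unusedSectionVars false

/-! ### Polynomial weights -/

/-! Everything is read off the short-time Fourier transform X ↦ `u (coh X)` with a Gaussian window.
The inversion formula `dist_inversion` expands test functions in coherent states, so these values
determine a distribution; L² becomes square integrability of the transform (`isL2_iff`) and rapid
decay characterises Schwartz functions (`exists_sdist_of_decay`).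

A Weyl operator acts on such transforms as an integral operator with kernel `gker`
(`IsWeylImage.eq_integral`). Its matrix element between the states at X and Y is the integral of the
symbol against a Gaussian centred at the midpoint of X and Y and oscillating with frequency X - Y.
The kernel therefore decays rapidly off the diagonal, and up to an error one order lower it is a(X)
times the kernel of the identity (`norm_gker_sub_le`). Where the symbol is elliptic of order m, with
v the image of u, division by a(X) bounds |u(coh X)| by ⟨X⟩^(-m) |v(coh X)|, plus ⟨X⟩^(-1) times a
local average of |u(coh ·)|, plus a rapidly decaying term (`elliptic_estimate_uniform`). Iterating
this on shrinking cones (`bootstrap_sq`, `bootstrap_sup`) does the work of a parametrix. Together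
with conic cutoffs for the converse, this shows that B^s is weighted square integrability
(`mem_shubinSobolev_iff`), and that a direction lies outside WF^s (resp. WF) exactly when on some
conic neighbourhood the transform is square integrable with weight ⟨X⟩^s (resp. decays rapidly):
`notMem_wfIsoOrder_iff`, `notMem_wfIso_iff`.

The kernel theorem is then an estimate for one integral. Coherent states tensorise
(`coh_joinPhase`), so the transform of 𝒦u at X is a constant times the integral over Y of the
transform of K at (X, Y) times that of u at the reflection of Y; this integral defines the extension
(`applyKer`).

Convergence: in each direction (0, Y) transversality makes one of the two factors decay rapidly
while the other grows polynomially. By compactness the product decays rapidly for |X| < ε|Y|;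
elsewhere |Y| is controlled by |X|, and the transform of a test function pays for any power of ⟨X⟩
(`pairing_bound`, `enorm_tensor_mul_le`).

Regularity at X₀: the directions lying over the ray through X₀ form a compact set. At (0, Y) there
is rapid decay. At (X₀, Y₁) the Cauchy–Schwarz inequality in Y pairs K at order s₁ with u at order
-r₂, or, when Y₁ ≠ 0, K at order -r₁ with u at order s₂. This proves the inclusion at order s_*
(`notMem_wfIsoOrder_applyKer`), and the order s_* - μ follows by monotonicity. The statement for
Schwartz u is the case r₂ = 0, s₂ = s₁ + r₁.

Continuity: a convergent sequence is uniformly of polynomial growth in phase space by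
Banach–Steinhaus (`exists_uniform_coh_bound`). Off Γ the elliptic bootstrap, applied to the supremum
over the sequence, gives uniform rapid decay, and dominated convergence applies
(`tendsto_applyKer`). Uniqueness: restricting the inversion integral to large balls approximates u
by Schwartz functions in 𝓢'_Γ with Γ = WF(u) (`exists_tendstoInCone`), and this Γ is itself an
admissible cone. -/

/-- The weight `1 + ‖x‖`. -/
def wt {F : Type*} [NormedAddCommGroup F] (x : F) : ℝ := 1 + ‖x‖

section Weight
variable {F : Type*} [NormedAddCommGroup F]

theorem one_le_wt (x : F) : 1 ≤ wt x := by unfold wt; linarith [norm_nonneg x]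

theorem wt_pos (x : F) : 0 < wt x := lt_of_lt_of_le one_pos (one_le_wt x)

theorem wt_rpow_pos (x : F) (s : ℝ) : 0 < wt x ^ s := Real.rpow_pos_of_pos (wt_pos x) s

theorem norm_le_wt (x : F) : ‖x‖ ≤ wt x := by unfold wt; linarith

@[simp] theorem wt_neg (x : F) : wt (-x) = wt x := by simp [wt]

theorem wt_sub_comm (x y : F) : wt (x - y) = wt (y - x) := by simp [wt, norm_sub_rev]

theorem wt_add_le (x y : F) : wt (x + y) ≤ wt x * wt y := by
  unfold wt
  nlinarith [norm_add_le x y, norm_nonneg x, norm_nonneg y,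
    mul_nonneg (norm_nonneg x) (norm_nonneg y)]

theorem wt_le_sub_mul (x y : F) : wt x ≤ wt (x - y) * wt y := by
  simpa using wt_add_le (x - y) y

theorem wt_rpow_le {x : F} {s t : ℝ} (h : s ≤ t) : wt x ^ s ≤ wt x ^ t :=
  Real.rpow_le_rpow_of_exponent_le (one_le_wt x) h

theorem wt_rpow_add (x : F) (s t : ℝ) : wt x ^ (s + t) = wt x ^ s * wt x ^ t :=
  Real.rpow_add (wt_pos x) s t

theorem wt_rpow_le_one (x : F) {s : ℝ} (h : s ≤ 0) : wt x ^ s ≤ 1 :=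
  Real.rpow_le_one_of_one_le_of_nonpos (one_le_wt x) h

theorem wt_rpow_mul_neg (x : F) (s : ℝ) : wt x ^ s * wt x ^ (-s) = 1 := by
  rw [← wt_rpow_add]; simp

/-- Peetre's inequality. -/
theorem wt_rpow_peetre (x y : F) (s : ℝ) : wt x ^ s ≤ wt (x - y) ^ |s| * wt y ^ s := by
  rcases le_total 0 s with hs | hs
  · rw [abs_of_nonneg hs, ← Real.mul_rpow (wt_pos _).le (wt_pos _).le]
    exact Real.rpow_le_rpow (wt_pos _).le (wt_le_sub_mul x y) hs
  · rw [abs_of_nonpos hs]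
    -- For negative exponents the inequality is the positive case with x and y exchanged.
    have h : wt y ^ (-s) ≤ wt (x - y) ^ (-s) * wt x ^ (-s) := by
      rw [← Real.mul_rpow (wt_pos _).le (wt_pos _).le, wt_sub_comm x y]
      exact Real.rpow_le_rpow (wt_pos _).le (wt_le_sub_mul y x) (by linarith)
    calc wt x ^ s = wt x ^ s * (wt y ^ (-s) * wt y ^ s) := by
          rw [mul_comm (wt y ^ (-s)), wt_rpow_mul_neg, mul_one]
      _ ≤ wt x ^ s * ((wt (x - y) ^ (-s) * wt x ^ (-s)) * wt y ^ s) := by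
          gcongr
          · exact (wt_rpow_pos _ _).le
          · exact (wt_rpow_pos _ _).le
      _ = wt (x - y) ^ (-s) * wt y ^ s * (wt x ^ s * wt x ^ (-s)) := by ring
      _ = _ := by rw [wt_rpow_mul_neg, mul_one]

theorem continuous_wt : Continuous (wt : F → ℝ) := by unfold wt; fun_prop

theorem continuous_wt_rpow (s : ℝ) : Continuous (fun x : F => wt x ^ s) :=
  continuous_wt.rpow_const fun x => Or.inl (wt_pos x).ne'

theorem wt_prod_fst_le {G : Type*} [NormedAddCommGroup G] (p : F × G) : wt p.1 ≤ wt p := by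
  unfold wt; linarith [norm_fst_le p]

theorem wt_prod_snd_le {G : Type*} [NormedAddCommGroup G] (p : F × G) : wt p.2 ≤ wt p := by
  unfold wt; linarith [norm_snd_le p]

theorem wt_prod_le {G : Type*} [NormedAddCommGroup G] (p : F × G) : wt p ≤ wt p.1 * wt p.2 := by
  unfold wt
  have := norm_prod_le_iff (x := p) (r := ‖p.1‖ + ‖p.2‖)
  nlinarith [this.2 ⟨by linarith [norm_nonneg p.2], by linarith [norm_nonneg p.1]⟩,
    norm_nonneg p.1, norm_nonneg p.2, mul_nonneg (norm_nonneg p.1) (norm_nonneg p.2)]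

theorem wt_smul_le {c : ℝ} (hc : |c| ≤ 1) [NormedSpace ℝ F] (x : F) : wt (c • x) ≤ wt x := by
  unfold wt
  rw [norm_smul, Real.norm_eq_abs]
  nlinarith [norm_nonneg x]

variable [NormedSpace ℝ F] [FiniteDimensional ℝ F] [MeasurableSpace F] [BorelSpace F]

/-- An exponent beyond which negative powers of the weight are integrable. -/
def intExp (F : Type*) [NormedAddCommGroup F] [NormedSpace ℝ F] : ℝ := Module.finrank ℝ F + 1

theorem intExp_pos (F : Type*) [NormedAddCommGroup F] [NormedSpace ℝ F] : 0 < intExp F := by unfold intExp; positivity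

theorem integrable_wt (μ : Measure F) [μ.IsAddHaarMeasure] {s : ℝ} (hs : s ≤ -intExp F) :
    Integrable (fun x : F => wt x ^ s) μ := by
  have := integrable_one_add_norm (E := F) (μ := μ) (r := -s) (by unfold intExp at hs; linarith)
  simpa [wt] using this

theorem lintegral_wt_lt_top (μ : Measure F) [μ.IsAddHaarMeasure] {s : ℝ} (hs : s ≤ -intExp F) :
    ∫⁻ x : F, ENNReal.ofReal (wt x ^ s) ∂μ < ⊤ := by
  have h := (integrable_wt μ hs).hasFiniteIntegral
  rwa [hasFiniteIntegral_iff_ofReal (Eventually.of_forall fun x => (wt_rpow_pos x s).le)] at h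

end Weight

/-! ### Square integrals -/

theorem lintegral_mul_sq_le {α : Type*} [MeasurableSpace α] (μ : Measure α) {f g : α → ℝ≥0∞}
    (hf : AEMeasurable f μ) (hg : AEMeasurable g μ) :
    (∫⁻ a, f a * g a ∂μ) ^ 2 ≤ (∫⁻ a, f a ^ 2 ∂μ) * ∫⁻ a, g a ^ 2 ∂μ := by
  have h := ENNReal.lintegral_mul_le_Lp_mul_Lq μ Real.HolderConjugate.two_two hf hg
  have h2 := pow_le_pow_left' h 2
  have e : ∀ x : ℝ≥0∞, (x ^ (1 / 2 : ℝ)) ^ 2 = x := fun x => by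
    rw [← ENNReal.rpow_natCast, ← ENNReal.rpow_mul]; simp
  simp only [mul_pow, e, Pi.mul_apply] at h2
  simpa using h2

theorem add_sq_le_two_mul (a b : ℝ≥0∞) : (a + b) ^ 2 ≤ 2 * a ^ 2 + 2 * b ^ 2 := by
  rcases eq_or_ne a ⊤ with rfl | ha
  · simp
  rcases eq_or_ne b ⊤ with rfl | hb
  · simp
  lift a to NNReal using ha
  lift b to NNReal using hb
  norm_cast
  have : ((a + b) ^ 2 : ℝ) ≤ 2 * a ^ 2 + 2 * b ^ 2 := by nlinarith [sq_nonneg ((a : ℝ) - b)]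
  exact_mod_cast this

/-- Schur's test for convolution kernels on `L²`. -/
theorem lintegral_convolution_sq_le {F : Type*} [NormedAddCommGroup F] [NormedSpace ℝ F]
    [FiniteDimensional ℝ F] [MeasurableSpace F] [BorelSpace F] (μ : Measure F) [μ.IsAddHaarMeasure]
    {k f : F → ℝ≥0∞} (hk : Measurable k) (hf : Measurable f) :
    ∫⁻ x, (∫⁻ z, k (x - z) * f z ∂μ) ^ 2 ∂μ ≤ (∫⁻ x, k x ∂μ) ^ 2 * ∫⁻ z, f z ^ 2 ∂μ := by
  have h1 : ∀ x, (∫⁻ z, k (x - z) * f z ∂μ) ^ 2 ≤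
      (∫⁻ x, k x ∂μ) * ∫⁻ z, k (x - z) * f z ^ 2 ∂μ := by
    intro x
    have hkx : Measurable fun z => k (x - z) := hk.comp (measurable_const.sub measurable_id)
    -- The kernel is split as k^(1/2) · k^(1/2) and only one of the factors is kept with f.
    have h := lintegral_mul_sq_le μ (f := fun z => (k (x - z)) ^ (1 / 2 : ℝ))
      (g := fun z => (k (x - z)) ^ (1 / 2 : ℝ) * f z)
      (hkx.pow_const _).aemeasurable ((hkx.pow_const _).mul hf).aemeasurable
    have e : ∀ x : ℝ≥0∞, x ^ (1 / 2 : ℝ) * x ^ (1 / 2 : ℝ) = x := fun x => by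
      rw [← ENNReal.rpow_add_of_nonneg _ _ (by norm_num) (by norm_num)]; norm_num
    have e2 : ∀ x : ℝ≥0∞, (x ^ (1 / 2 : ℝ)) ^ 2 = x := fun x => by rw [sq, e]
    simp only [← mul_assoc, e, mul_pow, e2] at h
    rwa [lintegral_sub_left_eq_self k x] at h
  calc _ ≤ ∫⁻ x, (∫⁻ x, k x ∂μ) * ∫⁻ z, k (x - z) * f z ^ 2 ∂μ ∂μ := lintegral_mono h1
    _ = (∫⁻ x, k x ∂μ) * ∫⁻ x, ∫⁻ z, k (x - z) * f z ^ 2 ∂μ ∂μ := by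
        rw [lintegral_const_mul]
        apply Measurable.lintegral_prod_right'
          (f := fun p : F × F => k (p.1 - p.2) * f p.2 ^ 2)
        fun_prop
    _ = (∫⁻ x, k x ∂μ) * ∫⁻ z, ∫⁻ x, k (x - z) * f z ^ 2 ∂μ ∂μ := by
        rw [lintegral_lintegral_swap]
        apply Measurable.aemeasurable
        fun_prop
    _ = _ := by
        have : ∀ z, ∫⁻ x, k (x - z) * f z ^ 2 ∂μ = (∫⁻ x, k x ∂μ) * f z ^ 2 := fun z => by
          rw [lintegral_mul_const _ (by fun_prop), lintegral_sub_right_eq_self k z]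
        simp_rw [this]
        rw [lintegral_const_mul _ (hf.pow_const _), sq, mul_assoc]

/-! ### Smoothness of parametric integrals -/

theorem hasFDerivAt_iteratedFDeriv {E F : Type*} [NormedAddCommGroup E] [NormedSpace ℝ E]
    [NormedAddCommGroup F] [NormedSpace ℝ F] {f : E → F} (hf : ContDiff ℝ ∞ f) (n : ℕ) (y : E) :
    HasFDerivAt (iteratedFDeriv ℝ n f) (iteratedFDeriv ℝ (n + 1) f y).curryLeft y := by
  have h := (contDiff_iff_ftaylorSeries.1 hf).fderiv n (by exact_mod_cast ENat.natCast_lt_top n) y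
  exact h

/-- The derivative is prescribed through its values on vectors: in the application it is the
currying of an integral of multilinear maps, and evaluation commutes with the integral on both
sides. -/
theorem hasFDerivAt_integral_of_apply_eq {α E G : Type*} [MeasurableSpace α] {μ : Measure α}
    [NormedAddCommGroup E] [NormedSpace ℝ E] [NormedAddCommGroup G] [NormedSpace ℝ G]
    {f : α → E → G} {f' : α → E → E →L[ℝ] G} {b : α → ℝ} {x : E} {A : E →L[ℝ] G}
    (hm : ∀ x, AEStronglyMeasurable (fun a => f a x) μ) (hi : Integrable (fun a => f a x) μ)
    (hm' : AEStronglyMeasurable (fun a => f' a x) μ) (hb : Integrable b μ)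
    (hfb : ∀ a x, ‖f' a x‖ ≤ b a) (hd : ∀ a x, HasFDerivAt (f a) (f' a x) x)
    (hA : ∀ v, A v = ∫ a, f' a x v ∂μ) :
    HasFDerivAt (fun x => ∫ a, f a x ∂μ) A x := by
  have hi' : Integrable (fun a => f' a x) μ :=
    hb.mono' hm' (Eventually.of_forall fun a => hfb a x)
  have hA' : A = ∫ a, f' a x ∂μ := by
    ext v
    rw [hA, ContinuousLinearMap.integral_apply hi']
  rw [hA']
  exact hasFDerivAt_integral_of_dominated_of_fderiv_le (bound := b) (s := univ)
    (F' := fun x a => f' a x) univ_mem (Eventually.of_forall hm) hi hm'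
    (Eventually.of_forall fun a x _ => hfb a x) hb (Eventually.of_forall fun a x _ => hd a x)

/-- The integrals of the successive derivatives form a Taylor series: domination of the derivative
of order n + 1, uniform in the parameter, allows one more differentiation under the integral sign.
The series yields smoothness and the formula together. -/
theorem contDiff_integral_of_dominated {α E F : Type*} [MeasurableSpace α] {μ : Measure α}
    [NormedAddCommGroup E] [NormedSpace ℝ E] [NormedAddCommGroup F] [NormedSpace ℝ F]
    [CompleteSpace F] {f : α → E → F} {b : ℕ → α → ℝ} (hf : ∀ a, ContDiff ℝ ∞ (f a))
    (hm : ∀ n x, AEStronglyMeasurable (fun a => iteratedFDeriv ℝ n (f a) x) μ)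
    (hb : ∀ n, Integrable (b n) μ) (hfb : ∀ n a x, ‖iteratedFDeriv ℝ n (f a) x‖ ≤ b n a) :
    ContDiff ℝ ∞ (fun x => ∫ a, f a x ∂μ) ∧
      ∀ n x, iteratedFDeriv ℝ n (fun x => ∫ a, f a x ∂μ) x = ∫ a, iteratedFDeriv ℝ n (f a) x ∂μ := by
  have hint : ∀ n x, Integrable (fun a => iteratedFDeriv ℝ n (f a) x) μ := fun n x =>
    (hb n).mono' (hm n x) (Eventually.of_forall fun a => hfb n a x)
  have hd : ∀ n x, HasFDerivAt (fun x => ∫ a, iteratedFDeriv ℝ n (f a) x ∂μ)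
      (∫ a, iteratedFDeriv ℝ (n + 1) (f a) x ∂μ).curryLeft x := by
    intro n x
    refine hasFDerivAt_integral_of_apply_eq (b := b (n + 1))
      (f' := fun a x => (iteratedFDeriv ℝ (n + 1) (f a) x).curryLeft)
      (hm n) (hint n x) ?_ (hb _) ?_ ?_ ?_
    · exact (continuousMultilinearCurryLeftEquiv ℝ
        (fun _ : Fin (n + 1) => E) F).continuous.comp_aestronglyMeasurable (hm (n + 1) x)
    · intro a y
      refine le_trans (le_of_eq ?_) (hfb (n + 1) a y)
      exact ContinuousMultilinearMap.curryLeft_norm _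
    · exact fun a y => hasFDerivAt_iteratedFDeriv (hf a) n y
    · intro v
      have hv : Integrable (fun a => (iteratedFDeriv ℝ (n + 1) (f a) x).curryLeft v) μ := by
        refine ((hb (n + 1)).mul_const ‖v‖).mono' ?_ (Eventually.of_forall fun a => ?_)
        · exact ((continuousMultilinearCurryLeftEquiv ℝ
            (fun _ : Fin (n + 1) => E) F).continuous.comp_aestronglyMeasurable
              (hm (n + 1) x)).apply_continuousLinearMap v
        · refine (ContinuousLinearMap.le_opNorm _ v).trans ?_
          gcongr
          exact (ContinuousMultilinearMap.curryLeft_norm _).le.trans (hfb (n + 1) a x)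
      ext m
      rw [ContinuousMultilinearMap.curryLeft_apply,
        ContinuousMultilinearMap.integral_apply (hint (n + 1) x),
        ContinuousMultilinearMap.integral_apply hv]
      rfl
  have hT : HasFTaylorSeriesUpTo ∞ (fun x => ∫ a, f a x ∂μ)
      (fun x n => ∫ a, iteratedFDeriv ℝ n (f a) x ∂μ) := by
    refine ⟨fun x => ?_, fun m _ x => ?_, fun m _ => ?_⟩
    · change (∫ a, iteratedFDeriv ℝ 0 (f a) x ∂μ) 0 = _
      rw [ContinuousMultilinearMap.integral_apply (hint 0 x)]
      simp
    · exact hd m x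
    · exact continuous_iff_continuousAt.2 fun x => (hd m x).continuousAt
  exact ⟨hT.contDiff, fun n x => (hT.eq_iteratedFDeriv (by exact_mod_cast le_top) x).symm⟩

/-! ### Derivatives of exponentials -/

/-- Since exp (w + z) = exp z · exp w, the derivatives at z are exp z times those at 0. -/
theorem norm_iteratedFDeriv_cexp_le (n : ℕ) :
    ∃ C : ℝ, 1 ≤ C ∧ ∀ i ≤ n, ∀ z : ℂ, ‖iteratedFDeriv ℝ i Complex.exp z‖ ≤ C * ‖Complex.exp z‖ := by
  have h : ∀ (i : ℕ) (z : ℂ), ‖iteratedFDeriv ℝ i Complex.exp z‖ ≤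
      ‖iteratedFDeriv ℝ i Complex.exp 0‖ * ‖Complex.exp z‖ := by
    intro i z
    have e : (fun w : ℂ => Complex.exp (w + z)) = Complex.exp z • Complex.exp := by
      ext w; simp [Complex.exp_add, mul_comm]
    have h1 := iteratedFDeriv_comp_add_right (𝕜 := ℝ) (f := Complex.exp) i z 0
    rw [zero_add] at h1
    rw [← h1, e, iteratedFDeriv_const_smul_apply, norm_smul, mul_comm]
    exact (Complex.contDiff_exp (n := (i : WithTop ℕ∞))).contDiffAt
  refine ⟨1 + ∑ i ∈ Finset.range (n + 1), ‖iteratedFDeriv ℝ i Complex.exp 0‖, ?_, fun i hi z => ?_⟩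
  · have : 0 ≤ ∑ i ∈ Finset.range (n + 1), ‖iteratedFDeriv ℝ i Complex.exp 0‖ := by positivity
    linarith
  · refine (h i z).trans ?_
    gcongr
    have := Finset.single_le_sum (f := fun i => ‖iteratedFDeriv ℝ i Complex.exp (0 : ℂ)‖)
      (fun i _ => norm_nonneg _) (Finset.mem_range.2 (Nat.lt_succ_of_le hi))
    linarith

theorem norm_iteratedFDeriv_cexp_comp_le {V : Type*} [NormedAddCommGroup V] [NormedSpace ℝ V]
    {q : V → ℂ} (hq : q.HasTemperateGrowth) (n : ℕ) :
    ∃ C M : ℝ, 0 ≤ C ∧ 0 ≤ M ∧ ∀ v,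
      ‖iteratedFDeriv ℝ n (fun v => Complex.exp (q v)) v‖ ≤ C * ‖Complex.exp (q v)‖ * wt v ^ M := by
  obtain ⟨k, D, hD0, hD⟩ := hq.norm_iteratedFDeriv_le_uniform n
  obtain ⟨C, hC1, hC⟩ := norm_iteratedFDeriv_cexp_le n
  refine ⟨n.factorial * C * (1 + D) ^ n, k * n, by positivity, by positivity, fun v => ?_⟩
  have hw : (1 : ℝ) ≤ (1 + ‖v‖) ^ k := one_le_pow₀ (by linarith [norm_nonneg v])
  -- The formula for composites needs the i-th derivative of q below the i-th power of one number;
  -- enlarging the constant to 1 + D makes that number at least 1, so a bound by its first power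
  -- suffices.
  have h := norm_iteratedFDeriv_comp_le (𝕜 := ℝ) (g := Complex.exp) (f := q) (N := n) (n := n)
    Complex.contDiff_exp (hq.1.of_le (by exact_mod_cast le_top)) le_rfl v
    (C := C * ‖Complex.exp (q v)‖) (D := (1 + D) * (1 + ‖v‖) ^ k)
    (fun i hi => hC i hi (q v)) (fun i hi1 hi => by
      have hge : 1 ≤ (1 + D) * (1 + ‖v‖) ^ k := by nlinarith
      calc _ ≤ D * (1 + ‖v‖) ^ k := hD i hi v
        _ ≤ (1 + D) * (1 + ‖v‖) ^ k := by gcongr; linarith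
        _ ≤ _ := le_self_pow₀ hge (by omega))
  refine h.trans (le_of_eq ?_)
  rw [mul_pow, Real.rpow_mul (wt_pos v).le, Real.rpow_natCast, Real.rpow_natCast]
  unfold wt
  ring

theorem exp_neg_sq_le (N : ℝ) : ∃ C : ℝ, 0 ≤ C ∧ ∀ t : ℝ, 0 ≤ t →
    Real.exp (-(t ^ 2 / 2)) ≤ C * (1 + t) ^ (-N) := by
  obtain ⟨k, hk⟩ := exists_nat_ge N
  refine ⟨k.factorial * Real.exp (3 / 2), by positivity, fun t ht => ?_⟩
  have h1 : (1 + t) ^ N ≤ (1 + t) ^ k := by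
    rw [← Real.rpow_natCast]
    exact Real.rpow_le_rpow_of_exponent_le (by linarith) hk
  -- The shift 3/2 is what (t - 1)² ≥ 0 requires; a single term of the exponential series then
  -- dominates the k-th power.
  have h2 : (1 + t) ^ k ≤ (3 / 2 + t ^ 2 / 2) ^ k := by
    refine pow_le_pow_left₀ (by linarith) ?_ k
    nlinarith [sq_nonneg (t - 1)]
  have h3 := Real.pow_div_factorial_le_exp (x := 3 / 2 + t ^ 2 / 2) (by positivity) k
  rw [div_le_iff₀ (by positivity), Real.exp_add] at h3
  rw [Real.rpow_neg (by linarith), Real.exp_neg, ← div_eq_mul_inv,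
    le_div_iff₀ (by positivity), inv_mul_le_iff₀ (Real.exp_pos _)]
  nlinarith

/-! ### Gaussian coherent states and their dependence on the centre -/

section Coherent

variable {E : Type*} [NormedAddCommGroup E] [InnerProductSpace ℝ E]

/-- The exponent of a Gaussian coherent state, as a function of its phase space centre and of the
space variable. -/
def cohExp (v : (E × E) × E) : ℂ :=
  ((-(1 / 2 : ℝ) * ‖v.2 - v.1.1‖ ^ 2 : ℝ) : ℂ) - Complex.I * ((inner ℝ v.2 v.1.2 : ℝ) : ℂ)

theorem cohExp_hasTemperateGrowth : (cohExp : (E × E) × E → ℂ).HasTemperateGrowth := by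
  have h1 : (fun v : (E × E) × E => ‖v.2 - v.1.1‖ ^ 2).HasTemperateGrowth := by
    have := (Function.hasTemperateGrowth_norm_sq (H := E)).comp
      ((ContinuousLinearMap.snd ℝ (E × E) E - (ContinuousLinearMap.fst ℝ E E).comp
        (ContinuousLinearMap.fst ℝ (E × E) E)).hasTemperateGrowth)
    exact this
  have h2 : (fun v : (E × E) × E => (inner ℝ v.2 v.1.2 : ℝ)).HasTemperateGrowth := by
    exact (innerSL ℝ (E := E)).bilinear_hasTemperateGrowth
      (ContinuousLinearMap.snd ℝ (E × E) E).hasTemperateGrowth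
      ((ContinuousLinearMap.snd ℝ E E).comp
        (ContinuousLinearMap.fst ℝ (E × E) E)).hasTemperateGrowth
  have e : (cohExp : (E × E) × E → ℂ) = fun v => ((-(1 / 2 : ℝ) : ℝ) : ℂ) *
      ((‖v.2 - v.1.1‖ ^ 2 : ℝ) : ℂ) - Complex.I * ((inner ℝ v.2 v.1.2 : ℝ) : ℂ) := by
    ext v; simp [cohExp]
  rw [e]
  exact ((Function.HasTemperateGrowth.const _).mul
    (Function.Complex.hasTemperateGrowth_ofReal.comp h1)).sub
    ((Function.HasTemperateGrowth.const _).mul (Function.Complex.hasTemperateGrowth_ofReal.comp h2))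

theorem norm_cexp_cohExp (v : (E × E) × E) :
    ‖Complex.exp (cohExp v)‖ = Real.exp (-(‖v.2 - v.1.1‖ ^ 2 / 2)) := by
  rw [Complex.norm_exp]
  congr 1
  simp only [cohExp, Complex.sub_re, Complex.ofReal_re, Complex.mul_re, Complex.I_re,
    Complex.I_im, Complex.ofReal_im]
  ring

/-- Peetre's inequality trades the Gaussian in x minus the centre for decay in x, at the price of a
power of the weight of the centre. Derivatives are taken jointly in centre and space variable, so
that the same bound controls both the Schwartz seminorms of a coherent state and its variation with
the centre. -/
theorem norm_iteratedFDeriv_cexp_cohExp_le (n : ℕ) (N : ℝ) :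
    ∃ C M : ℝ, 0 ≤ C ∧ 0 ≤ M ∧ ∀ (X : E × E) (x : E),
      ‖iteratedFDeriv ℝ n (fun v => Complex.exp (cohExp v)) (X, x)‖ ≤
        C * wt X ^ M * wt x ^ (-N) := by
  obtain ⟨C, M, hC, hM, h⟩ := norm_iteratedFDeriv_cexp_comp_le (cohExp_hasTemperateGrowth (E := E)) n
  obtain ⟨D, hD, hexp⟩ := exp_neg_sq_le (|N| + M)
  refine ⟨C * D, M + (|N| + M), by positivity, by positivity, fun X x => (h (X, x)).trans ?_⟩
  rw [norm_cexp_cohExp]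
  have h1 : Real.exp (-(‖x - X.1‖ ^ 2 / 2)) ≤ D * (wt X ^ (|N| + M) * wt x ^ (-(|N| + M))) := by
    refine (hexp _ (norm_nonneg _)).trans ?_
    gcongr
    have h2 := wt_rpow_peetre (x - X.1) x (-(|N| + M))
    simp only [sub_sub_cancel_left, wt_neg, abs_neg, abs_of_nonneg (a := |N| + M) (by positivity)]
      at h2
    refine h2.trans ?_
    gcongr
    · exact (wt_rpow_pos _ _).le
    · exact (wt_pos _).le
    · exact wt_prod_fst_le X
  have h3 : wt (X, x) ^ M ≤ wt X ^ M * wt x ^ M := by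
    rw [← Real.mul_rpow (wt_pos _).le (wt_pos _).le]
    exact Real.rpow_le_rpow (wt_pos _).le (wt_prod_le (X, x)) hM
  calc C * Real.exp (-(‖x - X.1‖ ^ 2 / 2)) * wt (X, x) ^ M
      ≤ C * (D * (wt X ^ (|N| + M) * wt x ^ (-(|N| + M)))) * (wt X ^ M * wt x ^ M) := by
        have := wt_pos X
        have := wt_pos x
        have := wt_pos (X, x)
        gcongr
    _ = C * D * wt X ^ (M + (|N| + M)) * (wt x ^ (-(|N| + M)) * wt x ^ M) := by
        rw [wt_rpow_add X M]; ring
    _ ≤ _ := by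
        rw [← wt_rpow_add]
        have := wt_pos X
        gcongr
        · exact one_le_wt x
        · linarith [le_abs_self N]

theorem iteratedFDeriv_cexp_cohExp_right (X : E × E) (n : ℕ) (x : E) :
    iteratedFDeriv ℝ n (fun x => Complex.exp (cohExp (X, x))) x =
      (iteratedFDeriv ℝ n (fun v => Complex.exp (cohExp v)) (X, x)).compContinuousLinearMap
        (fun _ => ContinuousLinearMap.inr ℝ (E × E) E) := by
  have hs : ContDiff ℝ ∞ (fun v : (E × E) × E => Complex.exp (cohExp ((X, 0) + v))) :=
    Complex.contDiff_exp.comp (cohExp_hasTemperateGrowth.1.comp (contDiff_const.add contDiff_id))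
  have e : (fun x : E => Complex.exp (cohExp (X, x))) =
      (fun v : (E × E) × E => Complex.exp (cohExp ((X, 0) + v))) ∘
        (ContinuousLinearMap.inr ℝ (E × E) E) := by
    ext x; simp
  rw [e, ContinuousLinearMap.iteratedFDeriv_comp_right _ hs x (by exact_mod_cast le_top),
    iteratedFDeriv_comp_add_left (f := fun v : (E × E) × E => Complex.exp (cohExp v))]
  simp

theorem norm_compContinuousLinearMap_inr_le {n : ℕ} (A : ((E × E) × E) [×n]→L[ℝ] ℂ) :
    ‖A.compContinuousLinearMap (fun _ => ContinuousLinearMap.inr ℝ (E × E) E)‖ ≤ ‖A‖ := by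
  refine (ContinuousMultilinearMap.norm_compContinuousLinearMap_le _ _).trans ?_
  refine mul_le_of_le_one_right (norm_nonneg _) ?_
  refine Finset.prod_le_one (fun _ _ => norm_nonneg _) fun _ _ => ?_
  exact ContinuousLinearMap.norm_inr_le_one ℝ (E × E) E

/-- The Gaussian coherent state `x ↦ exp (-|x - z|² / 2 - i ⟨x, ζ⟩)` centred at `X = (z, ζ)`. -/
def coh (X : E × E) : 𝓢(E, ℂ) where
  toFun x := Complex.exp (cohExp (X, x))
  smooth' := Complex.contDiff_exp.comp
    (cohExp_hasTemperateGrowth.1.comp (contDiff_const.prodMk contDiff_id))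
  decay' k n := by
    obtain ⟨C, M, hC, hM, h⟩ := norm_iteratedFDeriv_cexp_cohExp_le (E := E) n k
    refine ⟨C * wt X ^ M, fun x => ?_⟩
    rw [iteratedFDeriv_cexp_cohExp_right]
    calc _ ≤ wt x ^ (k : ℝ) * (C * wt X ^ M * wt x ^ (-(k : ℝ))) := by
          gcongr
          · exact (wt_rpow_pos _ _).le
          · rw [Real.rpow_natCast]
            exact pow_le_pow_left₀ (norm_nonneg _) (norm_le_wt x) k
          · exact (norm_compContinuousLinearMap_inr_le _).trans (h X x)
      _ = C * wt X ^ M * (wt x ^ (k : ℝ) * wt x ^ (-(k : ℝ))) := by ring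
      _ = _ := by rw [wt_rpow_mul_neg, mul_one]

theorem coh_apply (X : E × E) (x : E) : coh X x = Complex.exp (cohExp (X, x)) := rfl

theorem norm_coh_apply (X : E × E) (x : E) : ‖coh X x‖ = Real.exp (-(‖x - X.1‖ ^ 2 / 2)) :=
  norm_cexp_cohExp (X, x)

theorem norm_iteratedFDeriv_coh_le (n : ℕ) (N : ℝ) :
    ∃ C M : ℝ, 0 ≤ C ∧ 0 ≤ M ∧ ∀ (X : E × E) (x : E),
      ‖iteratedFDeriv ℝ n (coh X) x‖ ≤ C * wt X ^ M * wt x ^ (-N) := by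
  obtain ⟨C, M, hC, hM, h⟩ := norm_iteratedFDeriv_cexp_cohExp_le (E := E) n N
  refine ⟨C, M, hC, hM, fun X x => ?_⟩
  have := iteratedFDeriv_cexp_cohExp_right X n x
  change ‖iteratedFDeriv ℝ n (fun x => Complex.exp (cohExp (X, x))) x‖ ≤ _
  rw [this]
  exact (norm_compContinuousLinearMap_inr_le _).trans (h X x)

/-- The mean value inequality on the segment joining the centres, with one more joint derivative. -/
theorem norm_iteratedFDeriv_coh_sub_le (n : ℕ) (N : ℝ) :
    ∃ C M : ℝ, 0 ≤ C ∧ 0 ≤ M ∧ ∀ (X Y : E × E) (x : E),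
      ‖iteratedFDeriv ℝ n (coh Y) x - iteratedFDeriv ℝ n (coh X) x‖ ≤
        C * (wt X * wt (Y - X)) ^ M * wt x ^ (-N) * ‖Y - X‖ := by
  obtain ⟨C, M, hC, hM, h⟩ := norm_iteratedFDeriv_cexp_cohExp_le (E := E) (n + 1) N
  refine ⟨C, M, hC, hM, fun X Y x => ?_⟩
  change ‖iteratedFDeriv ℝ n (fun x => Complex.exp (cohExp (Y, x))) x -
    iteratedFDeriv ℝ n (fun x => Complex.exp (cohExp (X, x))) x‖ ≤ _
  rw [iteratedFDeriv_cexp_cohExp_right, iteratedFDeriv_cexp_cohExp_right]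
  set Φ : (E × E) × E → ℂ := fun v => Complex.exp (cohExp v) with hΦ
  have hsm : ContDiff ℝ ∞ Φ := Complex.contDiff_exp.comp cohExp_hasTemperateGrowth.1
  have e : (iteratedFDeriv ℝ n Φ (Y, x)).compContinuousLinearMap
        (fun _ => ContinuousLinearMap.inr ℝ (E × E) E) -
      (iteratedFDeriv ℝ n Φ (X, x)).compContinuousLinearMap
        (fun _ => ContinuousLinearMap.inr ℝ (E × E) E) =
      (iteratedFDeriv ℝ n Φ (Y, x) - iteratedFDeriv ℝ n Φ (X, x)).compContinuousLinearMap
        (fun _ => ContinuousLinearMap.inr ℝ (E × E) E) := by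
    ext; simp
  rw [e]
  refine (norm_compContinuousLinearMap_inr_le _).trans ?_
  have hmv := (convex_segment ((X, x) : (E × E) × E) (Y, x)).norm_image_sub_le_of_norm_fderiv_le
    (𝕜 := ℝ) (f := iteratedFDeriv ℝ n Φ) (C := C * (wt X * wt (Y - X)) ^ M * wt x ^ (-N))
    (fun v _ => (hasFDerivAt_iteratedFDeriv hsm n v).differentiableAt) (fun v hv => ?_)
    (left_mem_segment ℝ _ _) (right_mem_segment ℝ _ _)
  · refine hmv.trans (le_of_eq ?_)
    congr 1
    simp [Prod.norm_def]
  · rw [norm_fderiv_iteratedFDeriv]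
    obtain ⟨θ, ⟨hθ0, hθ1⟩, rfl⟩ := (segment_eq_image' ℝ ((X, x) : (E × E) × E) (Y, x) ▸ hv)
    have e2 : ((X, x) : (E × E) × E) + θ • ((Y, x) - (X, x)) = (X + θ • (Y - X), x) := by
      simp
    simp only [e2]
    refine (h _ x).trans ?_
    gcongr
    · exact (wt_rpow_pos _ _).le
    · exact (wt_pos _).le
    · refine (wt_add_le _ _).trans ?_
      gcongr
      · exact (wt_pos _).le
      · exact wt_smul_le (abs_le.2 ⟨by linarith, hθ1⟩) _

/-- Continuity with values in Schwartz space makes the short-time Fourier transform of every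
tempered distribution a continuous function. -/
theorem continuous_coh : Continuous (coh : E × E → 𝓢(E, ℂ)) := by
  rw [continuous_iff_continuousAt]
  intro X
  rw [ContinuousAt, (schwartz_withSeminorms ℝ E ℂ).tendsto_nhds]
  rintro ⟨k, n⟩ ε hε
  obtain ⟨C, M, hC, hM, h⟩ := norm_iteratedFDeriv_coh_sub_le (E := E) n k
  have hb : ∀ Y : E × E, SchwartzMap.seminorm ℝ k n (coh Y - coh X) ≤
      C * (wt X * wt (Y - X)) ^ M * ‖Y - X‖ := by
    intro Y
    have hw : 0 ≤ (wt X * wt (Y - X)) ^ M :=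
      Real.rpow_nonneg (mul_nonneg (wt_pos _).le (wt_pos _).le) _
    refine SchwartzMap.seminorm_le_bound ℝ k n _ (by positivity) fun x => ?_
    have e : iteratedFDeriv ℝ n (coh Y - coh X : 𝓢(E, ℂ)) x =
        iteratedFDeriv ℝ n (coh Y) x - iteratedFDeriv ℝ n (coh X) x := by
      have : ((coh Y - coh X : 𝓢(E, ℂ)) : E → ℂ) = (coh Y : E → ℂ) - (coh X : E → ℂ) := rfl
      rw [this, iteratedFDeriv_sub_apply (((coh Y).smooth n).contDiffAt)
        (((coh X).smooth n).contDiffAt)]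
    rw [e]
    calc _ ≤ wt x ^ (k : ℝ) * (C * (wt X * wt (Y - X)) ^ M * wt x ^ (-(k : ℝ)) * ‖Y - X‖) := by
          gcongr
          · exact (wt_rpow_pos _ _).le
          · rw [Real.rpow_natCast]
            exact pow_le_pow_left₀ (norm_nonneg _) (norm_le_wt x) k
          · exact h X Y x
      _ = C * (wt X * wt (Y - X)) ^ M * ‖Y - X‖ * (wt x ^ (k : ℝ) * wt x ^ (-(k : ℝ))) := by ring
      _ = _ := by rw [wt_rpow_mul_neg, mul_one]
  have ht : Tendsto (fun Y : E × E => C * (wt X * wt (Y - X)) ^ M * ‖Y - X‖) (𝓝 X) (𝓝 0) := by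
    have hc : Continuous (fun Y : E × E => C * (wt X * wt (Y - X)) ^ M * ‖Y - X‖) := by
      have : Continuous fun Y : E × E => wt X * wt (Y - X) :=
        continuous_const.mul (continuous_wt.comp (continuous_id.sub continuous_const))
      exact (continuous_const.mul (this.rpow_const fun _ => Or.inr hM)).mul
        (continuous_id.sub continuous_const).norm
    simpa using hc.tendsto X
  filter_upwards [ht.eventually (gt_mem_nhds hε)] with Y hY
  exact (hb Y).trans_lt hY

end Coherent

/-! ### Seminorms and functionals on Schwartz space -/

section Seminorms

variable {E : Type*} [NormedAddCommGroup E] [NormedSpace ℝ E]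

/-- The `N`-th norm of an increasing sequence defining the topology of Schwartz space. -/
def sn (N : ℕ) (f : 𝓢(E, ℂ)) : ℝ :=
  (Finset.Iic (N, N)).sup (schwartzSeminormFamily ℂ E ℂ) f

theorem sn_nonneg (N : ℕ) (f : 𝓢(E, ℂ)) : 0 ≤ sn N f := apply_nonneg _ _

theorem wt_mul_norm_iteratedFDeriv_le_sn {N k n : ℕ} (hk : k ≤ N) (hn : n ≤ N) (f : 𝓢(E, ℂ))
    (x : E) : wt x ^ (k : ℝ) * ‖iteratedFDeriv ℝ n f x‖ ≤ 2 ^ N * sn N f := by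
  rw [Real.rpow_natCast]
  exact SchwartzMap.one_add_le_sup_seminorm_apply (𝕜 := ℂ) (m := (N, N)) hk hn f x

theorem norm_iteratedFDeriv_le_sn {N k n : ℕ} (hk : k ≤ N) (hn : n ≤ N) (f : 𝓢(E, ℂ))
    (x : E) : ‖iteratedFDeriv ℝ n f x‖ ≤ 2 ^ N * sn N f * wt x ^ (-(k : ℝ)) := by
  have h := wt_mul_norm_iteratedFDeriv_le_sn hk hn f x
  have := wt_pos x
  rw [Real.rpow_neg (wt_pos x).le, ← div_eq_mul_inv, le_div_iff₀ (by positivity)]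
  linarith

theorem norm_le_sn {N k : ℕ} (hk : k ≤ N) (f : 𝓢(E, ℂ)) (x : E) :
    ‖f x‖ ≤ 2 ^ N * sn N f * wt x ^ (-(k : ℝ)) := by
  simpa using norm_iteratedFDeriv_le_sn hk (Nat.zero_le N) f x

theorem sn_le_of_bound {N : ℕ} {f : 𝓢(E, ℂ)} {B : ℝ} (hB : 0 ≤ B)
    (h : ∀ k ≤ N, ∀ n ≤ N, ∀ x, wt x ^ (k : ℝ) * ‖iteratedFDeriv ℝ n f x‖ ≤ B) : sn N f ≤ B := by
  refine Seminorm.finset_sup_apply_le hB fun i hi => ?_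
  rw [Finset.mem_Iic] at hi
  refine SchwartzMap.seminorm_le_bound ℂ i.1 i.2 f hB fun x => ?_
  refine le_trans ?_ (h i.1 hi.1 i.2 hi.2 x)
  rw [Real.rpow_natCast]
  gcongr
  exact norm_le_wt x

theorem exists_sn_bound (u : 𝓢'(E, ℂ)) : ∃ (N : ℕ) (C : ℝ), 0 ≤ C ∧ ∀ f, ‖u f‖ ≤ C * sn N f := by
  have hc : Continuous (fun f => ‖u f‖) := by
    have : Continuous (fun f => u f) := ContinuousLinearMap.continuous u
    exact this.norm
  obtain ⟨s, C, -, h⟩ := Seminorm.bound_of_continuous (schwartz_withSeminorms ℂ E ℂ)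
    ((normSeminorm ℂ ℂ).comp (u : 𝓢(E, ℂ) →L[ℂ] ℂ).toLinearMap) hc
  refine ⟨s.sup (fun i => max i.1 i.2), C, C.2, fun f => (h f).trans ?_⟩
  change (C : ℝ) * _ ≤ _
  gcongr
  refine Seminorm.finset_sup_apply_le (sn_nonneg _ f) fun i hi => ?_
  refine Seminorm.le_finset_sup_apply (p := schwartzSeminormFamily ℂ E ℂ) (Finset.mem_Iic.2 ?_)
  have := Finset.le_sup (f := fun i : ℕ × ℕ => max i.1 i.2) hi
  exact ⟨(le_max_left _ _).trans this, (le_max_right _ _).trans this⟩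

/-- A linear functional on Schwartz space bounded by one of the norms `sn N` as a tempered
distribution. -/
def mkDist (A : 𝓢(E, ℂ) →ₗ[ℂ] ℂ) (h : ∃ (N : ℕ) (C : ℝ), 0 ≤ C ∧ ∀ f, ‖A f‖ ≤ C * sn N f) :
    𝓢'(E, ℂ) :=
  ContinuousLinearMap.toPointwiseConvergenceCLM _ _ _ _
    (SchwartzMap.mkCLMtoNormedSpace (𝕜 := ℂ) (σ := RingHom.id ℂ) A A.map_add A.map_smul
      (by obtain ⟨N, C, hC, h⟩ := h; exact ⟨_, C, hC, h⟩))

@[simp] theorem mkDist_apply (A : 𝓢(E, ℂ) →ₗ[ℂ] ℂ)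
    (h : ∃ (N : ℕ) (C : ℝ), 0 ≤ C ∧ ∀ f, ‖A f‖ ≤ C * sn N f) (f : 𝓢(E, ℂ)) :
    mkDist A h f = A f := rfl

theorem sn_mono {N M : ℕ} (h : N ≤ M) (f : 𝓢(E, ℂ)) : sn N f ≤ sn M f := by
  refine Seminorm.finset_sup_apply_le (sn_nonneg _ f) fun i hi => ?_
  refine Seminorm.le_finset_sup_apply (p := schwartzSeminormFamily ℂ E ℂ) (Finset.mem_Iic.2 ?_)
  exact (Finset.mem_Iic.1 hi).trans ⟨h, h⟩

theorem tendsto_zero_of_sn {f : ℕ → 𝓢(E, ℂ)} (h : ∀ N, Tendsto (fun j => sn N (f j)) atTop (𝓝 0)) :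
    Tendsto f atTop (𝓝 0) := by
  rw [(schwartz_withSeminorms ℂ E ℂ).tendsto_nhds]
  rintro ⟨k, n⟩ ε hε
  filter_upwards [(h (max k n)).eventually (gt_mem_nhds hε)] with j hj
  rw [sub_zero]
  refine lt_of_le_of_lt (Seminorm.le_finset_sup_apply (p := schwartzSeminormFamily ℂ E ℂ)
    (Finset.mem_Iic.2 ?_)) hj
  exact ⟨le_max_left _ _, le_max_right _ _⟩

theorem sn_tendsto_zero {f : ℕ → 𝓢(E, ℂ)} (h : Tendsto f atTop (𝓝 0)) (N : ℕ) :
    Tendsto (fun j => sn N (f j)) atTop (𝓝 0) := by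
  have hc : Continuous (sn N : 𝓢(E, ℂ) → ℝ) :=
    Finset.sup_induction (p := fun p : Seminorm ℂ 𝓢(E, ℂ) => Continuous p) continuous_zero
      (fun a ha b hb => ha.sup hb)
      (fun i _ => (schwartz_withSeminorms ℂ E ℂ).continuous_seminorm i)
  have := hc.tendsto 0
  have h0 : sn N (0 : 𝓢(E, ℂ)) = 0 := map_zero _
  rw [h0] at this
  exact this.comp h

/-! #### An embedding of Schwartz space into a Banach space -/

/-- The index set of the embedding of Schwartz space into bounded functions. -/
def Probe (E : Type*) := Σ n : ℕ, E × (Fin n → E)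

/-- With the discrete topology every bounded function is continuous, so that the bounded continuous
functions on probes are a Banach space containing all the values needed. -/
instance : TopologicalSpace (Probe E) := ⊥

instance : DiscreteTopology (Probe E) := ⟨rfl⟩

/-- The value of a Schwartz function at a probe. -/
def probeVal (N : ℕ) (f : 𝓢(E, ℂ)) (p : Probe E) : ℂ :=
  if p.1 ≤ N then ((wt p.2.1 ^ (N : ℝ) * (∏ i, ‖p.2.2 i‖)⁻¹ : ℝ) : ℂ) *
    iteratedFDeriv ℝ p.1 f p.2.1 p.2.2 else 0

theorem norm_probeVal_le (N : ℕ) (f : 𝓢(E, ℂ)) (p : Probe E) :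
    ‖probeVal N f p‖ ≤ 2 ^ N * sn N f := by
  have hsn := sn_nonneg N f
  unfold probeVal
  split_ifs with hp
  · have hw := wt_pos p.2.1
    have h0 : 0 ≤ wt p.2.1 ^ (N : ℝ) * (∏ i, ‖p.2.2 i‖)⁻¹ :=
      mul_nonneg (by positivity) (inv_nonneg.2 (Finset.prod_nonneg fun _ _ => norm_nonneg _))
    rw [norm_mul, Complex.norm_real, Real.norm_of_nonneg h0]
    have h1 := (iteratedFDeriv ℝ p.1 f p.2.1).le_opNorm p.2.2
    have h2 := wt_mul_norm_iteratedFDeriv_le_sn le_rfl hp f p.2.1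
    have h3 : 0 ≤ (∏ i, ‖p.2.2 i‖) := Finset.prod_nonneg fun _ _ => norm_nonneg _
    calc _ ≤ wt p.2.1 ^ (N : ℝ) * (∏ i, ‖p.2.2 i‖)⁻¹ *
          (‖iteratedFDeriv ℝ p.1 f p.2.1‖ * ∏ i, ‖p.2.2 i‖) := by gcongr
      _ = wt p.2.1 ^ (N : ℝ) * ‖iteratedFDeriv ℝ p.1 f p.2.1‖ *
          ((∏ i, ‖p.2.2 i‖)⁻¹ * ∏ i, ‖p.2.2 i‖) := by ring
      _ ≤ wt p.2.1 ^ (N : ℝ) * ‖iteratedFDeriv ℝ p.1 f p.2.1‖ * 1 := by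
          gcongr
          exact inv_mul_le_one
      _ ≤ _ := by rwa [mul_one]
  · rw [norm_zero]; positivity

theorem iteratedFDeriv_schwartz_add (n : ℕ) (f g : 𝓢(E, ℂ)) (x : E) :
    iteratedFDeriv ℝ n (f + g : 𝓢(E, ℂ)) x = iteratedFDeriv ℝ n f x + iteratedFDeriv ℝ n g x := by
  have : ((f + g : 𝓢(E, ℂ)) : E → ℂ) = (f : E → ℂ) + (g : E → ℂ) := rfl
  rw [this, iteratedFDeriv_add_apply ((f.smooth n).contDiffAt) ((g.smooth n).contDiffAt)]

theorem iteratedFDeriv_schwartz_smul (n : ℕ) (c : ℂ) (f : 𝓢(E, ℂ)) (x : E) :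
    iteratedFDeriv ℝ n (c • f : 𝓢(E, ℂ)) x = c • iteratedFDeriv ℝ n f x := by
  have : ((c • f : 𝓢(E, ℂ)) : E → ℂ) = c • (f : E → ℂ) := rfl
  rw [this, iteratedFDeriv_const_smul_apply ((f.smooth n).contDiffAt)]

/-- Schwartz space embedded into the bounded functions on the set of probes. -/
def probeMap (N : ℕ) : 𝓢(E, ℂ) →ₗ[ℂ] BoundedContinuousFunction (Probe E) ℂ where
  toFun f := BoundedContinuousFunction.ofNormedAddCommGroup (probeVal N f)
    continuous_of_discreteTopology _ (norm_probeVal_le N f)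
  map_add' f g := by
    ext p
    simp only [BoundedContinuousFunction.coe_ofNormedAddCommGroup, BoundedContinuousFunction.coe_add,
      Pi.add_apply, probeVal, iteratedFDeriv_schwartz_add]
    split_ifs <;> simp [mul_add]
  map_smul' c f := by
    ext p
    simp only [BoundedContinuousFunction.coe_ofNormedAddCommGroup,
      BoundedContinuousFunction.coe_smul, RingHom.id_apply, probeVal, iteratedFDeriv_schwartz_smul]
    split_ifs
    · simp only [_root_.smul_apply, smul_eq_mul]
      ring
    · simp

theorem probeMap_apply (N : ℕ) (f : 𝓢(E, ℂ)) (p : Probe E) : probeMap N f p = probeVal N f p := rfl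

theorem norm_probeMap_le (N : ℕ) (f : 𝓢(E, ℂ)) : ‖probeMap N f‖ ≤ 2 ^ N * sn N f :=
  (BoundedContinuousFunction.norm_le (mul_nonneg (by positivity) (sn_nonneg N f))).2
    (norm_probeVal_le N f)

/-- The probes at (n, x, m) with varying m recover the operator norm of the n-th derivative at x.
With `norm_probeMap_le` this makes the sup norm over probes equivalent to `sn N`. -/
theorem sn_le_norm_probeMap (N : ℕ) (f : 𝓢(E, ℂ)) : sn N f ≤ ‖probeMap N f‖ := by
  refine sn_le_of_bound (norm_nonneg _) fun k hk n hn x => ?_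
  have hw := wt_pos x
  have h1 : wt x ^ (k : ℝ) ≤ wt x ^ (N : ℝ) := wt_rpow_le (by exact_mod_cast hk)
  refine (mul_le_mul_of_nonneg_right h1 (norm_nonneg _)).trans ?_
  rw [← le_div_iff₀' (by positivity)]
  refine ContinuousMultilinearMap.opNorm_le_bound (by positivity) fun m => ?_
  -- A probe with a zero vector carries the factor 0⁻¹ = 0 and gives no information, so this case is
  -- read off multilinearity.
  by_cases hm : ∏ i, ‖m i‖ = 0
  · have := (iteratedFDeriv ℝ n f x).le_opNorm m
    rw [hm, mul_zero] at this
    rw [hm, mul_zero]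
    exact this
  · have hpos : 0 < ∏ i, ‖m i‖ :=
      lt_of_le_of_ne (Finset.prod_nonneg fun _ _ => norm_nonneg _) (Ne.symm hm)
    have h2 : ‖probeVal N f ⟨n, x, m⟩‖ ≤ _ := (probeMap N f).norm_coe_le_norm ⟨n, x, m⟩
    have e : probeVal N f ⟨n, x, m⟩ = ((wt x ^ (N : ℝ) * (∏ i, ‖m i‖)⁻¹ : ℝ) : ℂ) *
      iteratedFDeriv ℝ n f x m := if_pos hn
    rw [e, norm_mul, Complex.norm_real, Real.norm_of_nonneg (by positivity)] at h2
    rw [div_mul_eq_mul_div, le_div_iff₀ (by positivity)]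
    calc _ = (wt x ^ (N : ℝ) * (∏ i, ‖m i‖)⁻¹ * ‖(iteratedFDeriv ℝ n f x) m‖) * ∏ i, ‖m i‖ := by
          field_simp
      _ ≤ _ := by gcongr

/-- Every tempered distribution factors through one of the embeddings `probeMap`. -/
theorem exists_probe_factor (u : 𝓢'(E, ℂ)) : ∃ (N : ℕ)
    (l : BoundedContinuousFunction (Probe E) ℂ →L[ℂ] ℂ), ∀ f, u f = l (probeMap N f) := by
  obtain ⟨N, C, hC, h⟩ := exists_sn_bound u
  have hinj : Function.Injective (probeMap (E := E) N) := by
    rw [injective_iff_map_eq_zero]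
    intro f hf
    have h0 := sn_le_norm_probeMap N f
    rw [hf, norm_zero] at h0
    ext x
    have h1 := norm_le_sn (Nat.zero_le N) f x
    have h2 : sn N f = 0 := le_antisymm h0 (sn_nonneg N f)
    rw [h2, mul_zero, zero_mul] at h1
    simpa using h1
  let e := LinearEquiv.ofInjective (probeMap (E := E) N) hinj
  let g : LinearMap.range (probeMap (E := E) N) →ₗ[ℂ] ℂ :=
    (u : 𝓢(E, ℂ) →L[ℂ] ℂ).toLinearMap.comp e.symm.toLinearMap
  have hg : ∀ y, ‖g y‖ ≤ C * ‖y‖ := by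
    intro y
    obtain ⟨f, rfl⟩ := e.surjective y
    have : g (e f) = u f := by
      change u (e.symm (e f)) = u f
      rw [LinearEquiv.symm_apply_apply]
    rw [this]
    refine (h f).trans ?_
    gcongr
    exact sn_le_norm_probeMap N f
  -- Hahn–Banach: u descends to the image of the embedding, where it is bounded for the sup norm.
  obtain ⟨l, hl, -⟩ := exists_extension_norm_eq (𝕜 := ℂ) _ (g.mkContinuous C hg)
  refine ⟨N, l, fun f => ?_⟩
  have h1 := hl (e f)
  have h2 : (g.mkContinuous C hg) (e f) = u f := by
    change u (e.symm (e f)) = u f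
    rw [LinearEquiv.symm_apply_apply]
  rw [h2] at h1
  exact h1.symm

theorem continuous_probeMap (N : ℕ) : Continuous (probeMap (E := E) N) := by
  refine WithSeminorms.continuous_normedSpace_rng _ (schwartz_withSeminorms ℂ E ℂ) _ ?_
  refine ⟨Finset.Iic (N, N), ⟨2 ^ N, by positivity⟩, fun f => ?_⟩
  exact norm_probeMap_le N f

end Seminorms

/-! ### Superpositions of coherent states -/

section Superposition

variable {E : Type*} [NormedAddCommGroup E] [InnerProductSpace ℝ E]

theorem continuous_iteratedFDeriv_coh (n : ℕ) (x : E) :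
    Continuous (fun X : E × E => iteratedFDeriv ℝ n (coh X) x) := by
  have hsm : ContDiff ℝ ∞ (fun v : (E × E) × E => Complex.exp (cohExp v)) :=
    Complex.contDiff_exp.comp cohExp_hasTemperateGrowth.1
  have h1 : Continuous (fun X : E × E =>
      iteratedFDeriv ℝ n (fun v : (E × E) × E => Complex.exp (cohExp v)) (X, x)) :=
    (hsm.continuous_iteratedFDeriv (m := n) (by exact_mod_cast le_top)).comp
      (continuous_id.prodMk continuous_const)
  have h2 := (ContinuousMultilinearMap.compContinuousLinearMapL (𝕜 := ℝ) (F := ℂ)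
    (fun _ : Fin n => ContinuousLinearMap.inr ℝ (E × E) E)).continuous.comp h1
  refine h2.congr fun X => ?_
  exact (iteratedFDeriv_cexp_cohExp_right X n x).symm

theorem sn_coh_le (N : ℕ) : ∃ C M : ℝ, 0 ≤ C ∧ 0 ≤ M ∧ ∀ X : E × E, sn N (coh X) ≤ C * wt X ^ M := by
  choose C M hC hM h using fun n => norm_iteratedFDeriv_coh_le (E := E) n N
  refine ⟨∑ n ∈ Finset.range (N + 1), C n, ∑ n ∈ Finset.range (N + 1), M n,
    Finset.sum_nonneg fun n _ => hC n, Finset.sum_nonneg fun n _ => hM n, fun X => ?_⟩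
  have hX := wt_pos X
  have hC0 : 0 ≤ ∑ n ∈ Finset.range (N + 1), C n := Finset.sum_nonneg fun n _ => hC n
  refine sn_le_of_bound (by positivity) fun k hk n hn x => ?_
  have hx := wt_pos x
  have hn' := Finset.mem_range.2 (Nat.lt_succ_of_le hn)
  have h1 : C n ≤ ∑ n ∈ Finset.range (N + 1), C n :=
    Finset.single_le_sum (fun i _ => hC i) hn'
  have h2 : M n ≤ ∑ n ∈ Finset.range (N + 1), M n :=
    Finset.single_le_sum (fun i _ => hM i) hn'
  calc _ ≤ wt x ^ (N : ℝ) * (C n * wt X ^ M n * wt x ^ (-(N : ℝ))) := by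
        gcongr
        · exact one_le_wt x
        · exact h n X x
    _ = C n * wt X ^ M n * (wt x ^ (N : ℝ) * wt x ^ (-(N : ℝ))) := by ring
    _ = C n * wt X ^ M n := by rw [wt_rpow_mul_neg, mul_one]
    _ ≤ _ := by
        gcongr
        exact one_le_wt X

/-- Schwartz space is not normed, so the integral of coherent states is formed pointwise; that a
distribution passes under it is checked in the Banach space of bounded functions on probes, through
which the distribution factors. The measure is arbitrary: Lebesgue measure serves the inversion
formula, counting measure serves series of coherent states. -/
theorem exists_superposition {α : Type*} [MeasurableSpace α] {μ : Measure α} {Z : α → E × E}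
    {F : α → ℂ} (hZ : AEStronglyMeasurable Z μ) (hF : AEStronglyMeasurable F μ)
    (hint : ∀ M : ℝ, Integrable (fun a => wt (Z a) ^ M * ‖F a‖) μ) :
    ∃ ψ : 𝓢(E, ℂ), (∀ x, ψ x = ∫ a, F a * coh (Z a) x ∂μ) ∧
      (∀ n x, iteratedFDeriv ℝ n ψ x = ∫ a, F a • iteratedFDeriv ℝ n (coh (Z a)) x ∂μ) ∧
      ∀ u : 𝓢'(E, ℂ), u ψ = ∫ a, F a * u (coh (Z a)) ∂μ := by
  have hD : ∀ n a x, iteratedFDeriv ℝ n (fun x => F a * coh (Z a) x) x =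
      F a • iteratedFDeriv ℝ n (coh (Z a)) x :=
    fun n a x => iteratedFDeriv_schwartz_smul n (F a) (coh (Z a)) x
  choose C M hC hM hcoh using fun (n : ℕ) (N : ℕ) => norm_iteratedFDeriv_coh_le (E := E) n N
  have hbd : ∀ (n k : ℕ) a x, ‖F a • iteratedFDeriv ℝ n (coh (Z a)) x‖ ≤
      C n k * (wt (Z a) ^ M n k * ‖F a‖) * wt x ^ (-(k : ℝ)) := by
    intro n k a x
    rw [norm_smul]
    calc _ ≤ ‖F a‖ * (C n k * wt (Z a) ^ M n k * wt x ^ (-(k : ℝ))) := by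
          gcongr; exact hcoh n k (Z a) x
      _ = _ := by ring
  have hmeas : ∀ n x, AEStronglyMeasurable (fun a => F a • iteratedFDeriv ℝ n (coh (Z a)) x) μ :=
    fun n x => hF.smul ((continuous_iteratedFDeriv_coh n x).comp_aestronglyMeasurable hZ)
  obtain ⟨hsm, hder⟩ := contDiff_integral_of_dominated (μ := μ)
    (f := fun a x => F a * coh (Z a) x) (b := fun n a => C n 0 * (wt (Z a) ^ M n 0 * ‖F a‖))
    (fun a => contDiff_const.mul ((coh (Z a)).smooth ⊤))
    (fun n x => by simpa only [hD] using hmeas n x)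
    (fun n => (hint _).const_mul _)
    (fun n a x => by rw [hD]; simpa using hbd n 0 a x)
  simp only [hD] at hder
  let ψ : 𝓢(E, ℂ) :=
    { toFun := fun x => ∫ a, F a * coh (Z a) x ∂μ
      smooth' := hsm
      decay' := by
        intro k n
        refine ⟨∫ a, C n k * (wt (Z a) ^ M n k * ‖F a‖) ∂μ, fun x => ?_⟩
        rw [hder]
        have hx := wt_pos x
        have h1 : ‖∫ a, F a • iteratedFDeriv ℝ n (coh (Z a)) x ∂μ‖ ≤
            (∫ a, C n k * (wt (Z a) ^ M n k * ‖F a‖) ∂μ) * wt x ^ (-(k : ℝ)) := by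
          rw [← integral_mul_const]
          exact norm_integral_le_of_norm_le (((hint _).const_mul _).mul_const _)
            (Eventually.of_forall fun a => hbd n k a x)
        calc _ ≤ wt x ^ (k : ℝ) * ((∫ a, C n k * (wt (Z a) ^ M n k * ‖F a‖) ∂μ) *
              wt x ^ (-(k : ℝ))) := by
              gcongr
              rw [Real.rpow_natCast]
              exact pow_le_pow_left₀ (norm_nonneg _) (norm_le_wt x) k
          _ = (∫ a, C n k * (wt (Z a) ^ M n k * ‖F a‖) ∂μ) *
              (wt x ^ (k : ℝ) * wt x ^ (-(k : ℝ))) := by ring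
          _ = _ := by rw [wt_rpow_mul_neg, mul_one] }
  refine ⟨ψ, fun x => rfl, fun n x => hder n x, fun u => ?_⟩
  obtain ⟨N, l, hl⟩ := exists_probe_factor u
  obtain ⟨C', M', hC', hM', hsn⟩ := sn_coh_le (E := E) N
  have hJint : Integrable (fun a => F a • probeMap N (coh (Z a))) μ := by
    refine ((hint M').const_mul (2 ^ N * C')).mono'
      (hF.smul ((continuous_probeMap N).comp continuous_coh |>.comp_aestronglyMeasurable hZ))
      (Eventually.of_forall fun a => ?_)
    rw [norm_smul]
    calc _ ≤ ‖F a‖ * (2 ^ N * (C' * wt (Z a) ^ M')) := by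
          gcongr
          refine (norm_probeMap_le N _).trans ?_
          gcongr
          exact hsn _
      _ = _ := by ring
  have hJ : probeMap N ψ = ∫ a, F a • probeMap N (coh (Z a)) ∂μ := by
    ext p
    have h1 := (BoundedContinuousFunction.evalCLM ℂ p).integral_comp_comm hJint
    simp only [BoundedContinuousFunction.evalCLM_apply] at h1
    rw [← h1, probeMap_apply]
    simp only [BoundedContinuousFunction.coe_smul, probeMap_apply, probeVal]
    split_ifs with hp
    · have hi : Integrable (fun a => F a • iteratedFDeriv ℝ p.1 (coh (Z a)) p.2.1) μ :=
        ((hint (M p.1 0)).const_mul (C p.1 0)).mono' (hmeas _ _)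
          (Eventually.of_forall fun a => by simpa using hbd p.1 0 a p.2.1)
      have h2 : iteratedFDeriv ℝ p.1 ψ p.2.1 = _ := hder p.1 p.2.1
      rw [h2, ContinuousMultilinearMap.integral_apply hi, ← integral_const_mul]
      refine integral_congr_ae (Eventually.of_forall fun a => ?_)
      simp only [_root_.smul_apply, smul_eq_mul]
      ring
    · simp
  rw [hl, hJ, ← l.integral_comp_comm hJint]
  simp only [map_smul, smul_eq_mul, hl]

end Superposition

/-! ### Decay of Fourier integrals -/

theorem exists_uniform_bound {α : Type*} {f : ℕ → α → ℝ} {g : α → ℝ} (hg : ∀ y, 0 ≤ g y)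
    (h : ∀ k, ∃ C : ℝ, ∀ y, f k y ≤ C * g y) (N : ℕ) :
    ∃ C : ℝ, 0 ≤ C ∧ ∀ k ≤ N, ∀ y, f k y ≤ C * g y := by
  choose C hC using h
  refine ⟨∑ k ∈ Finset.range (N + 1), |C k|, Finset.sum_nonneg fun _ _ => abs_nonneg _,
    fun k hk y => (hC k y).trans ?_⟩
  refine mul_le_mul_of_nonneg_right ((le_abs_self _).trans ?_) (hg y)
  exact Finset.single_le_sum (f := fun k => |C k|) (fun _ _ => abs_nonneg _)
    (Finset.mem_range.2 (Nat.lt_succ_of_le hk))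

/-- Repeated integration by parts. The norming condition on L supplies, for each frequency w, a
direction v in the unit ball along which the phase oscillates at rate at least ‖w‖. The constant
depends only on N and on the fixed data μ and L, which makes all later bounds uniform in the symbol
and in the base point. -/
theorem fourier_decay {V W : Type*} [NormedAddCommGroup V] [NormedSpace ℝ V]
    [FiniteDimensional ℝ V] [MeasurableSpace V] [BorelSpace V] [NormedAddCommGroup W]
    [NormedSpace ℝ W] (μ : Measure V) [μ.IsAddHaarMeasure] (L : V →L[ℝ] W →L[ℝ] ℝ)
    (hL : ∀ w, ∃ v, ‖v‖ ≤ 1 ∧ ‖w‖ ≤ |L v w|) (N : ℕ) :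
    ∃ C : ℝ, 0 ≤ C ∧ ∀ (f : V → ℂ) (b : V → ℝ), ContDiff ℝ ∞ f → Integrable b μ →
      (∀ k ≤ N, ∀ x, ‖iteratedFDeriv ℝ k f x‖ ≤ b x) → ∀ w,
        ‖∫ v, f v * Complex.exp (-Complex.I * ((L v w : ℝ) : ℂ)) ∂μ‖ ≤
          C * (∫ v, b v ∂μ) * wt w ^ (-(N : ℝ)) := by
  refine ⟨2 ^ N * (1 + (2 * Real.pi) ^ N * (2 ^ N * (N + 1))), by positivity,
    fun f b hf hb hfb w => ?_⟩
  set I : ℂ := ∫ v, f v * Complex.exp (-Complex.I * ((L v w : ℝ) : ℂ)) ∂μ with hI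
  have hcont : ∀ n : ℕ, Continuous (iteratedFDeriv ℝ n f) := fun n =>
    hf.continuous_iteratedFDeriv (by exact_mod_cast le_top)
  have hint : ∀ n ≤ N, Integrable (fun v => ‖iteratedFDeriv ℝ n f v‖) μ := fun n hn =>
    hb.mono' (hcont n).norm.aestronglyMeasurable
      (Eventually.of_forall fun v => by simpa using hfb n hn v)
  have hb0 : 0 ≤ ∫ v, b v ∂μ :=
    integral_nonneg fun v => (norm_nonneg _).trans (hfb 0 (Nat.zero_le N) v)
  have hIb : ‖I‖ ≤ ∫ v, b v ∂μ := by
    refine norm_integral_le_of_norm_le hb (Eventually.of_forall fun v => ?_)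
    have h1 : ‖Complex.exp (-Complex.I * ((L v w : ℝ) : ℂ))‖ = 1 := by
      rw [show -Complex.I * ((L v w : ℝ) : ℂ) = ((-(L v w) : ℝ) : ℂ) * Complex.I by push_cast; ring]
      exact Complex.norm_exp_ofReal_mul_I _
    rw [norm_mul, h1, mul_one]
    simpa using hfb 0 (Nat.zero_le N) v
  have hIN : ‖w‖ ^ N * ‖I‖ ≤ (2 * Real.pi) ^ N * (2 ^ N * (N + 1)) * ∫ v, b v ∂μ := by
    obtain ⟨v, hv1, hv2⟩ := hL w
    -- With K = 0 only derivatives of f enter, without moments; the factor (2π)⁻¹ compensates the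
    -- normalisation of the standard character.
    have h := VectorFourier.pow_mul_norm_iteratedFDeriv_fourierIntegral_le (μ := μ) (f := f)
      ((2 * Real.pi)⁻¹ • L) (K := 0) (N := N) (hf.of_le (by exact_mod_cast le_top))
      (fun k n hk hn => by
        have hk0 : k = 0 := by simpa using hk
        subst hk0
        simpa using hint n (by exact_mod_cast hn)) (k := 0) (n := N) le_rfl le_rfl v w
    have hF : VectorFourier.fourierIntegral Real.fourierChar μ
        ((2 * Real.pi)⁻¹ • L).toLinearMap₁₂ f w = I := by
      rw [hI, VectorFourier.fourierIntegral]
      refine integral_congr_ae (Eventually.of_forall fun v => ?_)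
      simp only [Circle.smul_def, Real.fourierChar_apply, smul_eq_mul]
      rw [mul_comm]
      congr 2
      have hpi : (Real.pi : ℂ) ≠ 0 := by exact_mod_cast Real.pi_ne_zero
      have e : ((2 * Real.pi)⁻¹ • L).toLinearMap₁₂ v w = (2 * Real.pi)⁻¹ * L v w := rfl
      rw [e]
      push_cast
      field_simp
    simp only [norm_iteratedFDeriv_zero, hF, pow_zero, mul_one, Nat.cast_zero, mul_zero, zero_add,
      Finset.range_one] at h
    have hsum : ∑ p ∈ ({0} : Finset ℕ) ×ˢ Finset.range (N + 1),
        ∫ v, ‖v‖ ^ p.1 * ‖iteratedFDeriv ℝ p.2 f v‖ ∂μ ≤ (N + 1) * ∫ v, b v ∂μ := by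
      have : ∀ p ∈ ({0} : Finset ℕ) ×ˢ Finset.range (N + 1),
          ∫ v, ‖v‖ ^ p.1 * ‖iteratedFDeriv ℝ p.2 f v‖ ∂μ ≤ ∫ v, b v ∂μ := by
        rintro ⟨p1, p2⟩ hp
        simp only [Finset.mem_product, Finset.mem_singleton, Finset.mem_range] at hp
        obtain ⟨rfl, hp2⟩ := hp
        simp only [pow_zero, one_mul]
        exact integral_mono (hint p2 (by omega)) hb fun v => hfb p2 (by omega) v
      refine (Finset.sum_le_card_nsmul _ _ _ this).trans (le_of_eq ?_)
      simp
    have hLv : ‖w‖ ≤ 2 * Real.pi * |((2 * Real.pi)⁻¹ • L) v w| := by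
      simp only [_root_.smul_apply, smul_eq_mul, abs_mul]
      rw [abs_of_pos (by positivity : (0 : ℝ) < (2 * Real.pi)⁻¹)]
      field_simp
      exact hv2
    calc ‖w‖ ^ N * ‖I‖ ≤ (2 * Real.pi * |((2 * Real.pi)⁻¹ • L) v w|) ^ N * ‖I‖ := by gcongr
      _ = (2 * Real.pi) ^ N * (|((2 * Real.pi)⁻¹ • L) v w| ^ N * ‖I‖) := by rw [mul_pow]; ring
      _ ≤ (2 * Real.pi) ^ N * (1 * 2 ^ N * ((N + 1) * ∫ v, b v ∂μ)) := by
          refine mul_le_mul_of_nonneg_left (h.trans ?_) (by positivity)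
          gcongr
          exact pow_le_one₀ (norm_nonneg _) hv1
      _ = _ := by ring
  have hw := wt_pos w
  rw [Real.rpow_neg hw.le, Real.rpow_natCast, ← div_eq_mul_inv, le_div_iff₀ (by positivity)]
  have hwN : wt w ^ N ≤ 2 ^ N * (1 + ‖w‖ ^ N) := by
    rcases le_total ‖w‖ 1 with h1 | h1
    · calc wt w ^ N ≤ 2 ^ N := by
            gcongr
            unfold wt; linarith
        _ ≤ _ := le_mul_of_one_le_right (by positivity) (by linarith [pow_nonneg (norm_nonneg w) N])
    · calc wt w ^ N ≤ (2 * ‖w‖) ^ N := by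
            gcongr
            unfold wt; linarith
        _ ≤ _ := by rw [mul_pow]; gcongr; linarith
  calc ‖I‖ * wt w ^ N ≤ ‖I‖ * (2 ^ N * (1 + ‖w‖ ^ N)) := by gcongr
    _ = 2 ^ N * (‖I‖ + ‖w‖ ^ N * ‖I‖) := by ring
    _ ≤ 2 ^ N * ((∫ v, b v ∂μ) + (2 * Real.pi) ^ N * (2 ^ N * (N + 1)) * ∫ v, b v ∂μ) := by gcongr
    _ = _ := by ring

theorem inner_norming {E : Type*} [NormedAddCommGroup E] [InnerProductSpace ℝ E] (w : E) :
    ∃ v : E, ‖v‖ ≤ 1 ∧ ‖w‖ ≤ |innerSL ℝ v w| := by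
  rcases eq_or_ne w 0 with rfl | hw
  · exact ⟨0, by simp, by simp⟩
  · refine ⟨‖w‖⁻¹ • w, by rw [norm_smul]; simp [hw], ?_⟩
    have : ‖w‖ ≠ 0 := by simpa using hw
    simp only [map_smul, _root_.smul_apply, innerSL_apply_apply, real_inner_self_eq_norm_sq,
      smul_eq_mul]
    rw [sq, ← mul_assoc, inv_mul_cancel₀ this, one_mul, abs_norm]

/-! ### The short-time Fourier transform -/

section STFT

variable {E : Type*} [NormedAddCommGroup E] [InnerProductSpace ℝ E]

/-- The reflection `(z, ζ) ↦ (z, -ζ)` of phase space. -/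
def flipP (X : E × E) : E × E := (X.1, -X.2)

@[simp] theorem flipP_flipP (X : E × E) : flipP (flipP X) = X := by simp [flipP]

@[simp] theorem wt_flipP (X : E × E) : wt (flipP X) = wt X := by simp [wt, flipP, Prod.norm_def]

theorem continuous_flipP : Continuous (flipP : E × E → E × E) := by unfold flipP; fun_prop

theorem coh_apply' (z ζ x : E) : coh (z, ζ) x =
    coh (z, 0) x * Complex.exp (-Complex.I * ((inner ℝ x ζ : ℝ) : ℂ)) := by
  simp only [coh_apply, cohExp, ← Complex.exp_add]
  congr 1
  simp
  ring

theorem coh_zero_eq (z x : E) : coh (z, 0) x = coh (0, 0) (x - z) := by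
  simp [coh_apply, cohExp]

theorem conj_coh (X : E × E) (x : E) : (starRingEnd ℂ) (coh X x) = coh (flipP X) x := by
  simp only [coh_apply, cohExp, flipP, ← Complex.exp_conj]
  congr 1
  simp only [map_sub, map_mul, Complex.conj_ofReal, Complex.conj_I, inner_neg_right,
    Complex.ofReal_neg]
  ring

theorem continuous_dist_coh (u : 𝓢'(E, ℂ)) : Continuous (fun X : E × E => u (coh X)) :=
  (ContinuousLinearMap.continuous u).comp continuous_coh

theorem exists_dist_coh_bound (u : 𝓢'(E, ℂ)) : ∃ C M : ℝ, 0 ≤ C ∧ 0 ≤ M ∧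
    ∀ X : E × E, ‖u (coh X)‖ ≤ C * wt X ^ M := by
  obtain ⟨N, C, hC, h⟩ := exists_sn_bound u
  obtain ⟨D, M, hD, hM, h2⟩ := sn_coh_le (E := E) N
  refine ⟨C * D, M, by positivity, hM, fun X => (h _).trans ?_⟩
  rw [mul_assoc]
  gcongr
  exact h2 X

variable [FiniteDimensional ℝ E] [MeasurableSpace E] [BorelSpace E]

theorem measurePreserving_flipP :
    MeasurePreserving (flipP : E × E → E × E) volume volume :=
  (MeasurePreserving.id (volume : Measure E)).prod
    (Measure.measurePreserving_neg (volume : Measure E))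

/-- `flipP` as a measurable equivalence. -/
def flipEquiv : (E × E) ≃ᵐ (E × E) where
  toFun := flipP
  invFun := flipP
  left_inv := flipP_flipP
  right_inv := flipP_flipP
  measurable_toFun := continuous_flipP.measurable
  measurable_invFun := continuous_flipP.measurable

theorem integral_flipP (f : E × E → ℂ) : ∫ X, f (flipP X) = ∫ X, f X :=
  measurePreserving_flipP.integral_comp flipEquiv.measurableEmbedding f

theorem lintegral_flipP (f : E × E → ℝ≥0∞) : ∫⁻ X, f (flipP X) = ∫⁻ X, f X :=
  measurePreserving_flipP.lintegral_comp_emb flipEquiv.measurableEmbedding f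

/-- The short-time Fourier transform of a Schwartz function with a Gaussian window. -/
def stft (φ : 𝓢(E, ℂ)) (X : E × E) : ℂ := ∫ x, φ x * coh X x

/-- The tempered distribution given by a Schwartz function. -/
def sdist (φ : 𝓢(E, ℂ)) : 𝓢'(E, ℂ) := SchwartzMap.toTemperedDistributionCLM E ℂ volume φ

theorem sdist_apply (φ ψ : 𝓢(E, ℂ)) : sdist φ ψ = ∫ x, φ x * ψ x := by
  refine (SchwartzMap.toTemperedDistributionCLM_apply_apply volume φ ψ).trans ?_
  simp [mul_comm]

theorem sdist_coh (φ : 𝓢(E, ℂ)) (X : E × E) : sdist φ (coh X) = stft φ X := sdist_apply φ _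

theorem continuous_stft (φ : 𝓢(E, ℂ)) : Continuous (stft φ) := by
  simpa only [sdist_coh] using continuous_dist_coh (sdist φ)

theorem norm_iteratedFDeriv_gauss_le (n : ℕ) (N : ℝ) : ∃ C : ℝ, 0 ≤ C ∧ ∀ x : E,
    ‖iteratedFDeriv ℝ n (coh (0 : E × E)) x‖ ≤ C * wt x ^ (-N) := by
  obtain ⟨C, M, hC, hM, h⟩ := norm_iteratedFDeriv_coh_le (E := E) n N
  refine ⟨C, hC, fun x => ?_⟩
  simpa [wt] using h 0 x

/-- At (z, ζ) the transform is a Fourier integral at frequency ζ of φ times a Gaussian translated by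
z. Integration by parts gives decay in ζ, and the joint concentration of the two factors gives decay
in z. -/
theorem stft_decay (N : ℕ) : ∃ (M : ℕ) (C : ℝ), 0 ≤ C ∧ ∀ (φ : 𝓢(E, ℂ)) (X : E × E),
    ‖stft φ X‖ ≤ C * sn M φ * wt X ^ (-(N : ℝ)) := by
  obtain ⟨C₁, hC₁, hF⟩ := fourier_decay (volume : Measure E) (innerSL ℝ) inner_norming N
  obtain ⟨C₂, hC₂, hG⟩ := exists_uniform_bound (α := E)
    (f := fun n x => ‖iteratedFDeriv ℝ n (coh (0 : E × E)) x‖)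
    (g := fun x => wt x ^ (-(N : ℝ))) (fun x => (wt_rpow_pos _ _).le)
    (fun n => (norm_iteratedFDeriv_gauss_le n N).imp fun C h => h.2) N
  -- Of the decay of φ, N powers turn decay in x - z into decay in z, and the remainder makes the
  -- integral over x converge.
  obtain ⟨K, hK⟩ := exists_nat_ge (N + intExp E)
  have hKN : N ≤ K := by
    have : (N : ℝ) ≤ K := by linarith [intExp_pos E]
    exact_mod_cast this
  set J : ℝ := ∫ x : E, wt x ^ (-intExp E) with hJ
  refine ⟨K, C₁ * (2 ^ N * 2 ^ K * C₂ * J), ?_, fun φ X => ?_⟩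
  · have : 0 ≤ J := integral_nonneg fun x => (wt_rpow_pos _ _).le
    positivity
  obtain ⟨z, ζ⟩ := X
  have hz := wt_pos z
  have hζ := wt_pos ζ
  have hsn := sn_nonneg K φ
  have hgs : ContDiff ℝ ∞ (fun x : E => coh (0 : E × E) (x - z)) :=
    ((coh 0).smooth ⊤).comp (contDiff_id.sub contDiff_const)
  have hφs : ContDiff ℝ ∞ φ := φ.smooth ⊤
  have h := hF (fun x => φ x * coh (0 : E × E) (x - z))
    (fun x => 2 ^ N * 2 ^ K * C₂ * sn K φ * wt z ^ (-(N : ℝ)) * wt x ^ (-intExp E))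
    (hφs.mul hgs) ((integrable_wt volume le_rfl).const_mul _) (fun k hk x => ?_) ζ
  · have e : stft φ (z, ζ) = ∫ v, φ v * coh (0 : E × E) (v - z) *
        Complex.exp (-Complex.I * ((innerSL ℝ v ζ : ℝ) : ℂ)) := by
      unfold stft
      congr 1
      ext x
      rw [coh_apply', coh_zero_eq]
      simp only [innerSL_apply_apply]
      rw [← mul_assoc]
      rfl
    rw [e]
    refine h.trans ?_
    rw [integral_const_mul]
    have hw : wt z ^ (-(N : ℝ)) * wt ζ ^ (-(N : ℝ)) ≤ wt (z, ζ) ^ (-(N : ℝ)) := by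
      rw [← Real.mul_rpow hz.le hζ.le]
      exact Real.rpow_le_rpow_of_nonpos (wt_pos _) (wt_prod_le (z, ζ)) (by simp)
    have hJ0 : 0 ≤ J := integral_nonneg fun x => (wt_rpow_pos _ _).le
    calc _ = C₁ * (2 ^ N * 2 ^ K * C₂ * J) * sn K φ * (wt z ^ (-(N : ℝ)) * wt ζ ^ (-(N : ℝ))) := by
          ring
      _ ≤ _ := by gcongr
  · have hx := wt_pos x
    have hxz := wt_pos (x - z)
    refine (norm_iteratedFDeriv_mul_le (𝕜 := ℝ) hφs hgs x (n := k)
      (by exact_mod_cast le_top)).trans ?_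
    have ht : ∀ i ∈ Finset.range (k + 1), (k.choose i : ℝ) * ‖iteratedFDeriv ℝ i φ x‖ *
        ‖iteratedFDeriv ℝ (k - i) (fun x : E => coh (0 : E × E) (x - z)) x‖ ≤
        (k.choose i : ℝ) * (2 ^ K * C₂ * sn K φ * wt z ^ (-(N : ℝ)) * wt x ^ (-intExp E)) := by
      intro i hi
      have hi' : i ≤ k := by simpa [Nat.lt_succ_iff] using hi
      have h1 := norm_iteratedFDeriv_le_sn (k := K) le_rfl ((hi'.trans hk).trans hKN) φ x
      have h2 : ‖iteratedFDeriv ℝ (k - i) (fun x : E => coh (0 : E × E) (x - z)) x‖ ≤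
          C₂ * wt (x - z) ^ (-(N : ℝ)) := by
        rw [iteratedFDeriv_comp_sub]
        exact hG (k - i) (by omega) (x - z)
      have h3 : wt (x - z) ^ (-(N : ℝ)) ≤ wt x ^ (N : ℝ) * wt z ^ (-(N : ℝ)) := by
        have := wt_rpow_peetre (x - z) (-z) (-(N : ℝ))
        simpa using this
      have h4 : wt x ^ (-(K : ℝ)) * wt x ^ (N : ℝ) ≤ wt x ^ (-intExp E) := by
        rw [← wt_rpow_add]
        exact wt_rpow_le (by linarith)
      rw [mul_assoc]
      refine mul_le_mul_of_nonneg_left ?_ (Nat.cast_nonneg _)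
      calc _ ≤ (2 ^ K * sn K φ * wt x ^ (-(K : ℝ))) *
            (C₂ * (wt x ^ (N : ℝ) * wt z ^ (-(N : ℝ)))) :=
            mul_le_mul h1 (h2.trans (mul_le_mul_of_nonneg_left h3 hC₂)) (norm_nonneg _)
              (by positivity)
        _ = 2 ^ K * C₂ * sn K φ * wt z ^ (-(N : ℝ)) * (wt x ^ (-(K : ℝ)) * wt x ^ (N : ℝ)) := by
            ring
        _ ≤ _ := by gcongr
    refine (Finset.sum_le_sum ht).trans ?_
    rw [← Finset.sum_mul]
    have hs : ∑ i ∈ Finset.range (k + 1), (k.choose i : ℝ) = 2 ^ k := by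
      exact_mod_cast Nat.sum_range_choose k
    rw [hs]
    calc _ ≤ (2 : ℝ) ^ N * (2 ^ K * C₂ * sn K φ * wt z ^ (-(N : ℝ)) * wt x ^ (-intExp E)) := by
          gcongr
          norm_num
      _ = _ := by ring

theorem stft_decay_rpow (N : ℝ) : ∃ (M : ℕ) (C : ℝ), 0 ≤ C ∧ ∀ (φ : 𝓢(E, ℂ)) (X : E × E),
    ‖stft φ X‖ ≤ C * sn M φ * wt X ^ (-N) := by
  obtain ⟨k, hk⟩ := exists_nat_ge N
  obtain ⟨M, C, hC, h⟩ := stft_decay (E := E) k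
  refine ⟨M, C, hC, fun φ X => (h φ X).trans ?_⟩
  have := sn_nonneg M φ
  gcongr
  exact one_le_wt X

end STFT

/-! ### Inversion of the short-time Fourier transform -/

section Inversion

open scoped FourierTransform

variable {E : Type*} [NormedAddCommGroup E] [InnerProductSpace ℝ E]
  [FiniteDimensional ℝ E] [MeasurableSpace E] [BorelSpace E]

instance isAddHaarMeasure_volume_prod {V W : Type*} [NormedAddCommGroup V] [NormedSpace ℝ V]
    [NormedAddCommGroup W] [NormedSpace ℝ W] [FiniteDimensional ℝ V] [FiniteDimensional ℝ W]
    [MeasureSpace V] [MeasureSpace W] [BorelSpace V] [BorelSpace W]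
    [(volume : Measure V).IsAddHaarMeasure] [(volume : Measure W).IsAddHaarMeasure] :
    (volume : Measure (V × W)).IsAddHaarMeasure := by
  rw [Measure.volume_eq_prod]
  infer_instance

/-- The substitution ζ = 2πw reduces the formula to the inversion theorem for the unitary
normalisation; the Jacobian is the power of 2π. -/
theorem fourier_inversion (f : 𝓢(E, ℂ)) (x : E) :
    ∫ ζ : E, Complex.exp (-Complex.I * ((inner ℝ x ζ : ℝ) : ℂ)) *
      ∫ y : E, f y * Complex.exp (Complex.I * ((inner ℝ y ζ : ℝ) : ℂ)) =
    (((2 * Real.pi) ^ Module.finrank ℝ E : ℝ) : ℂ) * f x := by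
  set h : E → ℂ := fun ζ => Complex.exp (-Complex.I * ((inner ℝ x ζ : ℝ) : ℂ)) *
      ∫ y : E, f y * Complex.exp (Complex.I * ((inner ℝ y ζ : ℝ) : ℂ)) with hh
  have hs := Measure.integral_comp_smul (volume : Measure E) h (2 * Real.pi)
  have hpi : (0 : ℝ) < 2 * Real.pi := by positivity
  have h1 : ∫ w, h ((2 * Real.pi) • w) = f x := by
    have e : (𝓕 (𝓕⁻ f)) x = f x := by rw [FourierTransform.fourier_fourierInv_eq]
    rw [← e, SchwartzMap.fourier_coe, Real.fourier_eq]
    refine integral_congr_ae (Eventually.of_forall fun w => ?_)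
    simp only [hh]
    rw [Circle.smul_def, Real.fourierChar_apply, smul_eq_mul, SchwartzMap.fourierInv_coe,
      Real.fourierInv_eq]
    congr 1
    · congr 1
      rw [real_inner_smul_right, real_inner_comm]
      push_cast
      ring
    · refine integral_congr_ae (Eventually.of_forall fun y => ?_)
      simp only
      rw [Circle.smul_def, Real.fourierChar_apply, smul_eq_mul, mul_comm]
      congr 2
      rw [real_inner_smul_right]
      push_cast
      ring
  rw [h1, abs_of_pos (by positivity), Complex.real_smul] at hs
  rw [hs, ← mul_assoc, ← Complex.ofReal_mul, mul_inv_cancel₀ (by positivity), Complex.ofReal_one,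
    one_mul]

/-- The constant in the inversion formula for the short-time Fourier transform. -/
def cInv (E : Type*) [NormedAddCommGroup E] [InnerProductSpace ℝ E]
    [FiniteDimensional ℝ E] [MeasurableSpace E] [BorelSpace E] : ℝ :=
  ((2 * Real.pi) ^ Module.finrank ℝ E * ∫ v : E, Real.exp (-‖v‖ ^ 2))⁻¹

theorem gauss_integral_pos : 0 < ∫ v : E, Real.exp (-‖v‖ ^ 2) := by
  have := GaussianFourier.integral_rexp_neg_mul_sq_norm (V := E) (b := 1) one_pos
  simp only [neg_mul, one_mul] at this
  rw [this]
  positivity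

theorem cInv_pos : 0 < cInv E := by
  have := gauss_integral_pos (E := E)
  unfold cInv
  positivity

theorem integrable_wt_mul_stft (φ : 𝓢(E, ℂ)) (M : ℝ) :
    Integrable (fun X : E × E => wt X ^ M * ‖stft φ X‖) := by
  obtain ⟨K, C, hC, h⟩ := stft_decay_rpow (E := E) (M + intExp (E × E))
  refine ((integrable_wt (volume : Measure (E × E)) le_rfl).const_mul (C * sn K φ)).mono'
    ((continuous_wt_rpow _).mul (continuous_stft φ).norm).aestronglyMeasurable
    (Eventually.of_forall fun X => ?_)
  have hw := wt_rpow_pos X M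
  rw [Real.norm_of_nonneg (by positivity)]
  calc _ ≤ wt X ^ M * (C * sn K φ * wt X ^ (-(M + intExp (E × E)))) := by gcongr; exact h φ X
    _ = C * sn K φ * (wt X ^ M * wt X ^ (-(M + intExp (E × E)))) := by ring
    _ = _ := by rw [← wt_rpow_add]; congr 2; ring

theorem norm_coh_le_one (X : E × E) (x : E) : ‖coh X x‖ ≤ 1 := by
  rw [norm_coh_apply]
  exact Real.exp_le_one_iff.2 (by have := sq_nonneg ‖x - X.1‖; linarith)

/-- For fixed z the transform is a Fourier integral in ζ of φ times the window at z. Inversion in ζ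
returns φ(x) times the window at x; multiplied by the window of `coh Z` this is φ(x) times a squared
Gaussian, whose integral over z is absorbed in `cInv`. The reflection appears because the synthesis
uses the conjugate phase. -/
theorem stft_inversion (φ : 𝓢(E, ℂ)) (x : E) :
    φ x = ∫ Z : E × E, ((cInv E : ℝ) : ℂ) * stft φ (flipP Z) * coh Z x := by
  have hcont : Continuous fun Z : E × E => stft φ (flipP Z) * coh Z x := by
    have := continuous_dist_coh (TemperedDistribution.delta x)
    exact ((continuous_stft φ).comp continuous_flipP).mul this
  have hint : Integrable (fun Z : E × E => stft φ (flipP Z) * coh Z x) := by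
    have h0 := (integrable_wt_mul_stft φ 0)
    simp only [Real.rpow_zero, one_mul] at h0
    have h1 := (measurePreserving_flipP (E := E)).integrable_comp_of_integrable h0
    refine h1.mono' hcont.aestronglyMeasurable (Eventually.of_forall fun Z => ?_)
    rw [norm_mul]
    exact mul_le_of_le_one_right (norm_nonneg _) (norm_coh_le_one _ _)
  have hz : ∀ z : E, ∫ ζ : E, stft φ (flipP (z, ζ)) * coh (z, ζ) x =
      (((2 * Real.pi) ^ Module.finrank ℝ E * Real.exp (-‖z - x‖ ^ 2) : ℝ) : ℂ) * φ x := by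
    intro z
    set f : 𝓢(E, ℂ) := SchwartzMap.smulLeftCLM ℂ (coh (z, 0)) φ with hf
    have hfa : ∀ y, f y = coh (z, 0) y * φ y := fun y => by
      rw [hf, SchwartzMap.smulLeftCLM_apply_apply (coh (z, 0)).hasTemperateGrowth, smul_eq_mul]
    have h := congrArg (fun t => coh (z, (0 : E)) x * t) (fourier_inversion f x)
    rw [← integral_const_mul] at h
    have hg : coh (z, (0 : E)) x * coh (z, 0) x = ((Real.exp (-‖z - x‖ ^ 2) : ℝ) : ℂ) := by
      simp only [coh_apply, cohExp, ← Complex.exp_add, Complex.ofReal_exp, norm_sub_rev z x]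
      congr 1
      simp
      ring
    have hr : coh (z, (0 : E)) x * ((((2 * Real.pi) ^ Module.finrank ℝ E : ℝ) : ℂ) * f x) =
        (((2 * Real.pi) ^ Module.finrank ℝ E * Real.exp (-‖z - x‖ ^ 2) : ℝ) : ℂ) * φ x := by
      rw [hfa, Complex.ofReal_mul, ← hg]
      ring
    rw [← hr, ← h]
    refine integral_congr_ae (Eventually.of_forall fun ζ => ?_)
    simp only
    have hs : stft φ (flipP (z, ζ)) =
        ∫ y : E, f y * Complex.exp (Complex.I * ((inner ℝ y ζ : ℝ) : ℂ)) := by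
      unfold stft flipP
      refine integral_congr_ae (Eventually.of_forall fun y => ?_)
      simp only
      rw [coh_apply', hfa]
      simp only [inner_neg_right, Complex.ofReal_neg]
      ring_nf
    rw [hs, coh_apply' z ζ x]
    ring
  simp only [mul_assoc]
  rw [integral_const_mul, Measure.volume_eq_prod, integral_prod _ hint]
  simp only [hz]
  rw [integral_mul_const, integral_complex_ofReal, integral_const_mul,
    integral_sub_right_eq_self (fun z : E => Real.exp (-‖z‖ ^ 2)) x, ← mul_assoc,
    ← Complex.ofReal_mul, cInv, inv_mul_cancel₀ ?_, Complex.ofReal_one, one_mul]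
  have := gauss_integral_pos (E := E)
  positivity

/-- The inversion formula presents φ as a superposition of coherent states, under which u passes.
This identity carries the whole analysis: distributions are handled through their values on coherent
states. -/
theorem dist_inversion (u : 𝓢'(E, ℂ)) (φ : 𝓢(E, ℂ)) :
    u φ = ((cInv E : ℝ) : ℂ) * ∫ Z : E × E, stft φ (flipP Z) * u (coh Z) := by
  have hm : AEStronglyMeasurable (fun Z : E × E => ((cInv E : ℝ) : ℂ) * stft φ (flipP Z)) volume :=
    (continuous_const.mul ((continuous_stft φ).comp continuous_flipP)).aestronglyMeasurable
  obtain ⟨ψ, h1, -, h3⟩ := exists_superposition (μ := (volume : Measure (E × E)))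
    (Z := fun Z => Z) (F := fun Z => ((cInv E : ℝ) : ℂ) * stft φ (flipP Z))
    aestronglyMeasurable_id hm (fun M => by
      have h0 := (integrable_wt_mul_stft φ M).const_mul (cInv E)
      have h1 := (measurePreserving_flipP (E := E)).integrable_comp_of_integrable h0
      refine h1.congr (Eventually.of_forall fun Z => ?_)
      simp only [Function.comp, wt_flipP, norm_mul, Complex.norm_real,
        Real.norm_of_nonneg cInv_pos.le]
      ring)
  have hψ : ψ = φ := by
    ext x
    rw [h1 x, ← stft_inversion]
  rw [← hψ, h3 u, hψ, ← integral_const_mul]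
  simp only [mul_assoc]

theorem dist_ext_coh {u v : 𝓢'(E, ℂ)} (h : ∀ X, u (coh X) = v (coh X)) : u = v := by
  ext φ
  rw [dist_inversion u, dist_inversion v]
  simp only [h]

/-- The complex conjugate of a Schwartz function. -/
def conjS (φ : 𝓢(E, ℂ)) : 𝓢(E, ℂ) :=
  SchwartzMap.postcompCLM (𝕜 := ℝ) (Complex.conjCLE : ℂ →L[ℝ] ℂ) φ

@[simp] theorem conjS_apply (φ : 𝓢(E, ℂ)) (x : E) : conjS φ x = (starRingEnd ℂ) (φ x) := by
  simp [conjS]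

theorem stft_conjS (φ : 𝓢(E, ℂ)) (X : E × E) :
    stft (conjS φ) X = (starRingEnd ℂ) (stft φ (flipP X)) := by
  unfold stft
  rw [← integral_conj]
  congr 1
  ext x
  rw [map_mul, conj_coh, flipP_flipP, conjS_apply]

theorem integrable_stft_sq (φ : 𝓢(E, ℂ)) : Integrable (fun X => ‖stft φ X‖ ^ 2) := by
  obtain ⟨K, C, hC, h⟩ := stft_decay_rpow (E := E) 0
  have h0 := (integrable_wt_mul_stft φ 0).const_mul (C * sn K φ)
  refine h0.mono' ((continuous_stft φ).norm.pow 2).aestronglyMeasurable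
    (Eventually.of_forall fun X => ?_)
  have := h φ X
  simp only [neg_zero, Real.rpow_zero, mul_one] at this
  rw [Real.norm_of_nonneg (by positivity), Real.rpow_zero, one_mul, sq]
  gcongr

/-- The inversion formula for the distribution given by the conjugate of φ, tested on φ itself. -/
theorem stft_plancherel (φ : 𝓢(E, ℂ)) :
    cInv E * ∫ X, ‖stft φ X‖ ^ 2 = ∫ x, ‖φ x‖ ^ 2 := by
  have h := dist_inversion (sdist (conjS φ)) φ
  simp only [sdist_coh] at h
  simp only [sdist_apply, stft_conjS, conjS_apply] at h
  have e1 : ∀ z : ℂ, z * (starRingEnd ℂ) z = ((‖z‖ ^ 2 : ℝ) : ℂ) := fun z => by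
    rw [Complex.mul_conj, Complex.normSq_eq_norm_sq]
  have e2 : ∀ z : ℂ, (starRingEnd ℂ) z * z = ((‖z‖ ^ 2 : ℝ) : ℂ) := fun z => by
    rw [mul_comm, e1]
  simp only [e1, e2] at h
  rw [integral_flipP (fun Z => ((‖stft φ Z‖ ^ 2 : ℝ) : ℂ)), integral_complex_ofReal, integral_complex_ofReal] at h
  exact_mod_cast h.symm

end Inversion

/-! ### Square integrable distributions and Schwartz functions on the phase space side -/

section L2

variable {E : Type*} [NormedAddCommGroup E] [InnerProductSpace ℝ E]
  [FiniteDimensional ℝ E] [MeasurableSpace E] [BorelSpace E]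

theorem norm_toLp_two_sq (φ : 𝓢(E, ℂ)) :
    ‖φ.toLp 2 (volume : Measure E)‖ ^ 2 = ∫ x, ‖φ x‖ ^ 2 := by
  have h0 : 0 ≤ ∫ x, ‖φ x‖ ^ 2 := integral_nonneg fun x => by positivity
  rw [SchwartzMap.norm_toLp' (by simp) (by simp)]
  simp only [ENNReal.toReal_ofNat, Real.rpow_ofNat]
  rw [← Real.rpow_natCast, ← Real.rpow_mul h0]
  norm_num

theorem lintegral_stft_sq (φ : 𝓢(E, ℂ)) : ∫⁻ X, ‖stft φ X‖ₑ ^ 2 =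
    ENNReal.ofReal ((cInv E)⁻¹ * ‖φ.toLp 2 (volume : Measure E)‖ ^ 2) := by
  rw [norm_toLp_two_sq, ← stft_plancherel, inv_mul_cancel_left₀ cInv_pos.ne',
    ofReal_integral_eq_lintegral_ofReal (integrable_stft_sq φ)
      (Eventually.of_forall fun X => by positivity)]
  congr 1
  ext X
  rw [ENNReal.ofReal_pow (norm_nonneg _), ofReal_norm]

/-- Schwartz approximations converge in L², hence their transforms converge pointwise; Plancherel's
identity bounds the norms and Fatou's lemma passes to the limit. -/
theorem lintegral_coh_sq_lt_top_of_Lp (f : Lp ℂ 2 (volume : Measure E)) :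
    ∫⁻ X : E × E, ‖(Lp.toTemperedDistribution f) (coh X)‖ₑ ^ 2 < ⊤ := by
  have hd := SchwartzMap.denseRange_toLpCLM (E := E) (F := ℂ) (p := 2) (μ := volume) (by simp)
  obtain ⟨g, hg, hgf⟩ := mem_closure_iff_seq_limit.1 (hd f)
  choose φ hφ using hg
  have hφ' : ∀ j, (φ j).toLp 2 (volume : Measure E) = g j := hφ
  have hpt : ∀ X : E × E, Tendsto (fun j => stft (φ j) X) atTop
      (𝓝 ((Lp.toTemperedDistribution f) (coh X))) := by
    intro X
    have h1 := ((Lp.toTemperedDistributionCLM ℂ (volume : Measure E) 2).continuous.tendsto f).comp hgf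
    have h2 := (PointwiseConvergenceCLM.tendsto_iff_forall_tendsto.1 h1) (coh X)
    refine h2.congr fun j => ?_
    simp only [Function.comp, Lp.toTemperedDistributionCLM_apply]
    rw [← hφ' j, Lp.toTemperedDistribution_toLp_eq]
    exact sdist_coh (φ j) X
  have hF : ∫⁻ X : E × E, ‖(Lp.toTemperedDistribution f) (coh X)‖ₑ ^ 2 ≤
      liminf (fun j => ∫⁻ X : E × E, ‖stft (φ j) X‖ₑ ^ 2) atTop := by
    refine le_trans (le_of_eq ?_) (lintegral_liminf_le fun j =>
      ((continuous_stft (φ j)).enorm.measurable.pow_const 2))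
    congr 1
    ext X
    exact (((ENNReal.continuous_pow 2).tendsto _).comp
      ((continuous_enorm.tendsto _).comp (hpt X))).liminf_eq.symm
  refine hF.trans_lt ?_
  simp only [lintegral_stft_sq, hφ']
  have ht : Tendsto (fun j => ENNReal.ofReal ((cInv E)⁻¹ * ‖g j‖ ^ 2)) atTop
      (𝓝 (ENNReal.ofReal ((cInv E)⁻¹ * ‖f‖ ^ 2))) :=
    (ENNReal.continuous_ofReal.tendsto _).comp ((hgf.norm.pow 2).const_mul _)
  rw [ht.liminf_eq]
  exact ENNReal.ofReal_lt_top

/-- Cauchy–Schwarz in the inversion formula and Plancherel's identity for φ bound u by the L² norm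
of φ. The functional then extends to L², and the Riesz theorem represents it. -/
theorem exists_Lp_of_lintegral_coh_sq (u : 𝓢'(E, ℂ)) (h : ∫⁻ X : E × E, ‖u (coh X)‖ₑ ^ 2 < ⊤) :
    ∃ f : Lp ℂ 2 (volume : Measure E), u = Lp.toTemperedDistribution f := by
  set J := ∫⁻ X : E × E, ‖u (coh X)‖ₑ ^ 2 with hJ
  have hc := cInv_pos (E := E)
  have hbound : ∀ φ : 𝓢(E, ℂ), ‖u φ‖ ≤ Real.sqrt (cInv E * J.toReal) *
      ‖φ.toLp 2 (volume : Measure E)‖ := by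
    intro φ
    refine le_of_sq_le_sq ?_ (by positivity)
    rw [mul_pow, Real.sq_sqrt (by positivity)]
    have h1 : ‖u φ‖ₑ ^ 2 ≤ ENNReal.ofReal (cInv E) ^ 2 *
        (ENNReal.ofReal ((cInv E)⁻¹ * ‖φ.toLp 2 (volume : Measure E)‖ ^ 2) * J) := by
      rw [dist_inversion u φ, enorm_mul, mul_pow]
      have e1 : ‖((cInv E : ℝ) : ℂ)‖ₑ = ENNReal.ofReal (cInv E) := by
        rw [← ofReal_norm, Complex.norm_real, Real.norm_of_nonneg hc.le]
      rw [e1]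
      gcongr
      have hm : AEMeasurable (fun Z : E × E => ‖stft φ (flipP Z)‖ₑ) volume :=
        ((continuous_stft φ).comp continuous_flipP).enorm.measurable.aemeasurable
      have hm2 : AEMeasurable (fun Z : E × E => ‖u (coh Z)‖ₑ) volume :=
        (continuous_dist_coh u).enorm.measurable.aemeasurable
      calc _ ≤ (∫⁻ Z : E × E, ‖stft φ (flipP Z)‖ₑ * ‖u (coh Z)‖ₑ) ^ 2 := by
            gcongr
            refine (enorm_integral_le_lintegral_enorm _).trans (le_of_eq ?_)
            simp only [enorm_mul]
        _ ≤ _ := lintegral_mul_sq_le volume hm hm2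
        _ = _ := by rw [lintegral_flipP (fun Z => ‖stft φ Z‖ₑ ^ 2), lintegral_stft_sq]
    have h2 := ENNReal.toReal_mono (by finiteness) h1
    simp only [ENNReal.toReal_mul, ENNReal.toReal_pow, toReal_enorm,
      ENNReal.toReal_ofReal hc.le] at h2
    rw [ENNReal.toReal_ofReal (by positivity)] at h2
    refine h2.trans (le_of_eq ?_)
    field_simp
  have hdense : DenseRange ((SchwartzMap.toLpCLM ℂ ℂ 2 (volume : Measure E)) :
      𝓢(E, ℂ) →ₗ[ℂ] Lp ℂ 2 (volume : Measure E)) :=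
    SchwartzMap.denseRange_toLpCLM (E := E) (F := ℂ) (p := 2) (μ := volume) (by simp)
  set A : 𝓢(E, ℂ) →ₗ[ℂ] ℂ := (u : 𝓢(E, ℂ) →L[ℂ] ℂ).toLinearMap
  set ℓ : Lp ℂ 2 (volume : Measure E) →L[ℂ] ℂ := A.extendOfNorm
    ((SchwartzMap.toLpCLM ℂ ℂ 2 (volume : Measure E)) : 𝓢(E, ℂ) →ₗ[ℂ] Lp ℂ 2 (volume : Measure E))
  have hℓ : ∀ φ : 𝓢(E, ℂ), ℓ (φ.toLp 2 volume) = u φ :=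
    LinearMap.extendOfNorm_eq hdense ⟨_, hbound⟩
  set g := (InnerProductSpace.toDual ℂ (Lp ℂ 2 (volume : Measure E))).symm ℓ
  -- The inner product is conjugate linear in its first argument, whereas the pairing of
  -- distributions is bilinear.
  refine ⟨star g, ?_⟩
  ext φ
  rw [Lp.toTemperedDistribution_apply, ← hℓ φ]
  have : inner ℂ g (φ.toLp 2 volume) = ℓ (φ.toLp 2 volume) := by
    rw [← InnerProductSpace.toDual_apply_apply, LinearIsometryEquiv.apply_symm_apply]
  rw [← this, L2.inner_def]
  refine integral_congr_ae ?_
  filter_upwards [φ.coeFn_toLp 2 (volume : Measure E), Lp.coeFn_star g] with x h1 h2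
  rw [h1, h2]
  simp

theorem isL2_iff (u : 𝓢'(E, ℂ)) :
    (∃ f : Lp ℂ 2 (volume : Measure E), u = Lp.toTemperedDistribution f) ↔
      ∫⁻ X : E × E, ‖u (coh X)‖ₑ ^ 2 < ⊤ :=
  ⟨fun ⟨f, hf⟩ => hf ▸ lintegral_coh_sq_lt_top_of_Lp f, exists_Lp_of_lintegral_coh_sq u⟩

/-- A distribution whose short-time Fourier transform decays rapidly is a Schwartz function. -/
theorem exists_sdist_of_decay (u : 𝓢'(E, ℂ))
    (h : ∀ N : ℝ, ∃ C : ℝ, ∀ X : E × E, ‖u (coh X)‖ ≤ C * wt X ^ (-N)) :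
    ∃ ψ : 𝓢(E, ℂ), u = sdist ψ ∧ ∀ x n, iteratedFDeriv ℝ n ψ x =
      ∫ X : E × E, (((cInv E : ℝ) : ℂ) * u (coh (flipP X))) • iteratedFDeriv ℝ n (coh X) x := by
  have hc := cInv_pos (E := E)
  have hcont : Continuous fun X : E × E => ((cInv E : ℝ) : ℂ) * u (coh (flipP X)) :=
    continuous_const.mul ((continuous_dist_coh u).comp continuous_flipP)
  obtain ⟨ψ, h1, h2, h3⟩ := exists_superposition (μ := (volume : Measure (E × E)))
    (Z := fun Z => Z) (F := fun X => ((cInv E : ℝ) : ℂ) * u (coh (flipP X)))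
    aestronglyMeasurable_id hcont.aestronglyMeasurable (fun M => by
      obtain ⟨C, hC⟩ := h (M + intExp (E × E))
      refine ((integrable_wt (volume : Measure (E × E)) le_rfl).const_mul (cInv E * C)).mono'
        ((continuous_wt_rpow _).mul hcont.norm).aestronglyMeasurable
        (Eventually.of_forall fun X => ?_)
      have hw := wt_rpow_pos X M
      rw [Real.norm_of_nonneg (by positivity), norm_mul, Complex.norm_real,
        Real.norm_of_nonneg hc.le]
      have := hC (flipP X)
      rw [wt_flipP] at this
      calc _ ≤ wt X ^ M * (cInv E * (C * wt X ^ (-(M + intExp (E × E))))) := by gcongr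
        _ = cInv E * C * (wt X ^ M * wt X ^ (-(M + intExp (E × E)))) := by ring
        _ = _ := by rw [← wt_rpow_add]; congr 2; ring)
  refine ⟨ψ, ?_, fun x n => h2 n x⟩
  ext φ
  rw [dist_inversion u φ, sdist_apply]
  have e : ∫ x, ψ x * φ x = ∫ x, φ x * ψ x := by simp only [mul_comm]
  rw [e, ← sdist_apply, h3 (sdist φ), ← integral_const_mul, ← integral_flipP]
  congr 1
  ext X
  rw [sdist_coh, flipP_flipP]
  ring

theorem sdist_injective {φ ψ : 𝓢(E, ℂ)} (h : sdist φ = sdist ψ) : φ = ψ := by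
  ext x
  rw [stft_inversion φ x, stft_inversion ψ x]
  simp only [← sdist_coh, h]

/-- Seminorms of a Schwartz function are controlled by its short-time Fourier transform. -/
theorem sn_le_of_stft (N : ℕ) : ∃ (C M : ℝ), 0 ≤ C ∧ ∀ (ψ : 𝓢(E, ℂ)) (B : ℝ),
    (∀ X, ‖stft ψ X‖ ≤ B * wt X ^ (-M)) → sn N ψ ≤ C * B := by
  have hc := cInv_pos (E := E)
  choose D K hD hK hcoh using fun n => norm_iteratedFDeriv_coh_le (E := E) n N
  set Dm := ∑ n ∈ Finset.range (N + 1), D n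
  set Km := ∑ n ∈ Finset.range (N + 1), K n
  have hDm : 0 ≤ Dm := Finset.sum_nonneg fun n _ => hD n
  have hle : ∀ n ≤ N, D n ≤ Dm ∧ K n ≤ Km := fun n hn =>
    ⟨Finset.single_le_sum (f := D) (fun _ _ => hD _) (Finset.mem_range.2 (by omega)),
      Finset.single_le_sum (f := K) (fun _ _ => hK _) (Finset.mem_range.2 (by omega))⟩
  set J := ∫ X : E × E, wt X ^ (-intExp (E × E)) with hJ
  have hJ0 : 0 ≤ J := integral_nonneg fun x => (wt_rpow_pos _ _).le
  refine ⟨cInv E * Dm * J, Km + intExp (E × E), by positivity, fun ψ B hB => ?_⟩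
  have hB0 : 0 ≤ B := by
    have := (norm_nonneg _).trans (hB 0)
    have h1 := wt_rpow_pos (0 : E × E) (-(Km + intExp (E × E)))
    exact nonneg_of_mul_nonneg_left this h1
  -- The function is recovered from its own transform, in order to have its derivatives as integrals
  -- of derivatives of coherent states.
  obtain ⟨ψ', e1, e2⟩ := exists_sdist_of_decay (sdist ψ) (fun N => by
    obtain ⟨M, C, hC, h⟩ := stft_decay_rpow (E := E) N
    exact ⟨C * sn M ψ, fun X => by rw [sdist_coh]; exact h ψ X⟩)
  obtain rfl := sdist_injective e1
  refine sn_le_of_bound (by positivity) fun k hk n hn x => ?_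
  have hx := wt_pos x
  have hb : ‖iteratedFDeriv ℝ n ψ x‖ ≤ ∫ X : E × E,
      cInv E * B * Dm * wt x ^ (-(N : ℝ)) * wt X ^ (-intExp (E × E)) := by
    rw [e2]
    refine norm_integral_le_of_norm_le ((integrable_wt volume le_rfl).const_mul _)
      (Eventually.of_forall fun X => ?_)
    have hX := wt_pos X
    rw [norm_smul, norm_mul, Complex.norm_real, Real.norm_of_nonneg hc.le, sdist_coh]
    have h1 := hB (flipP X)
    rw [wt_flipP] at h1
    have h2 : ‖iteratedFDeriv ℝ n (coh X) x‖ ≤ Dm * wt X ^ Km * wt x ^ (-(N : ℝ)) := by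
      refine (hcoh n X x).trans ?_
      have := hle n hn
      have h3 : wt X ^ K n ≤ wt X ^ Km := wt_rpow_le this.2
      have hDn := hD n
      gcongr
      exact this.1
    calc _ ≤ cInv E * (B * wt X ^ (-(Km + intExp (E × E)))) *
          (Dm * wt X ^ Km * wt x ^ (-(N : ℝ))) := by gcongr
      _ = cInv E * B * Dm * wt x ^ (-(N : ℝ)) *
          (wt X ^ (-(Km + intExp (E × E))) * wt X ^ Km) := by ring
      _ = _ := by rw [← wt_rpow_add]; congr 2; ring
  rw [integral_const_mul] at hb
  have h5 : wt x ^ (k : ℝ) ≤ wt x ^ (N : ℝ) := wt_rpow_le (by exact_mod_cast hk)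
  calc wt x ^ (k : ℝ) * ‖iteratedFDeriv ℝ n ψ x‖ ≤ wt x ^ (N : ℝ) *
        (cInv E * B * Dm * wt x ^ (-(N : ℝ)) * J) := by gcongr
    _ = cInv E * Dm * J * B * (wt x ^ (N : ℝ) * wt x ^ (-(N : ℝ))) := by ring
    _ = _ := by rw [wt_rpow_mul_neg, mul_one]

end L2

/-! ### Auxiliary estimates -/

section Aux

variable {V W : Type*} [NormedAddCommGroup V] [NormedSpace ℝ V] [NormedAddCommGroup W]
  [NormedSpace ℝ W]

theorem norm_iteratedFDeriv_comp_affine_le {f : W → ℂ} (hf : ContDiff ℝ ∞ f) (A : V →L[ℝ] W)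
    (hA : ‖A‖ ≤ 1) (p : W) (k : ℕ) (x : V) :
    ‖iteratedFDeriv ℝ k (fun x => f (A x + p)) x‖ ≤ ‖iteratedFDeriv ℝ k f (A x + p)‖ := by
  have hg : ContDiff ℝ ∞ (fun z => f (z + p)) := hf.comp (contDiff_id.add contDiff_const)
  have e : (fun x => f (A x + p)) = (fun z => f (z + p)) ∘ A := rfl
  rw [e, ContinuousLinearMap.iteratedFDeriv_comp_right _ hg x (by exact_mod_cast le_top)]
  refine (ContinuousMultilinearMap.norm_compContinuousLinearMap_le _ _).trans ?_
  rw [iteratedFDeriv_comp_add_right]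
  simp only [Finset.prod_const, Finset.card_univ, Fintype.card_fin]
  exact mul_le_of_le_one_right (norm_nonneg _) (pow_le_one₀ (norm_nonneg _) hA)

theorem norm_iteratedFDeriv_mul_le_of_le {f g : V → ℂ} (hf : ContDiff ℝ ∞ f)
    (hg : ContDiff ℝ ∞ g) {N : ℕ} {A B : ℝ} {x : V}
    (hA : ∀ k ≤ N, ‖iteratedFDeriv ℝ k f x‖ ≤ A) (hB : ∀ k ≤ N, ‖iteratedFDeriv ℝ k g x‖ ≤ B)
    {k : ℕ} (hk : k ≤ N) :
    ‖iteratedFDeriv ℝ k (fun x => f x * g x) x‖ ≤ 2 ^ N * A * B := by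
  have hA0 : 0 ≤ A := (norm_nonneg _).trans (hA 0 (Nat.zero_le _))
  have hB0 : 0 ≤ B := (norm_nonneg _).trans (hB 0 (Nat.zero_le _))
  refine (norm_iteratedFDeriv_mul_le (𝕜 := ℝ) hf hg x (n := k) (by exact_mod_cast le_top)).trans ?_
  have ht : ∀ i ∈ Finset.range (k + 1), (k.choose i : ℝ) * ‖iteratedFDeriv ℝ i f x‖ *
      ‖iteratedFDeriv ℝ (k - i) g x‖ ≤ (k.choose i : ℝ) * (A * B) := by
    intro i hi
    have hi' : i ≤ k := by simpa [Nat.lt_succ_iff] using hi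
    rw [mul_assoc]
    refine mul_le_mul_of_nonneg_left ?_ (Nat.cast_nonneg _)
    exact mul_le_mul (hA i (hi'.trans hk)) (hB (k - i) (by omega)) (norm_nonneg _) hA0
  refine (Finset.sum_le_sum ht).trans ?_
  have hs : ∑ i ∈ Finset.range (k + 1), (k.choose i : ℝ) = 2 ^ k := by
    exact_mod_cast Nat.sum_range_choose k
  rw [← Finset.sum_mul, hs, mul_assoc]
  gcongr
  norm_num

/-- Dividing by w(x) turns a majorant that grows with the parameter into a fixed one. -/
theorem continuous_integral_of_weighted {α β : Type*} [TopologicalSpace α]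
    [FirstCountableTopology α] [MeasurableSpace β] {μ : Measure β} {F : α → β → ℂ} {w : α → ℝ}
    {b : β → ℝ} (hw : Continuous w) (hw0 : ∀ x, 0 < w x) (hb : Integrable b μ)
    (hF : ∀ x, AEStronglyMeasurable (F x) μ) (hFc : ∀ y, Continuous fun x => F x y)
    (hle : ∀ x y, ‖F x y‖ ≤ w x * b y) : Continuous fun x => ∫ y, F x y ∂μ := by
  have h : Continuous fun x => ∫ y, (((w x)⁻¹ : ℝ) : ℂ) * F x y ∂μ := by
    refine continuous_of_dominated (fun x => (hF x).const_mul _)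
      (fun x => Eventually.of_forall fun y => ?_) hb (Eventually.of_forall fun y => ?_)
    · rw [norm_mul, Complex.norm_real, norm_inv, Real.norm_of_nonneg (hw0 x).le,
        inv_mul_le_iff₀ (hw0 x)]
      exact hle x y
    · exact (Complex.continuous_ofReal.comp (hw.inv₀ fun x => (hw0 x).ne')).mul (hFc y)
  have h2 := (Complex.continuous_ofReal.comp hw).mul h
  refine h2.congr fun x => ?_
  change ((w x : ℝ) : ℂ) * ∫ y, (((w x)⁻¹ : ℝ) : ℂ) * F x y ∂μ = _
  rw [integral_const_mul, ← mul_assoc, ← Complex.ofReal_mul, mul_inv_cancel₀ (hw0 x).ne']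
  simp

/-- The image of a Haar measure under a linear isomorphism is again a Haar measure, and Haar
measures are proportional. Only finiteness of integrals is at stake later, so the Jacobian is left
unspecified. -/
theorem exists_measurePreserving_smul [FiniteDimensional ℝ V] [FiniteDimensional ℝ W]
    [MeasurableSpace V] [BorelSpace V] [MeasurableSpace W] [BorelSpace W] (T : V ≃L[ℝ] W)
    (μ : Measure V) [μ.IsAddHaarMeasure] (ν : Measure W) [ν.IsAddHaarMeasure] :
    ∃ c : ℝ≥0∞, c ≠ 0 ∧ c ≠ ⊤ ∧ MeasurePreserving T μ (c • ν) := by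
  have h := T.isAddHaarMeasure_map μ
  refine ⟨Measure.addHaarScalarFactor (Measure.map T μ) ν, ?_, by simp, T.continuous.measurable, ?_⟩
  · have := Measure.addHaarScalarFactor_pos_of_isAddHaarMeasure (Measure.map T μ) ν
    simpa using this.ne'
  · exact Measure.isAddLeftInvariant_eq_smul (Measure.map T μ) ν

end Aux

/-! ### The Weyl integral -/

/-- Smooth functions all of whose derivatives are bounded by the same power of the weight. -/
def PolySymb {V : Type*} [NormedAddCommGroup V] [NormedSpace ℝ V] (L : ℝ) (a : V → ℂ) : Prop :=
  ContDiff ℝ ∞ a ∧ ∀ k : ℕ, ∃ C : ℝ, ∀ X, ‖iteratedFDeriv ℝ k a X‖ ≤ C * wt X ^ L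

section Weyl

variable {E : Type*} [NormedAddCommGroup E] [InnerProductSpace ℝ E]

theorem PolySymb.bound {V : Type*} [NormedAddCommGroup V] [NormedSpace ℝ V] {L : ℝ} {a : V → ℂ}
    (ha : PolySymb L a) (N : ℕ) :
    ∃ C : ℝ, 0 ≤ C ∧ ∀ k ≤ N, ∀ X, ‖iteratedFDeriv ℝ k a X‖ ≤ C * wt X ^ L :=
  exists_uniform_bound (fun X => (wt_rpow_pos X L).le) ha.2 N

theorem PolySymb.mono {V : Type*} [NormedAddCommGroup V] [NormedSpace ℝ V] {L L' : ℝ} {a : V → ℂ}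
    (ha : PolySymb L a) (hL : L ≤ L') : PolySymb L' a := by
  refine ⟨ha.1, fun k => ?_⟩
  obtain ⟨C, hC, h⟩ := ha.bound k
  exact ⟨C, fun X => (h k le_rfl X).trans (mul_le_mul_of_nonneg_left (wt_rpow_le hL) hC)⟩

theorem norm_cexp_I_mul (t : ℝ) : ‖Complex.exp (Complex.I * (t : ℂ))‖ = 1 := by
  rw [mul_comm]
  exact Complex.norm_exp_ofReal_mul_I t

theorem wt_half_add_le (x y ξ : E) :
    wt ((2⁻¹ : ℝ) • (x + y), ξ) ≤ wt x * wt ξ * wt y := by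
  refine (wt_prod_le _).trans ?_
  have h1 : wt ((2⁻¹ : ℝ) • (x + y)) ≤ wt x * wt y := by
    have : wt ((2⁻¹ : ℝ) • (x + y)) ≤ wt (x + y) := by
      unfold wt
      rw [norm_smul]
      norm_num
      linarith [norm_nonneg (x + y)]
    refine this.trans ?_
    simpa using wt_le_sub_mul (x + y) y
  have := wt_pos x
  have := wt_pos y
  have := wt_pos ξ
  calc _ ≤ (wt x * wt y) * wt ξ := by gcongr
    _ = _ := by ring

variable [FiniteDimensional ℝ E] [MeasurableSpace E] [BorelSpace E]

/-- The inner integral in the Weyl quantization. -/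
def weylInner (a : E × E → ℂ) (φ : 𝓢(E, ℂ)) (x ξ : E) : ℂ :=
  ∫ y : E, Complex.exp (Complex.I * ((inner ℝ (x - y) ξ : ℝ) : ℂ)) *
    a ((2⁻¹ : ℝ) • (x + y), ξ) * φ y

/-- For convergence only polynomial growth of the symbol and its derivatives matters, so one
treatment serves symbols of every order. -/
theorem norm_weylIntegrand_le {L : ℝ} (hL : 0 ≤ L) {a : E × E → ℂ} (ha : PolySymb L a) :
    ∃ C : ℝ, 0 ≤ C ∧ ∃ K : ℕ, ∀ (φ : 𝓢(E, ℂ)) (x ξ y : E),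
      ‖Complex.exp (Complex.I * ((inner ℝ (x - y) ξ : ℝ) : ℂ)) *
        a ((2⁻¹ : ℝ) • (x + y), ξ) * φ y‖ ≤
        C * sn K φ * (wt x * wt ξ) ^ L * wt y ^ (-intExp E) := by
  obtain ⟨C, hC, h⟩ := ha.bound 0
  obtain ⟨K, hK⟩ := exists_nat_ge (L + intExp E)
  refine ⟨C * 2 ^ K, by positivity, K, fun φ x ξ y => ?_⟩
  have hx := wt_pos x
  have hy := wt_pos y
  have hξ := wt_pos ξ
  have hsn := sn_nonneg K φ
  rw [norm_mul, norm_mul, norm_cexp_I_mul, one_mul]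
  have h1 : ‖a ((2⁻¹ : ℝ) • (x + y), ξ)‖ ≤ C * ((wt x * wt ξ) ^ L * wt y ^ L) := by
    rw [← Real.mul_rpow (by positivity) hy.le]
    have := h 0 le_rfl ((2⁻¹ : ℝ) • (x + y), ξ)
    rw [norm_iteratedFDeriv_zero] at this
    refine this.trans (mul_le_mul_of_nonneg_left ?_ hC)
    exact Real.rpow_le_rpow (wt_pos _).le (wt_half_add_le x y ξ) hL
  have h2 := norm_le_sn (le_refl K) φ y
  have h3 : wt y ^ L * wt y ^ (-(K : ℝ)) ≤ wt y ^ (-intExp E) := by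
    rw [← wt_rpow_add]
    exact wt_rpow_le (by linarith)
  calc _ ≤ (C * ((wt x * wt ξ) ^ L * wt y ^ L)) * (2 ^ K * sn K φ * wt y ^ (-(K : ℝ))) := by gcongr
    _ = C * 2 ^ K * sn K φ * (wt x * wt ξ) ^ L * (wt y ^ L * wt y ^ (-(K : ℝ))) := by ring
    _ ≤ _ := by gcongr

theorem continuous_weylIntegrand {a : E × E → ℂ} (ha : Continuous a) (φ : 𝓢(E, ℂ)) :
    Continuous fun p : (E × E) × E =>
      Complex.exp (Complex.I * ((inner ℝ (p.1.1 - p.2) p.1.2 : ℝ) : ℂ)) *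
        a ((2⁻¹ : ℝ) • (p.1.1 + p.2), p.1.2) * φ p.2 := by
  have := φ.continuous
  fun_prop

theorem integrable_weylIntegrand {L : ℝ} (hL : 0 ≤ L) {a : E × E → ℂ} (ha : PolySymb L a)
    (φ : 𝓢(E, ℂ)) (x ξ : E) :
    Integrable fun y : E => Complex.exp (Complex.I * ((inner ℝ (x - y) ξ : ℝ) : ℂ)) *
        a ((2⁻¹ : ℝ) • (x + y), ξ) * φ y := by
  obtain ⟨C, hC, K, h⟩ := norm_weylIntegrand_le hL ha
  refine ((integrable_wt volume le_rfl).const_mul _).mono' ?_ (Eventually.of_forall (h φ x ξ))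
  have h1 : Continuous fun y : E => (((x, ξ), y) : (E × E) × E) := by fun_prop
  exact ((continuous_weylIntegrand ha.1.continuous φ).comp h1).aestronglyMeasurable

theorem continuous_weylInner {L : ℝ} (hL : 0 ≤ L) {a : E × E → ℂ} (ha : PolySymb L a)
    (φ : 𝓢(E, ℂ)) : Continuous fun X : E × E => weylInner a φ X.1 X.2 := by
  obtain ⟨C, hC, K, h⟩ := norm_weylIntegrand_le hL ha
  have hc := continuous_weylIntegrand ha.1.continuous φ
  refine continuous_integral_of_weighted (F := fun (X : E × E) (y : E) =>
      Complex.exp (Complex.I * ((inner ℝ (X.1 - y) X.2 : ℝ) : ℂ)) *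
        a ((2⁻¹ : ℝ) • (X.1 + y), X.2) * φ y) (w := fun X : E × E => (wt X.1 * wt X.2) ^ L)
    (b := fun y => C * sn K φ * wt y ^ (-intExp E)) ?_ ?_
    ((integrable_wt volume le_rfl).const_mul _) (fun X => ?_) (fun y => ?_) (fun X y => ?_)
  · exact ((continuous_wt.comp continuous_fst).mul (continuous_wt.comp continuous_snd)).rpow_const
      fun X => Or.inr hL
  · intro X
    have := wt_pos X.1
    have := wt_pos X.2
    positivity
  · exact (integrable_weylIntegrand hL ha φ X.1 X.2).aestronglyMeasurable
  · have h1 : Continuous fun X : E × E => ((X, y) : (E × E) × E) := by fun_prop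
    exact (hc.comp h1 :)
  · refine (h φ X.1 X.2 y).trans (le_of_eq ?_)
    ring

/-- The double integral need not converge absolutely. Integration by parts in y makes the inner
integral decay in ξ to any order, which gives the outer integral a meaning. -/
theorem norm_weylInner_le {L : ℝ} (hL : 0 ≤ L) {a : E × E → ℂ} (ha : PolySymb L a) (N : ℝ) :
    ∃ C : ℝ, 0 ≤ C ∧ ∃ K : ℕ, ∀ (φ : 𝓢(E, ℂ)) (x ξ : E),
      ‖weylInner a φ x ξ‖ ≤ C * sn K φ * wt x ^ L * wt ξ ^ (-N) := by
  -- Of the P integrations by parts, L compensate the growth of the symbol in ξ.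
  obtain ⟨P, hP⟩ := exists_nat_ge (L + N)
  obtain ⟨C₁, hC₁, hF⟩ := fourier_decay (volume : Measure E) (innerSL ℝ) inner_norming P
  obtain ⟨C, hC, h⟩ := ha.bound P
  obtain ⟨K, hK⟩ := exists_nat_ge (L + intExp E + P)
  have hPK : P ≤ K := by
    have : (P : ℝ) ≤ K := by linarith [intExp_pos E]
    exact_mod_cast this
  set J : ℝ := ∫ x : E, wt x ^ (-intExp E) with hJ
  have hJ0 : 0 ≤ J := integral_nonneg fun x => (wt_rpow_pos _ _).le
  refine ⟨C₁ * (2 ^ P * C * 2 ^ K * J), by positivity, K, fun φ x ξ => ?_⟩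
  have hx := wt_pos x
  have hξ := wt_pos ξ
  have hsn := sn_nonneg K φ
  set A : E →L[ℝ] E × E := (2⁻¹ : ℝ) • ContinuousLinearMap.inl ℝ E E with hA
  have hA1 : ‖A‖ ≤ 1 := by
    refine ContinuousLinearMap.opNorm_le_bound _ zero_le_one fun y => ?_
    have e : A y = ((2⁻¹ : ℝ) • y, 0) := by simp [hA]
    rw [e, Prod.norm_def, norm_smul]
    have := norm_nonneg y
    simp
    linarith
  have hAe : ∀ y, A y + ((2⁻¹ : ℝ) • x, ξ) = ((2⁻¹ : ℝ) • (x + y), ξ) := by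
    intro y
    simp [hA, smul_add, add_comm]
  have has : ContDiff ℝ ∞ (fun y => a (A y + ((2⁻¹ : ℝ) • x, ξ))) :=
    ha.1.comp (A.contDiff.add contDiff_const)
  have hφs : ContDiff ℝ ∞ φ := φ.smooth ⊤
  have key := hF (fun y => a (A y + ((2⁻¹ : ℝ) • x, ξ)) * φ y)
    (fun y => 2 ^ P * C * 2 ^ K * sn K φ * (wt x * wt ξ) ^ L * wt y ^ (-intExp E))
    (has.mul hφs) ((integrable_wt volume le_rfl).const_mul _) (fun k hk y => ?_) ξ
  · have e : weylInner a φ x ξ = Complex.exp (Complex.I * ((inner ℝ x ξ : ℝ) : ℂ)) *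
        ∫ y, a (A y + ((2⁻¹ : ℝ) • x, ξ)) * φ y *
          Complex.exp (-Complex.I * ((innerSL ℝ y ξ : ℝ) : ℂ)) := by
      rw [weylInner, ← integral_const_mul]
      congr 1
      ext y
      rw [hAe, inner_sub_left, Complex.ofReal_sub, mul_sub, sub_eq_add_neg, Complex.exp_add,
        innerSL_apply_apply]
      ring_nf
    rw [e, norm_mul, norm_cexp_I_mul, one_mul]
    refine key.trans ?_
    rw [integral_const_mul, Real.mul_rpow hx.le hξ.le]
    have h3 : wt ξ ^ L * wt ξ ^ (-(P : ℝ)) ≤ wt ξ ^ (-N) := by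
      rw [← wt_rpow_add]
      exact wt_rpow_le (by linarith)
    calc _ = C₁ * (2 ^ P * C * 2 ^ K * J) * sn K φ * wt x ^ L * (wt ξ ^ L * wt ξ ^ (-(P : ℝ))) := by
          ring
      _ ≤ _ := by gcongr
  · have hy := wt_pos y
    have hm := norm_iteratedFDeriv_mul_le_of_le has hφs (N := P) (x := y)
      (A := C * ((wt x * wt ξ) ^ L * wt y ^ L)) (B := 2 ^ K * sn K φ * wt y ^ (-(K : ℝ)))
      (fun k hk => ?_) (fun k hk => norm_iteratedFDeriv_le_sn le_rfl (hk.trans hPK) φ y) hk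
    · refine hm.trans ?_
      have h3 : wt y ^ L * wt y ^ (-(K : ℝ)) ≤ wt y ^ (-intExp E) := by
        rw [← wt_rpow_add]
        exact wt_rpow_le (by linarith [(Nat.cast_nonneg P : (0 : ℝ) ≤ P)])
      calc _ = 2 ^ P * C * 2 ^ K * sn K φ * (wt x * wt ξ) ^ L * (wt y ^ L * wt y ^ (-(K : ℝ))) := by
            ring
        _ ≤ _ := by gcongr
    · refine (norm_iteratedFDeriv_comp_affine_le ha.1 A hA1 _ k y).trans ?_
      refine (h k hk _).trans (mul_le_mul_of_nonneg_left ?_ hC)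
      rw [hAe, ← Real.mul_rpow (by positivity) hy.le]
      exact Real.rpow_le_rpow (wt_pos _).le (wt_half_add_le x y ξ) hL

/-- The Weyl quantization of `a`, up to a constant factor. -/
def weylI (a : E × E → ℂ) (φ : 𝓢(E, ℂ)) (x : E) : ℂ := ∫ ξ : E, weylInner a φ x ξ

theorem integrable_weylInner {L : ℝ} (hL : 0 ≤ L) {a : E × E → ℂ} (ha : PolySymb L a)
    (φ : 𝓢(E, ℂ)) (x : E) : Integrable (weylInner a φ x) := by
  obtain ⟨C, hC, K, h⟩ := norm_weylInner_le hL ha (intExp E)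
  refine ((integrable_wt volume le_rfl).const_mul _).mono' ?_ (Eventually.of_forall (h φ x))
  have h1 : Continuous fun ξ : E => ((x, ξ) : E × E) := by fun_prop
  exact ((continuous_weylInner hL ha φ).comp h1).aestronglyMeasurable

theorem continuous_weylI {L : ℝ} (hL : 0 ≤ L) {a : E × E → ℂ} (ha : PolySymb L a)
    (φ : 𝓢(E, ℂ)) : Continuous (weylI a φ) := by
  obtain ⟨C, hC, K, h⟩ := norm_weylInner_le hL ha (intExp E)
  have hc := continuous_weylInner hL ha φ
  refine continuous_integral_of_weighted (F := weylInner a φ) (w := fun x : E => wt x ^ L)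
    (b := fun y => C * sn K φ * wt y ^ (-intExp E)) (continuous_wt_rpow L)
    (fun x => wt_rpow_pos x L)
    ((integrable_wt volume le_rfl).const_mul _) (fun X => ?_) (fun ξ => ?_) (fun X y => ?_)
  · exact (integrable_weylInner hL ha φ X).aestronglyMeasurable
  · have h1 : Continuous fun x : E => ((x, ξ) : E × E) := by fun_prop
    exact (hc.comp h1 :)
  · refine (h φ X y).trans (le_of_eq ?_)
    ring

theorem norm_weylI_le {L : ℝ} (hL : 0 ≤ L) {a : E × E → ℂ} (ha : PolySymb L a) :
    ∃ C : ℝ, 0 ≤ C ∧ ∃ K : ℕ, ∀ (φ : 𝓢(E, ℂ)) (x : E),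
      ‖weylI a φ x‖ ≤ C * sn K φ * wt x ^ L := by
  obtain ⟨C, hC, K, h⟩ := norm_weylInner_le hL ha (intExp E)
  set J : ℝ := ∫ x : E, wt x ^ (-intExp E) with hJ
  have hJ0 : 0 ≤ J := integral_nonneg fun x => (wt_rpow_pos _ _).le
  refine ⟨C * J, by positivity, K, fun φ x => ?_⟩
  refine (norm_integral_le_of_norm_le ((integrable_wt volume le_rfl).const_mul _)
    (Eventually.of_forall (h φ x))).trans (le_of_eq ?_)
  rw [integral_const_mul]
  ring

theorem weylI_add {L : ℝ} (hL : 0 ≤ L) {a : E × E → ℂ} (ha : PolySymb L a)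
    (φ ψ : 𝓢(E, ℂ)) (x : E) : weylI a (φ + ψ) x = weylI a φ x + weylI a ψ x := by
  have h1 : ∀ ξ, weylInner a (φ + ψ) x ξ = weylInner a φ x ξ + weylInner a ψ x ξ := by
    intro ξ
    unfold weylInner
    rw [← integral_add (integrable_weylIntegrand hL ha φ x ξ)
      (integrable_weylIntegrand hL ha ψ x ξ)]
    simp only [_root_.add_apply, mul_add]
  unfold weylI
  simp only [h1]
  exact integral_add (integrable_weylInner hL ha φ x) (integrable_weylInner hL ha ψ x)

theorem weylI_smul (a : E × E → ℂ) (c : ℂ) (φ : 𝓢(E, ℂ)) (x : E) :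
    weylI a (c • φ) x = c * weylI a φ x := by
  unfold weylI
  rw [← integral_const_mul]
  congr 1
  ext ξ
  unfold weylInner
  rw [← integral_const_mul]
  congr 1
  ext y
  simp only [_root_.smul_apply, smul_eq_mul]
  ring

theorem integrable_schwartz_mul_weylI {L : ℝ} (hL : 0 ≤ L) {a : E × E → ℂ} (ha : PolySymb L a) :
    ∃ C : ℝ, 0 ≤ C ∧ ∃ K : ℕ, ∀ (ψ φ : 𝓢(E, ℂ)), Integrable (fun x => ψ x * weylI a φ x) ∧
      ‖∫ x, ψ x * weylI a φ x‖ ≤ C * sn K ψ * sn K φ := by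
  obtain ⟨C, hC, K, h⟩ := norm_weylI_le hL ha
  obtain ⟨P, hP⟩ := exists_nat_ge (L + intExp E)
  set J : ℝ := ∫ x : E, wt x ^ (-intExp E) with hJ
  have hJ0 : 0 ≤ J := integral_nonneg fun x => (wt_rpow_pos _ _).le
  refine ⟨2 ^ P * C * J, by positivity, max K P, fun ψ φ => ?_⟩
  have hb : ∀ x, ‖ψ x * weylI a φ x‖ ≤ 2 ^ P * C * sn P ψ * sn K φ * wt x ^ (-intExp E) := by
    intro x
    have hx := wt_pos x
    have h1 := norm_le_sn (le_refl P) ψ x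
    have hs1 := sn_nonneg P ψ
    have hs2 := sn_nonneg K φ
    rw [norm_mul]
    have h3 : wt x ^ (-(P : ℝ)) * wt x ^ L ≤ wt x ^ (-intExp E) := by
      rw [← wt_rpow_add]
      exact wt_rpow_le (by linarith)
    calc _ ≤ (2 ^ P * sn P ψ * wt x ^ (-(P : ℝ))) * (C * sn K φ * wt x ^ L) := by
          gcongr; exact h φ x
      _ = 2 ^ P * C * sn P ψ * sn K φ * (wt x ^ (-(P : ℝ)) * wt x ^ L) := by ring
      _ ≤ _ := by gcongr
  have hi := (integrable_wt (volume : Measure E) le_rfl).const_mul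
    (2 ^ P * C * sn P ψ * sn K φ)
  refine ⟨hi.mono' (ψ.continuous.mul (continuous_weylI hL ha φ)).aestronglyMeasurable
    (Eventually.of_forall hb), ?_⟩
  refine (norm_integral_le_of_norm_le hi (Eventually.of_forall hb)).trans ?_
  rw [integral_const_mul]
  have h1 := sn_mono (le_max_left K P) φ
  have h2 := sn_mono (le_max_right K P) ψ
  have hs1 := sn_nonneg P ψ
  have hs2 := sn_nonneg K φ
  have hs3 := sn_nonneg (max K P) ψ
  calc _ = 2 ^ P * C * J * sn P ψ * sn K φ := by ring
    _ ≤ _ := by gcongr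

end Weyl

/-! ### The phase space kernel of a Weyl operator -/

section Kernel

variable {E : Type*} [NormedAddCommGroup E] [InnerProductSpace ℝ E]

/-- The standard Gaussian on phase space. -/
def gaussP (v : E × E) : ℂ := Complex.exp ((-(‖v.1‖ ^ 2 + ‖v.2‖ ^ 2) : ℝ) : ℂ)

/-- The symplectic form. -/
def sympl (E : Type*) [NormedAddCommGroup E] [InnerProductSpace ℝ E] :
    (E × E) →L[ℝ] (E × E) →L[ℝ] ℝ :=
  (innerSL ℝ (E := E)).bilinearComp (ContinuousLinearMap.fst ℝ E E)
      (ContinuousLinearMap.snd ℝ E E) -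
    (innerSL ℝ (E := E)).bilinearComp (ContinuousLinearMap.snd ℝ E E)
      (ContinuousLinearMap.fst ℝ E E)

theorem sympl_apply (v w : E × E) : sympl E v w = inner ℝ v.1 w.2 - inner ℝ v.2 w.1 := rfl

/-- Nondegeneracy of the symplectic form, as required by `fourier_decay` on phase space. -/
theorem sympl_norming (w : E × E) : ∃ v : E × E, ‖v‖ ≤ 1 ∧ ‖w‖ ≤ |sympl E v w| := by
  rcases le_total ‖w.1‖ ‖w.2‖ with h | h
  · obtain ⟨v, hv, hw⟩ := inner_norming w.2
    refine ⟨(v, 0), by simpa [Prod.norm_def] using hv, ?_⟩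
    rw [sympl_apply, Prod.norm_def, max_eq_right h]
    simpa using hw
  · obtain ⟨v, hv, hw⟩ := inner_norming w.1
    refine ⟨(0, v), by simpa [Prod.norm_def] using hv, ?_⟩
    rw [sympl_apply, Prod.norm_def, max_eq_left h]
    simpa using hw

theorem gaussP_contDiff : ContDiff ℝ ∞ (gaussP : E × E → ℂ) := by
  unfold gaussP
  have h : ContDiff ℝ ∞ (fun v : E × E => -(‖v.1‖ ^ 2 + ‖v.2‖ ^ 2)) :=
    ((contDiff_fst.norm_sq ℝ).add (contDiff_snd.norm_sq ℝ)).neg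
  exact Complex.contDiff_exp.comp (Complex.ofRealCLM.contDiff.comp h)

theorem norm_iteratedFDeriv_gaussP_le (n : ℕ) (N : ℝ) : ∃ C : ℝ, ∀ v : E × E,
    ‖iteratedFDeriv ℝ n gaussP v‖ ≤ C * wt v ^ (-N) := by
  have hq : (fun v : E × E => ((-(‖v.1‖ ^ 2 + ‖v.2‖ ^ 2) : ℝ) : ℂ)).HasTemperateGrowth := by
    have h1 : (fun v : E × E => ‖v.1‖ ^ 2).HasTemperateGrowth :=
      (Function.hasTemperateGrowth_norm_sq (H := E)).comp
        (ContinuousLinearMap.fst ℝ E E).hasTemperateGrowth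
    have h2 : (fun v : E × E => ‖v.2‖ ^ 2).HasTemperateGrowth :=
      (Function.hasTemperateGrowth_norm_sq (H := E)).comp
        (ContinuousLinearMap.snd ℝ E E).hasTemperateGrowth
    exact Function.Complex.hasTemperateGrowth_ofReal.comp (h1.add h2).neg
  obtain ⟨C, M, hC, hM, h⟩ := norm_iteratedFDeriv_cexp_comp_le hq n
  obtain ⟨D, hD, hexp⟩ := exp_neg_sq_le (N + M)
  refine ⟨C * D, fun v => (h v).trans ?_⟩
  have hv := wt_pos v
  have h1 : ‖Complex.exp ((-(‖v.1‖ ^ 2 + ‖v.2‖ ^ 2) : ℝ) : ℂ)‖ ≤ D * wt v ^ (-(N + M)) := by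
    rw [← Complex.ofReal_exp, Complex.norm_real, Real.norm_of_nonneg (Real.exp_pos _).le]
    refine le_trans ?_ (hexp ‖v‖ (norm_nonneg _))
    refine Real.exp_le_exp.2 ?_
    have : ‖v‖ ^ 2 ≤ ‖v.1‖ ^ 2 + ‖v.2‖ ^ 2 := by
      rw [Prod.norm_def]
      rcases max_cases ‖v.1‖ ‖v.2‖ with ⟨h, -⟩ | ⟨h, -⟩ <;> rw [h] <;> nlinarith [sq_nonneg ‖v.1‖, sq_nonneg ‖v.2‖]
    nlinarith [sq_nonneg ‖v‖]
  calc _ ≤ C * (D * wt v ^ (-(N + M))) * wt v ^ M := by gcongr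
    _ = C * D * (wt v ^ (-(N + M)) * wt v ^ M) := by ring
    _ = _ := by rw [← wt_rpow_add]; congr 2; ring

/-- The midpoint of two points of phase space. -/
def mid (X Y : E × E) : E × E := (2⁻¹ : ℝ) • (X + Y)

theorem wt_sub_mid_le (W X Y : E × E) : wt (W - X) ≤ wt (W - mid X Y) * wt (X - Y) := by
  have e : W - X = (W - mid X Y) + (2⁻¹ : ℝ) • (Y - X) := by
    unfold mid
    module
  rw [e]
  refine (wt_add_le _ _).trans ?_
  refine mul_le_mul_of_nonneg_left ?_ (wt_pos _).le
  rw [wt_sub_comm X Y]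
  exact wt_smul_le (by rw [abs_of_pos] <;> norm_num) _

/-- The unimodular factor in the phase space kernel. -/
def kphase (X Y : E × E) : ℂ :=
  Complex.exp (-Complex.I * ((inner ℝ (mid X Y).2 (X.1 - Y.1) : ℝ) : ℂ))

theorem norm_kphase (X Y : E × E) : ‖kphase X Y‖ = 1 := by
  unfold kphase
  rw [neg_mul, ← mul_neg, ← Complex.ofReal_neg, norm_cexp_I_mul]

variable [FiniteDimensional ℝ E] [MeasurableSpace E] [BorelSpace E]

/-- The kernel of the Weyl operator with symbol `a` between coherent states, up to a constant. -/
def gint (a : E × E → ℂ) (X Y : E × E) : ℂ :=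
  kphase X Y * ∫ W : E × E, a W * gaussP (W - mid X Y) *
    Complex.exp (-Complex.I * ((sympl E W (X - Y) : ℝ) : ℂ))

/-- This is a Fourier integral on phase space at frequency X - Y: N derivatives give decay of order
N off the diagonal, and the Gaussian at the midpoint absorbs any polynomial growth of the symbol
away from it. The bound is linear in the size B of the symbol near the midpoint, which is what
permits localisation. -/
theorem norm_gint_le (N : ℕ) (L : ℝ) : ∃ C : ℝ, 0 ≤ C ∧ ∀ (b : E × E → ℂ) (X Y : E × E) (B : ℝ),
    ContDiff ℝ ∞ b → (∀ k ≤ N, ∀ W, ‖iteratedFDeriv ℝ k b W‖ ≤ B * wt (W - mid X Y) ^ L) →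
      ‖gint b X Y‖ ≤ C * B * wt (X - Y) ^ (-(N : ℝ)) := by
  obtain ⟨C₁, hC₁, hF⟩ := fourier_decay (volume : Measure (E × E)) (sympl E) sympl_norming N
  obtain ⟨C₂, hC₂, hG⟩ := exists_uniform_bound
    (f := fun n (v : E × E) => ‖iteratedFDeriv ℝ n gaussP v‖)
    (g := fun v => wt v ^ (-(L + intExp (E × E)))) (fun v => (wt_rpow_pos _ _).le)
    (fun n => norm_iteratedFDeriv_gaussP_le n _) N
  set J : ℝ := ∫ v : E × E, wt v ^ (-intExp (E × E)) with hJ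
  have hJ0 : 0 ≤ J := integral_nonneg fun x => (wt_rpow_pos _ _).le
  refine ⟨C₁ * (2 ^ N * C₂ * J), by positivity, fun b X Y B hb hB => ?_⟩
  set M := mid X Y
  have hgs : ContDiff ℝ ∞ (fun W : E × E => gaussP (W - M)) :=
    gaussP_contDiff.comp (contDiff_id.sub contDiff_const)
  have hi : Integrable (fun W : E × E => wt (W - M) ^ (-intExp (E × E))) :=
    (integrable_wt (volume : Measure (E × E)) le_rfl).comp_sub_right M
  have key := hF (fun W => b W * gaussP (W - M))
    (fun W => 2 ^ N * B * C₂ * wt (W - M) ^ (-intExp (E × E))) (hb.mul hgs)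
    (hi.const_mul _) (fun k hk W => ?_) (X - Y)
  · rw [gint, norm_mul, norm_kphase, one_mul]
    refine key.trans (le_of_eq ?_)
    rw [integral_const_mul, integral_sub_right_eq_self (fun v : E × E => wt v ^ (-intExp (E × E)))]
    ring
  · have hW := wt_pos (W - M)
    have hm := norm_iteratedFDeriv_mul_le_of_le hb hgs (N := N) (x := W)
      (A := B * wt (W - M) ^ L) (B := C₂ * wt (W - M) ^ (-(L + intExp (E × E))))
      (fun k hk => hB k hk W) (fun k hk => ?_) hk
    · refine hm.trans (le_of_eq ?_)
      calc _ = 2 ^ N * B * C₂ * (wt (W - M) ^ L * wt (W - M) ^ (-(L + intExp (E × E)))) := by ring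
        _ = _ := by rw [← wt_rpow_add]; congr 2; ring
    · rw [iteratedFDeriv_comp_sub]
      exact hG k hk (W - M)

theorem continuous_gaussP : Continuous (gaussP : E × E → ℂ) := gaussP_contDiff.continuous

theorem continuous_mid : Continuous fun p : (E × E) × (E × E) => mid p.1 p.2 := by
  unfold mid; fun_prop

/-- Bounds for the integrand of the phase space kernel. -/
theorem norm_gint_integrand_le {L : ℝ} (hL : 0 ≤ L) {a : E × E → ℂ} (ha : PolySymb L a) :
    ∃ C : ℝ, 0 ≤ C ∧ ∀ (X Y W : E × E), ‖a W * gaussP (W - mid X Y) *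
      Complex.exp (-Complex.I * ((sympl E W (X - Y) : ℝ) : ℂ))‖ ≤
      wt (mid X Y) ^ (L + (L + intExp (E × E))) * (C * wt W ^ (-intExp (E × E))) := by
  obtain ⟨C, hC, h⟩ := ha.bound 0
  obtain ⟨D, hD⟩ := norm_iteratedFDeriv_gaussP_le (E := E) 0 (L + intExp (E × E))
  have hI := intExp_pos (E × E)
  have hD0 : 0 ≤ D := by
    have := (norm_nonneg _).trans (hD 0)
    exact nonneg_of_mul_nonneg_left this (wt_rpow_pos _ _)
  refine ⟨C * D, by positivity, fun X Y W => ?_⟩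
  have hW := wt_pos W
  have hM := wt_pos (mid X Y)
  rw [norm_mul, norm_mul, neg_mul, ← mul_neg, ← Complex.ofReal_neg, norm_cexp_I_mul, mul_one]
  have h1 := h 0 le_rfl W
  have h2 := hD (W - mid X Y)
  rw [norm_iteratedFDeriv_zero] at h1 h2
  have h3 : wt (W - mid X Y) ^ (-(L + intExp (E × E))) ≤
      wt (mid X Y) ^ (L + intExp (E × E)) * wt W ^ (-(L + intExp (E × E))) := by
    have := wt_rpow_peetre (W - mid X Y) W (-(L + intExp (E × E)))
    rwa [sub_sub_cancel_left, wt_neg, abs_neg, abs_of_nonneg (add_nonneg hL hI.le)] at this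
  calc _ ≤ (C * wt W ^ L) * (D * (wt (mid X Y) ^ (L + intExp (E × E)) *
        wt W ^ (-(L + intExp (E × E))))) := by gcongr; exact h2.trans (by gcongr)
    _ = wt (mid X Y) ^ (L + intExp (E × E)) *
        (C * D * (wt W ^ L * wt W ^ (-(L + intExp (E × E))))) := by ring
    _ = wt (mid X Y) ^ (L + intExp (E × E)) * (C * D * wt W ^ (-intExp (E × E))) := by
        rw [← wt_rpow_add]; congr 3; ring
    _ ≤ _ := by
        refine mul_le_mul_of_nonneg_right (wt_rpow_le (by linarith)) (by positivity)

theorem continuous_gint_integrand {a : E × E → ℂ} (ha : Continuous a) :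
    Continuous fun p : ((E × E) × (E × E)) × (E × E) =>
      a p.2 * gaussP (p.2 - mid p.1.1 p.1.2) *
        Complex.exp (-Complex.I * ((sympl E p.2 (p.1.1 - p.1.2) : ℝ) : ℂ)) := by
  have h1 := continuous_gaussP (E := E)
  have h2 : Continuous fun p : ((E × E) × (E × E)) × (E × E) => mid p.1.1 p.1.2 := by
    unfold mid; fun_prop
  have h3 : Continuous fun p : ((E × E) × (E × E)) × (E × E) =>
      (sympl E p.2 (p.1.1 - p.1.2) : ℝ) := by
    simp only [sympl_apply]; fun_prop
  fun_prop

theorem integrable_gint_integrand {L : ℝ} (hL : 0 ≤ L) {a : E × E → ℂ} (ha : PolySymb L a)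
    (X Y : E × E) : Integrable fun W => a W * gaussP (W - mid X Y) *
      Complex.exp (-Complex.I * ((sympl E W (X - Y) : ℝ) : ℂ)) := by
  obtain ⟨C, hC, h⟩ := norm_gint_integrand_le hL ha
  refine (((integrable_wt volume le_rfl).const_mul _).const_mul _).mono' ?_
    (Eventually.of_forall (h X Y))
  have h1 : Continuous fun W : E × E => (((X, Y), W) : ((E × E) × (E × E)) × (E × E)) := by fun_prop
  exact ((continuous_gint_integrand ha.1.continuous).comp h1 :).aestronglyMeasurable

theorem continuous_gint {L : ℝ} (hL : 0 ≤ L) {a : E × E → ℂ} (ha : PolySymb L a) :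
    Continuous fun p : (E × E) × (E × E) => gint a p.1 p.2 := by
  obtain ⟨C, hC, h⟩ := norm_gint_integrand_le hL ha
  have hc := continuous_gint_integrand ha.1.continuous
  have h1 : Continuous fun p : (E × E) × (E × E) => kphase p.1 p.2 := by
    unfold kphase mid; fun_prop
  refine h1.mul ?_
  refine continuous_integral_of_weighted (F := fun (p : (E × E) × (E × E)) W =>
      a W * gaussP (W - mid p.1 p.2) *
        Complex.exp (-Complex.I * ((sympl E W (p.1 - p.2) : ℝ) : ℂ)))
    (w := fun p => wt (mid p.1 p.2) ^ (L + (L + intExp (E × E))))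
    (b := fun W => C * wt W ^ (-intExp (E × E)))
    (((continuous_wt_rpow (F := E × E) _).comp (continuous_mid (E := E)) :)) (fun p => wt_rpow_pos _ _)
    ((integrable_wt volume le_rfl).const_mul _)
    (fun p => (integrable_gint_integrand hL ha p.1 p.2).aestronglyMeasurable) (fun W => ?_)
    (fun p W => h p.1 p.2 W)
  have h1 : Continuous fun p : (E × E) × (E × E) => ((p, W) : ((E × E) × (E × E)) × (E × E)) := by
    fun_prop
  exact (hc.comp h1 :)

theorem gint_sub {L : ℝ} (hL : 0 ≤ L) {a b : E × E → ℂ} (ha : PolySymb L a) (hb : PolySymb L b)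
    (X Y : E × E) : gint (fun W => a W - b W) X Y = gint a X Y - gint b X Y := by
  unfold gint
  rw [← mul_sub, ← integral_sub (integrable_gint_integrand hL ha X Y)
    (integrable_gint_integrand hL hb X Y)]
  simp only [sub_mul]

theorem gint_const_mul (c : ℂ) (a : E × E → ℂ) (X Y : E × E) :
    gint (fun W => c * a W) X Y = c * gint a X Y := by
  unfold gint
  simp only [mul_assoc]
  rw [integral_const_mul]
  ring

/-- Transposition of a Weyl operator in terms of matrix elements. It matches the reflected symbol
occurring in the definition of the action on distributions. -/
theorem gint_flip (a : E × E → ℂ) (X Y : E × E) :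
    gint (fun W => a (flipP W)) (flipP Y) (flipP X) = gint a X Y := by
  unfold gint
  rw [← integral_flipP]
  have e0 : mid (flipP Y) (flipP X) = flipP (mid X Y) := by
    simp [mid, flipP, add_comm]
  congr 1
  · unfold kphase
    rw [e0]
    congr 3
    simp only [flipP, inner_neg_left, ← inner_neg_right, neg_sub]
  · congr 1
    ext W
    simp only [flipP_flipP, e0]
    congr 1
    · congr 1
      simp only [gaussP, flipP, Prod.fst_sub, Prod.snd_sub]
      rw [neg_sub_neg, norm_sub_rev (mid X Y).2]
    · congr 3
      simp only [sympl_apply, flipP, Prod.fst_sub, Prod.snd_sub, inner_neg_left]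
      rw [neg_sub_neg, ← inner_neg_right, neg_sub]

end Kernel

/-! ### Matrix elements of Weyl operators between coherent states -/

section Matrix

variable {E : Type*} [NormedAddCommGroup E] [InnerProductSpace ℝ E]

/-- The linear change of variables `(w, s) ↦ (w + s, w - s)`. -/
def sumDiff (E : Type*) [NormedAddCommGroup E] [InnerProductSpace ℝ E] :
    (E × E) ≃L[ℝ] (E × E) :=
  ContinuousLinearEquiv.equivOfInverse
    ((ContinuousLinearMap.fst ℝ E E + ContinuousLinearMap.snd ℝ E E).prod
      (ContinuousLinearMap.fst ℝ E E - ContinuousLinearMap.snd ℝ E E))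
    ((2⁻¹ : ℝ) • ((ContinuousLinearMap.fst ℝ E E + ContinuousLinearMap.snd ℝ E E).prod
      (ContinuousLinearMap.fst ℝ E E - ContinuousLinearMap.snd ℝ E E)))
    (fun p => by
      ext
      · simp only [ContinuousLinearMap.prod_apply, _root_.smul_apply, _root_.add_apply,
          _root_.sub_apply, ContinuousLinearMap.coe_fst', ContinuousLinearMap.coe_snd',
          Prod.smul_mk]
        module
      · simp only [ContinuousLinearMap.prod_apply, _root_.smul_apply, _root_.add_apply,
          _root_.sub_apply, ContinuousLinearMap.coe_fst', ContinuousLinearMap.coe_snd',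
          Prod.smul_mk]
        module)
    (fun p => by
      ext
      · simp only [ContinuousLinearMap.prod_apply, _root_.smul_apply, _root_.add_apply,
          _root_.sub_apply, ContinuousLinearMap.coe_fst', ContinuousLinearMap.coe_snd',
          Prod.smul_mk]
        module
      · simp only [ContinuousLinearMap.prod_apply, _root_.smul_apply, _root_.add_apply,
          _root_.sub_apply, ContinuousLinearMap.coe_fst', ContinuousLinearMap.coe_snd',
          Prod.smul_mk]
        module)

theorem sumDiff_apply (p : E × E) : sumDiff E p = (p.1 + p.2, p.1 - p.2) := rfl

variable [FiniteDimensional ℝ E] [MeasurableSpace E] [BorelSpace E]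

/-- The substitution x = w + s, y = w - s introduces the midpoint w, where the Weyl symbol is
evaluated. -/
theorem exists_integral_sumDiff : ∃ c : ℂ, ∀ F : E × E → ℂ, Integrable F →
    Integrable (fun p : E × E => F (p.1 + p.2, p.1 - p.2)) ∧
      ∫ p, F p = c * ∫ p : E × E, F (p.1 + p.2, p.1 - p.2) := by
  obtain ⟨c, hc0, hct, hmp⟩ := exists_measurePreserving_smul (sumDiff E) volume volume
  refine ⟨((c.toReal⁻¹ : ℝ) : ℂ), fun F hF => ?_⟩
  have hme : MeasurableEmbedding (sumDiff E) :=
    (sumDiff E).toHomeomorph.measurableEmbedding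
  have h1 : Integrable F (c • volume) := hF.smul_measure hct
  refine ⟨(hmp.integrable_comp_of_integrable h1 :), ?_⟩
  have h2 := hmp.integral_comp hme F
  have h3 : ∫ p : E × E, F (p.1 + p.2, p.1 - p.2) = c.toReal • ∫ p, F p := by
    rw [← integral_smul_measure]
    exact h2
  have h4 : c.toReal ≠ 0 := (ENNReal.toReal_pos hc0 hct).ne'
  rw [h3, Complex.real_smul, ← mul_assoc, ← Complex.ofReal_mul, inv_mul_cancel₀ h4]
  simp

theorem integral_gauss_modulated (d q : E) :
    ∫ s : E, Complex.exp (((-‖s - d‖ ^ 2 : ℝ) : ℂ) + 2 * Complex.I * ((inner ℝ s q : ℝ) : ℂ)) =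
      (Real.pi : ℂ) ^ (Module.finrank ℝ E / 2 : ℂ) *
        Complex.exp (((-‖q‖ ^ 2 : ℝ) : ℂ) + 2 * Complex.I * ((inner ℝ d q : ℝ) : ℂ)) := by
  have h := GaussianFourier.integral_cexp_neg_mul_sq_norm_add (V := E) (b := 1) (by simp)
    (2 * Complex.I) q
  rw [← integral_add_right_eq_self _ d]
  simp only [add_sub_cancel_right]
  have e : ∀ s : E, Complex.exp (((-‖s‖ ^ 2 : ℝ) : ℂ) +
      2 * Complex.I * ((inner ℝ (s + d) q : ℝ) : ℂ)) =
      Complex.exp (2 * Complex.I * ((inner ℝ d q : ℝ) : ℂ)) *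
        Complex.exp (-1 * (‖s‖ : ℂ) ^ 2 + 2 * Complex.I * ((inner ℝ q s : ℝ) : ℂ)) := by
    intro s
    rw [← Complex.exp_add, inner_add_left, real_inner_comm s q]
    congr 1
    push_cast
    ring
  simp only [e]
  rw [integral_const_mul, h, div_one, mul_left_comm, ← Complex.exp_add]
  congr 2
  rw [mul_pow, Complex.I_sq]
  push_cast
  ring

/-- This is the cross-Wigner function of two coherent states. The parallelogram law separates w from
s in the product of Gaussians; what remains in s is the Fourier transform of a Gaussian, and the
phases combine into the symplectic form. -/
theorem integral_coh_coh (X Y : E × E) (w ξ : E) :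
    ∫ s : E, coh X (w + s) * coh (flipP Y) (w - s) *
      Complex.exp (Complex.I * ((inner ℝ ((2 : ℝ) • s) ξ : ℝ) : ℂ)) =
    (Real.pi : ℂ) ^ (Module.finrank ℝ E / 2 : ℂ) * (kphase X Y * (gaussP ((w, ξ) - mid X Y) *
      Complex.exp (-Complex.I * ((sympl E (w, ξ) (X - Y) : ℝ) : ℂ)))) := by
  obtain ⟨x, p⟩ := X
  obtain ⟨y, q⟩ := Y
  set m : E := (2⁻¹ : ℝ) • (x + y) with hm
  set d : E := (2⁻¹ : ℝ) • (x - y) with hd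
  set k : E := (2⁻¹ : ℝ) • (p + q) with hk
  have hx : x = m + d := by rw [hm, hd]; module
  have hy : y = m - d := by rw [hm, hd]; module
  have h := integral_gauss_modulated d (ξ - k)
  have hpar : ∀ s : E, ‖w + s - x‖ ^ 2 + ‖w - s - y‖ ^ 2 = 2 * (‖w - m‖ ^ 2 + ‖s - d‖ ^ 2) := by
    intro s
    have := parallelogram_law_with_norm ℝ (w - m) (s - d)
    have e1 : w - m + (s - d) = w + s - x := by rw [hx]; abel
    have e2 : w - m - (s - d) = w - s - y := by rw [hy]; abel
    rw [e1, e2] at this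
    nlinarith
  have e : ∀ s : E, coh (x, p) (w + s) * coh (flipP (y, q)) (w - s) *
      Complex.exp (Complex.I * ((inner ℝ ((2 : ℝ) • s) ξ : ℝ) : ℂ)) =
      Complex.exp (((-‖w - m‖ ^ 2 : ℝ) : ℂ) - Complex.I * ((inner ℝ w (p - q) : ℝ) : ℂ)) *
      Complex.exp (((-‖s - d‖ ^ 2 : ℝ) : ℂ) + 2 * Complex.I * ((inner ℝ s (ξ - k) : ℝ) : ℂ)) := by
    intro s
    simp only [coh_apply, cohExp, flipP, ← Complex.exp_add]
    congr 1
    have e3 : ((-(1 / 2 : ℝ) * ‖w + s - x‖ ^ 2 : ℝ) : ℂ) + ((-(1 / 2 : ℝ) * ‖w - s - y‖ ^ 2 : ℝ) : ℂ)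
        = ((-‖w - m‖ ^ 2 : ℝ) : ℂ) + ((-‖s - d‖ ^ 2 : ℝ) : ℂ) := by
      rw [← Complex.ofReal_add, ← Complex.ofReal_add]
      congr 1
      linarith [hpar s]
    have e4 : inner ℝ (w + s) p + inner ℝ (w - s) (-q) - inner ℝ ((2 : ℝ) • s) ξ =
        inner ℝ w (p - q) - 2 * inner ℝ s (ξ - k) := by
      rw [hk]
      simp only [inner_add_left, inner_sub_left, inner_neg_right, inner_sub_right,
        real_inner_smul_left, real_inner_smul_right, inner_add_right]
      ring
    have e5 : ((inner ℝ (w + s) p : ℝ) : ℂ) + ((inner ℝ (w - s) (-q) : ℝ) : ℂ) -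
        ((inner ℝ ((2 : ℝ) • s) ξ : ℝ) : ℂ) =
        ((inner ℝ w (p - q) : ℝ) : ℂ) - 2 * ((inner ℝ s (ξ - k) : ℝ) : ℂ) := by
      exact_mod_cast congrArg (fun t : ℝ => (t : ℂ)) e4
    linear_combination e3 - Complex.I * e5
  simp only [e]
  rw [integral_const_mul, h, mul_left_comm]
  congr 1
  simp only [kphase, gaussP, ← Complex.exp_add, sympl_apply, mid, Prod.mk_add_mk, Prod.smul_mk,
    Prod.mk_sub_mk]
  rw [← hm, ← hk]
  congr 1
  have e6 : 2 * inner ℝ d (ξ - k) = - inner ℝ k (x - y) + inner ℝ ξ (x - y) := by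
    rw [hd]
    simp only [inner_sub_right, inner_sub_left, real_inner_smul_left]
    rw [real_inner_comm x ξ, real_inner_comm y ξ, real_inner_comm x k, real_inner_comm y k]
    ring
  have e7 : 2 * ((inner ℝ d (ξ - k) : ℝ) : ℂ) = - ((inner ℝ k (x - y) : ℝ) : ℂ) +
      ((inner ℝ ξ (x - y) : ℝ) : ℂ) := by
    exact_mod_cast congrArg (fun t : ℝ => (t : ℂ)) e6
  push_cast
  linear_combination Complex.I * e7

theorem norm_coh_le_wt (X : E × E) (N : ℝ) : ∃ C : ℝ, 0 ≤ C ∧ ∀ x, ‖coh X x‖ ≤ C * wt x ^ (-N) := by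
  obtain ⟨C, M, hC, hM, h⟩ := norm_iteratedFDeriv_coh_le (E := E) 0 N
  refine ⟨C * wt X ^ M, by have := wt_pos X; positivity, fun x => ?_⟩
  simpa using h X x

/-- After exchanging the integrals over x and ξ and passing to midpoint and half difference, the
integral over s is the cross-Wigner function of the two states, and the symbol is integrated against
it over phase space. -/
theorem integral_coh_mul_weylI : ∃ κ : ℂ, ∀ (L : ℝ) (_ : 0 ≤ L) (a : E × E → ℂ) (_ : PolySymb L a)
    (X Y : E × E), ∫ x, coh X x * weylI a (coh (flipP Y)) x = κ * gint a X Y := by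
  obtain ⟨c, hc⟩ := exists_integral_sumDiff (E := E)
  refine ⟨c * (Real.pi : ℂ) ^ (Module.finrank ℝ E / 2 : ℂ), fun L hL a ha X Y => ?_⟩
  obtain ⟨D, hD, hcohX⟩ := norm_coh_le_wt X (L + intExp E)
  have hJc := continuous_weylInner hL ha (coh (flipP Y))
  -- the order of integration in `x` and `ξ`
  have hswap : ∫ x, coh X x * weylI a (coh (flipP Y)) x =
      ∫ ξ, ∫ x, coh X x * weylInner a (coh (flipP Y)) x ξ := by
    have hint : Integrable (Function.uncurry fun x ξ => coh X x * weylInner a (coh (flipP Y)) x ξ)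
        ((volume : Measure E).prod volume) := by
      obtain ⟨C, hC, K, h⟩ := norm_weylInner_le hL ha (intExp E)
      have hb := ((integrable_wt (volume : Measure E) le_rfl).mul_prod
        (integrable_wt (volume : Measure E) le_rfl)).const_mul (D * (C * sn K (coh (flipP Y))))
      refine hb.mono' ?_ (Eventually.of_forall fun p => ?_)
      · have h1 : Continuous fun p : E × E => coh X p.1 := (coh X).continuous.comp continuous_fst
        exact (h1.mul hJc).aestronglyMeasurable
      · have hx := wt_pos p.1
        have hξ := wt_pos p.2
        simp only [Function.uncurry]
        rw [norm_mul]
        calc _ ≤ (D * wt p.1 ^ (-(L + intExp E))) *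
              (C * sn K (coh (flipP Y)) * wt p.1 ^ L * wt p.2 ^ (-intExp E)) := by
              gcongr
              · exact hcohX p.1
              · exact h _ p.1 p.2
          _ = D * (C * sn K (coh (flipP Y))) * ((wt p.1 ^ (-(L + intExp E)) * wt p.1 ^ L) *
              wt p.2 ^ (-intExp E)) := by ring
          _ = _ := by
              rw [← wt_rpow_add]
              congr 4
              ring
    rw [← integral_integral_swap hint]
    congr 1
    ext x
    rw [weylI, integral_const_mul]
  have hin : ∀ ξ, ∫ x, coh X x * weylInner a (coh (flipP Y)) x ξ =
      c * (Real.pi : ℂ) ^ (Module.finrank ℝ E / 2 : ℂ) * kphase X Y * ∫ w, a (w, ξ) *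
        gaussP ((w, ξ) - mid X Y) *
        Complex.exp (-Complex.I * ((sympl E (w, ξ) (X - Y) : ℝ) : ℂ)) := by
    intro ξ
    set F : E × E → ℂ := fun p => coh X p.1 *
      (Complex.exp (Complex.I * ((inner ℝ (p.1 - p.2) ξ : ℝ) : ℂ)) *
        a ((2⁻¹ : ℝ) • (p.1 + p.2), ξ) * coh (flipP Y) p.2) with hFdef
    have hF : Integrable F ((volume : Measure E).prod volume) := by
      obtain ⟨C, hC, K, h⟩ := norm_weylIntegrand_le hL ha
      have hb := ((integrable_wt (volume : Measure E) le_rfl).mul_prod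
        (integrable_wt (volume : Measure E) le_rfl)).const_mul
          (D * (C * sn K (coh (flipP Y)) * wt ξ ^ L))
      refine hb.mono' ?_ (Eventually.of_forall fun p => ?_)
      · have h1 : Continuous fun p : E × E => coh X p.1 := (coh X).continuous.comp continuous_fst
        have h2 : Continuous fun p : E × E => (((p.1, ξ), p.2) : (E × E) × E) := by fun_prop
        exact (h1.mul ((continuous_weylIntegrand ha.1.continuous (coh (flipP Y))).comp h2
          :)).aestronglyMeasurable
      · have hx := wt_pos p.1
        have hξ := wt_pos ξ
        have hy := wt_pos p.2
        have hs := sn_nonneg K (coh (flipP Y))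
        rw [hFdef, norm_mul]
        calc _ ≤ (D * wt p.1 ^ (-(L + intExp E))) *
              (C * sn K (coh (flipP Y)) * (wt p.1 * wt ξ) ^ L * wt p.2 ^ (-intExp E)) :=
              mul_le_mul (hcohX p.1) (h _ p.1 ξ p.2) (norm_nonneg _) (by positivity)
          _ = D * (C * sn K (coh (flipP Y)) * wt ξ ^ L) *
              ((wt p.1 ^ (-(L + intExp E)) * wt p.1 ^ L) * wt p.2 ^ (-intExp E)) := by
              rw [Real.mul_rpow hx.le hξ.le]
              ring
          _ = _ := by
              rw [← wt_rpow_add]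
              congr 4
              ring
    have h1 : ∫ x, coh X x * weylInner a (coh (flipP Y)) x ξ = ∫ p, F p := by
      rw [Measure.volume_eq_prod, integral_prod _ hF]
      congr 1
      ext x
      rw [weylInner, ← integral_const_mul]
    obtain ⟨h2, h3⟩ := hc F hF
    have h6 : ∀ w, ∫ s, F (w + s, w - s) = (Real.pi : ℂ) ^ (Module.finrank ℝ E / 2 : ℂ) *
        kphase X Y * (a (w, ξ) * gaussP ((w, ξ) - mid X Y) *
        Complex.exp (-Complex.I * ((sympl E (w, ξ) (X - Y) : ℝ) : ℂ))) := by
      intro w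
      have h4 := integral_coh_coh X Y w ξ
      have h5 : ∫ s, F (w + s, w - s) = a (w, ξ) * ∫ s : E, coh X (w + s) * coh (flipP Y) (w - s) *
          Complex.exp (Complex.I * ((inner ℝ ((2 : ℝ) • s) ξ : ℝ) : ℂ)) := by
        rw [← integral_const_mul]
        congr 1
        ext s
        have e1 : w + s - (w - s) = (2 : ℝ) • s := by module
        have e2 : (2⁻¹ : ℝ) • (w + s + (w - s)) = w := by module
        simp only [hFdef, e1, e2]
        ring
      rw [h5, h4]
      ring
    rw [h1, h3, Measure.volume_eq_prod, integral_prod _ h2]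
    simp only [h6]
    rw [integral_const_mul]
    ring
  rw [hswap]
  simp only [hin]
  have hW := integrable_gint_integrand hL ha X Y
  rw [integral_const_mul, gint, Measure.volume_eq_prod, integral_prod_symm _ hW]
  ring

end Matrix

/-! ### Weyl operators on Schwartz functions and tempered distributions -/

section WeylAction

variable {E : Type*} [NormedAddCommGroup E] [InnerProductSpace ℝ E]
  [FiniteDimensional ℝ E] [MeasurableSpace E] [BorelSpace E]

theorem norm_gint_poly_le {L : ℝ} (hL : 0 ≤ L) {a : E × E → ℂ} (ha : PolySymb L a) (N : ℝ) :
    ∃ C : ℝ, 0 ≤ C ∧ ∀ X Y : E × E, ‖gint a X Y‖ ≤ C * wt X ^ L * wt (X - Y) ^ (-N) := by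
  obtain ⟨P, hP⟩ := exists_nat_ge (L + N)
  obtain ⟨C, hC, h⟩ := norm_gint_le (E := E) P L
  obtain ⟨D, hD, ha'⟩ := ha.bound P
  refine ⟨C * D, by positivity, fun X Y => ?_⟩
  have hX := wt_pos X
  have hXY := wt_pos (X - Y)
  refine (h a X Y (D * (wt X ^ L * wt (X - Y) ^ L)) ha.1 (fun k hk W => ?_)).trans ?_
  · refine (ha' k hk W).trans ?_
    have h1 : wt W ≤ wt X * wt (X - Y) * wt (W - mid X Y) := by
      calc wt W ≤ wt (W - X) * wt X := wt_le_sub_mul W X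
        _ ≤ (wt (W - mid X Y) * wt (X - Y)) * wt X := by gcongr; exact wt_sub_mid_le W X Y
        _ = _ := by ring
    have h2 := Real.rpow_le_rpow (wt_pos W).le h1 hL
    rw [Real.mul_rpow (by positivity) (wt_pos _).le, Real.mul_rpow hX.le hXY.le] at h2
    rw [mul_assoc]
    gcongr
  · have h3 : wt (X - Y) ^ L * wt (X - Y) ^ (-(P : ℝ)) ≤ wt (X - Y) ^ (-N) := by
      rw [← wt_rpow_add]
      exact wt_rpow_le (by linarith)
    calc _ = C * D * wt X ^ L * (wt (X - Y) ^ L * wt (X - Y) ^ (-(P : ℝ))) := by ring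
      _ ≤ _ := by gcongr

/-- The functional `φ ↦ ∫ ψ · Op(a) φ`. -/
theorem exists_weyl_functional {L : ℝ} (hL : 0 ≤ L) {a : E × E → ℂ} (ha : PolySymb L a)
    (ψ : 𝓢(E, ℂ)) : ∃ u : 𝓢'(E, ℂ), ∀ φ, u φ = ∫ x, ψ x * weylI a φ x := by
  obtain ⟨C, hC, K, h⟩ := integrable_schwartz_mul_weylI hL ha
  let A : 𝓢(E, ℂ) →ₗ[ℂ] ℂ :=
    { toFun := fun φ => ∫ x, ψ x * weylI a φ x
      map_add' := fun φ χ => by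
        rw [← integral_add (h ψ φ).1 (h ψ χ).1]
        simp only [weylI_add hL ha, mul_add]
      map_smul' := fun c φ => by
        simp only [weylI_smul, RingHom.id_apply, smul_eq_mul]
        rw [← integral_const_mul]
        congr 1
        ext x
        ring }
  exact ⟨mkDist A ⟨K, C * sn K ψ, mul_nonneg hC (sn_nonneg _ _), fun φ => (h ψ φ).2⟩, fun φ => rfl⟩

/-- The functional `ψ ↦ ∫ ψ · Op(a) φ`. -/
theorem exists_weyl_dist {L : ℝ} (hL : 0 ≤ L) {a : E × E → ℂ} (ha : PolySymb L a)
    (φ : 𝓢(E, ℂ)) : ∃ u : 𝓢'(E, ℂ), ∀ ψ, u ψ = ∫ x, ψ x * weylI a φ x := by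
  obtain ⟨C, hC, K, h⟩ := integrable_schwartz_mul_weylI hL ha
  let A : 𝓢(E, ℂ) →ₗ[ℂ] ℂ :=
    { toFun := fun ψ => ∫ x, ψ x * weylI a φ x
      map_add' := fun ψ χ => by
        rw [← integral_add (h ψ φ).1 (h χ φ).1]
        simp only [_root_.add_apply, add_mul]
      map_smul' := fun c ψ => by
        simp only [_root_.smul_apply, RingHom.id_apply, smul_eq_mul]
        rw [← integral_const_mul]
        congr 1
        ext x
        ring }
  refine ⟨mkDist A ⟨K, C * sn K φ, mul_nonneg hC (sn_nonneg _ _), fun ψ => ?_⟩, fun ψ => rfl⟩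
  refine (h ψ φ).2.trans (le_of_eq ?_)
  ring

theorem exists_kap (E : Type*) [NormedAddCommGroup E] [InnerProductSpace ℝ E]
    [FiniteDimensional ℝ E] [MeasurableSpace E] [BorelSpace E] :
    ∃ κ : ℂ, ∀ (L : ℝ) (_ : 0 ≤ L) (a : E × E → ℂ) (_ : PolySymb L a)
    (X Y : E × E), ∫ x, coh X x * weylI a (coh (flipP Y)) x = κ * gint a X Y :=
  integral_coh_mul_weylI

/-- The constant relating matrix elements of Weyl operators to the phase space kernel. -/
def kap (E : Type*) [NormedAddCommGroup E] [InnerProductSpace ℝ E]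
    [FiniteDimensional ℝ E] [MeasurableSpace E] [BorelSpace E] : ℂ := (exists_kap E).choose

theorem integral_coh_weyl {L : ℝ} (hL : 0 ≤ L) {a : E × E → ℂ} (ha : PolySymb L a)
    (X Y : E × E) : ∫ x, coh X x * weylI a (coh (flipP Y)) x = kap E * gint a X Y :=
  (exists_kap E).choose_spec L hL a ha X Y

/-- Expanding φ in coherent states reduces the claim to matrix elements, which concentrate near the
diagonal, while the coefficients of φ decay rapidly. -/
theorem weyl_decay {L : ℝ} (hL : 0 ≤ L) {a : E × E → ℂ} (ha : PolySymb L a) (N : ℝ) :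
    ∃ C : ℝ, 0 ≤ C ∧ ∃ K : ℕ, ∀ (φ : 𝓢(E, ℂ)) (X : E × E),
      ‖∫ x, coh X x * weylI a φ x‖ ≤ C * sn K φ * wt X ^ (-N) := by
  -- L powers pay for the growth of the symbol at X and |N| give the decay; Peetre's inequality
  -- charges the power P to the transform of φ.
  set P : ℝ := |N| + L
  have hP : 0 ≤ P := by positivity
  obtain ⟨C₁, hC₁, hG⟩ := norm_gint_poly_le hL ha P
  obtain ⟨K, C₂, hC₂, hS⟩ := stft_decay_rpow (E := E) (P + intExp (E × E))
  set J : ℝ := ∫ v : E × E, wt v ^ (-intExp (E × E)) with hJ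
  have hJ0 : 0 ≤ J := integral_nonneg fun x => (wt_rpow_pos _ _).le
  refine ⟨cInv E * (C₂ * (‖kap E‖ * C₁) * J), ?_, K, fun φ X => ?_⟩
  · have := cInv_pos (E := E)
    positivity
  have hX := wt_pos X
  have hsn := sn_nonneg K φ
  obtain ⟨u, hu⟩ := exists_weyl_functional hL ha (coh X)
  rw [← hu φ, dist_inversion u φ, norm_mul, Complex.norm_real, Real.norm_of_nonneg cInv_pos.le]
  have hb : ‖∫ Z : E × E, stft φ (flipP Z) * u (coh Z)‖ ≤
      ∫ Z : E × E, (C₂ * sn K φ * (‖kap E‖ * C₁) * wt X ^ (-N)) * wt Z ^ (-intExp (E × E)) := by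
    refine norm_integral_le_of_norm_le ((integrable_wt volume le_rfl).const_mul _)
      (Eventually.of_forall fun Z => ?_)
    have hZ := wt_pos Z
    have e : u (coh Z) = kap E * gint a X (flipP Z) := by
      rw [hu, ← integral_coh_weyl hL ha, flipP_flipP]
    rw [norm_mul, e, norm_mul]
    have h1 := hS φ (flipP Z)
    rw [wt_flipP] at h1
    have h2 := hG X (flipP Z)
    have h3 : wt (X - flipP Z) ^ (-P) ≤ wt Z ^ P * wt X ^ (-P) := by
      have := wt_rpow_peetre (X - flipP Z) X (-P)
      rwa [sub_sub_cancel_left, wt_neg, abs_neg, abs_of_nonneg hP, wt_flipP] at this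
    have h4 : wt X ^ L * wt X ^ (-P) ≤ wt X ^ (-N) := by
      rw [← wt_rpow_add]
      refine wt_rpow_le ?_
      have := le_abs_self N
      simp only [P]
      linarith
    have h5 : wt Z ^ (-(P + intExp (E × E))) * wt Z ^ P = wt Z ^ (-intExp (E × E)) := by
      rw [← wt_rpow_add]
      congr 1
      ring
    calc _ ≤ (C₂ * sn K φ * wt Z ^ (-(P + intExp (E × E)))) *
          (‖kap E‖ * (C₁ * wt X ^ L * (wt Z ^ P * wt X ^ (-P)))) := by
          gcongr
          refine h2.trans ?_
          gcongr
      _ = C₂ * sn K φ * (‖kap E‖ * C₁) * (wt X ^ L * wt X ^ (-P)) *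
          (wt Z ^ (-(P + intExp (E × E))) * wt Z ^ P) := by ring
      _ ≤ _ := by
          rw [h5]
          gcongr
  rw [integral_const_mul] at hb
  have := cInv_pos (E := E)
  calc _ ≤ cInv E * ((C₂ * sn K φ * (‖kap E‖ * C₁) * wt X ^ (-N)) * J) := by gcongr
    _ = _ := by ring

theorem eq_of_integral_schwartz_mul_eq {f g : E → ℂ} (hf : Continuous f) (hg : Continuous g)
    (h : ∀ χ : 𝓢(E, ℂ), ∫ x, χ x * f x = ∫ x, χ x * g x) : f = g := by
  have hae : f =ᵐ[volume] g := by
    refine ae_eq_of_integral_contDiff_smul_eq hf.locallyIntegrable hg.locallyIntegrable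
      fun χ hχ hc => ?_
    have h1 : HasCompactSupport (fun x => ((χ x : ℝ) : ℂ)) :=
      hc.comp_left (g := fun t : ℝ => (t : ℂ)) Complex.ofReal_zero
    have h2 : ContDiff ℝ ∞ (fun x => ((χ x : ℝ) : ℂ)) := Complex.ofRealCLM.contDiff.comp hχ
    have := h (h1.toSchwartzMap h2)
    simpa [Complex.real_smul] using this
  exact (Continuous.ae_eq_iff_eq volume hf hg).1 hae

/-- The Weyl integral defines a distribution whose transform decays rapidly, hence a Schwartz
function, and two continuous functions with the same integrals against test functions coincide. The
oscillatory integral is thus never differentiated. -/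
theorem exists_weylS {L : ℝ} (hL : 0 ≤ L) {a : E × E → ℂ} (ha : PolySymb L a) :
    ∃ S : 𝓢(E, ℂ) →ₗ[ℂ] 𝓢(E, ℂ), (∀ φ x, S φ x = weylI a φ x) ∧
      ∀ N, ∃ (K : ℕ) (C : ℝ), 0 ≤ C ∧ ∀ φ, sn N (S φ) ≤ C * sn K φ := by
  have hex : ∀ φ : 𝓢(E, ℂ), ∃ ψ : 𝓢(E, ℂ), ∀ x, ψ x = weylI a φ x := by
    intro φ
    obtain ⟨u, hu⟩ := exists_weyl_dist hL ha φ
    obtain ⟨ψ, hψ, -⟩ := exists_sdist_of_decay u (fun N => by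
      obtain ⟨C, hC, K, h⟩ := weyl_decay hL ha N
      exact ⟨C * sn K φ, fun X => by rw [hu]; exact h φ X⟩)
    refine ⟨ψ, fun x => ?_⟩
    refine congrFun (eq_of_integral_schwartz_mul_eq ψ.continuous (continuous_weylI hL ha φ)
      fun χ => ?_) x
    rw [← hu χ, hψ, sdist_apply]
    simp only [mul_comm]
  choose S hS using hex
  refine ⟨⟨⟨S, fun φ ψ => ?_⟩, fun c φ => ?_⟩, hS, fun N => ?_⟩
  · ext x
    rw [_root_.add_apply, hS, hS, hS, weylI_add hL ha]
  · ext x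
    rw [RingHom.id_apply, _root_.smul_apply, hS, hS, weylI_smul, smul_eq_mul]
  · obtain ⟨C, M, hC, h⟩ := sn_le_of_stft (E := E) N
    obtain ⟨D, hD, K, hd⟩ := weyl_decay hL ha M
    refine ⟨K, C * D, by positivity, fun φ => ?_⟩
    have := h (S φ) (D * sn K φ) (fun X => by
      have e : stft (S φ) X = ∫ x, coh X x * weylI a φ x := by
        unfold stft
        congr 1
        ext x
        rw [hS, mul_comm]
      rw [e]
      exact hd φ X)
    rw [mul_assoc]
    exact this

theorem PolySymb.comp_flipP {L : ℝ} {a : E × E → ℂ} (ha : PolySymb L a) :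
    PolySymb L (fun X => a (flipP X)) := by
  set A : E × E →L[ℝ] E × E := (ContinuousLinearMap.fst ℝ E E).prod (-ContinuousLinearMap.snd ℝ E E)
  have hA : ‖A‖ ≤ 1 := by
    refine ContinuousLinearMap.opNorm_le_bound _ zero_le_one fun X => ?_
    simp [A, Prod.norm_def]
  have e : ∀ X, A X + 0 = flipP X := fun X => by simp [A, flipP]
  refine ⟨?_, fun k => ?_⟩
  · have := ha.1.comp A.contDiff
    exact this
  · obtain ⟨C, hC⟩ := ha.2 k
    refine ⟨C, fun X => ?_⟩
    have h := norm_iteratedFDeriv_comp_affine_le ha.1 A hA 0 k X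
    simp only [e] at h
    refine h.trans ((hC _).trans (le_of_eq ?_))
    rw [wt_flipP]

theorem polySymb_const (c : ℂ) : PolySymb 0 (fun _ : E × E => c) := by
  refine ⟨contDiff_const, fun k => ⟨‖c‖, fun X => ?_⟩⟩
  rw [Real.rpow_zero, mul_one]
  rcases Nat.eq_zero_or_pos k with rfl | hk
  · simp
  · rw [iteratedFDeriv_const_of_ne (by omega)]
    simp

end WeylAction

/-! ### Weyl operators as integral operators on phase space -/

section Eucl

variable {ι : Type*} [Fintype ι]

theorem weylIntegral_eq (a : Phase ι → ℂ) (φ : 𝓢(Eucl ι, ℂ)) (x : Eucl ι) :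
    weylIntegral a φ x = (((2 * Real.pi) ^ Fintype.card ι : ℝ) : ℂ)⁻¹ * weylI a φ x := rfl

/-- The kernel of a Weyl operator acting on short-time Fourier transforms. -/
def gker (a : Phase ι → ℂ) (X Y : Phase ι) : ℂ :=
  (((cInv (Eucl ι) : ℝ) : ℂ) * ((((2 * Real.pi) ^ Fintype.card ι : ℝ) : ℂ)⁻¹ * kap (Eucl ι))) *
    gint a X Y

theorem cInv_mul_stft_weyl {L : ℝ} (hL : 0 ≤ L) {a : Phase ι → ℂ} (ha : PolySymb L a)
    {g : 𝓢(Eucl ι, ℂ)} {X : Phase ι}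
    (hg : ∀ x, g x = weylIntegral (fun X => a (X.1, -X.2)) (coh X) x) (Y : Phase ι) :
    ((cInv (Eucl ι) : ℝ) : ℂ) * stft g (flipP Y) = gker a X Y := by
  have e : stft g (flipP Y) = (((2 * Real.pi) ^ Fintype.card ι : ℝ) : ℂ)⁻¹ *
      (kap (Eucl ι) * gint a X Y) := by
    rw [← gint_flip, ← integral_coh_weyl hL ha.comp_flipP, flipP_flipP, ← integral_const_mul]
    unfold stft
    congr 1
    ext x
    rw [hg, weylIntegral_eq]
    change _ * weylI (fun X => a (flipP X)) _ _ * _ = _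
    ring
  rw [e, gker]
  ring

/-- By duality v tested on a coherent state is u tested on the transposed operator applied to that
state. Inverting this Schwartz function's transform leaves matrix elements as coefficients. -/
theorem IsWeylImage.eq_integral {L : ℝ} (hL : 0 ≤ L) {a : Phase ι → ℂ} (ha : PolySymb L a)
    {u v : 𝓢'(Eucl ι, ℂ)} (h : IsWeylImage a u v) (X : Phase ι) :
    v (coh X) = ∫ Y, gker a X Y * u (coh Y) := by
  obtain ⟨g, hg, hv⟩ := h (coh X)
  rw [hv, dist_inversion u g, ← integral_const_mul]
  congr 1
  ext Y
  rw [← cInv_mul_stft_weyl hL ha hg]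
  ring

theorem exists_weylImage {L : ℝ} (hL : 0 ≤ L) {a : Phase ι → ℂ} (ha : PolySymb L a)
    (u : 𝓢'(Eucl ι, ℂ)) : ∃ v, IsWeylImage a u v := by
  obtain ⟨S, hS, hb⟩ := exists_weylS hL ha.comp_flipP
  set c : ℂ := (((2 * Real.pi) ^ Fintype.card ι : ℝ) : ℂ)⁻¹
  obtain ⟨N, C, hC, hu⟩ := exists_sn_bound u
  obtain ⟨K, D, hD, hSn⟩ := hb N
  let A : 𝓢(Eucl ι, ℂ) →ₗ[ℂ] ℂ := c • ((u : 𝓢(Eucl ι, ℂ) →L[ℂ] ℂ).toLinearMap ∘ₗ S)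
  have hA : ∀ φ, A φ = u (c • S φ) := fun φ => by
    have : u (c • S φ) = c * u (S φ) := by
      rw [map_smul, smul_eq_mul]
    rw [this]
    rfl
  refine ⟨mkDist A ⟨K, ‖c‖ * (C * D), by positivity, fun φ => ?_⟩, fun φ => ⟨c • S φ, fun x => ?_, ?_⟩⟩
  · have : A φ = c * u (S φ) := rfl
    rw [this, norm_mul, mul_assoc]
    gcongr
    calc _ ≤ C * sn N (S φ) := hu _
      _ ≤ C * (D * sn K φ) := by gcongr; exact hSn φ
      _ = _ := by ring
  · rw [_root_.smul_apply, hS, smul_eq_mul, weylIntegral_eq]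
    rfl
  · rw [mkDist_apply, hA]

/-- Fourier inversion, after the change of ξ to -ξ that matches the signs of the exponentials. -/
theorem isWeylImage_one (u : 𝓢'(Eucl ι, ℂ)) : IsWeylImage (fun _ => (1 : ℂ)) u u := by
  refine fun φ => ⟨φ, fun x => ?_, rfl⟩
  rw [weylIntegral_eq, weylI, ← integral_neg_eq_self]
  have h := fourier_inversion φ x
  rw [finrank_euclideanSpace] at h
  have e : ∀ ξ : Eucl ι, weylInner (fun _ => (1 : ℂ)) φ x (-ξ) =
      Complex.exp (-Complex.I * ((inner ℝ x ξ : ℝ) : ℂ)) *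
      ∫ y : Eucl ι, φ y * Complex.exp (Complex.I * ((inner ℝ y ξ : ℝ) : ℂ)) := by
    intro ξ
    rw [weylInner, ← integral_const_mul]
    congr 1
    ext y
    rw [mul_one, mul_left_comm, ← Complex.exp_add, mul_comm]
    congr 2
    rw [inner_neg_right, inner_sub_left]
    push_cast
    ring
  simp only [e]
  rw [h, ← mul_assoc, inv_mul_cancel₀, one_mul]
  have : (0 : ℝ) < (2 * Real.pi) ^ Fintype.card ι := by positivity
  exact_mod_cast this.ne'

/-- The kernel of the identity reproduces short-time Fourier transforms; it is the leading part with
which kernels of general symbols are compared. -/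
theorem dist_reproducing (u : 𝓢'(Eucl ι, ℂ)) (X : Phase ι) :
    u (coh X) = ∫ Y, gker (fun _ => 1) X Y * u (coh Y) :=
  (isWeylImage_one u).eq_integral le_rfl (polySymb_const 1) X

end Eucl

/-! ### Symbols and kernel estimates -/

/-- Symbols of order `m` with values in a normed space. -/
def Symb {V G : Type*} [NormedAddCommGroup V] [NormedSpace ℝ V] [NormedAddCommGroup G]
    [NormedSpace ℝ G] (m : ℝ) (a : V → G) : Prop :=
  ContDiff ℝ ∞ a ∧ ∀ k : ℕ, ∃ C : ℝ, ∀ X, ‖iteratedFDeriv ℝ k a X‖ ≤ C * wt X ^ (m - k)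

section Symb

variable {V G : Type*} [NormedAddCommGroup V] [NormedSpace ℝ V] [NormedAddCommGroup G]
  [NormedSpace ℝ G]

theorem Symb.bound {m : ℝ} {a : V → G} (ha : Symb m a) (N : ℕ) :
    ∃ C : ℝ, 0 ≤ C ∧ ∀ k ≤ N, ∀ X, ‖iteratedFDeriv ℝ k a X‖ ≤ C * wt X ^ (m - k) := by
  choose C hC using ha.2
  refine ⟨∑ k ∈ Finset.range (N + 1), |C k|, Finset.sum_nonneg fun _ _ => abs_nonneg _,
    fun k hk X => (hC k X).trans ?_⟩
  refine mul_le_mul_of_nonneg_right ((le_abs_self _).trans ?_) (wt_rpow_pos _ _).le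
  exact Finset.single_le_sum (f := fun k => |C k|) (fun _ _ => abs_nonneg _)
    (Finset.mem_range.2 (Nat.lt_succ_of_le hk))

theorem Symb.polySymb {m : ℝ} {a : V → ℂ} (ha : Symb m a) : PolySymb |m| a := by
  refine ⟨ha.1, fun k => ?_⟩
  obtain ⟨C, hC, h⟩ := ha.bound k
  refine ⟨C, fun X => (h k le_rfl X).trans (mul_le_mul_of_nonneg_left (wt_rpow_le ?_) hC)⟩
  linarith [le_abs_self m, (Nat.cast_nonneg k : (0 : ℝ) ≤ k)]

end Symb

/-! ### Off-diagonal decay of the kernel and freezing of the symbol -/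

section KernelBounds

variable {ι : Type*} [Fintype ι]

theorem continuous_gker {L : ℝ} (hL : 0 ≤ L) {a : Phase ι → ℂ} (ha : PolySymb L a) :
    Continuous fun p : Phase ι × Phase ι => gker a p.1 p.2 :=
  continuous_const.mul (continuous_gint hL ha)

/-- Bounds around X are easier to verify than bounds around the midpoint; the passage costs P powers
of the distance from X to Y, paid by extra off-diagonal decay. -/
theorem norm_gker_le_of_center (N : ℝ) {P : ℝ} (hP : 0 ≤ P) : ∃ (n : ℕ) (C : ℝ), 0 ≤ C ∧
    ∀ (b : Phase ι → ℂ) (X Y : Phase ι) (B : ℝ), 0 ≤ B → ContDiff ℝ ∞ b →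
      (∀ k ≤ n, ∀ W, ‖iteratedFDeriv ℝ k b W‖ ≤ B * wt (W - X) ^ P) →
      ‖gker b X Y‖ ≤ C * B * wt (X - Y) ^ (-N) := by
  obtain ⟨n, hn⟩ := exists_nat_ge (P + N)
  obtain ⟨C, hC, h⟩ := norm_gint_le (E := Eucl ι) n P
  set c : ℂ := (((cInv (Eucl ι) : ℝ) : ℂ) *
    ((((2 * Real.pi) ^ Fintype.card ι : ℝ) : ℂ)⁻¹ * kap (Eucl ι))) with hc
  refine ⟨n, ‖c‖ * C, by positivity, fun b X Y B hB hb hbd => ?_⟩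
  have hXY := wt_pos (X - Y)
  have h1 := h b X Y (B * wt (X - Y) ^ P) hb (fun k hk W => by
    refine (hbd k hk W).trans ?_
    rw [mul_assoc, ← Real.mul_rpow hXY.le (wt_pos _).le]
    refine mul_le_mul_of_nonneg_left (Real.rpow_le_rpow (wt_pos _).le ?_ hP) hB
    rw [mul_comm]
    exact wt_sub_mid_le W X Y)
  rw [gker, norm_mul, ← hc]
  have h3 : wt (X - Y) ^ P * wt (X - Y) ^ (-(n : ℝ)) ≤ wt (X - Y) ^ (-N) := by
    rw [← wt_rpow_add]
    exact wt_rpow_le (by linarith)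
  calc _ ≤ ‖c‖ * (C * (B * wt (X - Y) ^ P) * wt (X - Y) ^ (-(n : ℝ))) := by gcongr
    _ = ‖c‖ * C * B * (wt (X - Y) ^ P * wt (X - Y) ^ (-(n : ℝ))) := by ring
    _ ≤ _ := by gcongr

theorem norm_gker_le {m : ℝ} {a : Phase ι → ℂ} (ha : Symb m a) (N : ℝ) :
    ∃ C : ℝ, 0 ≤ C ∧ ∀ X Y, ‖gker a X Y‖ ≤ C * wt X ^ m * wt (X - Y) ^ (-N) := by
  obtain ⟨n, C, hC, h⟩ := norm_gker_le_of_center (ι := ι) N (abs_nonneg m)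
  obtain ⟨D, hD, hd⟩ := ha.bound n
  refine ⟨C * D, by positivity, fun X Y => ?_⟩
  have := h a X Y (D * wt X ^ m) (by have := wt_pos X; positivity) ha.1 (fun k hk W => by
    refine (hd k hk W).trans ?_
    rw [mul_assoc]
    refine mul_le_mul_of_nonneg_left ?_ hD
    calc wt W ^ (m - k) ≤ wt W ^ m := wt_rpow_le (by simp)
      _ ≤ wt (W - X) ^ |m| * wt X ^ m := wt_rpow_peetre W X m
      _ = _ := mul_comm _ _)
  refine this.trans (le_of_eq ?_)
  ring

theorem norm_sub_apply_le_of_symb {m : ℝ} {a : Phase ι → ℂ} (ha : Symb m a) :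
    ∃ C : ℝ, 0 ≤ C ∧ ∀ X W, ‖a W - a X‖ ≤ C * wt X ^ (m - 1) * wt (W - X) ^ (|m - 1| + 1) := by
  obtain ⟨D, hD, hd⟩ := ha.bound 1
  refine ⟨D, hD, fun X W => ?_⟩
  have hX := wt_pos X
  have hWX := wt_pos (W - X)
  have hdiff : Differentiable ℝ a := ha.1.differentiable (by simp)
  have h := (convex_segment X W).norm_image_sub_le_of_norm_hasFDerivWithin_le
    (f := a) (f' := fderiv ℝ a) (C := D * (wt (W - X) ^ |m - 1| * wt X ^ (m - 1)))
    (fun Z _ => (hdiff Z).hasFDerivAt.hasFDerivWithinAt) (fun Z hZ => ?_)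
    (left_mem_segment ℝ X W) (right_mem_segment ℝ X W)
  · refine h.trans ?_
    calc _ ≤ D * (wt (W - X) ^ |m - 1| * wt X ^ (m - 1)) * wt (W - X) := by
          gcongr; exact norm_le_wt _
      _ = D * wt X ^ (m - 1) * (wt (W - X) ^ |m - 1| * wt (W - X) ^ (1 : ℝ)) := by
          rw [Real.rpow_one]; ring
      _ = _ := by rw [← wt_rpow_add]
  · have h1 := hd 1 le_rfl Z
    rw [← norm_fderiv_iteratedFDeriv, Nat.cast_one] at h1
    have h0 : ‖fderiv ℝ (iteratedFDeriv ℝ 0 a) Z‖ = ‖fderiv ℝ a Z‖ := by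
      rw [norm_fderiv_iteratedFDeriv, norm_iteratedFDeriv_one]
    rw [h0] at h1
    refine h1.trans (mul_le_mul_of_nonneg_left ?_ hD)
    refine (wt_rpow_peetre Z X (m - 1)).trans ?_
    have hZX : wt (Z - X) ≤ wt (W - X) := by
      obtain ⟨t, ht, rfl⟩ := (segment_eq_image' ℝ X W) ▸ hZ
      rw [add_sub_cancel_left]
      exact wt_smul_le (by rw [abs_of_nonneg ht.1]; exact ht.2) _
    have := wt_pos (Z - X)
    gcongr

/-- The difference a - a(X) is of one order lower near X, with polynomial growth in the distance to
X: the function itself by the mean value inequality, its derivatives because each gains an order.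
This is the only part of the symbol calculus that is needed. -/
theorem norm_gker_sub_le {m : ℝ} {a : Phase ι → ℂ} (ha : Symb m a) (N : ℝ) :
    ∃ C : ℝ, 0 ≤ C ∧ ∀ X Y, ‖gker a X Y - a X * gker (fun _ => 1) X Y‖ ≤
      C * wt X ^ (m - 1) * wt (X - Y) ^ (-N) := by
  have hP : 0 ≤ |m - 1| + 1 := by positivity
  obtain ⟨n, C, hC, h⟩ := norm_gker_le_of_center (ι := ι) N hP
  obtain ⟨D, hD, hd⟩ := ha.bound n
  obtain ⟨D', hD', hd'⟩ := norm_sub_apply_le_of_symb ha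
  refine ⟨C * (D + D'), by positivity, fun X Y => ?_⟩
  have hX := wt_pos X
  have e : gker a X Y - a X * gker (fun _ => 1) X Y = gker (fun W => a W - a X) X Y := by
    have h0 : gint (fun W => a W - a X) X Y = gint a X Y - a X * gint (fun _ => 1) X Y := by
      have h1 := gint_const_mul (a X) (fun _ => 1) X Y
      simp only [mul_one] at h1
      rw [← h1]
      exact gint_sub (abs_nonneg m) ha.polySymb ((polySymb_const (a X)).mono (abs_nonneg m)) X Y
    unfold gker
    rw [h0]
    ring
  rw [e]
  have := h (fun W => a W - a X) X Y ((D + D') * wt X ^ (m - 1)) (by positivity)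
    (ha.1.sub contDiff_const) (fun k hk W => by
      have hWX := wt_pos (W - X)
      rcases Nat.eq_zero_or_pos k with rfl | hk0
      · rw [norm_iteratedFDeriv_zero]
        refine (hd' X W).trans ?_
        gcongr
        linarith
      · have e1 : iteratedFDeriv ℝ k (fun W => a W - a X) W = iteratedFDeriv ℝ k a W := by
          have := iteratedFDeriv_sub_apply (𝕜 := ℝ) (i := k) (x := W) (f := a) (g := fun _ => a X)
            (ha.1.of_le (by exact_mod_cast le_top)).contDiffAt contDiffAt_const
          rw [iteratedFDeriv_const_of_ne (by omega)] at this
          simp only [Pi.zero_apply, sub_zero] at this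
          exact this
        rw [e1]
        refine (hd k hk W).trans ?_
        have hk1 : (1 : ℝ) ≤ k := by exact_mod_cast hk0
        have h2 : wt W ^ (m - k) ≤ wt X ^ (m - 1) * wt (W - X) ^ (|m - 1| + 1) :=
          calc wt W ^ (m - k) ≤ wt W ^ (m - 1) := wt_rpow_le (by linarith)
            _ ≤ wt (W - X) ^ |m - 1| * wt X ^ (m - 1) := wt_rpow_peetre W X _
            _ ≤ wt (W - X) ^ (|m - 1| + 1) * wt X ^ (m - 1) := by
                gcongr
                · exact one_le_wt _
                · linarith
            _ = _ := mul_comm _ _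
        calc _ ≤ D * (wt X ^ (m - 1) * wt (W - X) ^ (|m - 1| + 1)) := by gcongr
          _ ≤ (D + D') * (wt X ^ (m - 1) * wt (W - X) ^ (|m - 1| + 1)) := by gcongr; linarith
          _ = _ := by ring)
  refine this.trans (le_of_eq ?_)
  ring

/-- Polynomial loss in W - X is allowed in the hypothesis, so it suffices that the symbol be small
near X relative to the size of X. -/
theorem norm_gker_le_of_rapid {a : Phase ι → ℂ} (ha : ContDiff ℝ ∞ a) {A : Set (Phase ι)}
    (h : ∀ N : ℝ, ∃ P : ℝ, 0 ≤ P ∧ ∀ k : ℕ, ∃ C : ℝ, ∀ X ∈ A, ∀ W,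
      ‖iteratedFDeriv ℝ k a W‖ ≤ C * (wt X ^ (-N) * wt (W - X) ^ P)) (N : ℝ) :
    ∃ C : ℝ, 0 ≤ C ∧ ∀ X ∈ A, ∀ Y, ‖gker a X Y‖ ≤ C * wt X ^ (-N) * wt (X - Y) ^ (-N) := by
  obtain ⟨P, hP, hk⟩ := h N
  obtain ⟨n, C, hC, hb⟩ := norm_gker_le_of_center (ι := ι) N hP
  obtain ⟨D, hD, hd⟩ := exists_uniform_bound (α := A × Phase ι)
    (f := fun k p => ‖iteratedFDeriv ℝ k a p.2‖)
    (g := fun p => wt (p.1 : Phase ι) ^ (-N) * wt (p.2 - (p.1 : Phase ι)) ^ P)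
    (fun p => (mul_pos (wt_rpow_pos _ _) (wt_rpow_pos _ _)).le)
    (fun k => (hk k).imp fun C hC p => hC p.1 p.1.2 p.2) n
  refine ⟨C * D, by positivity, fun X hX Y => ?_⟩
  have := hb a X Y (D * wt X ^ (-N)) (by have := wt_pos X; positivity) ha (fun k hk W =>
    (hd k hk (⟨X, hX⟩, W)).trans (le_of_eq (by ring)))
  refine this.trans (le_of_eq ?_)
  ring

end KernelBounds

/-! ### Construction of symbols -/

section SymbolCalculus

variable {V G : Type*} [NormedAddCommGroup V] [NormedSpace ℝ V] [NormedAddCommGroup G]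
  [NormedSpace ℝ G]

theorem norm_iteratedFDeriv_smul_le_wt {f : V → ℝ} {g : V → G} (hf : ContDiff ℝ ∞ f)
    (hg : ContDiff ℝ ∞ g) {m m' : ℝ} {k : ℕ}
    (hfb : ∀ i ≤ k, ∃ C : ℝ, ∀ X, ‖iteratedFDeriv ℝ i f X‖ ≤ C * wt X ^ (m - i))
    (hgb : ∀ i ≤ k, ∃ C : ℝ, ∀ X, ‖iteratedFDeriv ℝ i g X‖ ≤ C * wt X ^ (m' - i)) :
    ∃ C : ℝ, ∀ X, ‖iteratedFDeriv ℝ k (fun X => f X • g X) X‖ ≤ C * wt X ^ (m + m' - k) := by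
  choose! C hC using hfb
  choose! D hD using hgb
  refine ⟨∑ i ∈ Finset.range (k + 1), (k.choose i : ℝ) * (C i * D (k - i)), fun X => ?_⟩
  refine (norm_iteratedFDeriv_smul_le (𝕜 := ℝ) hf hg X (n := k)
    (by exact_mod_cast le_top)).trans ?_
  rw [Finset.sum_mul]
  refine Finset.sum_le_sum fun i hi => ?_
  have hi' : i ≤ k := by simpa [Nat.lt_succ_iff] using hi
  rw [mul_assoc, mul_assoc]
  refine mul_le_mul_of_nonneg_left ?_ (Nat.cast_nonneg _)
  have h1 := hC i hi' X
  have h2 := hD (k - i) (by omega) X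
  calc _ ≤ (C i * wt X ^ (m - i)) * (D (k - i) * wt X ^ (m' - (k - i : ℕ))) :=
        mul_le_mul h1 h2 (norm_nonneg _) ((norm_nonneg _).trans h1)
    _ = C i * D (k - i) * (wt X ^ (m - i) * wt X ^ (m' - (k - i : ℕ))) := by ring
    _ = _ := by
        rw [← wt_rpow_add, Nat.cast_sub hi']
        congr 2
        ring

theorem Symb.smul {f : V → ℝ} {g : V → G} {m m' : ℝ} (hf : Symb m f) (hg : Symb m' g) :
    Symb (m + m') (fun X => f X • g X) :=
  ⟨hf.1.smul hg.1, fun _ => norm_iteratedFDeriv_smul_le_wt hf.1 hg.1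
    (fun i _ => hf.2 i) (fun i _ => hg.2 i)⟩

theorem symb_clm (A : V →L[ℝ] G) : Symb 1 A := by
  refine ⟨A.contDiff, fun k => ⟨‖A‖, fun X => ?_⟩⟩
  have hX := wt_pos X
  rcases k with _ | k
  · rw [norm_iteratedFDeriv_zero]
    simp only [Nat.cast_zero, sub_zero, Real.rpow_one]
    exact (A.le_opNorm X).trans (by gcongr; exact norm_le_wt X)
  · rw [← norm_iteratedFDeriv_fderiv]
    have e : fderiv ℝ A = fun _ => A := by ext1 X; exact A.fderiv
    rw [e]
    rcases Nat.eq_zero_or_pos k with rfl | hk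
    · simp
    · rw [iteratedFDeriv_const_of_ne (by omega)]
      simp only [Pi.zero_apply, norm_zero]
      positivity

theorem Symb.comp_compact {a : V → G} (ha : Symb 0 a) {Θ : G → ℂ} (hΘ : ContDiff ℝ ∞ Θ)
    (hc : HasCompactSupport Θ) : Symb 0 (fun X => Θ (a X)) := by
  refine ⟨hΘ.comp ha.1, fun k => ?_⟩
  have hb : ∀ i, ∃ C : ℝ, ∀ y, ‖iteratedFDeriv ℝ i Θ y‖ ≤ C := fun i =>
    (hc.iteratedFDeriv (𝕜 := ℝ) i).exists_bound_of_continuous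
      (hΘ.continuous_iteratedFDeriv (by exact_mod_cast le_top))
  obtain ⟨C, hC, hCb⟩ := exists_uniform_bound (g := fun _ : G => (1 : ℝ))
    (f := fun i y => ‖iteratedFDeriv ℝ i Θ y‖) (fun _ => zero_le_one)
    (fun i => (hb i).imp fun C h y => by simpa using h y) k
  obtain ⟨D, hD, hd⟩ := ha.bound k
  refine ⟨k.factorial * C * (1 + D) ^ k, fun X => ?_⟩
  have hX := wt_pos X
  have h := norm_iteratedFDeriv_comp_le (𝕜 := ℝ) (g := Θ) (f := a) (N := k) (n := k)
    (hΘ.of_le (by exact_mod_cast le_top)) (ha.1.of_le (by exact_mod_cast le_top)) le_rfl X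
    (C := C) (D := (1 + D) * wt X ^ (-1 : ℝ)) (fun i hi => by simpa using hCb i hi (a X))
    (fun i hi1 hi => by
      refine (hd i hi X).trans ?_
      rw [mul_pow, ← Real.rpow_mul_natCast hX.le]
      have h1 : D ≤ (1 + D) ^ i :=
        calc D ≤ 1 + D := by linarith
          _ ≤ _ := le_self_pow₀ (by linarith) (by omega)
      have e : (0 - (i : ℝ)) = -1 * i := by ring
      rw [e]
      gcongr)
  refine h.trans (le_of_eq ?_)
  rw [mul_pow, ← Real.rpow_mul_natCast hX.le]
  have e : (0 - (k : ℝ)) = -1 * k := by ring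
  rw [e]
  ring

theorem rpow_le_of_comparable {x y c : ℝ} (hx : 0 < x) (hy : 0 < y) (hc : 1 ≤ c)
    (h1 : x ≤ c * y) (h2 : y ≤ c * x) (s : ℝ) : x ^ s ≤ c ^ |s| * y ^ s := by
  rcases le_total 0 s with hs | hs
  · rw [abs_of_nonneg hs, ← Real.mul_rpow (by linarith) hy.le]
    exact Real.rpow_le_rpow hx.le h1 hs
  · have h3 : c⁻¹ * y ≤ x := by rw [inv_mul_le_iff₀ (by linarith)]; exact h2
    rw [abs_of_nonpos hs, Real.rpow_neg (by linarith), ← Real.inv_rpow (by linarith),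
      ← Real.mul_rpow (by positivity) hy.le]
    exact Real.rpow_le_rpow_of_nonpos (by positivity) h3 hs

end SymbolCalculus

/-! ### The weight of phase space as a symbol -/

section Japanese

variable {ι : Type*} [Fintype ι]

theorem japanese_pos (X : Phase ι) : 0 < japanese X := Real.sqrt_pos.2 (by positivity)

theorem japanese_sq (X : Phase ι) : japanese X ^ 2 = 1 + ‖X.1‖ ^ 2 + ‖X.2‖ ^ 2 :=
  Real.sq_sqrt (by positivity)

theorem phaseNorm_sq (X : Phase ι) : phaseNorm X ^ 2 = ‖X.1‖ ^ 2 + ‖X.2‖ ^ 2 :=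
  Real.sq_sqrt (by positivity)

theorem phaseNorm_nonneg (X : Phase ι) : 0 ≤ phaseNorm X := Real.sqrt_nonneg _

theorem norm_le_phaseNorm (X : Phase ι) : ‖X‖ ≤ phaseNorm X := by
  refine norm_prod_le_iff.2 ⟨?_, ?_⟩ <;> refine Real.le_sqrt_of_sq_le ?_ <;>
    nlinarith [sq_nonneg ‖X.1‖, sq_nonneg ‖X.2‖]

theorem phaseNorm_le (X : Phase ι) : phaseNorm X ≤ 2 * ‖X‖ := by
  refine Real.sqrt_le_iff.2 ⟨by positivity, ?_⟩
  nlinarith [norm_fst_le X, norm_snd_le X, norm_nonneg X.1, norm_nonneg X.2, norm_nonneg X]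

theorem wt_le_japanese (X : Phase ι) : wt X ≤ 2 * japanese X := by
  have h := phaseNorm_sq X
  have h1 := norm_le_phaseNorm X
  have h2 := japanese_sq X
  have h3 := japanese_pos X
  refine le_of_sq_le_sq ?_ (by positivity)
  unfold wt
  nlinarith [phaseNorm_nonneg X, norm_nonneg X, sq_nonneg (‖X‖ - 1)]

theorem japanese_le_wt (X : Phase ι) : japanese X ≤ 2 * wt X := by
  have h := phaseNorm_sq X
  have h1 := phaseNorm_le X
  have h2 := japanese_sq X
  have h3 := japanese_pos X
  unfold wt
  nlinarith [phaseNorm_nonneg X, norm_nonneg X]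

theorem wt_rpow_le_japanese (X : Phase ι) (s : ℝ) : wt X ^ s ≤ 2 ^ |s| * japanese X ^ s :=
  rpow_le_of_comparable (wt_pos X) (japanese_pos X) (by norm_num) (wt_le_japanese X)
    (japanese_le_wt X) s

theorem japanese_rpow_le_wt (X : Phase ι) (s : ℝ) : japanese X ^ s ≤ 2 ^ |s| * wt X ^ s :=
  rpow_le_of_comparable (japanese_pos X) (wt_pos X) (by norm_num) (japanese_le_wt X)
    (wt_le_japanese X) s

theorem isShubinSymbol_iff {m : ℝ} {a : Phase ι → ℂ} : IsShubinSymbol m a ↔ Symb m a := by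
  refine and_congr_right fun _ => forall_congr' fun k => ⟨fun ⟨C, h⟩ => ?_, fun ⟨C, h⟩ => ?_⟩
  · refine ⟨|C| * 2 ^ |m - k|, fun X => (h X).trans ?_⟩
    have := japanese_pos X
    calc _ ≤ |C| * japanese X ^ (m - k) := by gcongr; exact le_abs_self C
      _ ≤ |C| * (2 ^ |m - k| * wt X ^ (m - k)) := by gcongr; exact japanese_rpow_le_wt X _
      _ = _ := by ring
  · refine ⟨|C| * 2 ^ |m - k|, fun X => (h X).trans ?_⟩
    have := wt_pos X
    calc _ ≤ |C| * wt X ^ (m - k) := by gcongr; exact le_abs_self C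
      _ ≤ |C| * (2 ^ |m - k| * japanese X ^ (m - k)) := by gcongr; exact wt_rpow_le_japanese X _
      _ = _ := by ring

/-- The Euclidean inner product on phase space. -/
def phaseInner (ι : Type*) [Fintype ι] : Phase ι →L[ℝ] Phase ι →L[ℝ] ℝ :=
  (innerSL ℝ (E := Eucl ι)).bilinearComp (ContinuousLinearMap.fst ℝ (Eucl ι) (Eucl ι))
      (ContinuousLinearMap.fst ℝ (Eucl ι) (Eucl ι)) +
    (innerSL ℝ (E := Eucl ι)).bilinearComp (ContinuousLinearMap.snd ℝ (Eucl ι) (Eucl ι))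
      (ContinuousLinearMap.snd ℝ (Eucl ι) (Eucl ι))

theorem japanese_rpow_eq (X : Phase ι) (s : ℝ) :
    japanese X ^ s = (1 + ‖X.1‖ ^ 2 + ‖X.2‖ ^ 2) ^ (s / 2) := by
  rw [japanese, Real.sqrt_eq_rpow, ← Real.rpow_mul (by positivity)]
  congr 1
  ring

theorem contDiff_japanese_rpow (s : ℝ) : ContDiff ℝ ∞ (fun X : Phase ι => japanese X ^ s) := by
  simp only [japanese_rpow_eq]
  have h : ContDiff ℝ ∞ (fun X : Phase ι => 1 + ‖X.1‖ ^ 2 + ‖X.2‖ ^ 2) :=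
    (contDiff_const.add (contDiff_fst.norm_sq ℝ)).add (contDiff_snd.norm_sq ℝ)
  exact h.rpow_const_of_ne fun X => by positivity

theorem fderiv_japanese_rpow (s : ℝ) : fderiv ℝ (fun X : Phase ι => japanese X ^ s) =
    fun X => (s * japanese X ^ (s - 2)) • phaseInner ι X := by
  ext1 X
  simp only [japanese_rpow_eq]
  have h1 : HasFDerivAt (fun X : Phase ι => 1 + ‖X.1‖ ^ 2 + ‖X.2‖ ^ 2)
      ((2 : ℝ) • phaseInner ι X) X := by
    have e1 := ((hasFDerivAt_fst (𝕜 := ℝ) (E := Eucl ι) (F := Eucl ι) (p := X)).norm_sq)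
    have e2 := ((hasFDerivAt_snd (𝕜 := ℝ) (E := Eucl ι) (F := Eucl ι) (p := X)).norm_sq)
    refine ((e1.const_add 1).add e2).congr_fderiv ?_
    rw [two_smul, two_smul, two_smul]
    ext Y <;> simp [phaseInner]
  have h2 := (h1.rpow_const (p := s / 2) (Or.inl (by positivity))).fderiv
  rw [h2, smul_smul]
  congr 1
  rw [show (s - 2) / 2 = s / 2 - 1 by ring]
  ring

/-- The differential of ⟨X⟩^s is s⟨X⟩^(s-2) times a linear map, so the derivatives follow by
induction on their order, for all exponents at once. -/
theorem symb_japanese_rpow (s : ℝ) : Symb s (fun X : Phase ι => japanese X ^ s) := by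
  refine ⟨contDiff_japanese_rpow s, fun k => ?_⟩
  induction k using Nat.strong_induction_on generalizing s with
  | _ k ih =>
    rcases k with _ | k
    · refine ⟨2 ^ |s|, fun X => ?_⟩
      have := japanese_pos X
      rw [norm_iteratedFDeriv_zero, Real.norm_of_nonneg (by positivity), Nat.cast_zero, sub_zero]
      exact japanese_rpow_le_wt X s
    · have hsm : ContDiff ℝ ∞ (fun X : Phase ι => s * japanese X ^ (s - 2)) :=
        contDiff_const.mul (contDiff_japanese_rpow _)
      have hb : ∀ i ≤ k, ∃ C : ℝ, ∀ X : Phase ι, ‖iteratedFDeriv ℝ i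
          (fun X : Phase ι => s * japanese X ^ (s - 2)) X‖ ≤ C * wt X ^ (s - 2 - i) := by
        intro i hi
        obtain ⟨D, hD⟩ := ih i (by omega) (s - 2)
        refine ⟨|s| * D, fun X => ?_⟩
        have e : (fun X : Phase ι => s * japanese X ^ (s - 2)) =
            s • (fun X : Phase ι => japanese X ^ (s - 2)) := rfl
        rw [e, iteratedFDeriv_const_smul_apply
          ((contDiff_japanese_rpow _).of_le (by exact_mod_cast le_top)).contDiffAt, norm_smul,
          Real.norm_eq_abs, mul_assoc]
        exact mul_le_mul_of_nonneg_left (hD X) (abs_nonneg s)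
      obtain ⟨C, hC⟩ := norm_iteratedFDeriv_smul_le_wt (k := k) (m := s - 2) (m' := 1) hsm
        (phaseInner ι).contDiff hb (fun i _ => (symb_clm (phaseInner ι)).2 i)
      refine ⟨C, fun X => ?_⟩
      rw [← norm_iteratedFDeriv_fderiv, fderiv_japanese_rpow]
      refine (hC X).trans (le_of_eq ?_)
      congr 2
      push_cast
      ring

theorem symb_japanese_rpow_ofReal (s : ℝ) :
    Symb s (fun X : Phase ι => ((japanese X ^ s : ℝ) : ℂ)) := by
  obtain ⟨h1, h2⟩ := symb_japanese_rpow (ι := ι) s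
  refine ⟨Complex.ofRealCLM.contDiff.comp h1, fun k => (h2 k).imp fun C h X => ?_⟩
  have := Complex.ofRealLI.norm_iteratedFDeriv_comp_left (i := k) (x := X)
    (h1.of_le (by exact_mod_cast le_top)).contDiffAt le_rfl
  exact (le_of_eq this).trans (h X)

/-- The radial compactification of phase space to a ball. -/
def dir (X : Phase ι) : Phase ι := japanese X ^ (-1 : ℝ) • X

/-- Composition of this map with a compactly supported bump produces conic cutoffs of order 0 that
are smooth at the origin. -/
theorem symb_dir : Symb 0 (dir : Phase ι → Phase ι) := by
  have := (symb_japanese_rpow (ι := ι) (-1)).smul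
    (symb_clm (ContinuousLinearMap.id ℝ (Phase ι)))
  simp only [neg_add_cancel] at this
  exact this

end Japanese

/-! ### Conic regions and localized estimates for rapidly decaying kernels -/

section Cones

variable {V : Type*} [NormedAddCommGroup V]

/-- Powers of the weight with values in `[0, ∞]`. -/
def ew (x : V) (s : ℝ) : ℝ≥0∞ := ENNReal.ofReal (wt x ^ s)

theorem ew_ne_top (x : V) (s : ℝ) : ew x s ≠ ⊤ := ENNReal.ofReal_ne_top

theorem ew_add (x : V) (s t : ℝ) : ew x (s + t) = ew x s * ew x t := by
  rw [ew, wt_rpow_add, ENNReal.ofReal_mul (wt_rpow_pos _ _).le]; rfl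

theorem ew_mono (x : V) {s t : ℝ} (h : s ≤ t) : ew x s ≤ ew x t :=
  ENNReal.ofReal_le_ofReal (wt_rpow_le h)

@[simp] theorem ew_zero (x : V) : ew x 0 = 1 := by simp [ew]

theorem ew_mul_neg (x : V) (s : ℝ) : ew x s * ew x (-s) = 1 := by rw [← ew_add]; simp

theorem ew_peetre (x y : V) (s : ℝ) : ew x s ≤ ew (x - y) |s| * ew y s := by
  unfold ew
  rw [← ENNReal.ofReal_mul (wt_rpow_pos _ _).le]
  exact ENNReal.ofReal_le_ofReal (wt_rpow_peetre x y s)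

theorem ew_sub_comm (x y : V) (s : ℝ) : ew (x - y) s = ew (y - x) s := by
  unfold ew; rw [wt_sub_comm]

theorem ew_sq (x : V) (s : ℝ) : ew x s ^ 2 = ew x (2 * s) := by rw [sq, ← ew_add]; ring_nf

theorem measurable_ew [MeasurableSpace V] [BorelSpace V] (s : ℝ) :
    Measurable fun x : V => ew x s :=
  (continuous_wt_rpow s).measurable.ennreal_ofReal

variable [NormedSpace ℝ V]

/-- The cone generated by the ball of radius `δ` about `θ`. -/
def coneBall (θ : V) (δ : ℝ) : Set V := {X | ∃ t : ℝ, 0 < t ∧ ‖t • X - θ‖ < δ}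

theorem isOpen_coneBall (θ : V) (δ : ℝ) : IsOpen (coneBall θ δ) := by
  have e : coneBall θ δ = ⋃ t ∈ Ioi (0 : ℝ), {X : V | ‖t • X - θ‖ < δ} := by
    ext X; simp [coneBall]
  rw [e]
  refine isOpen_biUnion fun t _ => ?_
  exact isOpen_lt (by fun_prop) continuous_const

theorem coneBall_mono (θ : V) {δ δ' : ℝ} (h : δ ≤ δ') : coneBall θ δ ⊆ coneBall θ δ' :=
  fun _ ⟨t, ht, hX⟩ => ⟨t, ht, hX.trans_le h⟩

theorem mem_coneBall_self (θ : V) {δ : ℝ} (h : 0 < δ) : θ ∈ coneBall θ δ :=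
  ⟨1, one_pos, by simpa using h⟩

theorem smul_mem_coneBall {θ X : V} {δ r : ℝ} (hr : 0 < r) (h : X ∈ coneBall θ δ) :
    r • X ∈ coneBall θ δ := by
  obtain ⟨t, ht, hX⟩ := h
  refine ⟨t / r, by positivity, ?_⟩
  rwa [smul_smul, div_mul_cancel₀ _ hr.ne']

/-- With the centre at the origin, estimates on cones become global ones. -/
theorem coneBall_zero {δ : ℝ} (h : 0 < δ) : coneBall (0 : V) δ = univ := by
  refine eq_univ_of_forall fun X => ⟨δ / (‖X‖ + 1), by positivity, ?_⟩
  have := norm_nonneg X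
  rw [sub_zero, norm_smul, Real.norm_of_nonneg (by positivity), div_mul_eq_mul_div,
    div_lt_iff₀ (by positivity)]
  nlinarith

theorem zero_notMem_coneBall {θ : V} {δ : ℝ} (h : δ ≤ ‖θ‖) : (0 : V) ∉ coneBall θ δ := by
  rintro ⟨t, -, hX⟩
  simp at hX
  linarith

/-- Scale X by the t that brings it within δ of θ. Then t • Y is at distance at least δ' from θ, so
t‖X - Y‖ ≥ δ' - δ, whereas t‖X‖ ≤ ‖θ‖ + δ. -/
theorem coneBall_separation_norm (θ : V) {δ δ' : ℝ} (hδ : 0 ≤ δ) (h : δ < δ') :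
    ∃ ε : ℝ, 0 < ε ∧ ε ≤ 1 ∧ ∀ X ∈ coneBall θ δ, ∀ Y ∉ coneBall θ δ', ε * ‖X‖ ≤ ‖X - Y‖ := by
  have hd : 0 < δ' - δ := by linarith
  have hw := norm_nonneg θ
  set c := (δ' - δ) / (‖θ‖ + δ + (δ' - δ)) with hc
  have hc0 : 0 < c := by positivity
  have hc1 : c ≤ 1 := by
    rw [hc, div_le_one (by positivity)]
    linarith
  refine ⟨c, hc0, hc1, fun X ⟨t, ht, hX⟩ Y hY => ?_⟩
  have h1 : δ' ≤ ‖t • Y - θ‖ := by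
    by_contra hcon
    exact hY ⟨t, ht, not_le.1 hcon⟩
  have h2 : δ' - δ ≤ t * ‖X - Y‖ := by
    have e : t • Y - θ = (t • X - θ) - t • (X - Y) := by module
    have := norm_sub_le (t • X - θ) (t • (X - Y))
    rw [← e, norm_smul, Real.norm_of_nonneg ht.le] at this
    linarith
  have h3 : t * ‖X‖ ≤ ‖θ‖ + δ := by
    have e : t • X = (t • X - θ) + θ := by module
    have := norm_add_le (t • X - θ) θ
    rw [← e, norm_smul, Real.norm_of_nonneg ht.le] at this
    linarith
  rw [hc, div_mul_eq_mul_div, div_le_iff₀ (by positivity)]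
  have h5 : t * ((δ' - δ) * ‖X‖) ≤ t * (‖X - Y‖ * (‖θ‖ + δ + (δ' - δ))) := by
    have e1 : t * ((δ' - δ) * ‖X‖) = (δ' - δ) * (t * ‖X‖) := by ring
    have e2 : t * (‖X - Y‖ * (‖θ‖ + δ + (δ' - δ))) =
        (t * ‖X - Y‖) * (‖θ‖ + δ + (δ' - δ)) := by ring
    rw [e1, e2]
    have := norm_nonneg X
    exact mul_le_mul h2 (by linarith) (by positivity) (by linarith)
  exact le_of_mul_le_mul_left h5 ht

theorem coneBall_separation (θ : V) {δ δ' : ℝ} (hδ : 0 ≤ δ) (h : δ < δ') :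
    ∃ ε : ℝ, 0 < ε ∧ ε ≤ 1 ∧ ∀ X ∈ coneBall θ δ, ∀ Y ∉ coneBall θ δ', ε * wt X ≤ wt (X - Y) := by
  obtain ⟨c, hc0, hc1, hc⟩ := coneBall_separation_norm θ hδ h
  refine ⟨c, hc0, hc1, fun X hX Y hY => ?_⟩
  have := hc X hX Y hY
  unfold wt
  linarith

end Cones

/-! ### Convolution estimates on cones and the elliptic bootstrap -/

section Localized

variable {V : Type*} [NormedAddCommGroup V] [NormedSpace ℝ V] [FiniteDimensional ℝ V]
  [MeasurableSpace V] [BorelSpace V] (μ : Measure V) [μ.IsAddHaarMeasure]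

theorem lintegral_ew_lt_top {s : ℝ} (hs : s ≤ -intExp V) : ∫⁻ x : V, ew x s ∂μ < ⊤ :=
  lintegral_wt_lt_top μ hs

/-- Convolution with a negative power of the weight. -/
def conv (N : ℝ) (F : V → ℝ≥0∞) (X : V) : ℝ≥0∞ := ∫⁻ Y, ew (X - Y) (-N) * F Y ∂μ

/-- Points outside the larger cone lie at distance comparable to ⟨X⟩ from X, so there the decay of
the convolution kernel becomes decay in X and beats the polynomial growth of F. -/
theorem conv_split {F : V → ℝ≥0∞} {M : ℝ} (hM : 0 ≤ M) {C : NNReal}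
    (hF : ∀ X, F X ≤ C * ew X M) (θ : V) {δ δ' : ℝ} (hδ : 0 ≤ δ) (h : δ < δ') (Q : ℝ) :
    ∃ N₀ : ℝ, ∀ N ≥ N₀, ∃ D : NNReal, ∀ X ∈ coneBall θ δ,
      conv μ N F X ≤ conv μ N ((coneBall θ δ').indicator F) X + D * ew X (-Q) := by
  obtain ⟨ε, hε, hε1, hsep⟩ := coneBall_separation θ hδ h
  -- One M moves the growth of F from Y to X by Peetre's inequality, `intExp V` makes the integral
  -- converge, and the remaining M + |Q| turns the growth in X into decay of order Q.
  refine ⟨M + intExp V + M + |Q|, fun N hN => ?_⟩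
  have hQ := abs_nonneg Q
  set P : ℝ := N - M - intExp V with hP
  have hP0 : 0 ≤ P := by rw [hP]; linarith
  have hI := lintegral_ew_lt_top μ (V := V) le_rfl
  set J := ∫⁻ x : V, ew x (-intExp V) ∂μ with hJ
  refine ⟨C * Real.toNNReal (ε ^ (-P)) * J.toNNReal, fun X hX => ?_⟩
  have hA : MeasurableSet (coneBall θ δ') := (isOpen_coneBall θ δ').measurableSet
  have hs : conv μ N F X = (∫⁻ Y in coneBall θ δ', ew (X - Y) (-N) * F Y ∂μ) +
      ∫⁻ Y in (coneBall θ δ')ᶜ, ew (X - Y) (-N) * F Y ∂μ :=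
    (lintegral_add_compl _ hA).symm
  rw [hs]
  gcongr
  · rw [← lintegral_indicator hA, conv]
    refine lintegral_mono fun Y => ?_
    by_cases hY : Y ∈ coneBall θ δ' <;> simp [hY]
  · calc ∫⁻ Y in (coneBall θ δ')ᶜ, ew (X - Y) (-N) * F Y ∂μ
        ≤ ∫⁻ Y in (coneBall θ δ')ᶜ, (C * Real.toNNReal (ε ^ (-P)) * ew X (-Q)) *
            ew (X - Y) (-intExp V) ∂μ := by
          refine setLIntegral_mono' hA.compl fun Y hY => ?_
          have h1 : F Y ≤ C * (ew (X - Y) M * ew X M) := by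
            refine (hF Y).trans ?_
            gcongr
            have := ew_peetre Y X M
            rwa [abs_of_nonneg hM, ew_sub_comm] at this
          have h2 : ew (X - Y) (-P) ≤ Real.toNNReal (ε ^ (-P)) * ew X (-P) := by
            have hw := wt_pos X
            change _ ≤ ENNReal.ofReal (ε ^ (-P)) * ENNReal.ofReal (wt X ^ (-P))
            rw [← ENNReal.ofReal_mul (by positivity), ← Real.mul_rpow hε.le hw.le]
            exact ENNReal.ofReal_le_ofReal (Real.rpow_le_rpow_of_nonpos (by positivity)
              (hsep X hX Y hY) (by linarith))
          have e1 : ew (X - Y) (-N) * ew (X - Y) M = ew (X - Y) (-P) * ew (X - Y) (-intExp V) := by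
            rw [← ew_add, ← ew_add]; congr 1; rw [hP]; ring
          have e2 : ew X (-P) * ew X M ≤ ew X (-Q) := by
            rw [← ew_add]
            refine ew_mono _ ?_
            have := le_abs_self Q
            rw [hP]
            linarith
          calc _ ≤ ew (X - Y) (-N) * (C * (ew (X - Y) M * ew X M)) := by gcongr
            _ = C * ew X M * (ew (X - Y) (-N) * ew (X - Y) M) := by ring
            _ = C * ew X M * (ew (X - Y) (-P) * ew (X - Y) (-intExp V)) := by rw [e1]
            _ ≤ C * ew X M * ((Real.toNNReal (ε ^ (-P)) * ew X (-P)) * ew (X - Y) (-intExp V)) := by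
                gcongr
            _ = C * Real.toNNReal (ε ^ (-P)) * (ew X (-P) * ew X M) * ew (X - Y) (-intExp V) := by
                ring
            _ ≤ _ := by gcongr
      _ ≤ ∫⁻ Y, (C * Real.toNNReal (ε ^ (-P)) * ew X (-Q)) * ew (X - Y) (-intExp V) ∂μ :=
          setLIntegral_le_lintegral _ _
      _ = (C * Real.toNNReal (ε ^ (-P)) * ew X (-Q)) * J := by
          rw [lintegral_const_mul' _ _ (by
            have := ew_ne_top X (-Q); finiteness),
            lintegral_sub_left_eq_self (fun Y : V => ew Y (-intExp V))]
      _ = _ := by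
          push_cast
          rw [ENNReal.coe_toNNReal hI.ne]
          ring

theorem conv_le_of_le {F : V → ℝ≥0∞} {t : ℝ} {C : NNReal} (hF : ∀ X, F X ≤ C * ew X t) {N : ℝ}
    (hN : |t| + intExp V ≤ N) : ∃ D : NNReal, ∀ X, conv μ N F X ≤ D * ew X t := by
  have hI := lintegral_ew_lt_top μ (V := V) le_rfl
  set J := ∫⁻ x : V, ew x (-intExp V) ∂μ with hJ
  refine ⟨C * J.toNNReal, fun X => ?_⟩
  calc conv μ N F X ≤ ∫⁻ Y, (C * ew X t) * ew (X - Y) (-intExp V) ∂μ := by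
        refine lintegral_mono fun Y => ?_
        have h1 : ew Y t ≤ ew (X - Y) |t| * ew X t := by
          have := ew_peetre Y X t
          rwa [ew_sub_comm] at this
        calc _ ≤ ew (X - Y) (-N) * (C * (ew (X - Y) |t| * ew X t)) := by
              gcongr; exact (hF Y).trans (by gcongr)
          _ = (C * ew X t) * (ew (X - Y) (-N) * ew (X - Y) |t|) := by ring
          _ ≤ _ := by
              rw [← ew_add]
              gcongr
              exact ew_mono _ (by linarith)
    _ = (C * ew X t) * J := by
        rw [lintegral_const_mul' _ _ (by have := ew_ne_top X t; finiteness),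
          lintegral_sub_left_eq_self (fun Y : V => ew Y (-intExp V))]
    _ = _ := by
        push_cast
        rw [ENNReal.coe_toNNReal hI.ne]
        ring

theorem conv_le_cone {F : V → ℝ≥0∞} {M : ℝ} (hM : 0 ≤ M) {C : NNReal}
    (hF : ∀ X, F X ≤ C * ew X M) (θ : V) {δ δ' : ℝ} (hδ : 0 ≤ δ) (h : δ < δ') {t : ℝ}
    (ht : ∃ D : NNReal, ∀ X ∈ coneBall θ δ', F X ≤ D * ew X t) :
    ∃ N₀ : ℝ, ∀ N ≥ N₀, ∃ D : NNReal, ∀ X ∈ coneBall θ δ, conv μ N F X ≤ D * ew X t := by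
  obtain ⟨N₁, h1⟩ := conv_split μ hM hF θ hδ h (-t)
  obtain ⟨D, hD⟩ := ht
  refine ⟨max N₁ (|t| + intExp V), fun N hN => ?_⟩
  obtain ⟨D₁, hD₁⟩ := h1 N ((le_max_left _ _).trans hN)
  obtain ⟨D₂, hD₂⟩ := conv_le_of_le μ (F := (coneBall θ δ').indicator F) (t := t) (C := D)
    (fun X => by
      by_cases hX : X ∈ coneBall θ δ'
      · simpa [hX] using hD X hX
      · simp [hX]) ((le_max_right _ _).trans hN)
  refine ⟨D₂ + D₁, fun X hX => (hD₁ X hX).trans ?_⟩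
  rw [neg_neg]
  push_cast
  rw [add_mul]
  gcongr
  exact hD₂ X

/-- Peetre's inequality moves the weight through the convolution, after which Schur's test applies.
-/
theorem conv_sq_lt_top {F : V → ℝ≥0∞} (hFm : Measurable F) {t : ℝ}
    (hF : ∫⁻ X, (ew X t * F X) ^ 2 ∂μ < ⊤) {N : ℝ} (hN : |t| + intExp V ≤ N) :
    ∫⁻ X, (ew X t * conv μ N F X) ^ 2 ∂μ < ⊤ := by
  have hI := lintegral_ew_lt_top μ (V := V) (s := -intExp V) le_rfl
  have hm : Measurable fun X => ew X t * F X := (measurable_ew t).mul hFm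
  refine lt_of_le_of_lt ?_ (ENNReal.mul_lt_top (ENNReal.pow_lt_top hI (n := 2)) hF)
  refine le_trans (lintegral_mono fun X => ?_)
    (lintegral_convolution_sq_le μ (measurable_ew (-intExp V)) hm)
  gcongr
  rw [conv, ← lintegral_const_mul' _ _ (ew_ne_top X t)]
  refine lintegral_mono fun Y => ?_
  calc ew X t * (ew (X - Y) (-N) * F Y) ≤ (ew (X - Y) |t| * ew Y t) * (ew (X - Y) (-N) * F Y) := by
        gcongr; exact ew_peetre X Y t
    _ = (ew (X - Y) |t| * ew (X - Y) (-N)) * (ew Y t * F Y) := by ring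
    _ ≤ _ := by
        rw [← ew_add]
        gcongr
        exact ew_mono _ (by linarith)

theorem lintegral_add_sq_lt_top {f g : V → ℝ≥0∞} (hf : Measurable f) {A : Set V}
    (h1 : ∫⁻ X in A, f X ^ 2 ∂μ < ⊤) (h2 : ∫⁻ X in A, g X ^ 2 ∂μ < ⊤) :
    ∫⁻ X in A, (f X + g X) ^ 2 ∂μ < ⊤ := by
  refine lt_of_le_of_lt (lintegral_mono fun X => add_sq_le_two_mul (f X) (g X)) ?_
  rw [lintegral_add_left ((hf.pow_const 2).const_mul 2), lintegral_const_mul' _ _ (by simp),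
    lintegral_const_mul' _ _ (by simp)]
  finiteness

theorem lintegral_const_mul_sq_lt_top {f : V → ℝ≥0∞} (c : NNReal) {A : Set V}
    (h1 : ∫⁻ X in A, f X ^ 2 ∂μ < ⊤) : ∫⁻ X in A, (c * f X) ^ 2 ∂μ < ⊤ := by
  simp only [mul_pow]
  rw [lintegral_const_mul' _ _ (by finiteness)]
  finiteness

theorem lintegral_ew_sq_lt_top {s : ℝ} (hs : s ≤ -intExp V) (A : Set V) :
    ∫⁻ X in A, (ew X s) ^ 2 ∂μ < ⊤ := by
  simp only [ew_sq]
  have := intExp_pos V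
  exact lt_of_le_of_lt (setLIntegral_le_lintegral _ _) (lintegral_ew_lt_top μ (by linarith))

theorem measurable_conv {F : V → ℝ≥0∞} (hF : Measurable F) (N : ℝ) : Measurable (conv μ N F) := by
  have h : Measurable fun p : V × V => ew (p.1 - p.2) (-N) * F p.2 :=
    ((measurable_ew (-N)).comp (measurable_fst.sub measurable_snd)).mul (hF.comp measurable_snd)
  exact h.lintegral_prod_right'

theorem conv_sq_lt_top_cone {F : V → ℝ≥0∞} (hFm : Measurable F) {M : ℝ} (hM : 0 ≤ M) {C : NNReal}
    (hF : ∀ X, F X ≤ C * ew X M) (θ : V) {δ δ' : ℝ} (hδ : 0 ≤ δ) (h : δ < δ') {t : ℝ}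
    (ht : ∫⁻ X in coneBall θ δ', (ew X t * F X) ^ 2 ∂μ < ⊤) :
    ∃ N₀ : ℝ, ∀ N ≥ N₀, ∫⁻ X in coneBall θ δ, (ew X t * conv μ N F X) ^ 2 ∂μ < ⊤ := by
  obtain ⟨N₁, h1⟩ := conv_split μ hM hF θ hδ h (t + intExp V)
  refine ⟨max N₁ (|t| + intExp V), fun N hN => ?_⟩
  obtain ⟨D, hD⟩ := h1 N ((le_max_left _ _).trans hN)
  have hA : MeasurableSet (coneBall θ δ') := (isOpen_coneBall θ δ').measurableSet
  set F' := (coneBall θ δ').indicator F with hF'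
  have hm' : Measurable F' := hFm.indicator hA
  have h2 : ∫⁻ X, (ew X t * F' X) ^ 2 ∂μ < ⊤ := by
    rw [← lintegral_indicator hA] at ht
    refine lt_of_le_of_lt (lintegral_mono fun X => ?_) ht
    by_cases hX : X ∈ coneBall θ δ' <;> simp [hF', hX]
  have h3 := conv_sq_lt_top μ hm' h2 ((le_max_right _ _).trans hN)
  have h4 : ∫⁻ X in coneBall θ δ, (ew X t * conv μ N F' X + D * ew X (-intExp V)) ^ 2 ∂μ < ⊤ :=
    lintegral_add_sq_lt_top μ ((measurable_ew t).mul (measurable_conv μ hm' N))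
      (lt_of_le_of_lt (setLIntegral_le_lintegral _ _) h3)
      (lintegral_const_mul_sq_lt_top μ D (lintegral_ew_sq_lt_top μ le_rfl _))
  refine lt_of_le_of_lt (setLIntegral_mono' (isOpen_coneBall θ δ).measurableSet fun X hX => ?_) h4
  gcongr
  calc _ ≤ ew X t * (conv μ N F' X + D * ew X (-(t + intExp V))) := by gcongr; exact hD X hX
    _ = ew X t * conv μ N F' X + D * (ew X t * ew X (-(t + intExp V))) := by ring
    _ = _ := by rw [← ew_add]; congr 3; ring

/-- The remainder in the hypothesis carries a factor ⟨X⟩^(-1), so square integrability of order t on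
a slightly larger cone gives order t + 1, as long as the datum H allows it. Polynomial growth
provides some order to start from, and finitely many rounds reach s. -/
theorem bootstrap_sq {F H : V → ℝ≥0∞} (hFm : Measurable F) (hHm : Measurable H) {M : ℝ}
    (hM : 0 ≤ M) {C : NNReal} (hF : ∀ X, F X ≤ C * ew X M) (θ : V) {δ₀ s : ℝ}
    (hb : ∀ N Q : ℝ, ∃ D : NNReal, ∀ X ∈ coneBall θ δ₀,
      F X ≤ D * (H X + ew X (-1) * conv μ N F X + ew X (-Q)))
    (hH : ∫⁻ X in coneBall θ δ₀, (ew X s * H X) ^ 2 ∂μ < ⊤) {δ : ℝ} (hδ : 0 ≤ δ) (h : δ < δ₀) :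
    ∫⁻ X in coneBall θ δ, (ew X s * F X) ^ 2 ∂μ < ⊤ := by
  have key : ∀ (k : ℕ) (δ : ℝ), 0 ≤ δ → δ < δ₀ → ∫⁻ X in coneBall θ δ,
      (ew X (min s (k - (M + intExp V))) * F X) ^ 2 ∂μ < ⊤ := by
    intro k
    induction k with
    | zero =>
      intro δ _ _
      refine lt_of_le_of_lt (lintegral_mono fun X => ?_)
        (lintegral_const_mul_sq_lt_top μ C (lintegral_ew_sq_lt_top μ (V := V) le_rfl
          (coneBall θ δ)))
      refine pow_le_pow_left' ?_ 2
      calc _ ≤ ew X (min s ((0 : ℕ) - (M + intExp V))) * (C * ew X M) := by gcongr; exact hF X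
        _ = C * (ew X (min s ((0 : ℕ) - (M + intExp V))) * ew X M) := by ring
        _ ≤ _ := by
            rw [← ew_add]
            gcongr
            refine ew_mono _ ?_
            have := min_le_right s (((0 : ℕ) : ℝ) - (M + intExp V))
            push_cast at this ⊢
            linarith
    | succ k ih =>
      intro δ hδ h
      set t := min s ((k : ℝ) - (M + intExp V)) with ht
      -- Each round costs some aperture; halving the gap leaves room for every further round.
      have h1 : δ < (δ + δ₀) / 2 := by linarith
      obtain ⟨N, hN⟩ := conv_sq_lt_top_cone μ hFm hM hF θ hδ h1
        (ih ((δ + δ₀) / 2) (by linarith) (by linarith))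
      have h2 := hN N le_rfl
      -- The exponent is chosen so that the rapidly decaying term remains square integrable against
      -- the weight of order s.
      obtain ⟨D, hD⟩ := hb N (s + intExp V)
      have hHδ : ∫⁻ X in coneBall θ δ, (ew X s * H X) ^ 2 ∂μ < ⊤ :=
        lt_of_le_of_lt (lintegral_mono_set (coneBall_mono θ h.le)) hH
      have h4 := lintegral_const_mul_sq_lt_top μ D (lintegral_add_sq_lt_top μ
        (((measurable_ew s).mul hHm).add ((measurable_ew t).mul (measurable_conv μ hFm N)))
        (lintegral_add_sq_lt_top μ ((measurable_ew s).mul hHm) hHδ h2)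
        (lintegral_ew_sq_lt_top μ (V := V) le_rfl (coneBall θ δ)))
      refine lt_of_le_of_lt (setLIntegral_mono' (isOpen_coneBall θ δ).measurableSet
        fun X hX => ?_) h4
      refine pow_le_pow_left' ?_ 2
      set t' := min s (((k + 1 : ℕ) : ℝ) - (M + intExp V)) with ht'
      have ht's : t' ≤ s := min_le_left _ _
      have ht't : t' + -1 ≤ t := by
        refine le_min ?_ ?_
        · linarith
        · have := min_le_right s (((k + 1 : ℕ) : ℝ) - (M + intExp V))
          push_cast at this
          simp only [ht']
          push_cast
          linarith
      calc ew X t' * F X ≤ ew X t' * (D * (H X + ew X (-1) * conv μ N F X +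
            ew X (-(s + intExp V)))) := by
            gcongr; exact hD X (coneBall_mono θ h.le hX)
        _ = D * (ew X t' * H X + (ew X t' * ew X (-1)) * conv μ N F X +
            ew X t' * ew X (-(s + intExp V))) := by ring
        _ ≤ _ := by
            rw [← ew_add, ← ew_add]
            have e1 := ew_mono X ht's
            have e2 := ew_mono X ht't
            have e3 : ew X (t' + -(s + intExp V)) ≤ ew X (-intExp V) := ew_mono X (by linarith)
            exact mul_le_mul_right (add_le_add (add_le_add (mul_le_mul_left e1 _)
              (mul_le_mul_left e2 _)) e3) _
  obtain ⟨k, hk⟩ := exists_nat_ge (s + (M + intExp V))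
  have := key k δ hδ h
  rwa [min_eq_left (by linarith)] at this

/-- The same iteration with pointwise bounds. It asks for no measurability of F, so F may be a
supremum over a sequence of distributions. -/
theorem bootstrap_sup {F H : V → ℝ≥0∞} {M : ℝ}
    (hM : 0 ≤ M) {C : NNReal} (hF : ∀ X, F X ≤ C * ew X M) (θ : V) {δ₀ s : ℝ}
    (hb : ∀ N Q : ℝ, ∃ D : NNReal, ∀ X ∈ coneBall θ δ₀,
      F X ≤ D * (H X + ew X (-1) * conv μ N F X + ew X (-Q)))
    (hH : ∃ D : NNReal, ∀ X ∈ coneBall θ δ₀, H X ≤ D * ew X s) {δ : ℝ} (hδ : 0 ≤ δ) (h : δ < δ₀) :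
    ∃ D : NNReal, ∀ X ∈ coneBall θ δ, F X ≤ D * ew X s := by
  obtain ⟨D₁, hD₁⟩ := hH
  have key : ∀ (k : ℕ) (δ : ℝ), 0 ≤ δ → δ < δ₀ → ∃ D : NNReal, ∀ X ∈ coneBall θ δ,
      F X ≤ D * ew X (max s (M - k)) := by
    intro k
    induction k with
    | zero =>
      intro δ _ _
      refine ⟨C, fun X _ => (hF X).trans ?_⟩
      gcongr
      exact ew_mono _ (le_max_of_le_right (by simp))
    | succ k ih =>
      intro δ hδ h
      have h1 : δ < (δ + δ₀) / 2 := by linarith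
      obtain ⟨N, hN⟩ := conv_le_cone μ hM hF θ hδ h1
        (ih ((δ + δ₀) / 2) (by linarith) (by linarith))
      obtain ⟨D₂, h2⟩ := hN N le_rfl
      obtain ⟨D, hD⟩ := hb N (-s)
      set t' := max s (M - ((k + 1 : ℕ) : ℝ)) with ht'
      refine ⟨D * (D₁ + D₂ + 1), fun X hX => ?_⟩
      have hX0 := coneBall_mono θ h.le hX
      have ht's : s ≤ t' := le_max_left _ _
      have ht't : -1 + max s (M - (k : ℝ)) ≤ t' := by
        rw [← max_add_add_left]
        refine max_le_max (by linarith) (by push_cast; linarith)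
      calc F X ≤ D * (H X + ew X (-1) * conv μ N F X + ew X (- -s)) := hD X hX0
        _ ≤ D * (D₁ * ew X s + ew X (-1) * (D₂ * ew X (max s (M - k))) + ew X s) := by
            rw [neg_neg]
            gcongr
            · exact hD₁ X hX0
            · exact h2 X hX
        _ = D * (D₁ * ew X s + D₂ * (ew X (-1) * ew X (max s (M - k))) + ew X s) := by ring
        _ ≤ D * (D₁ * ew X t' + D₂ * ew X t' + ew X t') := by
            rw [← ew_add]
            gcongr
            · exact ew_mono _ ht's
            · exact ew_mono _ ht't
            · exact ew_mono _ ht's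
        _ = _ := by push_cast; ring
  obtain ⟨k, hk⟩ := exists_nat_ge (M - s)
  have := key k δ hδ h
  rwa [max_eq_left (by linarith)] at this

end Localized

/-! ### Microlocal regularity in terms of the short-time Fourier transform -/

section Micro

variable {ι : Type*} [Fintype ι]

theorem enorm_le_ew {z : ℂ} {C : ℝ} {X : Phase ι} {s : ℝ} (h : ‖z‖ ≤ C * wt X ^ s) :
    ‖z‖ₑ ≤ C.toNNReal * ew X s := by
  rw [← ofReal_norm]
  refine (ENNReal.ofReal_le_ofReal h).trans (le_of_eq ?_)
  rw [ENNReal.ofReal_mul' (wt_rpow_pos _ _).le]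
  rfl

theorem norm_le_of_enorm_le_ew {z : ℂ} {C : NNReal} {X : Phase ι} {s : ℝ}
    (h : ‖z‖ₑ ≤ C * ew X s) : ‖z‖ ≤ C * wt X ^ s := by
  have := ENNReal.toReal_mono (by have := ew_ne_top X s; finiteness) h
  rw [toReal_enorm, ENNReal.toReal_mul, ew, ENNReal.toReal_ofReal (wt_rpow_pos _ _).le] at this
  simpa using this

theorem exists_enorm_coh_bound (u : 𝓢'(Eucl ι, ℂ)) : ∃ (C : NNReal) (M : ℝ), 0 ≤ M ∧
    ∀ X : Phase ι, ‖u (coh X)‖ₑ ≤ C * ew X M := by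
  obtain ⟨C, M, -, hM, h⟩ := exists_dist_coh_bound u
  exact ⟨C.toNNReal, M, hM, fun X => enorm_le_ew (h X)⟩

theorem measurable_enorm_coh (u : 𝓢'(Eucl ι, ℂ)) : Measurable fun X : Phase ι => ‖u (coh X)‖ₑ :=
  (continuous_dist_coh u).enorm.measurable

theorem symb_const (c : ℂ) : Symb 0 (fun _ : Phase ι => c) := by
  refine ⟨contDiff_const, fun k => ⟨‖c‖, fun X => ?_⟩⟩
  have := wt_pos X
  rcases Nat.eq_zero_or_pos k with rfl | hk
  · simp
  · rw [iteratedFDeriv_const_of_ne (by omega)]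
    simp only [Pi.zero_apply, norm_zero]
    positivity

theorem integrable_gker_mul {m : ℝ} {a : Phase ι → ℂ} (ha : Symb m a) (u : 𝓢'(Eucl ι, ℂ))
    (X : Phase ι) : Integrable fun Y => gker a X Y * u (coh Y) := by
  obtain ⟨C, M, hC, hM, hu⟩ := exists_dist_coh_bound u
  obtain ⟨D, hD, hg⟩ := norm_gker_le ha (M + intExp (Phase ι))
  have hi : Integrable (fun Y : Phase ι => wt (X - Y) ^ (-intExp (Phase ι))) :=
    ((integrable_wt (volume : Measure (Phase ι)) le_rfl).comp_sub_right X).congr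
      (Eventually.of_forall fun Y => by simp only [wt_sub_comm X Y])
  refine (hi.const_mul (D * wt X ^ m * C * wt X ^ M)).mono' ?_ (Eventually.of_forall fun Y => ?_)
  · have h1 : Continuous fun Y : Phase ι => (X, Y) := by fun_prop
    exact (((continuous_gker (abs_nonneg m) ha.polySymb).comp h1 :).mul
      (continuous_dist_coh u)).aestronglyMeasurable
  · have hX := wt_pos X
    have hY := wt_pos Y
    have hXY := wt_pos (X - Y)
    rw [norm_mul]
    have h1 : wt Y ^ M ≤ wt (X - Y) ^ M * wt X ^ M := by
      have := wt_rpow_peetre Y X M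
      rwa [abs_of_nonneg hM, wt_sub_comm] at this
    calc _ ≤ (D * wt X ^ m * wt (X - Y) ^ (-(M + intExp (Phase ι)))) *
          (C * (wt (X - Y) ^ M * wt X ^ M)) := by
          gcongr
          · exact hg X Y
          · exact (hu Y).trans (by gcongr)
      _ = D * wt X ^ m * C * wt X ^ M *
          (wt (X - Y) ^ (-(M + intExp (Phase ι))) * wt (X - Y) ^ M) := by ring
      _ = _ := by rw [← wt_rpow_add]; congr 2; ring

theorem enorm_integral_kernel_le {k : Phase ι → Phase ι → ℂ} {X : Phase ι} {C m N : ℝ}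
    (hk : ∀ Y, ‖k X Y‖ ≤ C * wt X ^ m * wt (X - Y) ^ (-N)) (u : 𝓢'(Eucl ι, ℂ)) :
    ‖∫ Y, k X Y * u (coh Y)‖ₑ ≤ C.toNNReal * (ew X m *
      conv volume N (fun Y => ‖u (coh Y)‖ₑ) X) := by
  refine (enorm_integral_le_lintegral_enorm _).trans ?_
  rw [conv, ← mul_assoc, ← lintegral_const_mul' _ _ (by have := ew_ne_top X m; finiteness)]
  refine lintegral_mono fun Y => ?_
  rw [enorm_mul, ← mul_assoc]
  gcongr
  rw [← ofReal_norm]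
  refine (ENNReal.ofReal_le_ofReal (hk Y)).trans (le_of_eq ?_)
  rw [ENNReal.ofReal_mul' (wt_rpow_pos _ _).le, ENNReal.ofReal_mul' (wt_rpow_pos _ _).le]
  rfl

theorem enorm_weylImage_le {m : ℝ} {a : Phase ι → ℂ} (ha : Symb m a) {u v : 𝓢'(Eucl ι, ℂ)}
    (h : IsWeylImage a u v) (N : ℝ) : ∃ D : NNReal, ∀ X, ‖v (coh X)‖ₑ ≤ D * (ew X m *
      conv volume N (fun Y => ‖u (coh Y)‖ₑ) X) := by
  obtain ⟨C, -, hg⟩ := norm_gker_le ha N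
  refine ⟨C.toNNReal, fun X => ?_⟩
  rw [h.eq_integral (abs_nonneg m) ha.polySymb X]
  exact enorm_integral_kernel_le (k := gker a) (hg X) u

/-- Subtracting a(X) times the reproducing formula from the kernel formula for v leaves an integral
whose kernel is one order lower; then divide by a(X). The constant depends on u only through its
polynomial bound, so that the estimate can be used for sequences. -/
theorem elliptic_estimate_uniform {m : ℝ} {a : Phase ι → ℂ} (ha : Symb m a)
    {A : Set (Phase ι)} {c R : ℝ} (hc : 0 < c)
    (hell : ∀ X ∈ A, R ≤ ‖X‖ → c * wt X ^ m ≤ ‖a X‖) (N Q : ℝ) (C₀ : NNReal) {M : ℝ} (hM : 0 ≤ M) :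
    ∃ D : NNReal, ∀ u v : 𝓢'(Eucl ι, ℂ), IsWeylImage a u v →
      (∀ X, ‖u (coh X)‖ₑ ≤ C₀ * ew X M) → ∀ X ∈ A,
      ‖u (coh X)‖ₑ ≤ D * (ew X (-m) * ‖v (coh X)‖ₑ +
        ew X (-1) * conv volume N (fun Y => ‖u (coh Y)‖ₑ) X + ew X (-Q)) := by
  obtain ⟨C, hC, hg⟩ := norm_gker_sub_le ha N
  set c' : NNReal := c⁻¹.toNNReal with hc'
  -- For ‖X‖ < R nothing is known about the symbol, but there the polynomial bound on u is absorbed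
  -- in the last term.
  set D₂ : NNReal := C₀ * ((1 + |R|) ^ (M + |Q|)).toNNReal
  refine ⟨c' + c' * C.toNNReal + D₂, fun u v h hu X hX => ?_⟩
  set T := conv volume N (fun Y => ‖u (coh Y)‖ₑ) X with hT
  rcases le_or_gt R ‖X‖ with hR | hR
  · have h1 : a X * u (coh X) = v (coh X) -
        ∫ Y, (gker a X Y - a X * gker (fun _ => 1) X Y) * u (coh Y) := by
      have e1 := h.eq_integral (abs_nonneg m) ha.polySymb X
      have i1 := integrable_gker_mul ha u X
      have i2 := (integrable_gker_mul (symb_const 1) u X).const_mul (a X)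
      have e2 : ∫ Y, (gker a X Y - a X * gker (fun _ => 1) X Y) * u (coh Y) =
          v (coh X) - a X * u (coh X) := by
        rw [e1, dist_reproducing u X, ← integral_const_mul, ← integral_sub i1 i2]
        congr 1
        ext Y
        ring
      rw [e2]
      ring
    have h2 : ‖a X‖ₑ * ‖u (coh X)‖ₑ ≤ ‖v (coh X)‖ₑ + C.toNNReal * (ew X (m - 1) * T) := by
      rw [← enorm_mul, h1]
      exact (enorm_sub_le).trans (add_le_add le_rfl
        (enorm_integral_kernel_le (k := fun X Y => gker a X Y - a X * gker (fun _ => 1) X Y)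
          (hg X) u))
    have h3 : 1 ≤ c' * (ew X (-m) * ‖a X‖ₑ) := by
      have h4 := hell X hX hR
      have h5 : (1 : ℝ) ≤ c⁻¹ * (wt X ^ (-m) * ‖a X‖) := by
        rw [Real.rpow_neg (wt_pos X).le, ← mul_assoc, ← mul_inv, ← div_eq_inv_mul,
          one_le_div (mul_pos hc (wt_rpow_pos _ _))]
        exact h4
      have h6 := ENNReal.ofReal_le_ofReal h5
      rw [ENNReal.ofReal_one, ENNReal.ofReal_mul (by positivity),
        ENNReal.ofReal_mul (wt_rpow_pos _ _).le, ofReal_norm] at h6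
      exact h6
    calc ‖u (coh X)‖ₑ ≤ (c' * (ew X (-m) * ‖a X‖ₑ)) * ‖u (coh X)‖ₑ := le_mul_of_one_le_left' h3
      _ = c' * ew X (-m) * (‖a X‖ₑ * ‖u (coh X)‖ₑ) := by ring
      _ ≤ c' * ew X (-m) * (‖v (coh X)‖ₑ + C.toNNReal * (ew X (m - 1) * T)) := by gcongr
      _ = c' * (ew X (-m) * ‖v (coh X)‖ₑ) +
          (c' * C.toNNReal) * ((ew X (-m) * ew X (m - 1)) * T) := by ring
      _ = c' * (ew X (-m) * ‖v (coh X)‖ₑ) + (c' * C.toNNReal) * (ew X (-1) * T) := by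
          rw [← ew_add]; congr 4; ring
      _ ≤ (c' + c' * C.toNNReal + D₂ : NNReal) * (ew X (-m) * ‖v (coh X)‖ₑ) +
          (c' + c' * C.toNNReal + D₂ : NNReal) * (ew X (-1) * T) := by
          gcongr
          · rw [add_assoc]
            exact le_self_add
          · norm_cast
            calc c' * C.toNNReal ≤ c' + c' * C.toNNReal := le_add_self
              _ ≤ _ := le_self_add
      _ ≤ _ := by
          rw [← mul_add]
          exact mul_le_mul_right le_self_add _
  · have hw : wt X ≤ 1 + |R| := by
      unfold wt
      linarith [le_abs_self R]
    have h1 : ew X M ≤ ((1 + |R|) ^ (M + |Q|)).toNNReal * ew X (-Q) := by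
      have h2 : wt X ^ M ≤ (1 + |R|) ^ (M + |Q|) * wt X ^ (-Q) := by
        have h3 : wt X ^ M = wt X ^ (M + Q) * wt X ^ (-Q) := by
          rw [← wt_rpow_add]; congr 1; ring
        rw [h3]
        have := wt_pos X
        gcongr
        calc wt X ^ (M + Q) ≤ wt X ^ (M + |Q|) := wt_rpow_le (by linarith [le_abs_self Q])
          _ ≤ _ := Real.rpow_le_rpow (wt_pos X).le hw (by positivity)
      refine (ENNReal.ofReal_le_ofReal h2).trans (le_of_eq ?_)
      rw [ENNReal.ofReal_mul (by positivity)]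
      rfl
    calc ‖u (coh X)‖ₑ ≤ C₀ * (((1 + |R|) ^ (M + |Q|)).toNNReal * ew X (-Q)) :=
          (hu X).trans (by gcongr)
      _ = D₂ * ew X (-Q) := by rw [← mul_assoc]; norm_cast
      _ ≤ _ := by
          gcongr
          · exact le_add_self
          · exact le_add_self

theorem elliptic_estimate {m : ℝ} {a : Phase ι → ℂ} (ha : Symb m a) {u v : 𝓢'(Eucl ι, ℂ)}
    (h : IsWeylImage a u v) {A : Set (Phase ι)} {c R : ℝ} (hc : 0 < c)
    (hell : ∀ X ∈ A, R ≤ ‖X‖ → c * wt X ^ m ≤ ‖a X‖) (N Q : ℝ) :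
    ∃ D : NNReal, ∀ X ∈ A, ‖u (coh X)‖ₑ ≤ D * (ew X (-m) * ‖v (coh X)‖ₑ +
      ew X (-1) * conv volume N (fun Y => ‖u (coh Y)‖ₑ) X + ew X (-Q)) := by
  obtain ⟨C₀, M, hM, hu⟩ := exists_enorm_coh_bound u
  obtain ⟨D, hD⟩ := elliptic_estimate_uniform ha hc hell N Q C₀ hM
  exact ⟨D, hD u v h hu⟩

/-- The symbol ⟨X⟩^s is elliptic in every direction, so the bootstrap applies on the whole space,
realised as a cone about 0. Conversely the kernel of the operator is ⟨X⟩^s times a rapidly decaying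
convolution kernel, to which Schur's test applies. -/
theorem mem_shubinSobolev_iff {s : ℝ} {u : 𝓢'(Eucl ι, ℂ)} : u ∈ shubinSobolev ι s ↔
    ∫⁻ X : Phase ι, (ew X s * ‖u (coh X)‖ₑ) ^ 2 < ⊤ := by
  obtain ⟨C₀, M, hM, hu⟩ := exists_enorm_coh_bound u
  have hsy := symb_japanese_rpow_ofReal (ι := ι) s
  constructor
  · rintro ⟨v, hv, hL2⟩
    have hv2 := (isL2_iff v).1 hL2
    have := bootstrap_sq (volume : Measure (Phase ι)) (F := fun X => ‖u (coh X)‖ₑ)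
      (H := fun X => ew X (-s) * ‖v (coh X)‖ₑ) (measurable_enorm_coh u)
      ((measurable_ew _).mul (measurable_enorm_coh v)) hM hu (0 : Phase ι) (δ₀ := 2) (s := s)
      (elliptic_estimate hsy hv (A := coneBall 0 2) (c := ((2 : ℝ) ^ |s|)⁻¹) (R := 0)
        (by positivity) (fun X _ _ => by
          rw [Complex.norm_real, Real.norm_of_nonneg (by have := japanese_pos X; positivity),
            inv_mul_le_iff₀ (by positivity)]
          exact wt_rpow_le_japanese X s))
      (by
        rw [coneBall_zero two_pos, Measure.restrict_univ]
        simp only [← mul_assoc, ew_mul_neg, one_mul]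
        exact hv2) (δ := 1) zero_le_one one_lt_two
    rwa [coneBall_zero one_pos, Measure.restrict_univ] at this
  · intro hs
    obtain ⟨v, hv⟩ := exists_weylImage (abs_nonneg s) hsy.polySymb u
    refine ⟨v, hv, (isL2_iff v).2 ?_⟩
    obtain ⟨D, hD⟩ := enorm_weylImage_le hsy hv (|s| + intExp (Phase ι))
    have h1 := conv_sq_lt_top (volume : Measure (Phase ι)) (measurable_enorm_coh u) hs le_rfl
    have h2 := lintegral_const_mul_sq_lt_top (volume : Measure (Phase ι)) D (A := univ)
      (by rwa [Measure.restrict_univ])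
    rw [Measure.restrict_univ] at h2
    exact lt_of_le_of_lt (lintegral_mono fun X => pow_le_pow_left' (hD X) 2) h2

end Micro

/-! ### Conic cutoffs and the characterisation of the wave front sets -/

section WaveFront

variable {ι : Type*} [Fintype ι]

theorem separation_swap {V : Type*} [NormedAddCommGroup V] {ε : ℝ} (hε : 0 < ε) {X Y : V}
    (h : ε * wt X ≤ wt (X - Y)) : (1 + ε⁻¹)⁻¹ * wt Y ≤ wt (Y - X) := by
  have h1 : wt Y ≤ wt (Y - X) + wt X := by
    unfold wt
    have := norm_add_le (Y - X) X
    rw [sub_add_cancel] at this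
    linarith
  have h2 : wt X ≤ ε⁻¹ * wt (Y - X) := by
    rw [wt_sub_comm, ← div_eq_inv_mul, le_div_iff₀ hε]
    linarith
  rw [inv_mul_le_iff₀ (by positivity)]
  linarith

/-- On B the symbol decays by hypothesis; off B the distance from X is at least comparable to ⟨X⟩,
so a power of that distance stands in for decay in X. -/
theorem norm_gker_le_of_separated {a : Phase ι → ℂ} (ha : Symb 0 a) {A B : Set (Phase ι)}
    (hB : ∀ (k : ℕ) (N : ℝ), ∃ C : ℝ, ∀ W ∈ B, ‖iteratedFDeriv ℝ k a W‖ ≤ C * wt W ^ (-N))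
    {ε : ℝ} (hε : 0 < ε) (hsep : ∀ X ∈ A, ∀ W ∉ B, ε * wt X ≤ wt (X - W)) (N : ℝ) :
    ∃ C : ℝ, 0 ≤ C ∧ ∀ X ∈ A, ∀ Y, ‖gker a X Y‖ ≤ C * wt X ^ (-N) * wt (X - Y) ^ (-N) := by
  refine norm_gker_le_of_rapid ha.1 (fun N => ⟨|N|, abs_nonneg N, fun k => ?_⟩) N
  obtain ⟨C₁, h1⟩ := hB k N
  obtain ⟨C₂, h2⟩ := ha.2 k
  refine ⟨|C₁| + |C₂| * (1 + ε⁻¹) ^ |N|, fun X hX W => ?_⟩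
  have p1 := wt_pos X
  have p2 := wt_pos (W - X)
  by_cases hW : W ∈ B
  · calc _ ≤ C₁ * wt W ^ (-N) := h1 W hW
      _ ≤ |C₁| * (wt (W - X) ^ |N| * wt X ^ (-N)) := by
          have p3 := wt_pos W
          have := wt_rpow_peetre W X (-N)
          rw [abs_neg] at this
          exact mul_le_mul (le_abs_self _) this (by positivity) (abs_nonneg _)
      _ = |C₁| * (wt X ^ (-N) * wt (W - X) ^ |N|) := by ring
      _ ≤ _ := by
          refine mul_le_mul_of_nonneg_right ?_ (by positivity)
          have : 0 ≤ |C₂| * (1 + ε⁻¹) ^ |N| := by positivity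
          linarith
  · have hw1 : ‖iteratedFDeriv ℝ k a W‖ ≤ |C₂| := by
      refine (h2 W).trans ?_
      have : wt W ^ ((0 : ℝ) - k) ≤ 1 := wt_rpow_le_one W (by simp)
      have p3 := wt_rpow_pos W ((0 : ℝ) - k)
      calc _ ≤ |C₂| * wt W ^ ((0 : ℝ) - k) := by gcongr; exact le_abs_self _
        _ ≤ |C₂| * 1 := by gcongr
        _ = _ := mul_one _
    have hx : wt X ≤ (1 + ε⁻¹) * wt (W - X) := by
      have := hsep X hX W hW
      rw [wt_sub_comm] at this
      have h3 : wt X ≤ ε⁻¹ * wt (W - X) := by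
        rw [← div_eq_inv_mul, le_div_iff₀ hε]; linarith
      nlinarith
    have hone : 1 ≤ (1 + ε⁻¹) ^ |N| * (wt X ^ (-N) * wt (W - X) ^ |N|) := by
      have h4 : wt X ^ N ≤ ((1 + ε⁻¹) * wt (W - X)) ^ |N| :=
        (wt_rpow_le (le_abs_self N)).trans (Real.rpow_le_rpow p1.le hx (abs_nonneg N))
      rw [Real.mul_rpow (by positivity) p2.le] at h4
      calc (1 : ℝ) = wt X ^ N * wt X ^ (-N) := (wt_rpow_mul_neg X N).symm
        _ ≤ ((1 + ε⁻¹) ^ |N| * wt (W - X) ^ |N|) * wt X ^ (-N) := by gcongr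
        _ = _ := by ring
    have p4 : 0 ≤ wt X ^ (-N) * wt (W - X) ^ |N| := by positivity
    calc _ ≤ |C₂| * 1 := by rw [mul_one]; exact hw1
      _ ≤ |C₂| * ((1 + ε⁻¹) ^ |N| * (wt X ^ (-N) * wt (W - X) ^ |N|)) := by gcongr
      _ = (|C₂| * (1 + ε⁻¹) ^ |N|) * (wt X ^ (-N) * wt (W - X) ^ |N|) := by ring
      _ ≤ _ := by
          refine mul_le_mul_of_nonneg_right ?_ p4
          have := abs_nonneg C₁
          linarith

theorem enorm_weylImage_le_of_rapid {a : Phase ι → ℂ} (ha : Symb 0 a) {u v : 𝓢'(Eucl ι, ℂ)}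
    (h : IsWeylImage a u v) {A : Set (Phase ι)}
    (hA : ∀ N : ℝ, ∃ C : ℝ, 0 ≤ C ∧ ∀ X ∈ A, ∀ Y,
      ‖gker a X Y‖ ≤ C * wt X ^ (-N) * wt (X - Y) ^ (-N)) (Q : ℝ) :
    ∃ D : NNReal, ∀ X ∈ A, ‖v (coh X)‖ₑ ≤ D * ew X (-Q) := by
  obtain ⟨C₀, M, hM, hu⟩ := exists_enorm_coh_bound u
  have hi := intExp_pos (Phase ι)
  obtain ⟨C, hC, hk⟩ := hA (M + intExp (Phase ι) + |Q|)
  obtain ⟨D, hD⟩ := conv_le_of_le (volume : Measure (Phase ι)) hu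
    (N := M + intExp (Phase ι) + |Q|) (by rw [abs_of_nonneg hM]; linarith [abs_nonneg Q])
  refine ⟨C.toNNReal * D, fun X hX => ?_⟩
  rw [h.eq_integral (abs_nonneg 0) ha.polySymb X]
  refine (enorm_integral_kernel_le (k := gker a) (hk X hX) u).trans ?_
  calc _ ≤ (C.toNNReal : ℝ≥0∞) * (ew X (-(M + intExp (Phase ι) + |Q|)) * (D * ew X M)) := by
        gcongr; exact hD X
    _ = C.toNNReal * D * (ew X (-(M + intExp (Phase ι) + |Q|)) * ew X M) := by ring
    _ = C.toNNReal * D * ew X (-(M + intExp (Phase ι) + |Q|) + M) := by rw [ew_add]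
    _ ≤ _ := by
        push_cast
        gcongr
        exact ew_mono _ (by linarith [le_abs_self Q])

theorem phaseNorm_smul {t : ℝ} (ht : 0 ≤ t) (X : Phase ι) : phaseNorm (t • X) = t * phaseNorm X := by
  have h := phaseNorm_sq X
  have h0 := phaseNorm_nonneg X
  unfold phaseNorm at *
  rw [Real.sqrt_eq_iff_mul_self_eq (by positivity) (by positivity)]
  simp only [Prod.smul_fst, Prod.smul_snd, norm_smul, Real.norm_of_nonneg ht]
  linear_combination (-1 : ℝ) * t ^ 2 * h

theorem phaseNorm_pos {X : Phase ι} (h : X ≠ 0) : 0 < phaseNorm X :=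
  (norm_pos_iff.2 h).trans_le (norm_le_phaseNorm X)

theorem continuous_phaseNorm : Continuous (phaseNorm : Phase ι → ℝ) := by
  unfold phaseNorm; fun_prop

/-- A bump on the compactified phase space, centred at the boundary direction of X₀, pulled back by
`dir`. -/
theorem exists_cutoff {X₀ : Phase ι} (h0 : X₀ ≠ 0) {δ : ℝ} (hδ : 0 < δ) :
    ∃ a : Phase ι → ℂ, Symb 0 a ∧
      (∀ (k : ℕ), ∀ W ∉ coneBall X₀ δ, iteratedFDeriv ℝ k a W = 0) ∧
      ∃ δ' > 0, ∃ R : ℝ, ∀ X ∈ coneBall X₀ δ', R ≤ ‖X‖ → a X = 1 := by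
  set r := phaseNorm X₀ with hr
  have hr0 : 0 < r := phaseNorm_pos h0
  -- Even twice the outer radius of the bump corresponds to points of the cone; off the cone the
  -- cutoff therefore vanishes near the point, together with all derivatives.
  set η := δ / (2 * r) with hη
  have hη0 : 0 < η := by positivity
  set θ : Phase ι := r⁻¹ • X₀ with hθ
  let f : ContDiffBump θ := ⟨η / 2, η, by positivity, by linarith⟩
  have hΘ : ContDiff ℝ ∞ (fun y => ((f y : ℝ) : ℂ)) := Complex.ofRealCLM.contDiff.comp f.contDiff
  have hc : HasCompactSupport (fun y => ((f y : ℝ) : ℂ)) :=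
    f.hasCompactSupport.comp_left (g := fun x : ℝ => (x : ℂ)) (by simp)
  have hsub : ∀ W : Phase ι, ‖dir W - θ‖ < 2 * η → W ∈ coneBall X₀ δ := by
    intro W hW
    refine ⟨r * japanese W ^ (-1 : ℝ), by have := japanese_pos W; positivity, ?_⟩
    have e : (r * japanese W ^ (-1 : ℝ)) • W - X₀ = r • (dir W - θ) := by
      rw [hθ, smul_sub, smul_smul, mul_inv_cancel₀ hr0.ne', one_smul, dir, smul_smul]
    rw [e, norm_smul, Real.norm_of_nonneg hr0.le]
    calc r * ‖dir W - θ‖ < r * (2 * η) := by gcongr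
      _ = δ := by rw [hη]; field_simp
  refine ⟨fun X => ((f (dir X) : ℝ) : ℂ), symb_dir.comp_compact hΘ hc, fun k W hW => ?_, ?_⟩
  · have hW' : 2 * η ≤ ‖dir W - θ‖ := not_lt.1 fun h => hW (hsub W h)
    have hopen : ∀ᶠ Z in 𝓝 W, η < ‖dir Z - θ‖ := by
      have hcont : Continuous fun Z : Phase ι => ‖dir Z - θ‖ :=
        (symb_dir.1.continuous.sub continuous_const).norm
      exact hcont.continuousAt.eventually (lt_mem_nhds (by linarith))
    have heq : (fun X : Phase ι => ((f (dir X) : ℝ) : ℂ)) =ᶠ[𝓝 W] fun _ => 0 := by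
      filter_upwards [hopen] with Z hZ
      rw [f.zero_of_le_dist (by rw [dist_eq_norm]; exact hZ.le), Complex.ofReal_zero]
    rw [(Filter.EventuallyEq.iteratedFDeriv (𝕜 := ℝ) heq k).self_of_nhds]
    simp
  · have hg : ContinuousAt (fun X : Phase ι => (phaseNorm X)⁻¹ • X) X₀ :=
      (continuous_phaseNorm.continuousAt.inv₀ hr0.ne').smul continuousAt_id
    obtain ⟨δ', hδ', hd⟩ := Metric.continuousAt_iff.1 hg (η / 4) (by positivity)
    refine ⟨δ', hδ', 4 / η, fun X ⟨t, ht, hX⟩ hR => ?_⟩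
    have hXpos : 0 < ‖X‖ := lt_of_lt_of_le (by positivity) hR
    have hX0 : X ≠ 0 := norm_pos_iff.1 hXpos
    have hp := phaseNorm_pos hX0
    have hj := japanese_pos X
    have h1 : ‖(phaseNorm X)⁻¹ • X - θ‖ < η / 4 := by
      have := hd (x := t • X) (by rwa [dist_eq_norm])
      rw [dist_eq_norm, phaseNorm_smul ht.le, smul_smul] at this
      have e : (t * phaseNorm X)⁻¹ * t = (phaseNorm X)⁻¹ := by field_simp
      rwa [e] at this
    have hsq := japanese_sq X
    have hsq' := phaseNorm_sq X
    have hjp : phaseNorm X ≤ japanese X := by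
      refine le_of_sq_le_sq ?_ hj.le
      rw [hsq, hsq']; linarith
    have hjp1 : japanese X ≤ phaseNorm X + 1 := by
      refine le_of_sq_le_sq ?_ (by positivity)
      rw [hsq]; nlinarith
    -- The compactification differs from the radial projection to the unit sphere by O(1/|X|), which
    -- explains the radius R = 4/η.
    have h2 : ‖dir X - (phaseNorm X)⁻¹ • X‖ ≤ η / 4 := by
      rw [dir, ← sub_smul, norm_smul, Real.rpow_neg_one, norm_sub_rev, Real.norm_of_nonneg
        (sub_nonneg.2 (by gcongr))]
      calc ((phaseNorm X)⁻¹ - (japanese X)⁻¹) * ‖X‖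
          ≤ ((phaseNorm X)⁻¹ - (japanese X)⁻¹) * phaseNorm X :=
            mul_le_mul_of_nonneg_left (norm_le_phaseNorm X) (sub_nonneg.2 (by gcongr))
        _ = (japanese X - phaseNorm X) / japanese X := by field_simp
        _ ≤ 1 / (4 / η) := by
            have : 4 / η ≤ japanese X := hR.trans ((norm_le_phaseNorm X).trans hjp)
            gcongr
            linarith
        _ = η / 4 := by field_simp
    have h3 : dir X ∈ Metric.closedBall θ f.rIn := by
      rw [mem_closedBall_iff_norm]
      change _ ≤ η / 2
      have e : dir X - θ = (dir X - (phaseNorm X)⁻¹ • X) + ((phaseNorm X)⁻¹ • X - θ) := by abel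
      rw [e]
      linarith [norm_add_le (dir X - (phaseNorm X)⁻¹ • X) ((phaseNorm X)⁻¹ • X - θ)]
    simp only [f.one_of_mem_closedBall h3, Complex.ofReal_one]

theorem isOpenCone_coneBall {X₀ : Phase ι} {δ : ℝ} (h : δ ≤ ‖X₀‖) : IsOpenCone (coneBall X₀ δ) :=
  ⟨⟨zero_notMem_coneBall h, fun _ ht _ hX => smul_mem_coneBall ht hX⟩, isOpen_coneBall _ _⟩

theorem exists_coneBall_subset {Γ : Set (Phase ι)} (hΓ : IsOpen Γ)
    (hc : ∀ t : ℝ, 0 < t → ∀ X ∈ Γ, t • X ∈ Γ) {X₀ : Phase ι} (h0 : X₀ ∈ Γ) :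
    ∃ δ > 0, coneBall X₀ δ ⊆ Γ := by
  obtain ⟨δ, hδ, hb⟩ := Metric.isOpen_iff.1 hΓ X₀ h0
  refine ⟨δ, hδ, fun X ⟨t, ht, hX⟩ => ?_⟩
  have h1 : t • X ∈ Γ := hb (by rwa [mem_ball_iff_norm])
  have := hc t⁻¹ (by positivity) _ h1
  rwa [smul_smul, inv_mul_cancel₀ ht.ne', one_smul] at this

theorem isEllipticAt_of_eq_one {a : Phase ι → ℂ} {X₀ : Phase ι} (h0 : X₀ ≠ 0) {δ R : ℝ}
    (hδ : 0 < δ) (h : ∀ X ∈ coneBall X₀ δ, R ≤ ‖X‖ → a X = 1) : IsEllipticAt 0 a X₀ := by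
  have hn : 0 < ‖X₀‖ := norm_pos_iff.2 h0
  refine ⟨coneBall X₀ (min δ ‖X₀‖), isOpenCone_coneBall (min_le_right _ _),
    mem_coneBall_self _ (lt_min hδ hn), 1, 2 * |R| + 1, one_pos, by positivity, fun X hX hR => ?_⟩
  rw [h X (coneBall_mono _ (min_le_left _ _) hX)]
  · simp
  · linarith [phaseNorm_le X, le_abs_self R]

theorem IsEllipticAt.exists_coneBall {a : Phase ι → ℂ} {X₀ : Phase ι} (h : IsEllipticAt 0 a X₀) :
    ∃ δ > 0, ∃ c > 0, ∃ R : ℝ, ∀ X ∈ coneBall X₀ δ, R ≤ ‖X‖ → c * wt X ^ (0 : ℝ) ≤ ‖a X‖ := by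
  obtain ⟨Γ, hΓ, hX, c, C, hc, -, h⟩ := h
  obtain ⟨δ, hδ, hs⟩ := exists_coneBall_subset hΓ.2 hΓ.1.2 hX
  refine ⟨δ, hδ, c, hc, C, fun X hX hR => ?_⟩
  simpa using h X (hs hX) (hR.trans (norm_le_phaseNorm X))

/-- A cutoff to `coneBall X₀ δ` has a rapidly decaying kernel off any larger cone. -/
theorem cutoff_gker_le {a : Phase ι → ℂ} (ha : Symb 0 a) {X₀ : Phase ι} {δ δ' : ℝ} (hδ : 0 ≤ δ)
    (h : δ < δ') (hz : ∀ k : ℕ, ∀ W ∉ coneBall X₀ δ, iteratedFDeriv ℝ k a W = 0) (N : ℝ) :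
    ∃ C : ℝ, 0 ≤ C ∧ ∀ X ∈ (coneBall X₀ δ')ᶜ, ∀ Y,
      ‖gker a X Y‖ ≤ C * wt X ^ (-N) * wt (X - Y) ^ (-N) := by
  obtain ⟨ε, hε, -, hs⟩ := coneBall_separation X₀ hδ h
  refine norm_gker_le_of_separated ha (B := (coneBall X₀ δ)ᶜ) (fun k N => ⟨0, fun W hW => ?_⟩)
    (ε := (1 + ε⁻¹)⁻¹) (by positivity) (fun X hX W hW => ?_) N
  · rw [hz k W hW]; simp
  · exact separation_swap hε (hs W (not_not.1 hW) X hX)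

/-- If an operator elliptic at X₀ maps u into B^s, the bootstrap improves u on a cone. Conversely a
conic cutoff of u lies in B^s: near X₀ its transform is controlled by that of u on the given cone,
and elsewhere the kernel of the cutoff decays rapidly. -/
theorem notMem_wfIsoOrder_iff {s : ℝ} {u : 𝓢'(Eucl ι, ℂ)} {X₀ : Phase ι} (h0 : X₀ ≠ 0) :
    X₀ ∉ wfIsoOrder s u ↔
      ∃ δ > 0, ∫⁻ X in coneBall X₀ δ, (ew X s * ‖u (coh X)‖ₑ) ^ 2 < ⊤ := by
  obtain ⟨C₀, M, hM, hu⟩ := exists_enorm_coh_bound u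
  constructor
  · intro h
    simp only [wfIsoOrder, mem_ofPred_eq, not_and, not_forall] at h
    obtain ⟨a, v, ha, hv, hvs, hch⟩ := h h0
    rw [charSet, mem_ofPred_eq, not_and, not_not] at hch
    obtain ⟨δ, hδ, c, hc, R, hell⟩ := (hch h0).exists_coneBall
    rw [isShubinSymbol_iff] at ha
    refine ⟨δ / 2, by positivity, ?_⟩
    refine bootstrap_sq (volume : Measure (Phase ι)) (F := fun X => ‖u (coh X)‖ₑ)
      (H := fun X => ew X (-0) * ‖v (coh X)‖ₑ) (measurable_enorm_coh u)
      ((measurable_ew _).mul (measurable_enorm_coh v)) hM hu X₀ (δ₀ := δ) (s := s)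
      (fun N Q => elliptic_estimate ha hv hc hell N Q) ?_ (by positivity) (by linarith)
    simp only [neg_zero, ew_zero, one_mul]
    exact lt_of_le_of_lt (setLIntegral_le_lintegral _ _) (mem_shubinSobolev_iff.1 hvs)
  · rintro ⟨δ, hδ, hint⟩ hmem
    -- Three nested apertures: the cutoff lives in δ/3, the splitting is at δ/2, and u is controlled
    -- in δ.
    obtain ⟨a, ha, hz, δ', hδ', R, hone⟩ := exists_cutoff h0 (δ := δ / 3) (by positivity)
    obtain ⟨v, hv⟩ := exists_weylImage (abs_nonneg 0) ha.polySymb u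
    refine (hmem.2 a v (isShubinSymbol_iff.2 ha) hv ?_).2 (isEllipticAt_of_eq_one h0 hδ' hone)
    rw [mem_shubinSobolev_iff]
    have hA : MeasurableSet (coneBall X₀ (δ / 2)) := (isOpen_coneBall X₀ (δ / 2)).measurableSet
    rw [← lintegral_add_compl _ hA]
    refine ENNReal.add_lt_top.2 ⟨?_, ?_⟩
    · obtain ⟨N₀, hN⟩ := conv_sq_lt_top_cone (volume : Measure (Phase ι)) (measurable_enorm_coh u)
        hM hu X₀ (δ := δ / 2) (δ' := δ) (by positivity) (by linarith) hint
      obtain ⟨D, hD⟩ := enorm_weylImage_le ha hv N₀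
      refine lt_of_le_of_lt (lintegral_mono fun X => ?_)
        (lintegral_const_mul_sq_lt_top _ D (hN N₀ le_rfl))
      refine pow_le_pow_left' ?_ 2
      calc _ ≤ ew X s * (D * (ew X 0 * conv volume N₀ (fun Y => ‖u (coh Y)‖ₑ) X)) := by
            gcongr; exact hD X
        _ = _ := by rw [ew_zero]; ring
    · obtain ⟨D, hD⟩ := enorm_weylImage_le_of_rapid ha hv
        (cutoff_gker_le ha (by positivity) (by linarith : δ / 3 < δ / 2) hz)
        (s + intExp (Phase ι))
      refine lt_of_le_of_lt (setLIntegral_mono' hA.compl fun X hX => ?_)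
        (lintegral_const_mul_sq_lt_top _ D (lintegral_ew_sq_lt_top volume (le_refl
          (-intExp (Phase ι))) (coneBall X₀ (δ / 2))ᶜ))
      refine pow_le_pow_left' ?_ 2
      calc _ ≤ ew X s * (D * ew X (-(s + intExp (Phase ι)))) := by gcongr; exact hD X hX
        _ = D * (ew X s * ew X (-(s + intExp (Phase ι)))) := by ring
        _ = _ := by rw [← ew_add]; ring_nf

theorem sdist_enorm_le (ψ : 𝓢(Eucl ι, ℂ)) (N : ℝ) :
    ∃ D : NNReal, ∀ X : Phase ι, ‖sdist ψ (coh X)‖ₑ ≤ D * ew X (-N) := by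
  obtain ⟨M, C, hC, h⟩ := stft_decay_rpow (E := Eucl ι) N
  exact ⟨_, fun X => enorm_le_ew (by rw [sdist_coh]; exact h ψ X)⟩

/-- The same argument with pointwise rapid decay; for the converse, rapid decay of the transform of
the cutoff distribution on all of phase space makes it a Schwartz function. -/
theorem notMem_wfIso_iff {u : 𝓢'(Eucl ι, ℂ)} {X₀ : Phase ι} (h0 : X₀ ≠ 0) :
    X₀ ∉ wfIso u ↔ ∃ δ > 0, ∀ N : ℝ, ∃ D : NNReal,
      ∀ X ∈ coneBall X₀ δ, ‖u (coh X)‖ₑ ≤ D * ew X (-N) := by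
  obtain ⟨C₀, M, hM, hu⟩ := exists_enorm_coh_bound u
  constructor
  · intro h
    simp only [wfIso, mem_ofPred_eq, not_and, not_forall] at h
    obtain ⟨a, f, ha, hv, hch⟩ := h h0
    rw [charSet, mem_ofPred_eq, not_and, not_not] at hch
    obtain ⟨δ, hδ, c, hc, R, hell⟩ := (hch h0).exists_coneBall
    rw [isShubinSymbol_iff] at ha
    refine ⟨δ / 2, by positivity, fun N => ?_⟩
    refine bootstrap_sup (volume : Measure (Phase ι)) (F := fun X => ‖u (coh X)‖ₑ)
      (H := fun X => ew X (-0) * ‖schwartzDist f (coh X)‖ₑ) hM hu X₀ (δ₀ := δ) (s := -N)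
      (fun N Q => elliptic_estimate ha hv hc hell N Q) ?_ (by positivity) (by linarith)
    simp only [neg_zero, ew_zero, one_mul]
    obtain ⟨D, hD⟩ := sdist_enorm_le f N
    exact ⟨D, fun X _ => hD X⟩
  · rintro ⟨δ, hδ, hint⟩ hmem
    obtain ⟨a, ha, hz, δ', hδ', R, hone⟩ := exists_cutoff h0 (δ := δ / 3) (by positivity)
    obtain ⟨v, hv⟩ := exists_weylImage (abs_nonneg 0) ha.polySymb u
    have hdec : ∀ N : ℝ, ∃ C : ℝ, ∀ X : Phase ι, ‖v (coh X)‖ ≤ C * wt X ^ (-N) := by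
      intro N
      obtain ⟨N₀, hN⟩ := conv_le_cone (volume : Measure (Phase ι)) hM hu X₀ (δ := δ / 2)
        (δ' := δ) (by positivity) (by linarith) (hint N)
      obtain ⟨D₁, hD₁⟩ := hN N₀ le_rfl
      obtain ⟨D₂, hD₂⟩ := enorm_weylImage_le ha hv N₀
      obtain ⟨D₃, hD₃⟩ := enorm_weylImage_le_of_rapid ha hv
        (cutoff_gker_le ha (by positivity) (by linarith : δ / 3 < δ / 2) hz) N
      refine ⟨((D₂ * D₁ + D₃ : NNReal) : ℝ), fun X => norm_le_of_enorm_le_ew ?_⟩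
      push_cast
      by_cases hX : X ∈ coneBall X₀ (δ / 2)
      · calc _ ≤ D₂ * (ew X 0 * conv volume N₀ (fun Y => ‖u (coh Y)‖ₑ) X) := hD₂ X
          _ ≤ D₂ * (D₁ * ew X (-N)) := by rw [ew_zero, one_mul]; gcongr; exact hD₁ X hX
          _ = D₂ * D₁ * ew X (-N) := by ring
          _ ≤ _ := by gcongr; exact le_self_add
      · refine (hD₃ X hX).trans ?_
        gcongr; exact le_add_self
    obtain ⟨ψ, hψ, -⟩ := exists_sdist_of_decay v hdec
    rw [hψ] at hv
    exact (hmem.2 a ψ (isShubinSymbol_iff.2 ha) hv).2 (isEllipticAt_of_eq_one h0 hδ' hone)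

end WaveFront

/-! ### Tensor products and product coordinates in phase space -/

section Tensor

variable {ι κ : Type*} [Fintype ι] [Fintype κ]

theorem norm_sq_eq_proj (z : Eucl (ι ⊕ κ)) :
    ‖z‖ ^ 2 = ‖projX ι κ z‖ ^ 2 + ‖projY ι κ z‖ ^ 2 := by
  simp only [EuclideanSpace.norm_sq_eq, Fintype.sum_sum_type]
  rfl

theorem norm_projX_le : ‖projX ι κ‖ ≤ 1 := by
  refine ContinuousLinearMap.opNorm_le_bound _ zero_le_one fun z => ?_
  rw [one_mul]
  refine le_of_sq_le_sq ?_ (norm_nonneg z)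
  rw [norm_sq_eq_proj z]
  linarith [sq_nonneg ‖projY ι κ z‖]

theorem norm_projY_le : ‖projY ι κ‖ ≤ 1 := by
  refine ContinuousLinearMap.opNorm_le_bound _ zero_le_one fun z => ?_
  rw [one_mul]
  refine le_of_sq_le_sq ?_ (norm_nonneg z)
  rw [norm_sq_eq_proj z]
  linarith [sq_nonneg ‖projX ι κ z‖]

theorem wt_le_proj (z : Eucl (ι ⊕ κ)) : wt z ≤ wt (projX ι κ z) * wt (projY ι κ z) := by
  unfold wt
  nlinarith [norm_le_proj z, norm_nonneg (projX ι κ z), norm_nonneg (projY ι κ z),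
    mul_nonneg (norm_nonneg (projX ι κ z)) (norm_nonneg (projY ι κ z))]

theorem schwartzTensor_apply (φ : 𝓢(Eucl ι, ℂ)) (ψ : 𝓢(Eucl κ, ℂ)) (z : Eucl (ι ⊕ κ)) :
    schwartzTensor φ ψ z = φ (projX ι κ z) * ψ (projY ι κ z) := rfl

theorem norm_iteratedFDeriv_schwartzTensor_le {N k n : ℕ} (hk : k ≤ N) (hn : n ≤ N)
    (φ : 𝓢(Eucl ι, ℂ)) (ψ : 𝓢(Eucl κ, ℂ)) (z : Eucl (ι ⊕ κ)) :
    ‖iteratedFDeriv ℝ n (schwartzTensor φ ψ) z‖ ≤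
      2 ^ N * (2 ^ N * sn N φ * wt (projX ι κ z) ^ (-(k : ℝ))) *
        (2 ^ N * sn N ψ * wt (projY ι κ z) ^ (-(k : ℝ))) := by
  have c1 : ContDiff ℝ ∞ (fun z => φ (projX ι κ z + 0)) :=
    (φ.smooth ⊤).comp ((projX ι κ).contDiff.add contDiff_const)
  have c2 : ContDiff ℝ ∞ (fun z => ψ (projY ι κ z + 0)) :=
    (ψ.smooth ⊤).comp ((projY ι κ).contDiff.add contDiff_const)
  have d1 : ∀ i ≤ N, ‖iteratedFDeriv ℝ i (fun z => φ (projX ι κ z + 0)) z‖ ≤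
      2 ^ N * sn N φ * wt (projX ι κ z) ^ (-(k : ℝ)) := fun i hi => by
    have := norm_iteratedFDeriv_le_sn hk hi φ (projX ι κ z + 0)
    rw [add_zero] at this
    refine le_trans ?_ this
    have := norm_iteratedFDeriv_comp_affine_le (φ.smooth ⊤) (projX ι κ) norm_projX_le 0 i z
    rwa [add_zero] at this
  have d2 : ∀ i ≤ N, ‖iteratedFDeriv ℝ i (fun z => ψ (projY ι κ z + 0)) z‖ ≤
      2 ^ N * sn N ψ * wt (projY ι κ z) ^ (-(k : ℝ)) := fun i hi => by
    have := norm_iteratedFDeriv_le_sn hk hi ψ (projY ι κ z + 0)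
    rw [add_zero] at this
    refine le_trans ?_ this
    have := norm_iteratedFDeriv_comp_affine_le (ψ.smooth ⊤) (projY ι κ) norm_projY_le 0 i z
    rwa [add_zero] at this
  have hb := norm_iteratedFDeriv_mul_le_of_le c1 c2 d1 d2 hn
  have e : (fun z => φ (projX ι κ z + 0) * ψ (projY ι κ z + 0)) = ⇑(schwartzTensor φ ψ) := by
    ext z
    rw [add_zero, add_zero, schwartzTensor_apply]
  rwa [e] at hb

theorem sn_schwartzTensor_le (N : ℕ) (φ : 𝓢(Eucl ι, ℂ)) (ψ : 𝓢(Eucl κ, ℂ)) :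
    sn N (schwartzTensor φ ψ) ≤ 2 ^ N * (2 ^ N * sn N φ) * (2 ^ N * sn N ψ) := by
  have h1 := sn_nonneg N φ
  have h2 := sn_nonneg N ψ
  have h3 : 0 ≤ 2 ^ N * (2 ^ N * sn N φ) * (2 ^ N * sn N ψ) := by positivity
  refine sn_le_of_bound h3 fun k hk n hn z => ?_
  have w1 := wt_pos (projX ι κ z)
  have w2 := wt_pos (projY ι κ z)
  have hb := norm_iteratedFDeriv_schwartzTensor_le hk hn φ ψ z
  have hw : wt z ^ (k : ℝ) ≤ wt (projX ι κ z) ^ (k : ℝ) * wt (projY ι κ z) ^ (k : ℝ) := by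
    rw [← Real.mul_rpow w1.le w2.le]
    exact Real.rpow_le_rpow (wt_pos z).le (wt_le_proj z) (Nat.cast_nonneg k)
  have e1 := wt_rpow_mul_neg (projX ι κ z) k
  have e2 := wt_rpow_mul_neg (projY ι κ z) k
  have h4 : 0 ≤ wt (projX ι κ z) ^ (k : ℝ) * wt (projY ι κ z) ^ (k : ℝ) := by positivity
  refine (mul_le_mul hw hb (norm_nonneg _) h4).trans (le_of_eq ?_)
  generalize wt (projX ι κ z) ^ (k : ℝ) = p at *
  generalize wt (projX ι κ z) ^ (-(k : ℝ)) = p' at *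
  generalize wt (projY ι κ z) ^ (k : ℝ) = q at *
  generalize wt (projY ι κ z) ^ (-(k : ℝ)) = q' at *
  generalize (2 : ℝ) ^ N = t at *
  calc _ = t * (t * sn N φ) * (t * sn N ψ) * (p * p') * (q * q') := by ring
    _ = _ := by rw [e1, e2, mul_one, mul_one]

/-- The distribution `ψ ↦ ⟨K, φ ⊗ ψ⟩`. -/
def pairLeft (K : 𝓢'(Eucl (ι ⊕ κ), ℂ)) (φ : 𝓢(Eucl ι, ℂ)) : 𝓢'(Eucl κ, ℂ) :=
  mkDist { toFun := fun ψ => K (schwartzTensor φ ψ)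
           map_add' := fun ψ ψ' => by
             rw [← map_add]; congr 1; ext z; exact mul_add _ _ _
           map_smul' := fun c ψ => by
             rw [RingHom.id_apply, ← map_smul]; congr 1; ext z; exact mul_left_comm _ _ _ } <| by
    obtain ⟨N, C, hC, h⟩ := exists_sn_bound K
    have h1 := sn_nonneg N φ
    refine ⟨N, C * (2 ^ N * (2 ^ N * sn N φ) * 2 ^ N), by positivity, fun ψ => (h _).trans ?_⟩
    calc _ ≤ C * (2 ^ N * (2 ^ N * sn N φ) * (2 ^ N * sn N ψ)) := by
          gcongr; exact sn_schwartzTensor_le N φ ψ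
      _ = _ := by ring

@[simp] theorem pairLeft_apply (K : 𝓢'(Eucl (ι ⊕ κ), ℂ)) (φ : 𝓢(Eucl ι, ℂ)) (ψ : 𝓢(Eucl κ, ℂ)) :
    pairLeft K φ ψ = K (schwartzTensor φ ψ) := rfl

/-- The distribution `φ ↦ ⟨K, φ ⊗ ψ⟩`. -/
def pairRight (K : 𝓢'(Eucl (ι ⊕ κ), ℂ)) (ψ : 𝓢(Eucl κ, ℂ)) : 𝓢'(Eucl ι, ℂ) :=
  mkDist { toFun := fun φ => K (schwartzTensor φ ψ)
           map_add' := fun φ φ' => by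
             rw [← map_add]; congr 1; ext z; exact add_mul _ _ _
           map_smul' := fun c φ => by
             rw [RingHom.id_apply, ← map_smul]; congr 1; ext z; exact mul_assoc _ _ _ } <| by
    obtain ⟨N, C, hC, h⟩ := exists_sn_bound K
    have h1 := sn_nonneg N ψ
    refine ⟨N, C * (2 ^ N * 2 ^ N * (2 ^ N * sn N ψ)), by positivity, fun φ => (h _).trans ?_⟩
    calc _ ≤ C * (2 ^ N * (2 ^ N * sn N φ) * (2 ^ N * sn N ψ)) := by
          gcongr; exact sn_schwartzTensor_le N φ ψ
      _ = _ := by ring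

@[simp] theorem pairRight_apply (K : 𝓢'(Eucl (ι ⊕ κ), ℂ)) (φ : 𝓢(Eucl ι, ℂ)) (ψ : 𝓢(Eucl κ, ℂ)) :
    pairRight K ψ φ = K (schwartzTensor φ ψ) := rfl

/-- The product coordinates `(x, ξ), (y, η) ↦ (x, y, ξ, η)` of phase space. -/
def joinPhase (ι κ : Type*) [Fintype ι] [Fintype κ] :
    (Phase ι × Phase κ) ≃L[ℝ] Phase (ι ⊕ κ) :=
  LinearEquiv.toContinuousLinearEquiv
    { toFun := fun Z => (pairXY Z.1.1 Z.2.1, pairXY Z.1.2 Z.2.2)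
      invFun := fun W => ((projX ι κ W.1, projX ι κ W.2), (projY ι κ W.1, projY ι κ W.2))
      map_add' := fun Z Z' => by
        ext i <;> rcases i with i | i <;> rfl
      map_smul' := fun c Z => by
        ext i <;> rcases i with i | i <;> rfl
      left_inv := fun Z => rfl
      right_inv := fun W => by
        ext i <;> rcases i with i | i <;> rfl }

theorem joinPhase_apply (Z : Phase ι × Phase κ) :
    joinPhase ι κ Z = (pairXY Z.1.1 Z.2.1, pairXY Z.1.2 Z.2.2) := rfl

/-- Squared norms and inner products add over the two groups of coordinates, so Gaussians factor.
The transform of a kernel is therefore its matrix element between coherent states. -/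
theorem coh_joinPhase (X : Phase ι) (Y : Phase κ) :
    coh (joinPhase ι κ (X, Y)) = schwartzTensor (coh X) (coh Y) := by
  ext z
  rw [schwartzTensor_apply, coh_apply, coh_apply, coh_apply, ← Complex.exp_add]
  congr 1
  simp only [cohExp, joinPhase_apply]
  have h1 : ‖z - pairXY X.1 Y.1‖ ^ 2 = ‖projX ι κ z - X.1‖ ^ 2 + ‖projY ι κ z - Y.1‖ ^ 2 :=
    norm_sq_eq_proj _
  have h2 : inner ℝ z (pairXY X.2 Y.2) = inner ℝ (projX ι κ z) X.2 + inner ℝ (projY ι κ z) Y.2 := by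
    simp only [PiLp.inner_apply, Fintype.sum_sum_type]
    rfl
  rw [h1, h2]
  push_cast
  ring

/-- The short-time Fourier transform of a kernel, in product coordinates. -/
def kerSize (K : 𝓢'(Eucl (ι ⊕ κ), ℂ)) (Z : Phase ι × Phase κ) : ℝ≥0∞ := ‖K (coh (joinPhase ι κ Z))‖ₑ

theorem measurable_kerSize (K : 𝓢'(Eucl (ι ⊕ κ), ℂ)) : Measurable (kerSize K) :=
  (measurable_enorm_coh K).comp (joinPhase ι κ).continuous.measurable

theorem coneBall_preimage {V W : Type*} [NormedAddCommGroup V] [NormedSpace ℝ V]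
    [NormedAddCommGroup W] [NormedSpace ℝ W] (T : V →L[ℝ] W) (θ : V) {δ : ℝ} (hδ : 0 < δ) :
    ∃ δ' > 0, ∀ Z ∈ coneBall θ δ', T Z ∈ coneBall (T θ) δ := by
  refine ⟨δ / (‖T‖ + 1), by positivity, fun Z ⟨t, ht, hZ⟩ => ⟨t, ht, ?_⟩⟩
  rw [← map_smul, ← map_sub]
  rw [lt_div_iff₀ (by positivity)] at hZ
  have := T.le_opNorm (t • Z - θ)
  nlinarith [norm_nonneg (t • Z - θ)]

/-- The phase space of the product and the product of the phase spaces carry different norms;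
weights for the two are comparable. -/
theorem ew_equiv_le {V W : Type*} [NormedAddCommGroup V] [NormedSpace ℝ V]
    [NormedAddCommGroup W] [NormedSpace ℝ W] (T : V ≃L[ℝ] W) (s : ℝ) :
    ∃ C : NNReal, ∀ Z, ew Z s ≤ C * ew (T Z) s ∧ ew (T Z) s ≤ C * ew Z s := by
  set c : ℝ := 1 + ‖(T : V →L[ℝ] W)‖ + ‖(T.symm : W →L[ℝ] V)‖ with hc
  have n1 := norm_nonneg (T : V →L[ℝ] W)
  have n2 := norm_nonneg (T.symm : W →L[ℝ] V)
  have h1 : ∀ Z, wt (T Z) ≤ c * wt Z := fun Z => by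
    have := (T : V →L[ℝ] W).le_opNorm Z
    have h0 := norm_nonneg Z
    simp only [ContinuousLinearEquiv.coe_coe] at this
    unfold wt
    rw [hc]
    nlinarith [mul_nonneg n1 h0, mul_nonneg n2 h0]
  have h2 : ∀ Z, wt Z ≤ c * wt (T Z) := fun Z => by
    have := (T.symm : W →L[ℝ] V).le_opNorm (T Z)
    have h0 := norm_nonneg (T Z)
    simp only [ContinuousLinearEquiv.coe_coe, ContinuousLinearEquiv.symm_apply_apply] at this
    unfold wt
    rw [hc]
    nlinarith [mul_nonneg n1 h0, mul_nonneg n2 h0]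
  have key : ∀ x y : ℝ, x ≤ c ^ |s| * y →
      ENNReal.ofReal x ≤ ((c ^ |s|).toNNReal : ℝ≥0∞) * ENNReal.ofReal y := fun x y h => by
    refine (ENNReal.ofReal_le_ofReal h).trans (le_of_eq ?_)
    rw [ENNReal.ofReal_mul (by positivity)]
    rfl
  refine ⟨(c ^ |s|).toNNReal, fun Z => ⟨key _ _ ?_, key _ _ ?_⟩⟩
  · exact rpow_le_of_comparable (wt_pos _) (wt_pos _) (by linarith) (h2 Z) (h1 Z) s
  · exact rpow_le_of_comparable (wt_pos _) (wt_pos _) (by linarith) (h1 Z) (h2 Z) s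

theorem kerSize_bound (K : 𝓢'(Eucl (ι ⊕ κ), ℂ)) : ∃ (C : NNReal) (M : ℝ), 0 ≤ M ∧
    ∀ Z, kerSize K Z ≤ C * ew Z M := by
  obtain ⟨C, M, hM, h⟩ := exists_enorm_coh_bound K
  obtain ⟨C', h'⟩ := ew_equiv_le (joinPhase ι κ) M
  refine ⟨C * C', M, hM, fun Z => (h _).trans ?_⟩
  push_cast
  rw [mul_assoc]
  gcongr
  exact (h' Z).2

theorem kerSize_rapid {K : 𝓢'(Eucl (ι ⊕ κ), ℂ)} {Z₀ : Phase ι × Phase κ} (h0 : Z₀ ≠ 0)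
    (h : joinPhase ι κ Z₀ ∉ wfIso K) : ∃ δ > 0, ∀ N : ℝ, ∃ D : NNReal,
      ∀ Z ∈ coneBall Z₀ δ, kerSize K Z ≤ D * ew Z (-N) := by
  obtain ⟨δ, hδ, hr⟩ := (notMem_wfIso_iff (by simpa using h0)).1 h
  obtain ⟨δ', hδ', hs⟩ := coneBall_preimage (joinPhase ι κ : Phase ι × Phase κ →L[ℝ] Phase (ι ⊕ κ)) Z₀ hδ
  refine ⟨δ', hδ', fun N => ?_⟩
  obtain ⟨D, hD⟩ := hr N
  obtain ⟨C', h'⟩ := ew_equiv_le (joinPhase ι κ) (-N)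
  refine ⟨D * C', fun Z hZ => (hD _ (hs Z hZ)).trans ?_⟩
  push_cast
  rw [mul_assoc]
  gcongr
  exact (h' Z).2

theorem kerSize_setLIntegral_lt_top {K : 𝓢'(Eucl (ι ⊕ κ), ℂ)} {s : ℝ} {A : Set (Phase (ι ⊕ κ))}
    (hA : MeasurableSet A) (h : ∫⁻ X in A, (ew X s * ‖K (coh X)‖ₑ) ^ 2 < ⊤) :
    ∫⁻ Z in joinPhase ι κ ⁻¹' A, (ew Z s * kerSize K Z) ^ 2 < ⊤ := by
  have hH : (volume : Measure (Phase ι × Phase κ)).IsAddHaarMeasure :=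
    isAddHaarMeasure_volume_prod
  obtain ⟨c, -, hc, hmp⟩ := exists_measurePreserving_smul (joinPhase ι κ)
    (volume : Measure (Phase ι × Phase κ))
    (volume : Measure (Phase (ι ⊕ κ)))
  obtain ⟨C', h'⟩ := ew_equiv_le (joinPhase ι κ) s
  have hm : Measurable fun X : Phase (ι ⊕ κ) => (ew X s * ‖K (coh X)‖ₑ) ^ 2 :=
    ((measurable_ew s).mul (measurable_enorm_coh K)).pow_const 2
  have h1 : ∫⁻ Z in joinPhase ι κ ⁻¹' A, (ew (joinPhase ι κ Z) s * kerSize K Z) ^ 2 < ⊤ := by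
    have := hmp.setLIntegral_comp_preimage hA hm
    refine lt_of_eq_of_lt this ?_
    rw [Measure.restrict_smul, lintegral_smul_measure]
    exact ENNReal.mul_lt_top (lt_top_iff_ne_top.2 hc) h
  refine lt_of_le_of_lt (lintegral_mono fun Z => ?_) (lintegral_const_mul_sq_lt_top _ C' h1)
  refine pow_le_pow_left' ?_ 2
  rw [← mul_assoc]
  gcongr
  exact (h' Z).1

theorem kerSize_sq_cone {K : 𝓢'(Eucl (ι ⊕ κ), ℂ)} {s : ℝ} {Z₀ : Phase ι × Phase κ} (h0 : Z₀ ≠ 0)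
    (h : joinPhase ι κ Z₀ ∉ wfIsoOrder s K) :
    ∃ δ > 0, ∫⁻ Z in coneBall Z₀ δ, (ew Z s * kerSize K Z) ^ 2 < ⊤ := by
  obtain ⟨δ, hδ, hr⟩ := (notMem_wfIsoOrder_iff (by simpa using h0)).1 h
  obtain ⟨δ', hδ', hs⟩ := coneBall_preimage (joinPhase ι κ : Phase ι × Phase κ →L[ℝ] Phase (ι ⊕ κ)) Z₀ hδ
  exact ⟨δ', hδ', lt_of_le_of_lt (lintegral_mono_set hs)
    (kerSize_setLIntegral_lt_top (isOpen_coneBall _ δ).measurableSet hr)⟩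

theorem kerSize_sq_lt_top {K : 𝓢'(Eucl (ι ⊕ κ), ℂ)} {s : ℝ} (h : K ∈ shubinSobolev (ι ⊕ κ) s) :
    ∫⁻ Z, (ew Z s * kerSize K Z) ^ 2 < ⊤ := by
  have := kerSize_setLIntegral_lt_top (K := K) (s := s) MeasurableSet.univ
    (by rw [setLIntegral_univ]; exact mem_shubinSobolev_iff.1 h)
  rwa [preimage_univ, setLIntegral_univ] at this

end Tensor

/-! ### Pairing of a function on a product with a function of the second variable -/

section ConePairing

variable {V W : Type*} [NormedAddCommGroup V] [NormedSpace ℝ V] [NormedAddCommGroup W]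
  [NormedSpace ℝ W]

theorem ew_comparable {x : V} {y : W} {c : ℝ} (hc : 1 ≤ c) (h1 : wt x ≤ c * wt y)
    (h2 : wt y ≤ c * wt x) (s : ℝ) : ew x s ≤ (c ^ |s|).toNNReal * ew y s := by
  refine (ENNReal.ofReal_le_ofReal
    (rpow_le_of_comparable (wt_pos x) (wt_pos y) hc h1 h2 s)).trans (le_of_eq ?_)
  rw [ENNReal.ofReal_mul (by positivity)]
  rfl

theorem ew_le_of_wt_le {x : V} {y : W} {c : ℝ} (hc : 1 ≤ c) (h : wt x ≤ c * wt y) {s : ℝ}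
    (hs : 0 ≤ s) : ew x s ≤ (c ^ s).toNNReal * ew y s := by
  have h1 := Real.rpow_le_rpow (wt_pos x).le h hs
  rw [Real.mul_rpow (by linarith) (wt_pos y).le] at h1
  refine (ENNReal.ofReal_le_ofReal h1).trans (le_of_eq ?_)
  rw [ENNReal.ofReal_mul (by positivity)]
  rfl

theorem ew_snd_le (Z : V × W) {s : ℝ} (hs : 0 ≤ s) : ew Z.2 s ≤ ew Z s := by
  simpa using ew_le_of_wt_le le_rfl ((wt_prod_snd_le Z).trans_eq (one_mul _).symm) hs

theorem ew_neg_le_of_wt_le {x : V} {y : W} (h : wt y ≤ wt x) {s : ℝ}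
    (hs : 0 ≤ s) : ew x (-s) ≤ ew y (-s) :=
  ENNReal.ofReal_le_ofReal (Real.rpow_le_rpow_of_nonpos (wt_pos y) h (by linarith))

theorem ew_prod_neg_le (Z : V × W) {a b : ℝ} (ha : 0 ≤ a) (hb : 0 ≤ b) :
    ew Z (-(a + b)) ≤ ew Z.1 (-a) * ew Z.2 (-b) := by
  rw [neg_add, ew_add]
  exact mul_le_mul' (ew_neg_le_of_wt_le (wt_prod_fst_le Z) ha)
    (ew_neg_le_of_wt_le (wt_prod_snd_le Z) hb)

/-- Near a direction that the projection does not annihilate, the projected component dominates the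
whole vector. -/
theorem wt_le_of_mem_coneBall {Z₀ Z : V} {δ : ℝ} (hδ : 0 < δ) (h : Z ∈ coneBall Z₀ δ)
    (π : V →L[ℝ] W) (hπ : ‖π‖ ≤ 1) (h2 : 2 * δ ≤ ‖π Z₀‖) :
    wt Z ≤ ((‖Z₀‖ + δ) / δ) * wt (π Z) := by
  obtain ⟨t, ht, hZ⟩ := h
  have h0 := norm_nonneg Z₀
  have h3 : t * ‖Z‖ ≤ ‖Z₀‖ + δ := by
    have := norm_add_le (t • Z - Z₀) Z₀
    rw [sub_add_cancel, norm_smul, Real.norm_of_nonneg ht.le] at this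
    linarith
  have h4 : δ ≤ t * ‖π Z‖ := by
    have h5 : ‖π (t • Z - Z₀)‖ ≤ ‖t • Z - Z₀‖ := by
      simpa using π.le_of_opNorm_le hπ (t • Z - Z₀)
    have h6 := norm_sub_norm_le (π Z₀) (π Z₀ - π (t • Z))
    rw [sub_sub_cancel, norm_sub_rev (π Z₀), ← map_sub, map_smul, norm_smul,
      Real.norm_of_nonneg ht.le] at h6
    linarith
  have h7 : ‖Z‖ ≤ ((‖Z₀‖ + δ) / δ) * ‖π Z‖ := by
    rw [div_mul_eq_mul_div, le_div_iff₀ hδ]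
    refine le_of_mul_le_mul_left ?_ ht
    calc t * (‖Z‖ * δ) = (t * ‖Z‖) * δ := by ring
      _ ≤ (‖Z₀‖ + δ) * (t * ‖π Z‖) := mul_le_mul h3 h4 hδ.le (by positivity)
      _ = _ := by ring
  have h8 : 1 ≤ (‖Z₀‖ + δ) / δ := by
    rw [le_div_iff₀ hδ]; linarith
  unfold wt
  linarith

theorem ew_le_of_mem_coneBall {Z₀ : V} {δ : ℝ} (hδ : 0 < δ)
    (π : V →L[ℝ] W) (hπ : ‖π‖ ≤ 1) (h2 : 2 * δ ≤ ‖π Z₀‖) (s : ℝ) :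
    ∃ C : NNReal, ∀ Z ∈ coneBall Z₀ δ, ew Z s ≤ C * ew (π Z) s ∧ ew (π Z) s ≤ C * ew Z s := by
  set c := (‖Z₀‖ + δ) / δ with hc
  have hc1 : 1 ≤ c := by
    rw [hc, le_div_iff₀ hδ]; linarith [norm_nonneg Z₀]
  refine ⟨(c ^ |s|).toNNReal, fun Z hZ => ?_⟩
  have h3 := wt_le_of_mem_coneBall hδ hZ π hπ h2
  have h4 : wt (π Z) ≤ c * wt Z := by
    have : ‖π Z‖ ≤ ‖Z‖ := by simpa using π.le_of_opNorm_le hπ Z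
    have h5 := wt_pos Z
    calc wt (π Z) ≤ 1 * wt Z := by unfold wt; linarith
      _ ≤ _ := by gcongr
  exact ⟨ew_comparable hc1 h3 h4 s, ew_comparable hc1 h4 h3 s⟩

theorem mem_coneBall_snd {Z₀ Z : V × W} {δ : ℝ} (h : Z ∈ coneBall Z₀ δ) : Z.2 ∈ coneBall Z₀.2 δ := by
  obtain ⟨t, ht, hZ⟩ := h
  exact ⟨t, ht, lt_of_le_of_lt (norm_snd_le (t • Z - Z₀)) hZ⟩

/-- The product `H(X, Y) G(Y)` decays rapidly for `(X, Y) ∈ A`. -/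
def RapidOn (H : V × W → ℝ≥0∞) (G : W → ℝ≥0∞) (A : Set (V × W)) : Prop :=
  ∀ N : ℝ, ∃ D : NNReal, ∀ Z ∈ A, H Z * G Z.2 ≤ D * ew Z (-N)

variable {H : V × W → ℝ≥0∞} {G : W → ℝ≥0∞} {C C' : NNReal} {M M' : ℝ}

theorem RapidOn.union {A B : Set (V × W)} (hA : RapidOn H G A) (hB : RapidOn H G B) :
    RapidOn H G (A ∪ B) := fun N => by
  obtain ⟨D₁, h1⟩ := hA N
  obtain ⟨D₂, h2⟩ := hB N
  refine ⟨D₁ + D₂, fun Z hZ => ?_⟩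
  push_cast
  rcases hZ with hZ | hZ
  · exact (h1 Z hZ).trans (mul_le_mul_left le_self_add _)
  · exact (h2 Z hZ).trans (mul_le_mul_left le_add_self _)

/-- One factor decays rapidly and the other grows polynomially. If it is G that decays, then Y₁ ≠ 0
makes ⟨Y⟩ comparable to ⟨(X, Y)⟩ on a narrow cone, so the decay in Y is decay in the pair. -/
theorem exists_rapidOn (hH : ∀ Z, H Z ≤ C * ew Z M) (hM' : 0 ≤ M')
    (hG : ∀ Y, G Y ≤ C' * ew Y M') {Y₁ : W} (h0 : Y₁ ≠ 0)
    (h : (∃ δ > 0, ∀ N : ℝ, ∃ D : NNReal, ∀ Z ∈ coneBall ((0 : V), Y₁) δ, H Z ≤ D * ew Z (-N)) ∨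
      ∃ δ > 0, ∀ N : ℝ, ∃ D : NNReal, ∀ Y ∈ coneBall Y₁ δ, G Y ≤ D * ew Y (-N)) :
    ∃ δ > 0, RapidOn H G (coneBall ((0 : V), Y₁) δ) := by
  rcases h with ⟨δ, hδ, h⟩ | ⟨δ, hδ, h⟩
  · refine ⟨δ, hδ, fun N => ?_⟩
    obtain ⟨D, hD⟩ := h (N + M')
    refine ⟨D * C', fun Z hZ => ?_⟩
    calc H Z * G Z.2 ≤ (D * ew Z (-(N + M'))) * (C' * ew Z M') :=
          mul_le_mul' (hD Z hZ) ((hG _).trans (mul_le_mul_right (ew_snd_le Z hM') _))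
      _ = (D * C' : NNReal) * (ew Z (-(N + M')) * ew Z M') := by push_cast; ring
      _ = _ := by rw [← ew_add]; congr 2; ring
  · have hn := norm_pos_iff.2 h0
    set δ' := min δ (‖Y₁‖ / 2) with hδ'
    have hp : 0 < δ' := lt_min hδ (by positivity)
    have h2 : 2 * δ' ≤ ‖(ContinuousLinearMap.snd ℝ V W) ((0 : V), Y₁)‖ := by
      have := min_le_right δ (‖Y₁‖ / 2)
      simp only [ContinuousLinearMap.coe_snd']
      linarith
    refine ⟨δ', hp, fun N => ?_⟩
    obtain ⟨D, hD⟩ := h (N + M)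
    obtain ⟨E, hE⟩ := ew_le_of_mem_coneBall hp (ContinuousLinearMap.snd ℝ V W)
      (ContinuousLinearMap.norm_snd_le ℝ V W) h2 (-(N + M))
    refine ⟨C * (D * E), fun Z hZ => ?_⟩
    calc H Z * G Z.2 ≤ (C * ew Z M) * (D * (E * ew Z (-(N + M)))) :=
          mul_le_mul' (hH Z) ((hD _ (mem_coneBall_snd
            (coneBall_mono _ (min_le_left _ _) hZ))).trans (mul_le_mul_right (hE Z hZ).2 _))
      _ = (C * (D * E) : NNReal) * (ew Z M * ew Z (-(N + M))) := by push_cast; ring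
      _ = _ := by rw [← ew_add]; congr 2; ring

theorem smul_mem_cone_iff {O : Set V} (hO : ∀ t : ℝ, 0 < t → ∀ X ∈ O, t • X ∈ O) {t : ℝ} (ht : 0 < t)
    {X : V} : t • X ∈ O ↔ X ∈ O := by
  refine ⟨fun h => ?_, hO t ht X⟩
  have := hO t⁻¹ (by positivity) _ h
  rwa [smul_smul, inv_mul_cancel₀ ht.ne', one_smul] at this

/-- A property of open cones that passes to subsets and unions and holds near each point of a compact
set holds on an open cone containing it. -/
theorem exists_open_cone_of_compact {P : Set V → Prop} {S : Set V} (hS : IsCompact S)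
    (h0 : P ∅) (hu : ∀ A B, IsOpen A → IsOpen B → P A → P B → P (A ∪ B))
    (hx : ∀ x ∈ S, ∃ θ : V, ∃ δ : ℝ, x ∈ coneBall θ δ ∧ P (coneBall θ δ)) :
    ∃ O : Set V, IsOpen O ∧ (∀ t : ℝ, 0 < t → ∀ X ∈ O, t • X ∈ O) ∧ S ⊆ O ∧ P O := by
  refine hS.induction_on (p := fun A => ∃ O : Set V, IsOpen O ∧
    (∀ t : ℝ, 0 < t → ∀ X ∈ O, t • X ∈ O) ∧ A ⊆ O ∧ P O) ?_ ?_ ?_ ?_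
  · exact ⟨∅, isOpen_empty, fun _ _ _ h => h, subset_rfl, h0⟩
  · rintro s t hst ⟨O, h1, h2, h3, h4⟩
    exact ⟨O, h1, h2, hst.trans h3, h4⟩
  · rintro s t ⟨O, h1, h2, h3, h4⟩ ⟨O', h1', h2', h3', h4'⟩
    refine ⟨O ∪ O', h1.union h1', fun r hr X hX => ?_, union_subset_union h3 h3',
      hu O O' h1 h1' h4 h4'⟩
    exact hX.imp (h2 r hr X) (h2' r hr X)
  · intro x hxS
    obtain ⟨θ, δ, hm, hP⟩ := hx x hxS
    exact ⟨coneBall θ δ, mem_nhdsWithin_of_mem_nhds ((isOpen_coneBall θ δ).mem_nhds hm),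
      coneBall θ δ, isOpen_coneBall θ δ, fun t ht X hX => smul_mem_coneBall ht hX, subset_rfl, hP⟩

/-- Finitely many cones cover the compact set of unit vectors (0, Y), and the resulting open cone
contains a uniform neighbourhood of it. -/
theorem exists_rapidOn_cone [FiniteDimensional ℝ W]
    (h : ∀ Y₁ : W, Y₁ ≠ 0 → ∃ δ > 0, RapidOn H G (coneBall ((0 : V), Y₁) δ)) :
    ∃ ε > 0, RapidOn H G {Z | ‖Z.1‖ < ε * ‖Z.2‖} := by
  have hS : IsCompact (({0} : Set V) ×ˢ Metric.sphere (0 : W) 1) :=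
    isCompact_singleton.prod (isCompact_sphere 0 1)
  obtain ⟨O, hO, hcone, hSO, hR⟩ := exists_open_cone_of_compact (P := RapidOn H G) hS
    (fun N => ⟨0, fun Z hZ => hZ.elim⟩) (fun _ _ _ _ => RapidOn.union) (by
      rintro ⟨X, Y⟩ ⟨hX, hY⟩
      rw [mem_singleton_iff] at hX
      have hY1 : Y ≠ 0 := by
        rintro rfl
        simp at hY
      obtain ⟨δ, hδ, hr⟩ := h Y hY1
      simp only at hX
      subst hX
      exact ⟨_, δ, mem_coneBall_self _ hδ, hr⟩)
  obtain ⟨ε, hε, hth⟩ := hS.exists_thickening_subset_open hO hSO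
  refine ⟨ε, hε, fun N => ?_⟩
  obtain ⟨D, hD⟩ := hR N
  refine ⟨D, fun Z hZ => hD Z ?_⟩
  have hpos : 0 < ‖Z.2‖ := by
    by_contra hcon
    have : ‖Z.2‖ = 0 := le_antisymm (not_lt.1 hcon) (norm_nonneg _)
    have h2 : ‖Z.1‖ < ε * ‖Z.2‖ := hZ
    rw [this, mul_zero] at h2
    exact absurd h2 (not_lt.2 (norm_nonneg _))
  rw [← smul_mem_cone_iff hcone (inv_pos.2 hpos)]
  refine hth (Metric.mem_thickening_iff.2 ⟨(0, ‖Z.2‖⁻¹ • Z.2), ⟨rfl, ?_⟩, ?_⟩)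
  · rw [mem_sphere_zero_iff_norm, norm_smul, norm_inv, norm_norm, inv_mul_cancel₀ hpos.ne']
  · have e : ‖Z.2‖⁻¹ • Z - (0, ‖Z.2‖⁻¹ • Z.2) = (‖Z.2‖⁻¹ • Z.1, (0 : W)) := by
      ext <;> simp
    rw [dist_eq_norm, e, Prod.norm_mk, norm_zero, norm_smul, norm_inv, norm_norm,
      max_eq_left (by positivity), inv_mul_lt_iff₀ hpos, mul_comm]
    exact hZ

/-- Where ‖X‖ < ε‖Y‖ the product decays rapidly. Elsewhere ‖Y‖ is controlled by ‖X‖, and a power of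
⟨X⟩ pays both for the growth of the factors and for the required decay in Y. -/
theorem pairing_bound (hM : 0 ≤ M) (hH : ∀ Z, H Z ≤ C * ew Z M) (hM' : 0 ≤ M')
    (hG : ∀ Y, G Y ≤ C' * ew Y M') {ε : ℝ} (hε : 0 < ε)
    (h : RapidOn H G {Z | ‖Z.1‖ < ε * ‖Z.2‖}) {b : ℝ} (hb : 0 ≤ b) :
    ∃ a : ℝ, ∃ D : NNReal, ∀ Z, H Z * G Z.2 ≤ D * (ew Z.1 a * ew Z.2 (-b)) := by
  obtain ⟨D, hD⟩ := h b
  set c : ℝ := 1 + ε⁻¹ with hc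
  have hc1 : 1 ≤ c := by rw [hc]; linarith [inv_pos.2 hε]
  refine ⟨M + (M' + b), D + C * C' * (c ^ M).toNNReal * (c ^ (M' + b)).toNNReal, fun Z => ?_⟩
  rcases lt_or_ge ‖Z.1‖ (ε * ‖Z.2‖) with hZ | hZ
  · calc H Z * G Z.2 ≤ D * ew Z (-b) := hD Z hZ
      _ ≤ D * (1 * ew Z.2 (-b)) := by
          rw [one_mul]
          exact mul_le_mul_right (ew_neg_le_of_wt_le (wt_prod_snd_le Z) hb) _
      _ ≤ (D + C * C' * (c ^ M).toNNReal * (c ^ (M' + b)).toNNReal : NNReal) *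
          (ew Z.1 (M + (M' + b)) * ew Z.2 (-b)) := by
          refine mul_le_mul' (by push_cast; exact le_self_add) (mul_le_mul_left ?_ _)
          rw [← ew_zero Z.1]
          exact ew_mono _ (by positivity)
  · have h2 : ‖Z.2‖ ≤ ε⁻¹ * ‖Z.1‖ := by
      rw [← div_eq_inv_mul, le_div_iff₀ hε]; linarith
    have n1 := norm_nonneg Z.1
    have hi := inv_pos.2 hε
    have w2 : wt Z.2 ≤ c * wt Z.1 := by
      unfold wt; rw [hc]; nlinarith
    have w1 : wt Z ≤ c * wt Z.1 := by
      have : ‖Z‖ ≤ c * ‖Z.1‖ := by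
        rw [Prod.norm_def, hc]
        refine max_le ?_ ?_ <;> nlinarith
      unfold wt at *
      nlinarith
    calc H Z * G Z.2 ≤ (C * ew Z M) * (C' * (ew Z.2 (M' + b) * ew Z.2 (-b))) := by
          refine mul_le_mul' (hH Z) ((hG Z.2).trans (le_of_eq ?_))
          rw [← ew_add]; congr 2; ring
      _ ≤ (C * ((c ^ M).toNNReal * ew Z.1 M)) *
          (C' * (((c ^ (M' + b)).toNNReal * ew Z.1 (M' + b)) * ew Z.2 (-b))) := by
          gcongr
          · exact ew_le_of_wt_le hc1 w1 hM
          · exact ew_le_of_wt_le hc1 w2 (by positivity)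
      _ = (C * C' * (c ^ M).toNNReal * (c ^ (M' + b)).toNNReal : NNReal) *
          ((ew Z.1 M * ew Z.1 (M' + b)) * ew Z.2 (-b)) := by push_cast; ring
      _ ≤ _ := by
          rw [← ew_add]
          exact mul_le_mul_left (by push_cast; exact le_add_self) _

end ConePairing

/-! ### Square integrability of the pairing over a cone in the first variable -/

section SquarePairing

variable {V W : Type*} [NormedAddCommGroup V] [NormedSpace ℝ V] [FiniteDimensional ℝ V]
  [MeasureSpace V] [BorelSpace V] [(volume : Measure V).IsAddHaarMeasure]
  [NormedAddCommGroup W] [NormedSpace ℝ W] [FiniteDimensional ℝ W]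
  [MeasureSpace W] [BorelSpace W] [(volume : Measure W).IsAddHaarMeasure]
  {H : V × W → ℝ≥0∞} {G : W → ℝ≥0∞} {C C' : NNReal} {M M' : ℝ}

/-- The part over `A` of the pairing `∫ H(X, Y) G(Y) dY` is square integrable with weight `s`. -/
def SqOn (H : V × W → ℝ≥0∞) (G : W → ℝ≥0∞) (s : ℝ) (A : Set (V × W)) : Prop :=
  ∫⁻ X : V, (ew X s * ∫⁻ Y : W, A.indicator (fun Z => H Z * G Z.2) (X, Y)) ^ 2 < ⊤

theorem measurable_pairing (hHm : Measurable H) (hGm : Measurable G) {A : Set (V × W)}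
    (hA : MeasurableSet A) : Measurable (A.indicator fun Z => H Z * G Z.2) :=
  (hHm.mul (hGm.comp measurable_snd)).indicator hA

theorem SqOn.union (hHm : Measurable H) (hGm : Measurable G) {s : ℝ} {A B : Set (V × W)}
    (hA : MeasurableSet A) (hsA : SqOn H G s A) (hsB : SqOn H G s B) : SqOn H G s (A ∪ B) := by
  have mA := measurable_pairing hHm hGm hA
  have h := lintegral_add_sq_lt_top (volume : Measure V)
    (f := fun X => ew X s * ∫⁻ Y : W, A.indicator (fun Z => H Z * G Z.2) (X, Y))
    (g := fun X => ew X s * ∫⁻ Y : W, B.indicator (fun Z => H Z * G Z.2) (X, Y)) (A := univ)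
    ((measurable_ew s).mul mA.lintegral_prod_right') (by rwa [setLIntegral_univ])
    (by rwa [setLIntegral_univ])
  rw [setLIntegral_univ] at h
  refine lt_of_le_of_lt (lintegral_mono fun X => pow_le_pow_left' ?_ 2) h
  have mX : Measurable fun Y => A.indicator (fun Z => H Z * G Z.2) (X, Y) :=
    mA.comp measurable_prodMk_left
  rw [← mul_add, ← lintegral_add_left mX]
  refine mul_le_mul_right (lintegral_mono fun Y => ?_) _
  by_cases h1 : (X, Y) ∈ A
  · simp [h1]
  · by_cases h2 : (X, Y) ∈ B <;> simp [h1, h2]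

theorem RapidOn.sqOn {A : Set (V × W)} (h : RapidOn H G A) (s : ℝ) : SqOn H G s A := by
  have i1 := intExp_pos V
  have i2 := intExp_pos W
  have hs := abs_nonneg s
  obtain ⟨D, hD⟩ := h ((|s| + intExp V) + intExp W)
  have hJ := lintegral_ew_lt_top (volume : Measure W) (s := -intExp W) le_rfl
  set J := ∫⁻ Y : W, ew Y (-intExp W) with hJdef
  have h1 := lintegral_const_mul_sq_lt_top (volume : Measure V) (D * J.toNNReal)
    (lintegral_ew_sq_lt_top volume (le_refl (-intExp V)) univ)
  rw [setLIntegral_univ] at h1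
  refine lt_of_le_of_lt (lintegral_mono fun X => pow_le_pow_left' ?_ 2) h1
  have h2 : ∀ Y : W, A.indicator (fun Z => H Z * G Z.2) (X, Y) ≤
      (D * ew X (-(|s| + intExp V))) * ew Y (-intExp W) := fun Y => by
    by_cases hZ : (X, Y) ∈ A
    · rw [indicator_of_mem hZ, mul_assoc]
      exact (hD _ hZ).trans (mul_le_mul_right
        (ew_prod_neg_le (X, Y) (by positivity) i2.le) _)
    · simp [hZ]
  have hc : (D * ew X (-(|s| + intExp V)) : ℝ≥0∞) ≠ ⊤ := by
    have := ew_ne_top X (-(|s| + intExp V))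
    finiteness
  calc _ ≤ ew X s * ((D * ew X (-(|s| + intExp V))) * J) := by
        rw [hJdef, ← lintegral_const_mul' _ _ hc]
        exact mul_le_mul_right (lintegral_mono h2) _
    _ = D * J * (ew X s * ew X (-(|s| + intExp V))) := by ring
    _ ≤ D * J * ew X (-intExp V) := by
        rw [← ew_add]
        exact mul_le_mul_right (ew_mono _ (by linarith [le_abs_self s])) _
    _ = _ := by
        push_cast
        rw [ENNReal.coe_toNNReal hJ.ne]

/-- Cauchy–Schwarz in Y for each X bounds the squared pairing by the Y-integral of p², and
integration in X then gives the integral of p² over A. -/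
theorem sqOn_of_cauchySchwarz {p : V × W → ℝ≥0∞} {q : W → ℝ≥0∞} (hp : Measurable p)
    (hq : Measurable q) {A : Set (V × W)} (hA : MeasurableSet A) {s : ℝ} {D : NNReal}
    (h : ∀ Z ∈ A, ew Z.1 s * (H Z * G Z.2) ≤ D * (p Z * q Z.2))
    (hp2 : ∫⁻ Z in A, p Z ^ 2 < ⊤) (hq2 : ∫⁻ Y, q Y ^ 2 < ⊤) : SqOn H G s A := by
  have mp : Measurable (A.indicator p) := hp.indicator hA
  have hD : (D : ℝ≥0∞) ^ 2 * ∫⁻ Y, q Y ^ 2 ≠ ⊤ := by finiteness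
  have h1 : ∫⁻ X : V, ∫⁻ Y : W, (A.indicator p (X, Y)) ^ 2 < ⊤ := by
    rw [← lintegral_indicator hA] at hp2
    have e : ∫⁻ Z, (A.indicator p Z) ^ 2 = ∫⁻ Z, A.indicator (fun Z => p Z ^ 2) Z := by
      congr 1
      ext Z
      by_cases hZ : Z ∈ A <;> simp [hZ]
    rw [← e, Measure.volume_eq_prod, lintegral_prod _ (mp.pow_const 2).aemeasurable] at hp2
    exact hp2
  have h2 : ∀ X : V, (ew X s * ∫⁻ Y : W, A.indicator (fun Z => H Z * G Z.2) (X, Y)) ^ 2 ≤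
      ((D : ℝ≥0∞) ^ 2 * ∫⁻ Y, q Y ^ 2) * ∫⁻ Y : W, (A.indicator p (X, Y)) ^ 2 := fun X => by
    calc _ ≤ (∫⁻ Y : W, D * (A.indicator p (X, Y) * q Y)) ^ 2 := by
          refine pow_le_pow_left' ?_ 2
          rw [← lintegral_const_mul' _ _ (ew_ne_top X s)]
          refine lintegral_mono fun Y => ?_
          by_cases hZ : (X, Y) ∈ A
          · simpa [hZ] using h _ hZ
          · simp [hZ]
      _ = (D : ℝ≥0∞) ^ 2 * (∫⁻ Y : W, A.indicator p (X, Y) * q Y) ^ 2 := by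
          rw [lintegral_const_mul' _ _ (by simp), mul_pow]
      _ ≤ (D : ℝ≥0∞) ^ 2 * ((∫⁻ Y : W, (A.indicator p (X, Y)) ^ 2) * ∫⁻ Y, q Y ^ 2) :=
          mul_le_mul_right (lintegral_mul_sq_le volume
            (mp.comp measurable_prodMk_left).aemeasurable hq.aemeasurable) _
      _ = _ := by ring
  refine lt_of_le_of_lt (lintegral_mono h2) ?_
  rw [lintegral_const_mul' _ _ hD]
  finiteness

/-- Since X₀ ≠ 0, the weight of X is comparable to that of Z = (X, Y) near this direction. Hence s₁
- r₂ powers of it split into s₁ powers for H and a loss of at most r₂ powers of ⟨Y⟩ for G. The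
direction Y₁ = 0 is allowed. -/
theorem exists_sqOn_left (hHm : Measurable H) (hGm : Measurable G) {X₀ : V} {Y₁ : W} (h0 : X₀ ≠ 0)
    {s₁ r₂ : ℝ} (hr : 0 ≤ r₂)
    (h : ∃ δ > 0, ∫⁻ Z in coneBall (X₀, Y₁) δ, (ew Z s₁ * H Z) ^ 2 < ⊤)
    (hG : ∫⁻ Y, (ew Y (-r₂) * G Y) ^ 2 < ⊤) {s : ℝ} (hs : s ≤ s₁ - r₂) :
    ∃ δ > 0, SqOn H G s (coneBall (X₀, Y₁) δ) := by
  obtain ⟨δ, hδ, h⟩ := h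
  have hn := norm_pos_iff.2 h0
  set δ' := min δ (‖X₀‖ / 2) with hδ'
  have hp : 0 < δ' := lt_min hδ (by positivity)
  have h2 : 2 * δ' ≤ ‖(ContinuousLinearMap.fst ℝ V W) (X₀, Y₁)‖ := by
    have := min_le_right δ (‖X₀‖ / 2)
    simp only [ContinuousLinearMap.coe_fst']
    linarith
  obtain ⟨E, hE⟩ := ew_le_of_mem_coneBall hp (ContinuousLinearMap.fst ℝ V W)
    (ContinuousLinearMap.norm_fst_le ℝ V W) h2 (s₁ - r₂)
  refine ⟨δ', hp, sqOn_of_cauchySchwarz (p := fun Z => ew Z s₁ * H Z)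
    (q := fun Y => ew Y (-r₂) * G Y) ((measurable_ew _).mul hHm) ((measurable_ew _).mul hGm)
    (isOpen_coneBall _ _).measurableSet (D := E) (fun Z hZ => ?_)
    (lt_of_le_of_lt (lintegral_mono_set (coneBall_mono _ (min_le_left _ _))) h) hG⟩
  calc ew Z.1 s * (H Z * G Z.2) ≤ (E * ew Z (s₁ - r₂)) * (H Z * G Z.2) :=
        mul_le_mul_left ((ew_mono _ hs).trans (hE Z hZ).2) _
    _ = E * (ew Z s₁ * ew Z (-r₂)) * (H Z * G Z.2) := by rw [sub_eq_add_neg, ew_add]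
    _ ≤ E * (ew Z s₁ * ew Z.2 (-r₂)) * (H Z * G Z.2) := by
        gcongr
        exact ew_neg_le_of_wt_le (wt_prod_snd_le Z) hr
    _ = _ := by ring

/-- With both components nonzero the weights of X, Y and Z are all comparable, so s₂ powers can be
given to G whatever the sign of s₂, and H takes the loss r₁. -/
theorem exists_sqOn_right (hHm : Measurable H) (hGm : Measurable G) {X₀ : V} {Y₁ : W} (h0 : X₀ ≠ 0)
    (h0' : Y₁ ≠ 0) {s₂ r₁ : ℝ} (hH : ∫⁻ Z, (ew Z (-r₁) * H Z) ^ 2 < ⊤)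
    (h : ∃ δ > 0, ∫⁻ Y in coneBall Y₁ δ, (ew Y s₂ * G Y) ^ 2 < ⊤) {s : ℝ} (hs : s ≤ s₂ - r₁) :
    ∃ δ > 0, SqOn H G s (coneBall (X₀, Y₁) δ) := by
  obtain ⟨δ, hδ, h⟩ := h
  have hn := norm_pos_iff.2 h0
  have hn' := norm_pos_iff.2 h0'
  set δ' := min δ (min (‖X₀‖ / 2) (‖Y₁‖ / 2)) with hδ'
  have hp : 0 < δ' := lt_min hδ (lt_min (by positivity) (by positivity))
  have hle : δ' ≤ min (‖X₀‖ / 2) (‖Y₁‖ / 2) := min_le_right _ _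
  have h2 : 2 * δ' ≤ ‖(ContinuousLinearMap.fst ℝ V W) (X₀, Y₁)‖ := by
    have := hle.trans (min_le_left _ _)
    simp only [ContinuousLinearMap.coe_fst']
    linarith
  have h3 : 2 * δ' ≤ ‖(ContinuousLinearMap.snd ℝ V W) (X₀, Y₁)‖ := by
    have := hle.trans (min_le_right _ _)
    simp only [ContinuousLinearMap.coe_snd']
    linarith
  obtain ⟨E, hE⟩ := ew_le_of_mem_coneBall hp (ContinuousLinearMap.fst ℝ V W)
    (ContinuousLinearMap.norm_fst_le ℝ V W) h2 (s₂ - r₁)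
  obtain ⟨E', hE'⟩ := ew_le_of_mem_coneBall hp (ContinuousLinearMap.snd ℝ V W)
    (ContinuousLinearMap.norm_snd_le ℝ V W) h3 s₂
  have hB : MeasurableSet (coneBall Y₁ δ) := (isOpen_coneBall _ _).measurableSet
  refine ⟨δ', hp, sqOn_of_cauchySchwarz (p := fun Z => ew Z (-r₁) * H Z)
    (q := (coneBall Y₁ δ).indicator fun Y => ew Y s₂ * G Y) ((measurable_ew _).mul hHm)
    (((measurable_ew _).mul hGm).indicator hB)
    (isOpen_coneBall _ _).measurableSet (D := E * E') (fun Z hZ => ?_)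
    (lt_of_le_of_lt (setLIntegral_le_lintegral _ _) hH) ?_⟩
  · rw [indicator_of_mem (mem_coneBall_snd (coneBall_mono _ (min_le_left _ _) hZ))]
    calc ew Z.1 s * (H Z * G Z.2) ≤ (E * ew Z (s₂ - r₁)) * (H Z * G Z.2) :=
          mul_le_mul_left ((ew_mono _ hs).trans (hE Z hZ).2) _
      _ = E * (ew Z s₂ * ew Z (-r₁)) * (H Z * G Z.2) := by rw [sub_eq_add_neg, ew_add]
      _ ≤ E * ((E' * ew Z.2 s₂) * ew Z (-r₁)) * (H Z * G Z.2) := by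
          gcongr
          exact (hE' Z hZ).1
      _ = _ := by push_cast; ring
  · rw [← lintegral_indicator hB] at h
    refine lt_of_eq_of_lt ?_ h
    congr 1
    ext Y
    by_cases hY : Y ∈ coneBall Y₁ δ <;> simp [hY]

/-- Scaling X close to X₀ moves (X, Y) close to a pair with first component exactly X₀, and
normalising that pair lands in the compact set of directions over the ray. The proximity is uniform
in Y because the normalising factor is at least ‖X₀‖. -/
theorem exists_coneBall_prod_subset {X₀ : V} (h0 : X₀ ≠ 0) {O : Set (V × W)} (hO : IsOpen O)
    (hcone : ∀ t : ℝ, 0 < t → ∀ Z ∈ O, t • Z ∈ O)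
    (hS : {Z : V × W | ‖Z‖ = 1 ∧ ∃ t ∈ Icc 0 ‖X₀‖⁻¹, Z.1 = t • X₀} ⊆ O)
    (hc : IsCompact {Z : V × W | ‖Z‖ = 1 ∧ ∃ t ∈ Icc 0 ‖X₀‖⁻¹, Z.1 = t • X₀}) :
    ∃ δ > 0, ∀ X ∈ coneBall X₀ δ, ∀ Y : W, (X, Y) ∈ O := by
  have hn := norm_pos_iff.2 h0
  obtain ⟨ε, hε, hth⟩ := hc.exists_thickening_subset_open hO hS
  refine ⟨ε * ‖X₀‖, by positivity, fun X ⟨t, ht, hX⟩ Y => ?_⟩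
  set ρ := ‖(X₀, t • Y)‖ with hρ
  have hρ0 : ‖X₀‖ ≤ ρ := norm_fst_le (X₀, t • Y)
  have hρ1 : 0 < ρ := hn.trans_le hρ0
  rw [← smul_mem_cone_iff hcone ht, ← smul_mem_cone_iff hcone (inv_pos.2 hρ1)]
  refine hth (Metric.mem_thickening_iff.2 ⟨ρ⁻¹ • (X₀, t • Y), ⟨?_, ρ⁻¹, ⟨by positivity, ?_⟩, rfl⟩, ?_⟩)
  · rw [norm_smul, norm_inv, hρ, norm_norm, inv_mul_cancel₀ hρ1.ne']
  · gcongr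
  · have e : ρ⁻¹ • t • (X, Y) - ρ⁻¹ • (X₀, t • Y) = (ρ⁻¹ • (t • X - X₀), (0 : W)) := by
      ext
      · simp [smul_sub]
      · simp
    rw [dist_eq_norm, e, Prod.norm_mk, norm_zero, norm_smul, norm_inv, Real.norm_of_nonneg hρ1.le,
      max_eq_left (by positivity), inv_mul_lt_iff₀ hρ1, mul_comm]
    exact hX.trans_le (mul_le_mul_of_nonneg_left hρ0 hε.le)

theorem isCompact_directions (X₀ : V) :
    IsCompact {Z : V × W | ‖Z‖ = 1 ∧ ∃ t ∈ Icc 0 ‖X₀‖⁻¹, Z.1 = t • X₀} := by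
  have h1 : IsCompact ((fun t : ℝ => t • X₀) '' Icc 0 ‖X₀‖⁻¹) :=
    isCompact_Icc.image (by fun_prop)
  have e : {Z : V × W | ‖Z‖ = 1 ∧ ∃ t ∈ Icc 0 ‖X₀‖⁻¹, Z.1 = t • X₀} =
      Metric.sphere 0 1 ∩ Prod.fst ⁻¹' ((fun t : ℝ => t • X₀) '' Icc 0 ‖X₀‖⁻¹) := by
    ext Z
    simp only [mem_ofPred_eq, mem_inter_iff, mem_sphere_zero_iff_norm, mem_preimage, mem_image]
    refine and_congr_right fun _ => exists_congr fun t => and_congr_right fun _ => eq_comm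
  rw [e]
  exact (isCompact_sphere _ _).inter_right (h1.isClosed.preimage continuous_fst)

/-- The directions over the ray of X₀ are compact once the limit directions (0, Y) are included.
These are treated by rapid decay; the others are, up to scaling, of the form (X₀, Y₁). A finite
cover then contains every pair (X, Y) with X in a conic neighbourhood of X₀. -/
theorem pairing_sq_lt_top (hHm : Measurable H) (hGm : Measurable G)
    (hrap : ∀ Y₁ : W, Y₁ ≠ 0 → ∃ δ > 0, RapidOn H G (coneBall ((0 : V), Y₁) δ))
    {X₀ : V} (h0 : X₀ ≠ 0) {s : ℝ}
    (h : ∀ Y₁ : W, ∃ δ > 0, SqOn H G s (coneBall (X₀, Y₁) δ)) :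
    ∃ δ > 0, ∫⁻ X in coneBall X₀ δ, (ew X s * ∫⁻ Y : W, H (X, Y) * G Y) ^ 2 < ⊤ := by
  have hc := isCompact_directions (W := W) X₀
  have hn := norm_pos_iff.2 h0
  obtain ⟨O, hO, hcone, hSO, hR⟩ := exists_open_cone_of_compact (P := SqOn H G s) hc
    (by simp [SqOn]) (fun A B hA _ => SqOn.union hHm hGm hA.measurableSet) (by
      rintro ⟨X, Y⟩ ⟨hZ, t, ht, hX⟩
      simp only at hX
      rcases ht.1.eq_or_lt with rfl | htpos
      · rw [zero_smul] at hX
        subst hX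
        have hY : Y ≠ 0 := by
          rintro rfl
          simp at hZ
        obtain ⟨δ, hδ, hr⟩ := hrap Y hY
        exact ⟨_, δ, mem_coneBall_self _ hδ, hr.sqOn s⟩
      · obtain ⟨δ, hδ, hr⟩ := h (t⁻¹ • Y)
        refine ⟨_, δ, ?_, hr⟩
        have e : (X, Y) = t • (X₀, t⁻¹ • Y) := by
          rw [Prod.smul_mk, smul_smul, mul_inv_cancel₀ htpos.ne', one_smul, hX]
        rw [e]
        exact smul_mem_coneBall htpos (mem_coneBall_self _ hδ))
  obtain ⟨δ, hδ, hsub⟩ := exists_coneBall_prod_subset h0 hO hcone hSO hc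
  refine ⟨δ, hδ, ?_⟩
  refine lt_of_le_of_lt ?_ (lt_of_le_of_lt (setLIntegral_le_lintegral (coneBall X₀ δ) _) hR)
  refine setLIntegral_mono' (isOpen_coneBall _ _).measurableSet fun X hX => ?_
  refine pow_le_pow_left' (mul_le_mul_right (lintegral_mono fun Y => ?_) _) 2
  rw [indicator_of_mem (hsub X hX Y)]

end SquarePairing

/-! ### The action of a kernel on distributions -/

section KernelAction

variable {ι κ : Type*} [Fintype ι] [Fintype κ]

theorem flipP_ne_zero {Y : Phase κ} (h : Y ≠ 0) : flipP Y ≠ 0 := fun h' => h <| by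
  rw [← flipP_flipP Y, h']
  simp [flipP]

theorem ew_flipP (Y : Phase κ) (s : ℝ) : ew (flipP Y) s = ew Y s := by
  unfold ew
  rw [wt_flipP]

theorem flipP_mem_coneBall {Y Y₁ : Phase κ} {δ : ℝ} (h : Y ∈ coneBall Y₁ δ) :
    flipP Y ∈ coneBall (flipP Y₁) δ := by
  obtain ⟨t, ht, hY⟩ := h
  refine ⟨t, ht, ?_⟩
  have e : t • flipP Y - flipP Y₁ = flipP (t • Y - Y₁) := by
    unfold flipP
    ext <;> simp
    ring
  have := wt_flipP (t • Y - Y₁)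
  unfold wt at this
  rw [e]
  linarith

/-- The size of the short-time Fourier transform of a distribution at the reflected point. -/
def flipSize (u : 𝓢'(Eucl κ, ℂ)) (Y : Phase κ) : ℝ≥0∞ := ‖u (coh (flipP Y))‖ₑ

theorem measurable_flipSize (u : 𝓢'(Eucl κ, ℂ)) : Measurable (flipSize u) :=
  (measurable_enorm_coh u).comp continuous_flipP.measurable

theorem flipSize_bound (u : 𝓢'(Eucl κ, ℂ)) : ∃ (C : NNReal) (M : ℝ), 0 ≤ M ∧
    ∀ Y, flipSize u Y ≤ C * ew Y M := by
  obtain ⟨C, M, hM, h⟩ := exists_enorm_coh_bound u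
  exact ⟨C, M, hM, fun Y => (h _).trans_eq (by rw [ew_flipP])⟩

theorem flipSize_rapid {u : 𝓢'(Eucl κ, ℂ)} {Y₁ : Phase κ} (h0 : Y₁ ≠ 0) (h : flipP Y₁ ∉ wfIso u) :
    ∃ δ > 0, ∀ N : ℝ, ∃ D : NNReal, ∀ Y ∈ coneBall Y₁ δ, flipSize u Y ≤ D * ew Y (-N) := by
  obtain ⟨δ, hδ, hr⟩ := (notMem_wfIso_iff (flipP_ne_zero h0)).1 h
  refine ⟨δ, hδ, fun N => (hr N).imp fun D hD Y hY => ?_⟩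
  exact (hD _ (flipP_mem_coneBall hY)).trans_eq (by rw [ew_flipP])

theorem flipSize_sq_lt_top {u : 𝓢'(Eucl κ, ℂ)} {s : ℝ} (h : u ∈ shubinSobolev κ s) :
    ∫⁻ Y, (ew Y s * flipSize u Y) ^ 2 < ⊤ := by
  have := mem_shubinSobolev_iff.1 h
  rw [← lintegral_flipP] at this
  simp only [ew_flipP] at this
  exact this

theorem flipSize_sq_cone {u : 𝓢'(Eucl κ, ℂ)} {s : ℝ} {Y₁ : Phase κ} (h0 : Y₁ ≠ 0)
    (h : flipP Y₁ ∉ wfIsoOrder s u) :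
    ∃ δ > 0, ∫⁻ Y in coneBall Y₁ δ, (ew Y s * flipSize u Y) ^ 2 < ⊤ := by
  obtain ⟨δ, hδ, hr⟩ := (notMem_wfIsoOrder_iff (flipP_ne_zero h0)).1 h
  refine ⟨δ, hδ, ?_⟩
  have hm : Measurable fun X : Phase κ => (ew X s * ‖u (coh X)‖ₑ) ^ 2 :=
    ((measurable_ew s).mul (measurable_enorm_coh u)).pow_const 2
  have e := (measurePreserving_flipP (E := Eucl κ)).setLIntegral_comp_preimage
    (isOpen_coneBall (flipP Y₁) δ).measurableSet hm
  simp only [ew_flipP] at e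
  rw [← e] at hr
  exact lt_of_le_of_lt (lintegral_mono_set fun Y hY => flipP_mem_coneBall hY) hr

/-- The reflection in the inversion formula is the same as the sign change of η in the definition of
`partY`. -/
theorem wfIso_inter_partY_iff {K : 𝓢'(Eucl (ι ⊕ κ), ℂ)} {u : 𝓢'(Eucl κ, ℂ)} :
    wfIso u ∩ partY (wfIso K) = ∅ ↔
      ∀ Y₁ : Phase κ, Y₁ ≠ 0 → joinPhase ι κ (0, Y₁) ∉ wfIso K ∨ flipP Y₁ ∉ wfIso u := by
  rw [eq_empty_iff_forall_notMem]
  constructor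
  · intro h Y₁ h0
    by_contra hcon
    rw [not_or, not_not, not_not] at hcon
    refine h (flipP Y₁) ⟨hcon.2, flipP_ne_zero h0, ?_⟩
    have := hcon.1
    simpa [joinPhase_apply, flipP] using this
  · rintro h Y ⟨hu, h0, hK⟩
    rcases h (flipP Y) (flipP_ne_zero h0) with h1 | h1
    · exact h1 hK
    · rw [flipP_flipP] at h1
      exact h1 hu

theorem enorm_cInv : ‖((cInv (Eucl ι) : ℝ) : ℂ)‖ₑ = ((cInv (Eucl ι)).toNNReal : ℝ≥0∞) := by
  rw [← ofReal_norm, Complex.norm_real, Real.norm_of_nonneg cInv_pos.le]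
  rfl

theorem exists_rapidOn_kerSize (K : 𝓢'(Eucl (ι ⊕ κ), ℂ)) {G : Phase κ → ℝ≥0∞} {C' : NNReal} {M' : ℝ}
    (hM' : 0 ≤ M') (hG : ∀ Y, G Y ≤ C' * ew Y M')
    (hA : ∀ Y₁ : Phase κ, Y₁ ≠ 0 → joinPhase ι κ (0, Y₁) ∉ wfIso K ∨
      ∃ δ > 0, ∀ N : ℝ, ∃ D : NNReal, ∀ Y ∈ coneBall Y₁ δ, G Y ≤ D * ew Y (-N))
    (Y₁ : Phase κ) (h0 : Y₁ ≠ 0) :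
    ∃ δ > 0, RapidOn (kerSize K) G (coneBall ((0 : Phase ι), Y₁) δ) := by
  obtain ⟨C, M, hM, hH⟩ := kerSize_bound K
  exact exists_rapidOn hH hM' hG h0
    ((hA Y₁ h0).imp_left (kerSize_rapid fun h => h0 (congrArg Prod.snd h)))

/-- Rapid decay of the pairing of a kernel with a function of the second variable. -/
theorem enorm_tensor_mul_le (K : 𝓢'(Eucl (ι ⊕ κ), ℂ)) {G : Phase κ → ℝ≥0∞} {C' : NNReal} {M' : ℝ}
    (hM' : 0 ≤ M') (hG : ∀ Y, G Y ≤ C' * ew Y M')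
    (hA : ∀ Y₁ : Phase κ, Y₁ ≠ 0 → joinPhase ι κ (0, Y₁) ∉ wfIso K ∨
      ∃ δ > 0, ∀ N : ℝ, ∃ D : NNReal, ∀ Y ∈ coneBall Y₁ δ, G Y ≤ D * ew Y (-N)) :
    ∃ (N : ℕ) (C : NNReal), ∀ (φ : 𝓢(Eucl ι, ℂ)) (Y : Phase κ),
      ‖K (schwartzTensor φ (coh Y))‖ₑ * G Y ≤
        C * ENNReal.ofReal (sn N φ) * ew Y (-intExp (Phase κ)) := by
  obtain ⟨C, M, hM, hH⟩ := kerSize_bound K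
  obtain ⟨ε, hε, hR⟩ := exists_rapidOn_cone (exists_rapidOn_kerSize K hM' hG hA)
  -- The decay in Y is chosen integrable. The growth a in X that it costs is absorbed by the
  -- transform of φ, whose seminorm index N is chosen accordingly.
  obtain ⟨a, D, hD⟩ := pairing_bound hM hH hM' hG hε hR (intExp_pos (Phase κ)).le
  obtain ⟨N, C₁, hC₁, hst⟩ := stft_decay_rpow (E := Eucl ι) (a + intExp (Phase ι))
  have hJ := lintegral_ew_lt_top (volume : Measure (Phase ι)) (s := -intExp (Phase ι)) le_rfl
  set J := ∫⁻ X : Phase ι, ew X (-intExp (Phase ι)) with hJdef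
  refine ⟨N, (cInv (Eucl ι)).toNNReal * (C₁.toNNReal * D) * J.toNNReal, fun φ Y => ?_⟩
  have h1 : K (schwartzTensor φ (coh Y)) = ((cInv (Eucl ι) : ℝ) : ℂ) *
      ∫ X, stft φ (flipP X) * K (coh (joinPhase ι κ (X, Y))) := by
    rw [← pairRight_apply, dist_inversion]
    simp only [pairRight_apply, coh_joinPhase]
  have hew : ew Y (-intExp (Phase κ)) ≠ ⊤ := ew_ne_top _ _
  have hGt : G Y ≠ ⊤ := ne_top_of_le_ne_top (by have := ew_ne_top Y M'; finiteness) (hG Y)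
  set B : ℝ≥0∞ := (C₁.toNNReal * D) * ENNReal.ofReal (sn N φ) * ew Y (-intExp (Phase κ)) with hB
  have hBt : B ≠ ⊤ := by finiteness
  have h2 : ∀ X, ‖stft φ (flipP X) * K (coh (joinPhase ι κ (X, Y)))‖ₑ * G Y ≤
      B * ew X (-intExp (Phase ι)) := fun X => by
    have h3 : ‖stft φ (flipP X)‖ₑ ≤ C₁.toNNReal * ENNReal.ofReal (sn N φ) *
        ew X (-(a + intExp (Phase ι))) := by
      have := enorm_le_ew (hst φ (flipP X))
      rwa [ew_flipP, Real.toNNReal_mul hC₁, ENNReal.coe_mul] at this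
    calc _ = ‖stft φ (flipP X)‖ₑ * (kerSize K (X, Y) * G Y) := by
          rw [enorm_mul, mul_assoc]; rfl
      _ ≤ (C₁.toNNReal * ENNReal.ofReal (sn N φ) * ew X (-(a + intExp (Phase ι)))) *
          (D * (ew X a * ew Y (-intExp (Phase κ)))) := mul_le_mul' h3 (hD (X, Y))
      _ = B * (ew X (-(a + intExp (Phase ι))) * ew X a) := by rw [hB]; ring
      _ = _ := by rw [← ew_add]; congr 2; ring
  calc _ = (cInv (Eucl ι)).toNNReal *
        (‖∫ X, stft φ (flipP X) * K (coh (joinPhase ι κ (X, Y)))‖ₑ * G Y) := by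
        rw [h1, enorm_mul, enorm_cInv, mul_assoc]
    _ ≤ (cInv (Eucl ι)).toNNReal *
        ((∫⁻ X, ‖stft φ (flipP X) * K (coh (joinPhase ι κ (X, Y)))‖ₑ) * G Y) := by
        gcongr
        exact enorm_integral_le_lintegral_enorm _
    _ = (cInv (Eucl ι)).toNNReal *
        ∫⁻ X, ‖stft φ (flipP X) * K (coh (joinPhase ι κ (X, Y)))‖ₑ * G Y := by
        rw [lintegral_mul_const' _ _ hGt]
    _ ≤ (cInv (Eucl ι)).toNNReal * (B * J) := by
        rw [hJdef, ← lintegral_const_mul' _ _ hBt]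
        exact mul_le_mul_right (lintegral_mono h2) _
    _ = _ := by
        rw [hB]
        push_cast
        rw [ENNReal.coe_toNNReal hJ.ne]
        ring

/-- The wave front sets of the distribution `u` and of the kernel `K` do not interact. -/
def Transversal (K : 𝓢'(Eucl (ι ⊕ κ), ℂ)) (u : 𝓢'(Eucl κ, ℂ)) : Prop :=
  ∀ Y₁ : Phase κ, Y₁ ≠ 0 → joinPhase ι κ (0, Y₁) ∉ wfIso K ∨ flipP Y₁ ∉ wfIso u

variable {K : 𝓢'(Eucl (ι ⊕ κ), ℂ)} {u : 𝓢'(Eucl κ, ℂ)}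

theorem Transversal.enorm_le (h : Transversal K u) : ∃ (N : ℕ) (C : NNReal),
    ∀ (φ : 𝓢(Eucl ι, ℂ)) (Y : Phase κ),
      ‖K (schwartzTensor φ (coh Y)) * u (coh (flipP Y))‖ₑ ≤
        C * ENNReal.ofReal (sn N φ) * ew Y (-intExp (Phase κ)) := by
  obtain ⟨C', M', hM', hG⟩ := flipSize_bound u
  obtain ⟨N, C, h⟩ := enorm_tensor_mul_le K hM' hG
    fun Y₁ h0 => (h Y₁ h0).imp_right (flipSize_rapid h0)
  exact ⟨N, C, fun φ Y => by rw [enorm_mul]; exact h φ Y⟩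

theorem Transversal.norm_le (h : Transversal K u) : ∃ (N : ℕ) (C : ℝ), 0 ≤ C ∧
    ∀ (φ : 𝓢(Eucl ι, ℂ)) (Y : Phase κ),
      ‖K (schwartzTensor φ (coh Y)) * u (coh (flipP Y))‖ ≤
        C * sn N φ * wt Y ^ (-intExp (Phase κ)) := by
  obtain ⟨N, C, h⟩ := h.enorm_le
  refine ⟨N, C, C.2, fun φ Y => ?_⟩
  have := norm_le_of_enorm_le_ew (C := C * (sn N φ).toNNReal) (by push_cast; exact h φ Y)
  push_cast at this
  rwa [Real.coe_toNNReal _ (sn_nonneg N φ)] at this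

theorem continuous_tensor_mul (K : 𝓢'(Eucl (ι ⊕ κ), ℂ)) (u : 𝓢'(Eucl κ, ℂ)) (φ : 𝓢(Eucl ι, ℂ)) :
    Continuous fun Y : Phase κ => K (schwartzTensor φ (coh Y)) * u (coh (flipP Y)) :=
  (continuous_dist_coh (pairLeft K φ)).mul
    ((continuous_dist_coh u).comp continuous_flipP :)

theorem Transversal.integrable (h : Transversal K u) (φ : 𝓢(Eucl ι, ℂ)) :
    Integrable fun Y : Phase κ => K (schwartzTensor φ (coh Y)) * u (coh (flipP Y)) := by
  obtain ⟨N, C, -, hN⟩ := h.norm_le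
  exact ((integrable_wt volume le_rfl).const_mul (C * sn N φ)).mono'
    (continuous_tensor_mul K u φ).aestronglyMeasurable (Eventually.of_forall fun Y => hN φ Y)

/-- The image of the distribution `u` under the operator with kernel `K`. -/
def applyKer (K : 𝓢'(Eucl (ι ⊕ κ), ℂ)) (u : 𝓢'(Eucl κ, ℂ)) (h : Transversal K u) :
    𝓢'(Eucl ι, ℂ) :=
  mkDist { toFun := fun φ => ((cInv (Eucl κ) : ℝ) : ℂ) *
             ∫ Y : Phase κ, K (schwartzTensor φ (coh Y)) * u (coh (flipP Y))
           map_add' := fun φ φ' => by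
             rw [← mul_add, ← integral_add (h.integrable φ) (h.integrable φ')]
             congr 2
             ext Y
             rw [← add_mul]
             congr 1
             exact map_add (pairRight K (coh Y)) φ φ'
           map_smul' := fun c φ => by
             rw [RingHom.id_apply, smul_eq_mul, mul_left_comm, ← integral_const_mul c]
             congr 2
             ext Y
             rw [← mul_assoc]
             congr 1
             exact map_smul (pairRight K (coh Y)) c φ } <| by
    obtain ⟨N, C, hC, hN⟩ := h.norm_le
    set J := ∫ Y : Phase κ, wt Y ^ (-intExp (Phase κ)) with hJ
    have hJ0 : 0 ≤ J := integral_nonneg fun Y => (wt_rpow_pos _ _).le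
    have hc := (cInv_pos (E := Eucl κ)).le
    refine ⟨N, cInv (Eucl κ) * C * J, by positivity, fun φ => ?_⟩
    have hi : Integrable fun Y : Phase κ => C * sn N φ * wt Y ^ (-intExp (Phase κ)) :=
      (integrable_wt volume le_rfl).const_mul _
    have h1 := norm_integral_le_of_norm_le hi (Eventually.of_forall fun Y => hN φ Y)
    rw [integral_const_mul] at h1
    calc _ = cInv (Eucl κ) *
          ‖∫ Y : Phase κ, K (schwartzTensor φ (coh Y)) * u (coh (flipP Y))‖ := by
          simp only [LinearMap.coe_mk, AddHom.coe_mk]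
          rw [norm_mul, Complex.norm_real, Real.norm_of_nonneg hc]
      _ ≤ cInv (Eucl κ) * (C * sn N φ * J) := by gcongr
      _ = _ := by ring

theorem applyKer_apply (h : Transversal K u) (φ : 𝓢(Eucl ι, ℂ)) :
    applyKer K u h φ = ((cInv (Eucl κ) : ℝ) : ℂ) *
      ∫ Y : Phase κ, K (schwartzTensor φ (coh Y)) * u (coh (flipP Y)) := rfl

/-- The inversion formula for the distribution ψ ↦ ⟨K, φ ⊗ ψ⟩, tested on f. -/
theorem applyKer_sdist (f : 𝓢(Eucl κ, ℂ)) (h : Transversal K (sdist f)) (φ : 𝓢(Eucl ι, ℂ)) :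
    applyKer K (sdist f) h φ = K (schwartzTensor φ f) := by
  rw [applyKer_apply, ← pairLeft_apply, dist_inversion]
  simp only [sdist_coh, pairLeft_apply]
  congr 2
  ext Y
  ring

/-- On coherent states the image is bounded by the pairing of the two transforms. For each Y₁ either
the kernel is of order s₁ at (X₀, Y₁) and u only of order -r₂, or Y₁ ≠ 0, u is of order s₂ and the
kernel only of order -r₁; the directions (0, Y) come from transversality. -/
theorem notMem_wfIsoOrder_applyKer (h : Transversal K u) {r₁ r₂ s₁ s₂ : ℝ}
    (hK : K ∈ shubinSobolev (ι ⊕ κ) (-r₁)) (hr₂ : 0 ≤ r₂) (hu : u ∈ shubinSobolev κ (-r₂))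
    {X₀ : Phase ι} (h0 : X₀ ≠ 0)
    (hX : ∀ Y₁ : Phase κ, joinPhase ι κ (X₀, Y₁) ∉ wfIsoOrder s₁ K ∨
      (Y₁ ≠ 0 ∧ flipP Y₁ ∉ wfIsoOrder s₂ u)) :
    X₀ ∉ wfIsoOrder (min (s₁ - r₂) (s₂ - r₁)) (applyKer K u h) := by
  have i1 : (volume : Measure (Phase ι)).IsAddHaarMeasure := isAddHaarMeasure_volume_prod
  have i2 : (volume : Measure (Phase κ)).IsAddHaarMeasure := isAddHaarMeasure_volume_prod
  obtain ⟨C', M', hM', hG⟩ := flipSize_bound u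
  rw [notMem_wfIsoOrder_iff h0]
  set s := min (s₁ - r₂) (s₂ - r₁) with hs
  have hrap := exists_rapidOn_kerSize K hM' hG
    fun Y₁ h0 => (h Y₁ h0).imp_right (flipSize_rapid h0)
  obtain ⟨δ, hδ, hint⟩ := pairing_sq_lt_top (measurable_kerSize K) (measurable_flipSize u) hrap h0
    (s := s) (fun Y₁ => by
      rcases hX Y₁ with h1 | ⟨h1, h2⟩
      · exact exists_sqOn_left (measurable_kerSize K) (measurable_flipSize u) h0 hr₂
          (kerSize_sq_cone (fun h => h0 (congrArg Prod.fst h)) h1) (flipSize_sq_lt_top hu)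
          (min_le_left _ _)
      · exact exists_sqOn_right (measurable_kerSize K) (measurable_flipSize u) h0 h1
          (kerSize_sq_lt_top hK) (flipSize_sq_cone h1 h2) (min_le_right _ _))
  refine ⟨δ, hδ, lt_of_le_of_lt (lintegral_mono fun X => ?_)
    (lintegral_const_mul_sq_lt_top _ (cInv (Eucl κ)).toNNReal hint)⟩
  refine pow_le_pow_left' ?_ 2
  rw [applyKer_apply, enorm_mul, enorm_cInv, mul_left_comm]
  refine mul_le_mul_right (mul_le_mul_right
    ((enorm_integral_le_lintegral_enorm _).trans (lintegral_mono fun Y => ?_)) _) _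
  rw [enorm_mul, ← coh_joinPhase]
  rfl

theorem wfIsoOrder_mono {s t : ℝ} (h : s ≤ t) (u : 𝓢'(Eucl ι, ℂ)) :
    wfIsoOrder s u ⊆ wfIsoOrder t u := by
  intro X hX
  by_contra hcon
  obtain ⟨δ, hδ, hi⟩ := (notMem_wfIsoOrder_iff hX.1).1 hcon
  refine (notMem_wfIsoOrder_iff hX.1).2 ⟨δ, hδ, lt_of_le_of_lt (lintegral_mono fun X => ?_) hi⟩ hX
  exact pow_le_pow_left' (mul_le_mul_left (ew_mono X h) _) 2

theorem wfIso_sdist (f : 𝓢(Eucl ι, ℂ)) : wfIso (sdist f) = ∅ := by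
  refine eq_empty_of_forall_notMem fun X hX => ?_
  refine (notMem_wfIso_iff hX.1).2 ⟨1, one_pos, fun N => ?_⟩ hX
  obtain ⟨D, hD⟩ := sdist_enorm_le f N
  exact ⟨D, fun X _ => hD X⟩

theorem sdist_sq_lt_top (f : 𝓢(Eucl ι, ℂ)) (s : ℝ) :
    ∫⁻ X : Phase ι, (ew X s * ‖sdist f (coh X)‖ₑ) ^ 2 < ⊤ := by
  obtain ⟨D, hD⟩ := sdist_enorm_le f (s + intExp (Phase ι))
  have h := lintegral_const_mul_sq_lt_top (volume : Measure (Phase ι)) D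
    (lintegral_ew_sq_lt_top volume (le_refl (-intExp (Phase ι))) univ)
  rw [setLIntegral_univ] at h
  refine lt_of_le_of_lt (lintegral_mono fun X => pow_le_pow_left' ?_ 2) h
  calc _ ≤ ew X s * (D * ew X (-(s + intExp (Phase ι)))) := by gcongr; exact hD X
    _ = D * (ew X s * ew X (-(s + intExp (Phase ι)))) := by ring
    _ = _ := by rw [← ew_add]; ring_nf

theorem sdist_mem_shubinSobolev (f : 𝓢(Eucl ι, ℂ)) (s : ℝ) : sdist f ∈ shubinSobolev ι s :=
  mem_shubinSobolev_iff.2 (sdist_sq_lt_top f s)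

theorem notMem_wfIsoOrder_sdist (f : 𝓢(Eucl ι, ℂ)) (s : ℝ) (X : Phase ι) :
    X ∉ wfIsoOrder s (sdist f) := fun hX =>
  (notMem_wfIsoOrder_iff hX.1).2 ⟨1, one_pos,
    lt_of_le_of_lt (setLIntegral_le_lintegral _ _) (sdist_sq_lt_top f s)⟩ hX

end KernelAction

open scoped BoundedContinuousFunction

/-! ### Sequential continuity -/

section UniformBound

variable {ι : Type*} [Fintype ι]

theorem summable_weights (X : ℕ → Phase ι) (M : ℝ) :
    Summable fun k : ℕ => wt (X k) ^ M * ((1 / 2 : ℝ) ^ k * wt (X k) ^ (-(k : ℝ))) := by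
  refine (summable_geometric_two).of_norm_bounded_eventually_nat ?_
  filter_upwards [eventually_ge_atTop ⌈M⌉₊] with k hk
  have hk' : M ≤ k := (Nat.le_ceil M).trans (by exact_mod_cast hk)
  have h1 := wt_pos (X k)
  rw [Real.norm_of_nonneg (by positivity)]
  calc _ = (1 / 2 : ℝ) ^ k * (wt (X k) ^ M * wt (X k) ^ (-(k : ℝ))) := by ring
    _ = (1 / 2 : ℝ) ^ k * wt (X k) ^ (M + -(k : ℝ)) := by rw [wt_rpow_add]
    _ ≤ (1 / 2 : ℝ) ^ k * 1 := by
        gcongr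
        exact wt_rpow_le_one _ (by linarith)
    _ = _ := mul_one _

/-- A pointwise bounded sequence of distributions is uniformly of polynomial growth in phase
space. -/
theorem exists_uniform_coh_bound {w : ℕ → 𝓢'(Eucl ι, ℂ)}
    (h : ∀ φ : 𝓢(Eucl ι, ℂ), ∃ B : ℝ, ∀ j, ‖w j φ‖ ≤ B) :
    ∃ (C : NNReal) (M : ℝ), 0 ≤ M ∧ ∀ j X, ‖w j (coh X)‖ₑ ≤ C * ew X M := by
  suffices hs : ∃ k : ℕ, ∀ j X, ‖w j (coh X)‖ ≤ (k * 2 ^ k : ℝ) * wt X ^ (k : ℝ) by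
    obtain ⟨k, hk⟩ := hs
    exact ⟨_, k, Nat.cast_nonneg k, fun j X => enorm_le_ew (hk j X)⟩
  by_contra hcon
  push Not at hcon
  choose J X hX using hcon
  -- The weights are small enough for ∑ c_k ρ_k coh (X_k) to converge in Schwartz space for every
  -- bounded c, yet the supposed failure makes ρ_k |w_j (coh X_k)| exceed k for j = J k.
  set ρ : ℕ → ℝ := fun k => (1 / 2 : ℝ) ^ k * wt (X k) ^ (-(k : ℝ)) with hρ
  have hρ0 : ∀ k, 0 < ρ k := fun k => by
    have := wt_pos (X k)
    positivity
  have hsum : ∀ j, Summable fun k => ρ k * ‖w j (coh (X k))‖ := fun j => by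
    obtain ⟨C, M, hC, hM, hb⟩ := exists_dist_coh_bound (w j)
    refine Summable.of_nonneg_of_le (fun k => by have := hρ0 k; positivity) (fun k => ?_)
      ((summable_weights X M).mul_left C)
    calc ρ k * ‖w j (coh (X k))‖ ≤ ρ k * (C * wt (X k) ^ M) :=
          mul_le_mul_of_nonneg_left (hb _) (hρ0 k).le
      _ = _ := by rw [hρ]; ring
  have hterm : ∀ (j : ℕ) (c : ℕ →ᵇ ℂ) (k : ℕ),
      ‖c k * ((ρ k : ℂ) * w j (coh (X k)))‖ ≤ ‖c‖ * (ρ k * ‖w j (coh (X k))‖) := fun j c k => by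
    rw [norm_mul, norm_mul, Complex.norm_real, Real.norm_of_nonneg (hρ0 k).le]
    have := hρ0 k
    gcongr
    exact c.norm_coe_le_norm k
  have hsc : ∀ (j : ℕ) (c : ℕ →ᵇ ℂ), Summable fun k => c k * ((ρ k : ℂ) * w j (coh (X k))) :=
    fun j c => Summable.of_norm_bounded ((hsum j).mul_left ‖c‖) (hterm j c)
  let L : ℕ → (ℕ →ᵇ ℂ) →L[ℂ] ℂ := fun j => LinearMap.mkContinuous
    { toFun := fun c => ∑' k, c k * ((ρ k : ℂ) * w j (coh (X k)))
      map_add' := fun c d => by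
        rw [← (hsc j c).tsum_add (hsc j d)]
        simp only [BoundedContinuousFunction.coe_add, Pi.add_apply, add_mul]
      map_smul' := fun r c => by
        rw [RingHom.id_apply, smul_eq_mul, ← tsum_mul_left]
        simp only [BoundedContinuousFunction.coe_smul, smul_eq_mul, mul_assoc] }
    (∑' k, ρ k * ‖w j (coh (X k))‖) (fun c => by
      refine (tsum_of_norm_bounded ((hsum j).mul_left ‖c‖).hasSum (hterm j c)).trans (le_of_eq ?_)
      rw [tsum_mul_left, mul_comm])
  have hL : ∀ j c, L j c = ∑' k, c k * ((ρ k : ℂ) * w j (coh (X k))) := fun _ _ => rfl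
  -- The uniform boundedness principle is applied on the Banach space of bounded sequences;
  -- pointwise boundedness holds because each value is w_j on the Schwartz function with those
  -- coefficients.
  obtain ⟨B, hB⟩ := banach_steinhaus (g := L) (fun c => by
    have hF : ∀ M : ℝ, Integrable (fun k => wt (X k) ^ M * ‖c k * (ρ k : ℂ)‖) Measure.count := by
      intro M
      rw [integrable_count_iff]
      refine Summable.of_nonneg_of_le (fun k => norm_nonneg _) (fun k => ?_)
        ((summable_weights X M).mul_left ‖c‖)
      have h1 := wt_pos (X k)
      have h2 := hρ0 k
      rw [Real.norm_of_nonneg (by positivity), norm_mul, Complex.norm_real,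
        Real.norm_of_nonneg h2.le]
      calc _ ≤ wt (X k) ^ M * (‖c‖ * ρ k) := by gcongr; exact c.norm_coe_le_norm k
        _ = _ := by rw [hρ]; ring
    obtain ⟨ψ, -, -, hψ⟩ := exists_superposition (μ := (Measure.count : Measure ℕ)) (Z := X)
      (F := fun k => c k * (ρ k : ℂ)) (measurable_of_countable _).aestronglyMeasurable
      (measurable_of_countable _).aestronglyMeasurable hF
    obtain ⟨B, hB⟩ := h ψ
    refine ⟨B, fun j => ?_⟩
    have e : L j c = w j ψ := by
      rw [hψ, hL, integral_countable]
      · simp [mul_assoc]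
      · rw [integrable_count_iff]
        simpa only [mul_assoc] using (hsc j c).norm
    rw [e]
    exact hB j)
  -- Unit sequences extract the individual terms.
  have hkey : ∀ j k, ρ k * ‖w j (coh (X k))‖ ≤ B := fun j k => by
    let e : ℕ →ᵇ ℂ := BoundedContinuousFunction.ofNormedAddCommGroupDiscrete
      (Pi.single k (1 : ℂ)) 1 (fun i => by
        rcases eq_or_ne i k with rfl | hik
        · simp
        · simp [hik])
    have he : ‖e‖ ≤ 1 := BoundedContinuousFunction.norm_le_of_nonempty.2 fun i => by
        rcases eq_or_ne i k with rfl | hik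
        · simp [e]
        · simp [e, hik]
    have h1 : L j e = (ρ k : ℂ) * w j (coh (X k)) := by
      rw [hL, tsum_eq_single k]
      · simp [e]
      · intro i hi
        simp [e, hi]
    have h2 := (L j).le_of_opNorm_le (hB j) e
    rw [h1, norm_mul, Complex.norm_real, Real.norm_of_nonneg (hρ0 k).le] at h2
    have hB0 : 0 ≤ B := (norm_nonneg _).trans (hB j)
    exact h2.trans (by nlinarith)
  obtain ⟨k, hk⟩ := exists_nat_gt B
  have h3 := hkey (J k) k
  have h4 := mul_lt_mul_of_pos_left (hX k) (hρ0 k)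
  have h5 : ρ k * ((k * 2 ^ k : ℝ) * wt (X k) ^ (k : ℝ)) = k := by
    have e1 := wt_rpow_mul_neg (X k) k
    have e2 : (1 / 2 : ℝ) ^ k * 2 ^ k = 1 := by rw [← mul_pow]; norm_num
    calc _ = (k : ℝ) * ((1 / 2 : ℝ) ^ k * 2 ^ k) *
          (wt (X k) ^ (k : ℝ) * wt (X k) ^ (-(k : ℝ))) := by rw [hρ]; ring
      _ = _ := by rw [e1, e2, mul_one, mul_one]
  linarith

theorem tendsto_dist_iff {u : ℕ → 𝓢'(Eucl ι, ℂ)} {u₀ : 𝓢'(Eucl ι, ℂ)} :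
    Tendsto u atTop (𝓝 u₀) ↔ ∀ φ, Tendsto (fun j => u j φ) atTop (𝓝 (u₀ φ)) :=
  PointwiseConvergenceCLM.tendsto_iff_forall_tendsto

/-- A symbol that vanishes to infinite order off `coneBall X₁ δ` has essential conic support in
every larger cone. -/
theorem essConeSupp_subset_coneBall {a : Phase ι → ℂ} {X₁ : Phase ι} {δ δ' : ℝ} (hδ : 0 ≤ δ)
    (h : δ < δ') (hz : ∀ k : ℕ, ∀ W ∉ coneBall X₁ δ, iteratedFDeriv ℝ k a W = 0) :
    essConeSupp a ⊆ coneBall X₁ δ' := by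
  rintro X ⟨h0, hX⟩
  by_contra hcon
  obtain ⟨c, hc0, hc1, hc⟩ := coneBall_separation_norm X₁ hδ h
  have hn := norm_pos_iff.2 h0
  refine hX ⟨coneBall X (c * ‖X‖ / 3), isOpenCone_coneBall (by nlinarith),
    mem_coneBall_self _ (by positivity), fun k N => ⟨0, fun Z hZ _ => ?_⟩⟩
  obtain ⟨t, ht, hZ⟩ := hZ
  rw [hz k Z, norm_zero, zero_mul]
  intro hmem
  have h1 := hc _ (smul_mem_coneBall ht hmem) X hcon
  have h2 := norm_sub_norm_le X (t • Z)
  rw [norm_sub_rev] at h2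
  have h3 : ‖t • Z‖ < ‖X‖ / 3 := lt_of_mul_lt_mul_left (by linarith) hc0.le
  have h4 : c * ‖X‖ ≤ ‖X‖ := mul_le_of_le_one_left hn.le hc1
  linarith

theorem exists_coneBall_subset_compl {Γ : Set (Phase ι)} (hΓ : IsClosedCone Γ) {X₁ : Phase ι}
    (h0 : X₁ ≠ 0) (h1 : X₁ ∉ Γ) : ∃ δ > 0, Disjoint Γ (coneBall X₁ δ) := by
  obtain ⟨δ, hδ, hs⟩ := exists_coneBall_subset (Γ := (insert 0 Γ)ᶜ) hΓ.2.isOpen_compl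
    (fun t ht X hX hmem => hX <| by
      rcases hmem with hm | hm
      · left
        exact (smul_eq_zero.1 hm).resolve_left ht.ne'
      · right
        exact (smul_mem_cone_iff hΓ.1.2 ht).1 hm) (X₀ := X₁) (by simp [h0, h1])
  exact ⟨δ, hδ, Set.disjoint_left.2 fun X hX hX' => hs hX' (Or.inr hX)⟩

/-- A conic cutoff elliptic at X₁ has essential support off Γ, so its images of u_j - u₀ tend to 0
in 𝓢 and are uniformly rapidly decaying. The elliptic estimate has constants independent of j, hence
passes to the supremum over j and can be bootstrapped there. -/
theorem TendstoInCone.exists_uniform_rapid {Γ : Set (Phase ι)} (hΓ : IsClosedCone Γ)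
    {u : ℕ → 𝓢'(Eucl ι, ℂ)} {u₀ : 𝓢'(Eucl ι, ℂ)} (ht : TendstoInCone Γ u u₀) {C₀ : NNReal} {M : ℝ}
    (hM : 0 ≤ M) (hb : ∀ j X, ‖(u j - u₀) (coh X)‖ₑ ≤ C₀ * ew X M) {X₁ : Phase ι}
    (h0 : X₁ ≠ 0) (h1 : X₁ ∉ Γ) :
    ∃ δ > 0, ∀ N : ℝ, ∃ D : NNReal, ∀ X ∈ coneBall X₁ δ,
      ⨆ j, ‖(u j - u₀) (coh X)‖ₑ ≤ D * ew X (-N) := by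
  obtain ⟨δ, hδ, hdis⟩ := exists_coneBall_subset_compl hΓ h0 h1
  obtain ⟨a, ha, hz, δ', hδ', R, hone⟩ := exists_cutoff h0 (δ := δ / 2) (by positivity)
  obtain ⟨f, hf, hf0⟩ := ht.2.2.2 a (isShubinSymbol_iff.2 ha)
    (hdis.mono_right (essConeSupp_subset_coneBall (by positivity) (by linarith) hz))
  refine ⟨δ' / 2, by positivity, fun N => ?_⟩
  refine bootstrap_sup (volume : Measure (Phase ι)) (F := fun X => ⨆ j, ‖(u j - u₀) (coh X)‖ₑ)
    (H := fun X => ⨆ j, ‖sdist (f j) (coh X)‖ₑ) hM (fun X => iSup_le fun j => hb j X) X₁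
    (δ₀ := δ') (s := -N) (fun N Q => ?_) ?_ (by positivity) (by linarith)
  · obtain ⟨D, hD⟩ := elliptic_estimate_uniform ha (A := coneBall X₁ δ') (R := R) one_pos
      (fun X hX hR => by rw [hone X hX hR]; simp) N Q C₀ hM
    refine ⟨D, fun X hX => iSup_le fun j => (hD _ _ (hf j) (hb j) X hX).trans ?_⟩
    rw [neg_zero, ew_zero, one_mul]
    refine mul_le_mul_right (add_le_add_left (add_le_add (le_iSup
      (fun j => ‖sdist (f j) (coh X)‖ₑ) j) (mul_le_mul_right (lintegral_mono fun Y => ?_) _)) _) _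
    exact mul_le_mul_right (le_iSup (fun j => ‖(u j - u₀) (coh Y)‖ₑ) j) _
  · obtain ⟨m, C, hC, hst⟩ := stft_decay_rpow (E := Eucl ι) N
    obtain ⟨B, hB⟩ := (sn_tendsto_zero hf0 m).bddAbove_range
    refine ⟨(C * B).toNNReal, fun X _ => iSup_le fun j => enorm_le_ew ?_⟩
    rw [sdist_coh]
    refine (hst (f j) X).trans ?_
    have := wt_pos X
    gcongr
    exact hB ⟨j, rfl⟩

end UniformBound

/-! ### Sequential continuity of the extended operator -/

section Continuity

variable {ι κ : Type*} [Fintype ι] [Fintype κ] {K : 𝓢'(Eucl (ι ⊕ κ), ℂ)}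

/-- Dominated convergence in the defining integral over Y. The supremum over j of the transforms of
u_j - u₀ has polynomial growth and decays rapidly off Γ, so `enorm_tensor_mul_le` gives one
integrable majorant for all the differences; the fixed term u₀ has its own. -/
theorem tendsto_applyKer {Γ : Set (Phase κ)} (hΓ : IsClosedCone Γ)
    (hdis : Disjoint Γ (partY (wfIso K))) {u : ℕ → 𝓢'(Eucl κ, ℂ)} {u₀ : 𝓢'(Eucl κ, ℂ)}
    (hu : ∀ j, Transversal K (u j)) (hu₀ : Transversal K u₀) (ht : TendstoInCone Γ u u₀) :
    Tendsto (fun j => applyKer K (u j) (hu j)) atTop (𝓝 (applyKer K u₀ hu₀)) := by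
  rw [tendsto_dist_iff]
  intro φ
  have hpt := tendsto_dist_iff.1 ht.2.2.1
  obtain ⟨C₀, M, hM, hb⟩ := exists_uniform_coh_bound (w := fun j => u j - u₀) (fun φ => by
    have h1 : Tendsto (fun j => ‖u j φ - u₀ φ‖) atTop (𝓝 ‖u₀ φ - u₀ φ‖) :=
      ((hpt φ).sub tendsto_const_nhds).norm
    obtain ⟨B, hB⟩ := h1.bddAbove_range
    exact ⟨B, fun j => hB ⟨j, rfl⟩⟩)
  obtain ⟨N, C, hN⟩ := enorm_tensor_mul_le K (G := fun Y => ⨆ j, ‖(u j - u₀) (coh (flipP Y))‖ₑ) hM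
    (fun Y => iSup_le fun j => (hb j _).trans_eq (by rw [ew_flipP])) (fun Y₁ h0 => by
      by_cases hY : joinPhase ι κ (0, Y₁) ∈ wfIso K
      · right
        have hmem : flipP Y₁ ∈ partY (wfIso K) := by
          refine ⟨flipP_ne_zero h0, ?_⟩
          simpa [joinPhase_apply, flipP] using hY
        obtain ⟨δ, hδ, hr⟩ := ht.exists_uniform_rapid hΓ hM hb (flipP_ne_zero h0)
          (fun h => Set.disjoint_left.1 hdis h hmem)
        refine ⟨δ, hδ, fun N => (hr N).imp fun D hD Y hY => ?_⟩
        exact (hD _ (flipP_mem_coneBall hY)).trans_eq (by rw [ew_flipP])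
      · exact Or.inl hY)
  obtain ⟨N', C', -, hN'⟩ := hu₀.norm_le
  simp only [applyKer_apply]
  refine Tendsto.const_mul _ (tendsto_integral_of_dominated_convergence
    (fun Y => C * sn N φ * wt Y ^ (-intExp (Phase κ)) + C' * sn N' φ * wt Y ^ (-intExp (Phase κ)))
    (fun j => (continuous_tensor_mul K (u j) φ).aestronglyMeasurable) ?_ ?_ ?_)
  · exact ((integrable_wt volume le_rfl).const_mul _).add ((integrable_wt volume le_rfl).const_mul _)
  · refine fun j => Eventually.of_forall fun Y => ?_
    have e : K (schwartzTensor φ (coh Y)) * u j (coh (flipP Y)) =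
        K (schwartzTensor φ (coh Y)) * (u j - u₀) (coh (flipP Y)) +
        K (schwartzTensor φ (coh Y)) * u₀ (coh (flipP Y)) := by
      rw [← mul_add]
      congr 1
      exact (sub_add_cancel _ _).symm
    rw [e]
    refine (norm_add_le _ _).trans (add_le_add ?_ (hN' φ Y))
    have h1 : ‖K (schwartzTensor φ (coh Y)) * (u j - u₀) (coh (flipP Y))‖ₑ ≤
        (C * (sn N φ).toNNReal : NNReal) * ew Y (-intExp (Phase κ)) := by
      rw [enorm_mul]
      refine (mul_le_mul_right (le_iSup (fun j => ‖(u j - u₀) (coh (flipP Y))‖ₑ) j) _).trans ?_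
      push_cast
      exact hN φ Y
    have := norm_le_of_enorm_le_ew h1
    push_cast at this
    rwa [Real.coe_toNNReal _ (sn_nonneg N φ)] at this
  · exact Eventually.of_forall fun Y => (hpt _).const_mul _

end Continuity

/-! ### Approximation by Schwartz functions -/

section Truncation

variable {ι : Type*} [Fintype ι]

theorem isClosedCone_wfIso (u : 𝓢'(Eucl ι, ℂ)) : IsClosedCone (wfIso u) := by
  refine ⟨⟨fun h => h.1 rfl, fun t ht X hX => ?_⟩, ?_⟩
  · by_contra hcon
    have h0 : t • X ≠ 0 := smul_ne_zero ht.ne' hX.1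
    obtain ⟨δ, hδ, hr⟩ := (notMem_wfIso_iff h0).1 hcon
    have hmem : X ∈ coneBall (t • X) δ := ⟨t, ht, by simpa using hδ⟩
    obtain ⟨δ', hδ', hs⟩ := exists_coneBall_subset (isOpen_coneBall (t • X) δ)
      (fun _ ht _ hX => smul_mem_coneBall ht hX) hmem
    exact (notMem_wfIso_iff hX.1).2 ⟨δ', hδ', fun N => (hr N).imp fun D hD Y hY =>
      hD Y (hs hY)⟩ hX
  · rw [← isOpen_compl_iff, isOpen_iff_mem_nhds]
    intro X hX
    rw [mem_compl_iff, mem_insert_iff, not_or] at hX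
    obtain ⟨δ, hδ, hr⟩ := (notMem_wfIso_iff hX.1).1 hX.2
    filter_upwards [(isOpen_coneBall X δ).mem_nhds (mem_coneBall_self X hδ),
      isOpen_ne.mem_nhds hX.1] with Y hY hY0
    rw [mem_compl_iff, mem_insert_iff, not_or]
    refine ⟨hY0, (notMem_wfIso_iff hY0).2 ?_⟩
    obtain ⟨δ', hδ', hs⟩ := exists_coneBall_subset (isOpen_coneBall X δ)
      (fun _ ht _ hX => smul_mem_coneBall ht hX) hY
    exact ⟨δ', hδ', fun N => (hr N).imp fun D hD Z hZ => hD Z (hs hZ)⟩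

theorem stft_add (φ ψ : 𝓢(Eucl ι, ℂ)) (X : Phase ι) : stft (φ + ψ) X = stft φ X + stft ψ X := by
  simp only [← sdist_coh]
  rw [sdist, map_add]
  rfl

theorem stft_smul (c : ℂ) (φ : 𝓢(Eucl ι, ℂ)) (X : Phase ι) : stft (c • φ) X = c * stft φ X := by
  simp only [← sdist_coh]
  rw [sdist, map_smul]
  rfl

theorem norm_stft_mul_le (u : 𝓢'(Eucl ι, ℂ)) : ∃ (N : ℕ) (C : ℝ), 0 ≤ C ∧
    ∀ (φ : 𝓢(Eucl ι, ℂ)) (Z : Phase ι),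
      ‖stft φ (flipP Z) * u (coh Z)‖ ≤ C * sn N φ * wt Z ^ (-intExp (Phase ι)) := by
  obtain ⟨C, M, hC, hM, hu⟩ := exists_dist_coh_bound u
  obtain ⟨N, C₁, hC₁, hst⟩ := stft_decay_rpow (E := Eucl ι) (M + intExp (Phase ι))
  refine ⟨N, C₁ * C, by positivity, fun φ Z => ?_⟩
  have h1 := hst φ (flipP Z)
  rw [wt_flipP] at h1
  have h2 := wt_pos Z
  have h3 := sn_nonneg N φ
  rw [norm_mul]
  calc _ ≤ (C₁ * sn N φ * wt Z ^ (-(M + intExp (Phase ι)))) * (C * wt Z ^ M) :=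
        mul_le_mul h1 (hu Z) (norm_nonneg _) (by positivity)
    _ = C₁ * C * sn N φ * (wt Z ^ (-(M + intExp (Phase ι))) * wt Z ^ M) := by ring
    _ = _ := by rw [← wt_rpow_add]; congr 2; ring

theorem integrable_stft_mul (u : 𝓢'(Eucl ι, ℂ)) (φ : 𝓢(Eucl ι, ℂ)) :
    Integrable fun Z : Phase ι => stft φ (flipP Z) * u (coh Z) := by
  obtain ⟨N, C, -, hN⟩ := norm_stft_mul_le u
  exact ((integrable_wt volume le_rfl).const_mul (C * sn N φ)).mono'
    (((continuous_stft φ).comp continuous_flipP :).mul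
      (continuous_dist_coh u)).aestronglyMeasurable (Eventually.of_forall fun Z => hN φ Z)

/-- The restriction of a distribution to the part of phase space over `A`. -/
def phaseRestrict (u : 𝓢'(Eucl ι, ℂ)) (A : Set (Phase ι)) : 𝓢'(Eucl ι, ℂ) :=
  mkDist { toFun := fun φ => ((cInv (Eucl ι) : ℝ) : ℂ) *
             ∫ Z in A, stft φ (flipP Z) * u (coh Z)
           map_add' := fun φ φ' => by
             rw [← mul_add, ← integral_add (integrable_stft_mul u φ).integrableOn
               (integrable_stft_mul u φ').integrableOn]
             simp only [stft_add, add_mul]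
           map_smul' := fun c φ => by
             rw [RingHom.id_apply, smul_eq_mul, mul_left_comm, ← integral_const_mul c]
             simp only [stft_smul, mul_assoc] } <| by
    obtain ⟨N, C, hC, hN⟩ := norm_stft_mul_le u
    set J := ∫ Y : Phase ι in A, wt Y ^ (-intExp (Phase ι)) with hJ
    have hJ0 : 0 ≤ J := integral_nonneg fun Y => (wt_rpow_pos _ _).le
    have hc := (cInv_pos (E := Eucl ι)).le
    refine ⟨N, cInv (Eucl ι) * C * J, by positivity, fun φ => ?_⟩
    have hi : IntegrableOn (fun Y : Phase ι => C * sn N φ * wt Y ^ (-intExp (Phase ι))) A :=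
      ((integrable_wt volume le_rfl).const_mul _).integrableOn
    have h1 := norm_integral_le_of_norm_le hi (Eventually.of_forall fun Y => hN φ Y)
    rw [integral_const_mul] at h1
    calc _ = cInv (Eucl ι) * ‖∫ Z in A, stft φ (flipP Z) * u (coh Z)‖ := by
          simp only [LinearMap.coe_mk, AddHom.coe_mk]
          rw [norm_mul, Complex.norm_real, Real.norm_of_nonneg hc]
      _ ≤ cInv (Eucl ι) * (C * sn N φ * J) := by gcongr
      _ = _ := by ring

theorem phaseRestrict_apply (u : 𝓢'(Eucl ι, ℂ)) (A : Set (Phase ι)) (φ : 𝓢(Eucl ι, ℂ)) :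
    phaseRestrict u A φ = ((cInv (Eucl ι) : ℝ) : ℂ) * ∫ Z in A, stft φ (flipP Z) * u (coh Z) := rfl

theorem phaseRestrict_add_compl (u : 𝓢'(Eucl ι, ℂ)) {A : Set (Phase ι)} (hA : MeasurableSet A) :
    phaseRestrict u A + phaseRestrict u Aᶜ = u := by
  refine dist_ext_coh fun X => ?_
  change phaseRestrict u A (coh X) + phaseRestrict u Aᶜ (coh X) = u (coh X)
  rw [phaseRestrict_apply, phaseRestrict_apply, ← mul_add,
    integral_add_compl hA (integrable_stft_mul u _), dist_inversion u (coh X)]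

theorem tendsto_phaseRestrict_closedBall (u : 𝓢'(Eucl ι, ℂ)) :
    Tendsto (fun j : ℕ => phaseRestrict u (Metric.closedBall 0 j)) atTop (𝓝 u) := by
  rw [tendsto_dist_iff]
  intro φ
  rw [dist_inversion u φ]
  simp only [phaseRestrict_apply]
  refine Tendsto.const_mul _ ?_
  have := tendsto_setIntegral_of_monotone (μ := (volume : Measure (Phase ι)))
    (s := fun j : ℕ => Metric.closedBall (0 : Phase ι) j)
    (f := fun Z => stft φ (flipP Z) * u (coh Z)) (fun j => Metric.isClosed_closedBall.measurableSet)
    (fun i j hij => Metric.closedBall_subset_closedBall (by exact_mod_cast hij))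
    (integrable_stft_mul u φ).integrableOn
  rwa [Metric.iUnion_closedBall_nat, setIntegral_univ] at this

theorem IsWeylImage.phaseRestrict_coh {L : ℝ} (hL : 0 ≤ L) {a : Phase ι → ℂ} (ha : PolySymb L a)
    {u v : 𝓢'(Eucl ι, ℂ)} {A : Set (Phase ι)} (h : IsWeylImage a (phaseRestrict u A) v)
    (X : Phase ι) : v (coh X) = ∫ Z in A, gker a X Z * u (coh Z) := by
  obtain ⟨g, hg, hv⟩ := h (coh X)
  rw [hv, phaseRestrict_apply, ← integral_const_mul]
  congr 1
  ext Z
  rw [← cInv_mul_stft_weyl hL ha hg]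
  ring

theorem phaseRestrict_coh (u : 𝓢'(Eucl ι, ℂ)) (A : Set (Phase ι)) (X : Phase ι) :
    phaseRestrict u A (coh X) = ∫ Z in A, gker (fun _ => 1) X Z * u (coh Z) :=
  (isWeylImage_one _).phaseRestrict_coh le_rfl (polySymb_const 1) X

theorem wt_neg_mul_le (X Z : Phase ι) {N : ℝ} (hN : 0 ≤ N) :
    wt (X - Z) ^ (-N) * wt Z ^ (-N) ≤ wt X ^ (-N) := by
  have h := wt_rpow_peetre Z X (-N)
  rw [abs_neg, abs_of_nonneg hN, wt_sub_comm] at h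
  have h1 := wt_pos (X - Z)
  calc _ ≤ wt (X - Z) ^ (-N) * (wt (X - Z) ^ N * wt X ^ (-N)) := by gcongr
    _ = (wt (X - Z) ^ N * wt (X - Z) ^ (-N)) * wt X ^ (-N) := by ring
    _ = _ := by rw [wt_rpow_mul_neg, one_mul]

/-- A rapidly decaying kernel gives a rapidly decaying image, with explicit dependence on the
region of integration. -/
theorem norm_setIntegral_kernel_le {k : Phase ι → ℂ} {X : Phase ι} {A : Set (Phase ι)}
    (hA : MeasurableSet A) {C N : ℝ} (hC : 0 ≤ C) (hN : 0 ≤ N)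
    (h : ∀ Z ∈ A, ‖k Z‖ ≤ C * wt (X - Z) ^ (-N) * wt Z ^ (-(N + intExp (Phase ι)))) :
    ‖∫ Z in A, k Z‖ ≤ C * (∫ Z : Phase ι in A, wt Z ^ (-intExp (Phase ι))) * wt X ^ (-N) := by
  have hi : IntegrableOn (fun Z : Phase ι => C * wt X ^ (-N) * wt Z ^ (-intExp (Phase ι))) A :=
    ((integrable_wt volume le_rfl).const_mul _).integrableOn
  have h1 : ∀ᵐ Z ∂volume.restrict A, ‖k Z‖ ≤ C * wt X ^ (-N) * wt Z ^ (-intExp (Phase ι)) := by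
    refine (ae_restrict_iff' hA).2 (Eventually.of_forall fun Z hZ => (h Z hZ).trans ?_)
    have h2 := wt_pos Z
    rw [neg_add, wt_rpow_add]
    calc _ = C * (wt (X - Z) ^ (-N) * wt Z ^ (-N)) * wt Z ^ (-intExp (Phase ι)) := by ring
      _ ≤ _ := by gcongr; exact wt_neg_mul_le X Z hN
  refine (norm_integral_le_of_norm_le hi h1).trans (le_of_eq ?_)
  rw [integral_const_mul]
  ring

/-- Over a ball the growth of u is bounded, and the kernel of the identity decays in the distance
from X, so the transform of the truncation decays rapidly. -/
theorem exists_sdist_phaseRestrict (u : 𝓢'(Eucl ι, ℂ)) (j : ℕ) :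
    ∃ f : 𝓢(Eucl ι, ℂ), phaseRestrict u (Metric.closedBall 0 j) = sdist f := by
  obtain ⟨C, M, hC, hM, hu⟩ := exists_dist_coh_bound u
  have hI := intExp_pos (Phase ι)
  obtain ⟨f, hf, -⟩ := exists_sdist_of_decay (phaseRestrict u (Metric.closedBall 0 j)) (fun N => by
    obtain ⟨D, hD, hg⟩ := norm_gker_le (symb_const (ι := ι) 1) |N|
    set P := M + (|N| + intExp (Phase ι)) with hP
    have hP0 : 0 ≤ P := by positivity
    have hj : (0 : ℝ) ≤ j := Nat.cast_nonneg j
    refine ⟨D * C * (1 + j) ^ P * ∫ Z : Phase ι in Metric.closedBall 0 j,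
      wt Z ^ (-intExp (Phase ι)), fun X => ?_⟩
    rw [phaseRestrict_coh]
    refine (norm_setIntegral_kernel_le (X := X) (C := D * C * (1 + j) ^ P)
      Metric.isClosed_closedBall.measurableSet (by positivity) (abs_nonneg N)
      (fun Z hZ => ?_)).trans ?_
    · have h1 := hg X Z
      rw [Real.rpow_zero, mul_one] at h1
      have h2 := wt_pos (X - Z)
      have h3 := wt_pos Z
      have hZ' : wt Z ≤ 1 + j := by
        rw [mem_closedBall_zero_iff] at hZ
        unfold wt
        linarith
      rw [norm_mul]
      calc _ ≤ (D * wt (X - Z) ^ (-|N|)) * (C * wt Z ^ M) :=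
            mul_le_mul h1 (hu Z) (norm_nonneg _) (by positivity)
        _ = (D * wt (X - Z) ^ (-|N|)) * (C * (wt Z ^ P *
            wt Z ^ (-(|N| + intExp (Phase ι))))) := by
            rw [← wt_rpow_add]; congr 3; rw [hP]; ring
        _ ≤ (D * wt (X - Z) ^ (-|N|)) * (C * ((1 + j) ^ P *
            wt Z ^ (-(|N| + intExp (Phase ι))))) := by gcongr
        _ = _ := by ring
    · refine mul_le_mul_of_nonneg_left (wt_rpow_le (neg_le_neg (le_abs_self N))) ?_
      exact mul_nonneg (by positivity) (integral_nonneg fun Z => (wt_rpow_pos _ _).le))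
  exact ⟨f, hf⟩

theorem tail_tendsto_zero : Tendsto (fun j : ℕ => ∫ Z in (Metric.closedBall (0 : Phase ι) j)ᶜ,
    wt Z ^ (-intExp (Phase ι))) atTop (𝓝 0) := by
  have hi : Integrable fun Z : Phase ι => wt Z ^ (-intExp (Phase ι)) :=
    integrable_wt volume le_rfl
  have := tendsto_setIntegral_of_monotone (μ := (volume : Measure (Phase ι)))
    (s := fun j : ℕ => Metric.closedBall (0 : Phase ι) j)
    (f := fun Z => wt Z ^ (-intExp (Phase ι))) (fun j => Metric.isClosed_closedBall.measurableSet)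
    (fun i j hij => Metric.closedBall_subset_closedBall (by exact_mod_cast hij)) hi.integrableOn
  rw [Metric.iUnion_closedBall_nat, setIntegral_univ] at this
  have h2 := (tendsto_const_nhds (x := ∫ Z : Phase ι, wt Z ^ (-intExp (Phase ι)))).sub this
  rw [sub_self] at h2
  refine h2.congr fun j => ?_
  rw [← integral_add_compl (s := Metric.closedBall (0 : Phase ι) j)
    Metric.isClosed_closedBall.measurableSet hi]
  ring

/-- The definition constrains the symbol only for |X| ≥ 1; on the bounded remainder weights are
bounded and the symbol estimates suffice. -/
theorem rapid_of_notMem_essConeSupp {a : Phase ι → ℂ} (ha : Symb 0 a) {X₁ : Phase ι} (h0 : X₁ ≠ 0)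
    (h : X₁ ∉ essConeSupp a) : ∃ δ > 0, ∀ (k : ℕ) (N : ℝ), ∃ C : ℝ, ∀ W ∈ coneBall X₁ δ,
      ‖iteratedFDeriv ℝ k a W‖ ≤ C * wt W ^ (-N) := by
  have h' : ∃ Γ : Set (Phase ι), IsOpenCone Γ ∧ X₁ ∈ Γ ∧
      ∀ k N : ℕ, ∃ C : ℝ, ∀ X ∈ Γ, 1 ≤ phaseNorm X →
        ‖iteratedFDeriv ℝ k a X‖ ≤ C * japanese X ^ (-(N : ℝ)) := by
    by_contra hcon
    exact h ⟨h0, hcon⟩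
  obtain ⟨Γ, hΓ, hX, hr⟩ := h'
  obtain ⟨δ, hδ, hs⟩ := exists_coneBall_subset hΓ.2 hΓ.1.2 hX
  refine ⟨δ, hδ, fun k N => ?_⟩
  obtain ⟨C₁, h1⟩ := hr k ⌈N⌉₊
  obtain ⟨C₂, h2⟩ := ha.2 k
  refine ⟨|C₁| * 2 ^ |-(⌈N⌉₊ : ℝ)| + |C₂| * 2 ^ |N|, fun W hW => ?_⟩
  have w := wt_pos W
  have w' := japanese_pos W
  rcases le_or_gt 1 (phaseNorm W) with hp | hp
  · calc _ ≤ C₁ * japanese W ^ (-(⌈N⌉₊ : ℝ)) := h1 W (hs hW) hp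
      _ ≤ |C₁| * (2 ^ |-(⌈N⌉₊ : ℝ)| * wt W ^ (-(⌈N⌉₊ : ℝ))) :=
          mul_le_mul (le_abs_self _) (japanese_rpow_le_wt W _) (by positivity) (abs_nonneg _)
      _ ≤ |C₁| * (2 ^ |-(⌈N⌉₊ : ℝ)| * wt W ^ (-N)) := by
          have := wt_rpow_le (x := W) (neg_le_neg (Nat.le_ceil N))
          gcongr
      _ = |C₁| * 2 ^ |-(⌈N⌉₊ : ℝ)| * wt W ^ (-N) := by ring
      _ ≤ _ := by
          refine mul_le_mul_of_nonneg_right ?_ (by positivity)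
          have : 0 ≤ |C₂| * 2 ^ |N| := by positivity
          linarith
  · have hw2 : wt W ≤ 2 := by
      unfold wt
      linarith [norm_le_phaseNorm W]
    have h3 : wt W ^ ((0 : ℝ) - k) ≤ 1 := wt_rpow_le_one W (by simp)
    have h4 : (1 : ℝ) ≤ 2 ^ |N| * wt W ^ (-N) := by
      calc (1 : ℝ) = wt W ^ N * wt W ^ (-N) := (wt_rpow_mul_neg W N).symm
        _ ≤ _ := by
          gcongr
          exact (wt_rpow_le (le_abs_self N)).trans (Real.rpow_le_rpow w.le hw2 (abs_nonneg N))
    calc _ ≤ C₂ * wt W ^ ((0 : ℝ) - k) := h2 W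
      _ ≤ |C₂| * 1 := mul_le_mul (le_abs_self _) h3 (by positivity) (abs_nonneg _)
      _ ≤ |C₂| * (2 ^ |N| * wt W ^ (-N)) := by gcongr
      _ = |C₂| * 2 ^ |N| * wt W ^ (-N) := by ring
      _ ≤ _ := by
          refine mul_le_mul_of_nonneg_right ?_ (by positivity)
          have : 0 ≤ |C₁| * 2 ^ |-(⌈N⌉₊ : ℝ)| := by positivity
          linarith

/-- The kernel of a Weyl operator decays rapidly where its second argument lies in a cone on which
the symbol does. -/
theorem norm_gker_le_snd {a : Phase ι → ℂ} (ha : Symb 0 a) {X₁ : Phase ι} (h0 : X₁ ≠ 0)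
    (h : X₁ ∉ essConeSupp a) : ∃ δ > 0, ∀ N P : ℝ, 0 ≤ N → 0 ≤ P → ∃ C : ℝ, 0 ≤ C ∧
      ∀ Z ∈ coneBall X₁ δ, ∀ X, ‖gker a X Z‖ ≤ C * wt (X - Z) ^ (-N) * wt Z ^ (-P) := by
  obtain ⟨δ, hδ, hr⟩ := rapid_of_notMem_essConeSupp ha h0 h
  obtain ⟨ε₁, hε₁, -, hs₁⟩ := coneBall_separation X₁ (δ := δ / 2) (δ' := δ) (by positivity)
    (by linarith)
  obtain ⟨ε₂, hε₂, -, hs₂⟩ := coneBall_separation X₁ (δ := δ / 4) (δ' := δ / 2) (by positivity)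
    (by linarith)
  refine ⟨δ / 4, by positivity, fun N P hN hP => ?_⟩
  obtain ⟨C₁, hC₁, h1⟩ := norm_gker_le_of_separated ha hr hε₁ hs₁ (N + P)
  obtain ⟨C₂, hC₂, h2⟩ := norm_gker_le ha (N + P)
  refine ⟨C₁ + C₂ * ε₂ ^ (-P), by positivity, fun Z hZ X => ?_⟩
  have p1 := wt_pos X
  have p2 := wt_pos Z
  have p3 := wt_pos (X - Z)
  -- Z lies in the cone of aperture δ/4. If X lies in that of aperture δ/2, the symbol decays near X
  -- and Peetre's inequality moves the decay to Z; if not, X is at distance comparable to ⟨Z⟩ from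
  -- Z, and off-diagonal decay is enough.
  by_cases hX : X ∈ coneBall X₁ (δ / 2)
  · have h3 : wt X ^ (-(N + P)) ≤ wt (X - Z) ^ P * wt Z ^ (-P) := by
      have := wt_rpow_peetre X Z (-P)
      rw [abs_neg, abs_of_nonneg hP] at this
      exact (wt_rpow_le (by linarith)).trans this
    calc _ ≤ C₁ * wt X ^ (-(N + P)) * wt (X - Z) ^ (-(N + P)) := h1 X hX Z
      _ ≤ C₁ * (wt (X - Z) ^ P * wt Z ^ (-P)) * wt (X - Z) ^ (-(N + P)) := by gcongr
      _ = C₁ * (wt (X - Z) ^ P * wt (X - Z) ^ (-(N + P))) * wt Z ^ (-P) := by ring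
      _ = C₁ * wt (X - Z) ^ (-N) * wt Z ^ (-P) := by
          rw [← wt_rpow_add]; congr 3; ring
      _ ≤ _ := by
          gcongr
          have : 0 ≤ C₂ * ε₂ ^ (-P) := by positivity
          linarith
  · have h3 : wt (X - Z) ^ (-P) ≤ ε₂ ^ (-P) * wt Z ^ (-P) := by
      have := hs₂ Z hZ X hX
      rw [wt_sub_comm] at this
      rw [← Real.mul_rpow hε₂.le p2.le]
      exact Real.rpow_le_rpow_of_nonpos (by positivity) this (by linarith)
    have h4 := h2 X Z
    rw [Real.rpow_zero, mul_one] at h4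
    calc _ ≤ C₂ * wt (X - Z) ^ (-(N + P)) := h4
      _ = C₂ * (wt (X - Z) ^ (-N) * wt (X - Z) ^ (-P)) := by rw [neg_add, wt_rpow_add]
      _ ≤ C₂ * (wt (X - Z) ^ (-N) * (ε₂ ^ (-P) * wt Z ^ (-P))) := by gcongr
      _ = (C₂ * ε₂ ^ (-P)) * wt (X - Z) ^ (-N) * wt Z ^ (-P) := by ring
      _ ≤ _ := by
          gcongr
          linarith

/-- Every direction is outside WF(u), where the transform of u decays, or outside the essential
support, where the kernel decays in its second argument. Compactness of the unit sphere makes the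
bound uniform. -/
theorem norm_gker_mul_le {a : Phase ι → ℂ} (ha : Symb 0 a) {u : 𝓢'(Eucl ι, ℂ)}
    (hd : Disjoint (wfIso u) (essConeSupp a)) {N P : ℝ} (hN : 0 ≤ N) (hP : 0 ≤ P) :
    ∃ C : ℝ, 0 ≤ C ∧ ∀ X Z : Phase ι, Z ≠ 0 →
      ‖gker a X Z * u (coh Z)‖ ≤ C * wt (X - Z) ^ (-N) * wt Z ^ (-P) := by
  obtain ⟨C₀, M, hC₀, hM, hu⟩ := exists_dist_coh_bound u
  obtain ⟨O, -, hcone, hS, C, hC, h⟩ := exists_open_cone_of_compact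
    (P := fun A : Set (Phase ι) => ∃ C : ℝ, 0 ≤ C ∧ ∀ Z ∈ A, ∀ X,
      ‖gker a X Z * u (coh Z)‖ ≤ C * wt (X - Z) ^ (-N) * wt Z ^ (-P))
    (isCompact_sphere (0 : Phase ι) 1) ⟨0, le_rfl, fun Z hZ => hZ.elim⟩
    (by
      rintro A B - - ⟨C₁, hC₁, h1⟩ ⟨C₂, hC₂, h2⟩
      refine ⟨C₁ + C₂, by positivity, fun Z hZ X => ?_⟩
      have p2 := wt_pos Z
      have p3 := wt_pos (X - Z)
      rcases hZ with hZ | hZ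
      · refine (h1 Z hZ X).trans ?_
        gcongr
        linarith
      · refine (h2 Z hZ X).trans ?_
        gcongr
        linarith)
    (by
      intro Y hY
      have hY0 : Y ≠ 0 := by
        rintro rfl
        simp at hY
      by_cases hm : Y ∈ wfIso u
      · obtain ⟨δ, hδ, hg⟩ := norm_gker_le_snd ha hY0 (Set.disjoint_left.1 hd hm)
        obtain ⟨C, hC, hg⟩ := hg N (P + M) hN (by positivity)
        refine ⟨Y, δ, mem_coneBall_self Y hδ, C * C₀, by positivity, fun Z hZ X => ?_⟩
        have p2 := wt_pos Z
        have p3 := wt_pos (X - Z)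
        rw [norm_mul]
        calc _ ≤ (C * wt (X - Z) ^ (-N) * wt Z ^ (-(P + M))) * (C₀ * wt Z ^ M) :=
              mul_le_mul (hg Z hZ X) (hu Z) (norm_nonneg _) (by positivity)
          _ = C * C₀ * wt (X - Z) ^ (-N) * (wt Z ^ (-(P + M)) * wt Z ^ M) := by ring
          _ = _ := by rw [← wt_rpow_add]; congr 2; ring
      · obtain ⟨δ, hδ, hr⟩ := (notMem_wfIso_iff hY0).1 hm
        obtain ⟨D, hD⟩ := hr P
        obtain ⟨C, hC, hg⟩ := norm_gker_le ha N
        refine ⟨Y, δ, mem_coneBall_self Y hδ, C * D, by positivity, fun Z hZ X => ?_⟩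
        have p3 := wt_pos (X - Z)
        have h4 := hg X Z
        rw [Real.rpow_zero, mul_one] at h4
        rw [norm_mul]
        calc _ ≤ (C * wt (X - Z) ^ (-N)) * (D * wt Z ^ (-P)) :=
              mul_le_mul h4 (norm_le_of_enorm_le_ew (hD Z hZ)) (norm_nonneg _) (by positivity)
          _ = _ := by ring)
  refine ⟨C, hC, fun X Z hZ => h Z ?_ X⟩
  have hn := norm_pos_iff.2 hZ
  rw [← smul_mem_cone_iff hcone (inv_pos.2 hn)]
  refine hS ?_
  rw [mem_sphere_zero_iff_norm, norm_smul, norm_inv, norm_norm, inv_mul_cancel₀ hn.ne']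

theorem IsWeylImage.neg {a : Phase ι → ℂ} {u v : 𝓢'(Eucl ι, ℂ)} (h : IsWeylImage a u v) :
    IsWeylImage a (-u) (-v) := fun φ => by
  obtain ⟨g, hg, hv⟩ := h φ
  exact ⟨g, hg, congrArg Neg.neg hv⟩

theorem sdist_neg (f : 𝓢(Eucl ι, ℂ)) : sdist (-f) = -sdist f := map_neg _ f

/-- Every distribution is a limit of Schwartz functions, with control of the wave front set. -/
theorem exists_tendstoInCone (u : 𝓢'(Eucl ι, ℂ)) : ∃ f : ℕ → 𝓢(Eucl ι, ℂ),
    TendstoInCone (wfIso u) (fun j => sdist (f j)) u := by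
  choose f hf using exists_sdist_phaseRestrict u
  refine ⟨f, fun j => by rw [wfIso_sdist]; exact empty_subset _, subset_rfl, ?_, fun a ha hd => ?_⟩
  · simpa only [hf] using tendsto_phaseRestrict_closedBall u
  rw [isShubinSymbol_iff] at ha
  have hI := intExp_pos (Phase ι)
  set J : ℕ → ℝ := fun j => ∫ Z in (Metric.closedBall (0 : Phase ι) j)ᶜ,
    wt Z ^ (-intExp (Phase ι)) with hJ
  -- The error of the approximation is the part of u over the complement of a ball. Its image decays
  -- to every order with the tail integral J j as a factor, and this factor drives convergence in 𝓢.
  choose v hv using fun j : ℕ => exists_weylImage (abs_nonneg 0) ha.polySymb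
    (phaseRestrict u (Metric.closedBall 0 j)ᶜ)
  have hdec : ∀ N : ℝ, 0 ≤ N → ∃ C : ℝ, 0 ≤ C ∧ ∀ j X, ‖v j (coh X)‖ ≤ C * J j * wt X ^ (-N) := by
    intro N hN
    obtain ⟨C, hC, hg⟩ := norm_gker_mul_le ha hd hN (P := N + intExp (Phase ι)) (by positivity)
    refine ⟨C, hC, fun j X => ?_⟩
    rw [(hv j).phaseRestrict_coh (abs_nonneg 0) ha.polySymb]
    refine norm_setIntegral_kernel_le Metric.isClosed_closedBall.measurableSet.compl hC hN
      fun Z hZ => hg X Z ?_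
    rintro rfl
    exact hZ (Metric.mem_closedBall_self (Nat.cast_nonneg j))
  choose g hg _ using fun j => exists_sdist_of_decay (v j) (fun N => by
    obtain ⟨C, hC, hb⟩ := hdec |N| (abs_nonneg N)
    refine ⟨C * J j, fun X => (hb j X).trans ?_⟩
    refine mul_le_mul_of_nonneg_left (wt_rpow_le (neg_le_neg (le_abs_self N))) ?_
    exact mul_nonneg hC (integral_nonneg fun Z => (wt_rpow_pos _ _).le))
  refine ⟨fun j => -g j, fun j => ?_, ?_⟩
  · have e : sdist (f j) - u = -phaseRestrict u (Metric.closedBall 0 j)ᶜ := by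
      rw [← hf j]
      nth_rw 2 [← phaseRestrict_add_compl u (A := Metric.closedBall 0 (j : ℝ))
        Metric.isClosed_closedBall.measurableSet]
      abel
    rw [e]
    change IsWeylImage a _ (sdist (-g j))
    rw [sdist_neg, ← hg j]
    exact (hv j).neg
  · have h0 : Tendsto g atTop (𝓝 0) := by
      refine tendsto_zero_of_sn fun N => ?_
      obtain ⟨C, M, hC, hst⟩ := sn_le_of_stft (E := Eucl ι) N
      obtain ⟨C', hC', hb⟩ := hdec |M| (abs_nonneg _)
      have hJ0 : ∀ j, 0 ≤ J j := fun j => integral_nonneg fun Z => (wt_rpow_pos _ _).le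
      refine squeeze_zero (fun j => sn_nonneg N _) (g := fun j => C * (C' * J j))
        (fun j => hst (g j) (C' * J j) fun X => ?_) ?_
      · rw [← sdist_coh, ← hg j]
        refine (hb j X).trans (mul_le_mul_of_nonneg_left
          (wt_rpow_le (neg_le_neg (le_abs_self _))) (mul_nonneg hC' (hJ0 j)))
      · have := ((tail_tendsto_zero (ι := ι)).const_mul C').const_mul C
        simpa using this
    simpa using h0.neg

end Truncation

/-! ### The continuous extension -/

section Extension

variable {ι κ : Type*} [Fintype ι] [Fintype κ]

theorem wfIso_add_subset (u v : 𝓢'(Eucl ι, ℂ)) : wfIso (u + v) ⊆ wfIso u ∪ wfIso v := by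
  intro X hX
  by_contra hcon
  rw [mem_union, not_or] at hcon
  obtain ⟨δ₁, hδ₁, h1⟩ := (notMem_wfIso_iff hX.1).1 hcon.1
  obtain ⟨δ₂, hδ₂, h2⟩ := (notMem_wfIso_iff hX.1).1 hcon.2
  refine (notMem_wfIso_iff hX.1).2 ⟨min δ₁ δ₂, lt_min hδ₁ hδ₂, fun N => ?_⟩ hX
  obtain ⟨D₁, hD₁⟩ := h1 N
  obtain ⟨D₂, hD₂⟩ := h2 N
  refine ⟨D₁ + D₂, fun Y hY => ?_⟩
  push_cast
  rw [add_mul]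
  exact (enorm_add_le (u (coh Y)) (v (coh Y))).trans
    (add_le_add (hD₁ Y (coneBall_mono _ (min_le_left _ _) hY))
      (hD₂ Y (coneBall_mono _ (min_le_right _ _) hY)))

theorem wfIso_smul_subset (c : ℂ) (u : 𝓢'(Eucl ι, ℂ)) : wfIso (c • u) ⊆ wfIso u := by
  intro X hX
  by_contra hcon
  obtain ⟨δ, hδ, h⟩ := (notMem_wfIso_iff hX.1).1 hcon
  refine (notMem_wfIso_iff hX.1).2 ⟨δ, hδ, fun N => ?_⟩ hX
  obtain ⟨D, hD⟩ := h N
  refine ⟨‖c‖₊ * D, fun Y hY => ?_⟩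
  push_cast
  rw [mul_assoc]
  refine (enorm_mul c (u (coh Y))).trans_le ?_
  exact mul_le_mul_right (hD Y hY) _

theorem wfIso_zero : wfIso (0 : 𝓢'(Eucl ι, ℂ)) = ∅ := by
  have := wfIso_sdist (0 : 𝓢(Eucl ι, ℂ))
  rwa [sdist, map_zero] at this

/-- The distributions whose wave front set does not meet `F`. -/
def wfAvoiding (F : Set (Phase κ)) : Submodule ℂ 𝓢'(Eucl κ, ℂ) where
  carrier := {u | wfIso u ∩ F = ∅}
  zero_mem' := by
    change wfIso (0 : 𝓢'(Eucl κ, ℂ)) ∩ F = ∅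
    rw [wfIso_zero, empty_inter]
  add_mem' := fun {u v} hu hv => by
    refine subset_empty_iff.1 fun X hX => ?_
    rcases wfIso_add_subset u v hX.1 with h | h
    · exact (eq_empty_iff_forall_notMem.1 hu X) ⟨h, hX.2⟩
    · exact (eq_empty_iff_forall_notMem.1 hv X) ⟨h, hX.2⟩
  smul_mem' := fun c u hu => by
    refine subset_empty_iff.1 fun X hX => ?_
    exact (eq_empty_iff_forall_notMem.1 hu X) ⟨wfIso_smul_subset c u hX.1, hX.2⟩

theorem mem_wfAvoiding {F : Set (Phase κ)} {u : 𝓢'(Eucl κ, ℂ)} :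
    u ∈ wfAvoiding F ↔ wfIso u ∩ F = ∅ := Iff.rfl

theorem sdist_mem_wfAvoiding (F : Set (Phase κ)) (f : 𝓢(Eucl κ, ℂ)) : sdist f ∈ wfAvoiding F := by
  rw [mem_wfAvoiding, wfIso_sdist, empty_inter]

theorem transversal_of_mem {K : 𝓢'(Eucl (ι ⊕ κ), ℂ)} {u : 𝓢'(Eucl κ, ℂ)}
    (h : u ∈ wfAvoiding (partY (wfIso K))) : Transversal K u := wfIso_inter_partY_iff.1 h

/-- The operator with kernel `K`, on the distributions it can be applied to. -/
def kerMap (K : 𝓢'(Eucl (ι ⊕ κ), ℂ)) : wfAvoiding (partY (wfIso K)) →ₗ[ℂ] 𝓢'(Eucl ι, ℂ) where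
  toFun u := applyKer K u (transversal_of_mem u.2)
  map_add' u v := by
    refine dist_ext_coh fun X => ?_
    change _ = applyKer K u (transversal_of_mem u.2) (coh X) +
      applyKer K v (transversal_of_mem v.2) (coh X)
    simp only [applyKer_apply]
    rw [← mul_add, ← integral_add ((transversal_of_mem u.2).integrable _)
      ((transversal_of_mem v.2).integrable _)]
    congr 2
    ext Y
    exact mul_add _ _ _
  map_smul' c u := by
    refine dist_ext_coh fun X => ?_
    change _ = c * applyKer K u (transversal_of_mem u.2) (coh X)
    simp only [applyKer_apply]
    rw [mul_left_comm, ← integral_const_mul c]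
    congr 2
    ext Y
    exact mul_left_comm _ _ _

theorem kerMap_apply (K : 𝓢'(Eucl (ι ⊕ κ), ℂ)) (u : wfAvoiding (partY (wfIso K))) :
    kerMap K u = applyKer K u (transversal_of_mem u.2) := rfl

theorem kerMap_sdist {𝒦 : 𝓢(Eucl κ, ℂ) →ₗ[ℂ] 𝓢'(Eucl ι, ℂ)} {K : 𝓢'(Eucl (ι ⊕ κ), ℂ)}
    (hK : HasKernel 𝒦 K) (f : 𝓢(Eucl κ, ℂ)) :
    kerMap K ⟨sdist f, sdist_mem_wfAvoiding _ f⟩ = 𝒦 f := by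
  refine dist_ext_coh fun X => ?_
  rw [kerMap_apply, applyKer_sdist, hK]

theorem isContinuousExtension_kerMap {𝒦 : 𝓢(Eucl κ, ℂ) →ₗ[ℂ] 𝓢'(Eucl ι, ℂ)}
    {K : 𝓢'(Eucl (ι ⊕ κ), ℂ)} (hK : HasKernel 𝒦 K) :
    IsContinuousExtension 𝒦 (partY (wfIso K)) (wfAvoiding (partY (wfIso K))) (kerMap K) :=
  ⟨fun f => ⟨sdist_mem_wfAvoiding _ f, kerMap_sdist hK f⟩, fun _ hΓ hd u u₀ ht =>
    tendsto_applyKer hΓ hd (fun j => transversal_of_mem (u j).2) (transversal_of_mem u₀.2) ht⟩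

/-- Both maps agree on Schwartz functions and are sequentially continuous on 𝓢'_Γ for Γ = WF(u),
where u is a limit of Schwartz functions. -/
theorem IsContinuousExtension.eq_kerMap {𝒦 : 𝓢(Eucl κ, ℂ) →ₗ[ℂ] 𝓢'(Eucl ι, ℂ)}
    {K : 𝓢'(Eucl (ι ⊕ κ), ℂ)} (hK : HasKernel 𝒦 K)
    {T : wfAvoiding (partY (wfIso K)) →ₗ[ℂ] 𝓢'(Eucl ι, ℂ)}
    (hT : IsContinuousExtension 𝒦 (partY (wfIso K)) (wfAvoiding (partY (wfIso K))) T) :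
    T = kerMap K := by
  refine LinearMap.ext fun u => ?_
  obtain ⟨f, hf⟩ := exists_tendstoInCone (u : 𝓢'(Eucl κ, ℂ))
  have hd : Disjoint (wfIso (u : 𝓢'(Eucl κ, ℂ))) (partY (wfIso K)) :=
    Set.disjoint_iff_inter_eq_empty.2 u.2
  have h1 := hT.2 _ (isClosedCone_wfIso _) hd
    (fun j => ⟨sdist (f j), sdist_mem_wfAvoiding _ (f j)⟩) u hf
  have h2 := (isContinuousExtension_kerMap hK).2 _ (isClosedCone_wfIso _) hd
    (fun j => ⟨sdist (f j), sdist_mem_wfAvoiding _ (f j)⟩) u hf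
  refine tendsto_nhds_unique (h1.congr fun j => ?_) h2
  obtain ⟨h3, h4⟩ := hT.1 (f j)
  exact h4.trans (kerMap_sdist hK (f j)).symm

/-- If (X, Y) lies in WF^(s₁)(K), then Y ≠ 0 because X is outside `partX`, and the reflection of Y
is outside WF^(s₂)(u) because X is outside the composition. This is the alternative needed for every
Y. -/
theorem wfIsoOrder_applyKer_subset {K : 𝓢'(Eucl (ι ⊕ κ), ℂ)} {u : 𝓢'(Eucl κ, ℂ)}
    (h : Transversal K u) {r₁ r₂ : ℝ} (hK : K ∈ shubinSobolev (ι ⊕ κ) (-r₁)) (hr₂ : 0 ≤ r₂)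
    (hu : u ∈ shubinSobolev κ (-r₂)) (s₁ s₂ : ℝ) :
    wfIsoOrder (min (s₁ - r₂) (s₂ - r₁)) (applyKer K u h) ⊆
      partX (wfIsoOrder s₁ K) ∪ relComp (twist (wfIsoOrder s₁ K)) (wfIsoOrder s₂ u) := by
  intro X hX
  by_contra hcon
  rw [mem_union, not_or] at hcon
  refine notMem_wfIsoOrder_applyKer h (s₁ := s₁) (s₂ := s₂) hK hr₂ hu hX.1 (fun Y => ?_) hX
  by_cases hY : joinPhase ι κ (X, Y) ∈ wfIsoOrder s₁ K
  · right
    refine ⟨?_, fun hm => hcon.2 ⟨flipP Y, hm, ?_⟩⟩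
    · rintro rfl
      exact hcon.1 ⟨hX.1, hY⟩
    · simpa [twist, joinPhase_apply, flipP] using hY
  · exact Or.inl hY

end Extension

end

theorem theorem1p1 (m n : ℕ) (hmn : m ≤ n)
    (𝒦 : 𝓢(Eucl (Fin n), ℂ) →ₗ[ℂ] 𝓢'(Eucl (Fin m), ℂ))
    (K : 𝓢'(Eucl (Fin m ⊕ Fin n), ℂ)) (hK : HasKernel 𝒦 K)
    (r₁ : ℝ) (hr₁ : 0 ≤ r₁) (hKr : K ∈ shubinSobolev (Fin m ⊕ Fin n) (-r₁)) :
    (∀ (u : 𝓢(Eucl (Fin n), ℂ)) (μ : ℝ), (n : ℝ) < μ → ∀ s₁ : ℝ,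
      wfIsoOrder (s₁ - μ) (𝒦 u) ⊆ partX (wfIsoOrder s₁ K)) ∧
    ∃ D : Submodule ℂ 𝓢'(Eucl (Fin n), ℂ),
      (∀ u, u ∈ D ↔ wfIso u ∩ partY (wfIso K) = ∅) ∧
      ∃ T : D →ₗ[ℂ] 𝓢'(Eucl (Fin m), ℂ),
        IsContinuousExtension 𝒦 (partY (wfIso K)) D T ∧
        (∀ T' : D →ₗ[ℂ] 𝓢'(Eucl (Fin m), ℂ),
          IsContinuousExtension 𝒦 (partY (wfIso K)) D T' → T' = T) ∧
        ∀ (r₂ : ℝ), 0 ≤ r₂ → ∀ u : D, (u : 𝓢'(Eucl (Fin n), ℂ)) ∈ shubinSobolev (Fin n) (-r₂) →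
          ∀ s₁ s₂ : ℝ, min (s₁ - r₂) (s₂ - r₁) ≤ s₁ + s₂ →
            ∀ μ : ℝ, (n : ℝ) < μ →
              wfIsoOrder (min (s₁ - r₂) (s₂ - r₁) - μ) (T u) ⊆
                partX (wfIsoOrder s₁ K) ∪
                  relComp (twist (wfIsoOrder s₁ K))
                    (wfIsoOrder s₂ (u : 𝓢'(Eucl (Fin n), ℂ))) := by
  have hμ : ∀ μ : ℝ, (n : ℝ) < μ → ∀ s : ℝ, s - μ ≤ s := fun μ h s => by
    have : (0 : ℝ) ≤ n := Nat.cast_nonneg n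
    linarith
  refine ⟨fun f μ h s₁ => ?_, wfAvoiding (partY (wfIso K)), fun u => mem_wfAvoiding, kerMap K,
    isContinuousExtension_kerMap hK, fun T' hT' => hT'.eq_kerMap hK,
    fun r₂ hr₂ u hu s₁ s₂ _ μ h => ?_⟩
  · have ht := transversal_of_mem (sdist_mem_wfAvoiding (partY (wfIso K)) f)
    -- A Schwartz function has every order. With r₂ = 0 and s₂ = s₁ + r₁ both entries of the minimum
    -- equal s₁, and the composition term is empty.
    have h1 := wfIsoOrder_applyKer_subset ht hKr le_rfl
      (sdist_mem_shubinSobolev f (-0)) s₁ (s₁ + r₁)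
    rw [sub_zero, add_sub_cancel_right, min_self] at h1
    rw [← kerMap_sdist hK f]
    intro X hX
    rcases h1 (wfIsoOrder_mono (hμ μ h s₁) _ hX) with h2 | ⟨Y, hY, -⟩
    · exact h2
    · exact absurd hY (notMem_wfIsoOrder_sdist f _ Y)
  · exact (wfIsoOrder_mono (hμ μ h _) _).trans
      (wfIsoOrder_applyKer_subset (transversal_of_mem u.2) hKr hr₂ hu s₁ s₂)
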